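/- Let $k$ be a scheme and let $\mathcal V$ be a full subcategory of the category of $k$-schemes such that: (1) every scheme in $\mathcal V$ is quasi-compact and quasi-separated and has an ample family of line bundles; (2) $k$ and $\varnothing$ are in $\mathcal V$; (3) if $X,Y$ are in $\mathcal V$, so are $X\sqcup Y$ and $X\times_k Y$; (4) quasi-compact open subschemes of schemes in $\mathcal V$ are in $\mathcal V$; (5) if $X$ is in $\mathcal V$ and $Y$ is a quasi-compact open subscheme of a Grassmannian bundle over $X$ such that $Y\to X$ is affine, then $Y$ is in $\mathcal V$. A cohomology theory $(A,\partial)$ on $\mathcal V$ is a contravariant functor assigning an abelian group $A_Z(X)$ to every pair of a scheme $X$ and a closed subset $Z\subset X$ with $X$ and $X\smallsetminus Z$ in $\mathcal V$, and a homomorphism $f^A\colon A_Z(X)\to A_{Z'}(X')$ to every $f\colon X'\to X$ with $f^{-1}(Z)\subset Z'$, together with a natural transformation $\partial\colon A(X\smallsetminus Z)\to A_Z(X)$, where $A(X)=A_X(X)$, such that: the sequences $A(X\smallsetminus Z)\xrightarrow{\partial}A_Z(X)\xrightarrow{e^A}A(X)\xrightarrow{j^A}A(X\smallsetminus Z)\xrightarrow{\partial}A_Z(X)$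 are exact, where $e^A$ is extension of supports and $j^A$ is restriction; $f^A\colon A_Z(X)\to A_{Z'}(X')$ is an isomorphism whenever $f$ is étale, $Z'=f^{-1}(Z)$ and $f$ induces an isomorphism $Z'\to Z$ of reduced closed subschemes; and $A(X)\to A(X\times\mathbb A^1)$ is an isomorphism for all $X$. Let $S$ be in $\mathcal V$, let $1\le r\le n$, and let $(E,\phi)$ be a symplectic bundle of rank $2n-2$ over $S$, that is, a vector bundle with a nondegenerate alternating form. Let $F=\mathcal O_S\oplus E\oplus\mathcal O_S$ with the symplectic form $\psi((a,x,b),(a',x',b'))=ab'+\phi(x,x')-ba'$. For a symplectic bundle $(B,\beta)$ over $S$ let $\mathrm{HGr}_S(m,B,\beta)$ be the $S$-scheme parametrizing the rank $2m$ subbundles of $B$ on which $\beta$ is nondegenerate; it exists, as an open subscheme of the Grassmannian bundle $\mathrm{Gr}_S(2m,B)$. Let $$N^+=\mathrm{HGr}_S(r,F,\psi)\cap\mathrm{Gr}_S(2r,\mathcal O_S\oplus E),\quad N^-=\mathrm{HGr}_S(r,F,\psi)\cap\mathrm{Gr}_S(2r,E\oplus\mathcal O_S),\quad Y=\mathrm{HGr}_S(r,F,\psi)\smallsetminus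 N^+ ,$$ and let $j\colon Y\to\mathrm{HGr}_S(r,F,\psi)$ be the inclusion. Then for any cohomology theory $A$ on $\mathcal V$ the following hold, all the schemes that occur being in $\mathcal V$. (a) If $r=1$, the projection $t\colon Y\to S$ induces an isomorphism $t^A\colon A(S)\to A(Y)$. (b) Let $\mathcal U_{r-1}$ be the tautological subbundle on $\mathrm{HGr}_S(r-1,E,\phi)$. The morphism $\mathrm{HGr}_S(r-1,E,\phi)\to\mathrm{HGr}_S(r,F,\psi)$ classifying the subbundle $\mathcal O\oplus\mathcal U_{r-1}\oplus\mathcal O$ of the pullback of $F$ factors through a morphism $\sigma\colon\mathrm{HGr}_S(r-1,E,\phi)\to Y$, and $\sigma^A\colon A(Y)\to A(\mathrm{HGr}_S(r-1,E,\phi))$ is an isomorphism. (c) Let $\mathcal U_E$ be the total space of the tautological rank $2r$ bundle on $\mathrm{HGr}_S(r,E,\phi)$, whose points are pairs $(U,x)$ with $x\in U$. Let $f\colon\mathcal U_E\to\mathrm{HGr}_S(r,F,\psi)$ be the morphism sending $(U,x)$ to the subbundle $\{(0,y,\phi(x,y)) : y\in U\}$. Then $f$ is a closed immersion identifying $\mathcal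 U_E$ with $N^-$, the inverse image $f^{-1}(N^+)$ is the zero section $\mathrm{HGr}_S(r,E,\phi)\subset\mathcal U_E$, the map $f^A\colon A_{N^+}(\mathrm{HGr}_S(r,F,\psi))\to A_{\mathrm{HGr}_S(r,E,\phi)}(\mathcal U_E)$ is an isomorphism, and the localization sequence of $N^+\subset\mathrm{HGr}_S(r,F,\psi)$ becomes the long exact sequence $$\cdots\to A_{\mathrm{HGr}_S(r,E,\phi)}(\mathcal U_E)\xrightarrow{e^A(f^A)^{-1}}A(\mathrm{HGr}_S(r,F,\psi))\xrightarrow{\sigma^Aj^A}A(\mathrm{HGr}_S(r-1,E,\phi))\xrightarrow{f^A\partial(\sigma^A)^{-1}}A_{\mathrm{HGr}_S(r,E,\phi)}(\mathcal U_E)\to\cdots$$ -/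

import Mathlib

open CategoryTheory CategoryTheory.Limits AlgebraicGeometry TopologicalSpace Opposite

universe w u

noncomputable section Definitions

namespace QuatGrass

/-! ### Vector bundles and symplectic forms, through their functors of points -/

section Bundles

variable {S : Scheme.{u}}

/-- The ring `Γ(T, 𝒪_T)` of global functions of an `S`-scheme `T`. -/
abbrev Fun (T : Over S) : Type u := Γ(T.left, ⊤)

/-- Pullback of functions along a morphism of `S`-schemes. -/
def resFun {T' T : Over S} (h : T' ⟶ T) : Fun T →+* Fun T' := h.left.appTop.hom

lemma resFun_id {T : Over S} (a : Fun T) : resFun (𝟙 T) a = a := by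
  simp [resFun]

lemma resFun_comp {T'' T' T : Over S} (g : T'' ⟶ T') (h : T' ⟶ T) (a : Fun T) :
    resFun (g ≫ h) a = resFun g (resFun h a) := by
  simp only [resFun, Over.comp_left, Scheme.Hom.comp_appTop, CommRingCat.hom_comp,
    RingHom.comp_apply]

/-- The open subscheme `W` of an `S`-scheme `T`, as an `S`-scheme. -/
abbrev openSub (T : Over S) (W : T.left.Opens) : Over S := Over.mk (W.ι ≫ T.hom)

/-- The inclusion of an open subscheme. -/
abbrev openIncl (T : Over S) (W : T.left.Opens) : openSub T W ⟶ T := Over.homMk W.ι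

/-- The spectrum of the residue field of a point `x` of an `S`-scheme `T`, as an `S`-scheme. -/
abbrev pt (T : Over S) (x : T.left) : Over S :=
  Over.mk (T.left.fromSpecResidueField x ≫ T.hom)

/-- The canonical morphism from the spectrum of a residue field. -/
abbrev ptIncl (T : Over S) (x : T.left) : pt T x ⟶ T :=
  Over.homMk (T.left.fromSpecResidueField x)

lemma exists_lift_pt {T : Over S} (W : T.left.Opens) (x : T.left) (hx : x ∈ W) :
    ∃ h : pt T x ⟶ openSub T W, h ≫ openIncl T W = ptIncl T x ∧
      ∀ s, h.left s = (⟨x, hx⟩ : W) := by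
  have hr : Set.range (T.left.fromSpecResidueField x) ⊆ Set.range W.ι := by
    rw [Scheme.range_fromSpecResidueField, Scheme.Opens.range_ι]
    simpa using hx
  refine ⟨Over.homMk (IsOpenImmersion.lift W.ι (T.left.fromSpecResidueField x) hr) ?_, ?_, ?_⟩
  · change _ ≫ W.ι ≫ T.hom = T.left.fromSpecResidueField x ≫ T.hom
    rw [IsOpenImmersion.lift_fac_assoc]
  · ext1
    exact IsOpenImmersion.lift_fac _ _ _
  · intro s
    apply Subtype.ext
    change W.ι (IsOpenImmersion.lift W.ι (T.left.fromSpecResidueField x) hr s) = x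
    rw [← Scheme.Hom.comp_apply, IsOpenImmersion.lift_fac]
    exact Scheme.fromSpecResidueField_apply _ _

lemma resFun_pt_ne_zero_iff {T T' : Over S} {x : T.left} (h : pt T x ⟶ T') (y : T'.left)
    (hy : ∀ s, h.left s = y) (f : Fun T') :
    resFun h f ≠ 0 ↔ y ∈ T'.left.basicOpen f := by
  have hpre : h.left ⁻¹ᵁ T'.left.basicOpen f = (pt T x).left.basicOpen (resFun h f) :=
    Scheme.preimage_basicOpen_top h.left f
  let s : (pt T x).left := (default : Spec (T.left.residueField x))
  constructor
  · intro h0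
    let i : Fun (pt T x) ≃+* T.left.residueField x :=
      (Scheme.ΓSpecIso (T.left.residueField x)).commRingCatIsoToRingEquiv
    have hu : IsUnit (resFun h f) := by
      rw [← MulEquiv.isUnit_map i]
      exact IsUnit.mk0 _ ((map_ne_zero_iff i i.injective).2 h0)
    have : s ∈ h.left ⁻¹ᵁ T'.left.basicOpen f := by
      rw [hpre, Scheme.basicOpen_of_isUnit _ hu]; trivial
    have h2 : h.left s ∈ T'.left.basicOpen f := this
    rwa [hy s] at h2
  · intro hmem h0
    rw [h0, Scheme.basicOpen_zero] at hpre
    have : s ∈ h.left ⁻¹ᵁ T'.left.basicOpen f := by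
      change h.left s ∈ T'.left.basicOpen f
      rwa [hy s]
    rw [hpre] at this
    exact this

variable (S) in
/-- A presheaf of modules over the structure sheaf `T ↦ Γ(T, 𝒪_T)` on the category of `S`-schemes.
A vector bundle `E` on `S` gives the presheaf with `sec T = Γ(T, g^*E)` for `g : T ⟶ S`. -/
structure BigModule where
  /-- The sections over `T`. -/
  sec : Over S → Type u
  [addCommGroup : ∀ T, AddCommGroup (sec T)]
  [module : ∀ T, Module (Fun T) (sec T)]
  /-- The pullback of sections. -/
  res : ∀ {T' T : Over S}, (T' ⟶ T) → sec T →+ sec T'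
  res_smul : ∀ {T' T : Over S} (h : T' ⟶ T) (a : Fun T) (x : sec T),
    res h (a • x) = resFun h a • res h x
  res_id : ∀ {T : Over S} (x : sec T), res (𝟙 T) x = x
  res_comp : ∀ {T'' T' T : Over S} (g : T'' ⟶ T') (h : T' ⟶ T) (x : sec T),
    res (g ≫ h) x = res g (res h x)

attribute [instance] BigModule.addCommGroup BigModule.module

namespace BigModule

variable (M : BigModule S)

/-- The underlying presheaf of sets. -/
def toFunctor : (Over S)ᵒᵖ ⥤ Type u where
  obj T := M.sec T.unop
  map f := ↾(fun x => M.res f.unop x)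
  map_id T := by ext x; exact M.res_id x
  map_comp f g := by ext x; exact M.res_comp _ _ x

/-- The sections `b i` over `T` form a basis universally: over every `T'` over `T`, the pullbacks
of the `b i` form a basis of the module of sections. -/
def IsBasis {ι : Type} [Fintype ι] {T : Over S} (b : ι → M.sec T) : Prop :=
  ∀ (T' : Over S) (h : T' ⟶ T),
    Function.Bijective fun c : ι → Fun T' => ∑ i, c i • M.res h (b i)

/-- Vector bundles of rank `m` on `S`: Zariski sheaves of modules on the category of `S`-schemes
which are, locally on `S`, free of rank `m`. (By `E ↦ (g ↦ Γ(T, g^*E))` this is the same as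
a locally free `𝒪_S`-module of rank `m`.) -/
structure IsVectorBundle (m : ℕ) : Prop where
  isSheaf : Presieve.IsSheaf (Scheme.zariskiTopology.over S) M.toFunctor
  locallyFree : ∀ s : S, ∃ W : S.Opens, s ∈ W ∧
    ∃ b : Fin m → M.sec (Over.mk W.ι), M.IsBasis b

/-- Alternating bilinear forms with values in the structure sheaf. -/
structure AltForm where
  /-- The form on sections over `T`. -/
  form : ∀ T : Over S, M.sec T →ₗ[Fun T] M.sec T →ₗ[Fun T] Fun T
  alt : ∀ (T : Over S) (x : M.sec T), form T x x = 0
  res_form : ∀ {T' T : Over S} (h : T' ⟶ T) (x y : M.sec T),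
    form T' (M.res h x) (M.res h y) = resFun h (form T x y)

/-- The form identifies the bundle with its dual. A symplectic bundle is a vector bundle
with a nondegenerate alternating form. -/
def AltForm.IsNondegenerate {M : BigModule S} (φ : M.AltForm) : Prop :=
  ∀ T : Over S, IsAffine T.left → Function.Bijective (φ.form T)

/-- Zariski subsheaves of modules of the pullback of `M` to an `S`-scheme `T`. -/
@[ext]
structure SubSheaf (T : Over S) where
  /-- The sections over a `T`-scheme `T'`. -/
  sec : ∀ {T' : Over S} (_ : T' ⟶ T), Submodule (Fun T') (M.sec T')
  res_mem : ∀ {T'' T' : Over S} (g : T'' ⟶ T') (h : T' ⟶ T) (x : M.sec T'),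
    x ∈ sec h → M.res g x ∈ sec (g ≫ h)
  local_mem : ∀ {T' : Over S} (h : T' ⟶ T) (x : M.sec T'),
    (∀ t : T'.left, ∃ W : T'.left.Opens, t ∈ W ∧
      M.res (openIncl T' W) x ∈ sec (openIncl T' W ≫ h)) → x ∈ sec h

namespace SubSheaf

variable {M} {T : Over S}

/-- The pullback of a subsheaf along a morphism of `S`-schemes. -/
def pull {T₁ : Over S} (U : M.SubSheaf T) (g : T₁ ⟶ T) : M.SubSheaf T₁ where
  sec h := U.sec (h ≫ g)
  res_mem a h x hx := by
    have := U.res_mem a (h ≫ g) x hx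
    rwa [← Category.assoc] at this
  local_mem h x hx := U.local_mem (h ≫ g) x (by simpa only [Category.assoc] using hx)

/-- `U` is a subbundle of rank `m`: locally on `T` the bundle has a basis whose first `m` members
form a basis of `U` (that is, `U` is locally a direct summand, free of rank `m`). -/
def IsSubbundle (U : M.SubSheaf T) (m : ℕ) : Prop :=
  ∀ t : T.left, ∃ W : T.left.Opens, t ∈ W ∧ ∃ (l : ℕ) (b : Fin m ⊕ Fin l → M.sec (openSub T W)),
    M.IsBasis b ∧ ∀ (T' : Over S) (h : T' ⟶ openSub T W),
      U.sec (h ≫ openIncl T W) =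
        Submodule.span (Fun T') (Set.range fun i : Fin m => M.res h (b (Sum.inl i)))

/-- The restriction of the form `φ` to `U` is nondegenerate. -/
def IsSymplectic (U : M.SubSheaf T) (φ : M.AltForm) : Prop :=
  ∀ (T' : Over S) (h : T' ⟶ T), IsAffine T'.left →
    Function.Bijective ((φ.form T').domRestrict₁₂ (U.sec h) (U.sec h))

lemma IsSubbundle.pull {T₁ : Over S} {U : M.SubSheaf T} {m : ℕ} (hU : U.IsSubbundle m)
    (g : T₁ ⟶ T) : (U.pull g).IsSubbundle m := by
  intro t
  obtain ⟨W, htW, l, b, hb, hspan⟩ := hU (g.left t)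
  let W' : T₁.left.Opens := g.left ⁻¹ᵁ W
  let g' : openSub T₁ W' ⟶ openSub T W :=
    Over.homMk (g.left ∣_ W) (by
      change (g.left ∣_ W) ≫ W.ι ≫ T.hom = W'.ι ≫ T₁.hom
      rw [← Over.w g, morphismRestrict_ι_assoc])
  have hg' : g' ≫ openIncl T W = openIncl T₁ W' ≫ g := by
    ext1
    exact morphismRestrict_ι g.left W
  refine ⟨W', htW, l, fun i => M.res g' (b i), ?_, ?_⟩
  · intro T' h
    simpa only [M.res_comp] using hb T' (h ≫ g')
  · intro T' h
    have := hspan T' (h ≫ g')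
    rw [Category.assoc, hg'] at this
    simp only [M.res_comp] at this
    change U.sec ((h ≫ openIncl T₁ W') ≫ g) = _
    rw [Category.assoc]
    exact this

lemma pull_id (U : M.SubSheaf T) : U.pull (𝟙 T) = U := by
  ext T' h x
  simp [pull]

lemma pull_comp {T₁ T₂ : Over S} (U : M.SubSheaf T) (g : T₁ ⟶ T) (f : T₂ ⟶ T₁) :
    U.pull (f ≫ g) = (U.pull g).pull f := by
  ext T' h x
  simp [pull]

end SubSheaf

/-- The functor of points of the Grassmannian bundle `Gr_S(m, M)`: it sends `T` to the set of
rank `m` subbundles of the pullback of `M` to `T`. -/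
def grassmannian (m : ℕ) : (Over S)ᵒᵖ ⥤ Type (u + 1) where
  obj T := {U : M.SubSheaf T.unop // U.IsSubbundle m}
  map g := ↾(fun U => ⟨U.1.pull g.unop, U.2.pull g.unop⟩)
  map_id T := by refine ConcreteCategory.hom_ext _ _ fun U => ?_; exact Subtype.ext (SubSheaf.pull_id U.1)
  map_comp f g := by refine ConcreteCategory.hom_ext _ _ fun U => ?_; exact Subtype.ext (SubSheaf.pull_comp U.1 f.unop g.unop)

variable {M}

/-- The functor of points of the quaternionic Grassmannian bundle `HGr_S(r; M, φ)`: it sends `T` to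
the set of those rank `2r` subbundles of the pullback of `M` to `T` on which `φ` is
nondegenerate. -/
def AltForm.hgr (φ : M.AltForm) (r : ℕ) : (Over S)ᵒᵖ ⥤ Type (u + 1) where
  obj T := {U : M.SubSheaf T.unop // U.IsSubbundle (2 * r) ∧ U.IsSymplectic φ}
  map g := ↾(fun U => ⟨U.1.pull g.unop, U.2.1.pull g.unop, fun T' h => U.2.2 T' (h ≫ g.unop)⟩)
  map_id T := by refine ConcreteCategory.hom_ext _ _ fun U => ?_; exact Subtype.ext (SubSheaf.pull_id U.1)
  map_comp f g := by refine ConcreteCategory.hom_ext _ _ fun U => ?_; exact Subtype.ext (SubSheaf.pull_comp U.1 f.unop g.unop)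

/-- The functor of points of the total space of the tautological bundle of `HGr_S(r; M, φ)`: it
sends `T` to the set of pairs `(U, x)` of a symplectic subbundle `U` as above and a section `x`
of `U` over `T`. -/
def AltForm.tautTotal (φ : M.AltForm) (r : ℕ) : (Over S)ᵒᵖ ⥤ Type (u + 1) where
  obj T := {p : (φ.hgr r).obj T × M.sec T.unop // p.2 ∈ p.1.1.sec (𝟙 T.unop)}
  map {T T'} g := ↾(fun p => ⟨((φ.hgr r).map g p.1.1, M.res g.unop p.1.2), by
    have := p.1.1.1.res_mem g.unop (𝟙 _) p.1.2 p.2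
    rw [Category.comp_id] at this
    change _ ∈ p.1.1.1.sec (𝟙 _ ≫ g.unop)
    rwa [Category.id_comp]⟩)
  map_id T := by
    refine ConcreteCategory.hom_ext _ _ fun p => ?_
    refine Subtype.ext (Prod.ext ?_ (M.res_id _))
    exact ConcreteCategory.congr_hom ((φ.hgr r).map_id T) p.1.1
  map_comp f g := by
    refine ConcreteCategory.hom_ext _ _ fun p => ?_
    refine Subtype.ext (Prod.ext ?_ (M.res_comp _ _ _))
    exact ConcreteCategory.congr_hom ((φ.hgr r).map_comp f g) p.1.1

section Universal

variable {φ : M.AltForm} {r : ℕ} {G : Over S} (e : (φ.hgr r).RepresentableBy G)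

/-- The subbundle of the pullback of `M` to `T` which is classified by `g : T ⟶ G`, where the
`S`-scheme `G` is the quaternionic Grassmannian bundle. -/
def classified {T : Over S} (g : T ⟶ G) : M.SubSheaf T := (e.homEquiv g).1

/-- The tautological symplectic subbundle on the quaternionic Grassmannian bundle. -/
def taut : M.SubSheaf G := classified e (𝟙 G)

lemma taut_isSubbundle : (taut e).IsSubbundle (2 * r) := (e.homEquiv (𝟙 G)).2.1

/-- The zero section `G ⟶ V` of the total space `V` of the tautological bundle. -/
def zeroSection {V : Over S} (eV : (φ.tautTotal r).RepresentableBy V) : G ⟶ V :=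
  eV.homEquiv.symm ⟨(e.homEquiv (𝟙 G), 0), Submodule.zero_mem _⟩

end Universal

variable (M) in
/-- The bundle `𝒪 ⊕ M ⊕ 𝒪`. -/
def hyp : BigModule S where
  sec T := Fun T × M.sec T × Fun T
  res h := (resFun h).toAddMonoidHom.prodMap ((M.res h).prodMap (resFun h).toAddMonoidHom)
  res_smul h a x := by
    refine Prod.ext ?_ (Prod.ext ?_ ?_)
    · exact map_mul (resFun h) a x.1
    · exact M.res_smul h a x.2.1
    · exact map_mul (resFun h) a x.2.2
  res_id x := by
    refine Prod.ext ?_ (Prod.ext ?_ ?_)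
    · exact resFun_id x.1
    · exact M.res_id x.2.1
    · exact resFun_id x.2.2
  res_comp g h x := by
    refine Prod.ext ?_ (Prod.ext ?_ ?_)
    · exact resFun_comp g h x.1
    · exact M.res_comp g h x.2.1
    · exact resFun_comp g h x.2.2

/-- The orthogonal sum of a bilinear form `f` and the hyperbolic form: the form
`((a, x, b), (a', x', b')) ↦ a b' + f(x, x') - b a'`. -/
def hypForm {R N : Type*} [CommRing R] [AddCommGroup N] [Module R N] (f : N →ₗ[R] N →ₗ[R] R) :
    (R × N × R) →ₗ[R] (R × N × R) →ₗ[R] R :=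
  LinearMap.mk₂ R (fun v v' => v.1 * v'.2.2 + f v.2.1 v'.2.1 - v.2.2 * v'.1)
    (by intros; simp; ring) (by intros; simp; ring) (by intros; simp; ring)
    (by intros; simp; ring)

/-- The orthogonal sum of `φ` and the hyperbolic form on `𝒪 ⊕ M ⊕ 𝒪`, that is, the form
`ψ((a, x, b), (a', x', b')) = a b' + φ(x, x') - b a'`. -/
def AltForm.hyp (φ : M.AltForm) : M.hyp.AltForm where
  form T := hypForm (φ.form T)
  alt T x := by
    change x.1 * x.2.2 + φ.form T x.2.1 x.2.1 - x.2.2 * x.1 = 0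
    rw [φ.alt]; ring
  res_form h x y := by
    change resFun h x.1 * resFun h y.2.2 + φ.form _ (M.res h x.2.1) (M.res h y.2.1)
      - resFun h x.2.2 * resFun h y.1 = resFun h (x.1 * y.2.2 + φ.form _ x.2.1 y.2.1 - x.2.2 * y.1)
    rw [φ.res_form]; simp

/-- The closed set of the points of `T` over which a subbundle `U` of `𝒪 ⊕ M ⊕ 𝒪` is contained in
`𝒪 ⊕ M`. For the tautological subbundle of `HGr_S(r; 𝒪 ⊕ M ⊕ 𝒪, ψ)` this is the closed set `N⁺`,
the intersection of `HGr_S(r; 𝒪 ⊕ M ⊕ 𝒪, ψ)` and `Gr_S(2r, 𝒪 ⊕ M)`. -/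
def nPlus {T : Over S} (U : M.hyp.SubSheaf T) {m : ℕ} (hU : U.IsSubbundle m) :
    Closeds T.left where
  carrier := {x | ∀ v ∈ U.sec (ptIncl T x), v.2.2 = 0}
  isClosed' := by
    rw [← isOpen_compl_iff, isOpen_iff_forall_mem_open]
    intro x hx
    simp only [Set.mem_compl_iff, Set.mem_ofPred_eq, not_forall] at hx
    obtain ⟨v, hv, hv0⟩ := hx
    obtain ⟨W, hxW, l, b, -, hspan⟩ := hU x
    obtain ⟨h, hh, hhx⟩ := exists_lift_pt W x hxW
    have key : ∃ i, resFun h (b (Sum.inl i)).2.2 ≠ 0 := by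
      by_contra! hcon
      apply hv0
      rw [← hh, hspan _ h] at hv
      induction hv using Submodule.span_induction with
      | mem y hy => obtain ⟨i, rfl⟩ := hy; exact hcon i
      | zero => rfl
      | add y z _ _ hy hz =>
        change y.2.2 + z.2.2 = 0
        by_cases hy0 : y.2.2 = 0
        · by_cases hz0 : z.2.2 = 0
          · rw [hy0, hz0, add_zero]
          · exact absurd (hz hz0) hz0
        · exact absurd (hy hy0) hy0
      | smul a y _ hy =>
        change a * y.2.2 = 0
        by_cases hy0 : y.2.2 = 0
        · rw [hy0, mul_zero]
        · exact absurd (hy hy0) hy0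
    obtain ⟨i, hi⟩ := key
    let f : Γ(W.toScheme, ⊤) := (b (Sum.inl i)).2.2
    refine ⟨(W.ι ''ᵁ W.toScheme.basicOpen f : T.left.Opens), ?_, Opens.isOpen _, ?_⟩
    · rintro y ⟨y, hy, rfl⟩ hy'
      obtain ⟨h', hh', hhy⟩ := exists_lift_pt W (W.ι y) y.2
      refine (resFun_pt_ne_zero_iff h' y hhy f).2 hy ?_
      have hmem : M.hyp.res h' (b (Sum.inl i)) ∈ U.sec (ptIncl T (W.ι y)) := by
        rw [← hh', hspan _ h']
        exact Submodule.subset_span ⟨i, rfl⟩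
      exact hy' _ hmem
    · exact ⟨⟨x, hxW⟩, (resFun_pt_ne_zero_iff h ⟨x, hxW⟩ hhx f).1 hi, rfl⟩

section Maps

variable {φ : M.AltForm} {r r' : ℕ} {GF G' V : Over S}

/-- The morphism `σ : G' ⟶ GF` from `G' = HGr_S(r'; M, φ)` to `GF = HGr_S(r; 𝒪 ⊕ M ⊕ 𝒪, ψ)`
classifies the subbundle `𝒪 ⊕ U' ⊕ 𝒪`, where `U'` is the tautological subbundle on `G'`. -/
def ClassifiesSum (e' : (φ.hgr r').RepresentableBy G') (eF : (φ.hyp.hgr r).RepresentableBy GF)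
    (σ : G' ⟶ GF) : Prop :=
  ∀ (T : Over S) (h : T ⟶ G') (v : Fun T × M.sec T × Fun T),
    v ∈ (classified eF σ).sec h ↔ v.2.1 ∈ (taut e').sec h

/-- The morphism `f : V ⟶ GF` from the total space `V` of the tautological bundle `U` on
`HGr_S(r; M, φ)` to `GF = HGr_S(r; 𝒪 ⊕ M ⊕ 𝒪, ψ)` sends a pair `(U, x)` to the subbundle of the
vectors `(0, y, φ(x, y))` with `y` in `U`. -/
def ClassifiesGraph (eV : (φ.tautTotal r).RepresentableBy V)
    (eF : (φ.hyp.hgr r).RepresentableBy GF) (f : V ⟶ GF) : Prop :=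
  ∀ (T : Over S) (h : T ⟶ V) (v : Fun T × M.sec T × Fun T),
    v ∈ (classified eF f).sec h ↔
      v.1 = 0 ∧ v.2.1 ∈ (eV.homEquiv h).1.1.1.sec (𝟙 T) ∧
        v.2.2 = φ.form T (eV.homEquiv h).1.2 v.2.1

/-- The morphism `f : V ⟶ GF` identifies `V` with the closed subscheme
`N⁻ = HGr_S(r; 𝒪 ⊕ M ⊕ 𝒪, ψ) ∩ Gr_S(2r, M ⊕ 𝒪)` of `GF = HGr_S(r; 𝒪 ⊕ M ⊕ 𝒪, ψ)`. -/
def IsNMinus (eF : (φ.hyp.hgr r).RepresentableBy GF) (f : V ⟶ GF) : Prop :=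
  IsClosedImmersion f.left ∧ ∀ (T : Over S) (g : T ⟶ GF),
    (∃ h : T ⟶ V, h ≫ f = g) ↔
      ∀ (T' : Over S) (a : T' ⟶ T) (v : Fun T' × M.sec T' × Fun T'),
        v ∈ (classified eF g).sec a → v.1 = 0

end Maps

end BigModule

end Bundles

/-! ### Categories of `k`-schemes and cohomology theories -/

section Cohomology

/-- A scheme has an ample family of line bundles if every point has an affine open neighbourhood
which is the nonvanishing locus of a global section of some line bundle. (For a quasi-compact
scheme this is the usual notion, as powers of line bundles are line bundles.) -/
def HasAmpleFamily (X : Scheme.{u}) : Prop :=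
  ∀ x : X, ∃ (L : BigModule X) (_ : L.IsVectorBundle 1) (s : L.sec (Over.mk (𝟙 X)))
    (W : X.Opens), x ∈ W ∧ IsAffineOpen W ∧
      ∀ y : X, y ∈ W ↔ L.res (ptIncl (Over.mk (𝟙 X)) y) s ≠ 0

variable {k : Scheme.{u}}

/-- The conditions on the full subcategory `𝒱` of the category of `k`-schemes. -/
structure IsAdmissible (𝒱 : ObjectProperty (Over k)) : Prop where
  compactSpace : ∀ X, 𝒱 X → CompactSpace X.left
  quasiSeparatedSpace : ∀ X, 𝒱 X → QuasiSeparatedSpace X.left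
  hasAmpleFamily : ∀ X, 𝒱 X → HasAmpleFamily X.left
  base : 𝒱 (Over.mk (𝟙 k))
  empty : ∀ X : Over k, IsEmpty X.left → 𝒱 X
  coprod : ∀ X Y : Over k, 𝒱 X → 𝒱 Y → 𝒱 (Over.mk (coprod.desc X.hom Y.hom))
  prod : ∀ X Y : Over k, 𝒱 X → 𝒱 Y → 𝒱 (Over.mk (pullback.fst X.hom Y.hom ≫ X.hom))
  opens : ∀ (X U : Over k) (j : U ⟶ X), 𝒱 X → IsOpenImmersion j.left → CompactSpace U.left → 𝒱 U
  /-- A quasi-compact open subscheme `Y` of a Grassmannian bundle `G` over a scheme `X` in `𝒱`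
  which is affine over `X` is in `𝒱`. -/
  grassmannian : ∀ (X : Over k), 𝒱 X → ∀ (B : BigModule X.left) (N m : ℕ), B.IsVectorBundle N →
    ∀ (G : Over X.left), Nonempty ((B.grassmannian m).RepresentableBy G) →
    ∀ (Y : Over X.left) (j : Y ⟶ G), IsOpenImmersion j.left → CompactSpace Y.left →
      IsAffineHom Y.hom → 𝒱 ((Over.map X.hom).obj Y)

/-- An `S`-scheme, regarded as a `k`-scheme. -/
abbrev toBase (S : Over k) (G : Over S.left) : Over k := (Over.map S.hom).obj G

/-- A morphism of `S`-schemes, regarded as a morphism of `k`-schemes. -/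
abbrev toBaseMap (S : Over k) {G G' : Over S.left} (f : G ⟶ G') : toBase S G ⟶ toBase S G' :=
  (Over.map S.hom).map f

/-- The structure morphism of an `S`-scheme, as a morphism of `k`-schemes. -/
abbrev toBaseProj (S : Over k) (G : Over S.left) : toBase S G ⟶ S := Over.homMk G.hom

/-- The open complement of a closed subset, as a `k`-scheme. -/
abbrev openCompl (X : Over k) (Z : Closeds X.left) : Over k := openSub X Z.compl

/-- The inclusion of the open complement of a closed subset. -/
abbrev openComplIncl (X : Over k) (Z : Closeds X.left) : openCompl X Z ⟶ X := openIncl X Z.compl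

/-- A pair of a `k`-scheme `X` and a closed subset `Z` of `X` such that `X` and `X ∖ Z` are
in `𝒱`. -/
structure SupportPair (𝒱 : ObjectProperty (Over k)) where
  X : Over k
  Z : Closeds X.left
  mem : 𝒱 X
  mem_compl : 𝒱 (openCompl X Z)

namespace SupportPair

variable {𝒱 : ObjectProperty (Over k)}

/-- A morphism `(X', Z') ⟶ (X, Z)` is a morphism `f : X' ⟶ X` with `f⁻¹(Z) ⊆ Z'`. -/
@[ext]
structure Hom (q p : SupportPair 𝒱) where
  f : q.X ⟶ p.X
  preimage_subset : f.left ⁻¹' (p.Z : Set p.X.left) ⊆ q.Z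

instance : Category (SupportPair 𝒱) where
  Hom := Hom
  id p := ⟨𝟙 p.X, fun _ hx => by simpa using hx⟩
  comp a b := ⟨a.f ≫ b.f, fun x hx => a.preimage_subset (b.preimage_subset (by simpa using hx))⟩

/-- The pair `(X, X)`. -/
def total (h𝒱 : IsAdmissible 𝒱) (X : Over k) (hX : 𝒱 X) : SupportPair 𝒱 where
  X := X
  Z := ⊤
  mem := hX
  mem_compl := h𝒱.empty _ ⟨fun x => x.2 trivial⟩

/-- The morphism `(X', X') ⟶ (X, X)` given by a morphism `X' ⟶ X`. -/
def totalMap (h𝒱 : IsAdmissible 𝒱) {X' X : Over k} (hX' : 𝒱 X') (hX : 𝒱 X) (f : X' ⟶ X) :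
    total h𝒱 X' hX' ⟶ total h𝒱 X hX :=
  Hom.mk f fun _ _ => trivial

/-- The morphism `(X, X) ⟶ (X, Z)` given by the identity of `X`. -/
def forgetSupport (h𝒱 : IsAdmissible 𝒱) (p : SupportPair 𝒱) : total h𝒱 p.X p.mem ⟶ p :=
  Hom.mk (𝟙 p.X) fun _ _ => trivial

/-- The morphism `(X ∖ Z, X ∖ Z) ⟶ (X, X)` given by the inclusion. -/
def inclCompl (h𝒱 : IsAdmissible 𝒱) (p : SupportPair 𝒱) :
    total h𝒱 (openCompl p.X p.Z) p.mem_compl ⟶ total h𝒱 p.X p.mem :=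
  totalMap h𝒱 _ _ (openComplIncl p.X p.Z)

end SupportPair

open SupportPair

/-- The affine line over a `k`-scheme `X`, as a `k`-scheme. -/
abbrev affineLine (X : Over k) : Over k :=
  Over.mk ((𝔸(PUnit.{u + 1}; X.left) ↘ X.left) ≫ X.hom)

/-- The projection from the affine line over `X` to `X`. -/
abbrev affineLineProj (X : Over k) : affineLine X ⟶ X :=
  Over.homMk (𝔸(PUnit.{u + 1}; X.left) ↘ X.left)

/-- A cohomology theory `(A, ∂)` on `𝒱`. -/
structure CohomologyTheory {𝒱 : ObjectProperty (Over k)} (h𝒱 : IsAdmissible 𝒱) where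
  /-- The functor `(X, Z) ↦ A_Z(X)`. -/
  A : (SupportPair 𝒱)ᵒᵖ ⥤ AddCommGrpCat.{w}
  /-- The boundary map `A(X ∖ Z) → A_Z(X)`. -/
  bd : ∀ p : SupportPair 𝒱,
    A.obj (op (total h𝒱 (openCompl p.X p.Z) p.mem_compl)) ⟶ A.obj (op p)
  /-- The boundary map is natural: `g` is the map `X' ∖ Z' ⟶ X ∖ Z` induced by `f`. -/
  bd_natural : ∀ {q p : SupportPair 𝒱} (f : q ⟶ p) (g : openCompl q.X q.Z ⟶ openCompl p.X p.Z),
    g ≫ openComplIncl p.X p.Z = openComplIncl q.X q.Z ≫ f.f →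
    A.map (totalMap h𝒱 q.mem_compl p.mem_compl g).op ≫ bd q = bd p ≫ A.map f.op
  exact_bd_e : ∀ p : SupportPair 𝒱, Function.Exact (bd p) (A.map (forgetSupport h𝒱 p).op)
  exact_e_j : ∀ p : SupportPair 𝒱,
    Function.Exact (A.map (forgetSupport h𝒱 p).op) (A.map (inclCompl h𝒱 p).op)
  exact_j_bd : ∀ p : SupportPair 𝒱, Function.Exact (A.map (inclCompl h𝒱 p).op) (bd p)
  /-- Étale excision; closed subsets are regarded as reduced closed subschemes. -/
  excision : ∀ {q p : SupportPair 𝒱} (f : q ⟶ p), Etale f.f.left →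
    (q.Z : Set q.X.left) = f.f.left ⁻¹' (p.Z : Set p.X.left) →
    IsIso (pullback.snd f.f.left (Scheme.IdealSheafData.vanishingIdeal p.Z).subschemeι) →
    Function.Bijective (A.map f.op)
  homotopy : ∀ (X : Over k) (hX : 𝒱 X) (hX' : 𝒱 (affineLine X)),
    Function.Bijective (A.map (totalMap h𝒱 hX' hX (affineLineProj X)).op)

namespace CohomologyTheory

variable {𝒱 : ObjectProperty (Over k)} {h𝒱 : IsAdmissible 𝒱} (A : CohomologyTheory.{w} h𝒱)

/-- The group `A_Z(X)`. -/
abbrev grp (p : SupportPair 𝒱) : Type w := A.A.obj (op p)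

/-- The pullback `f^A : A_Z(X) → A_{Z'}(X')` along `f : (X', Z') ⟶ (X, Z)`. -/
abbrev pullback {q p : SupportPair 𝒱} (f : q ⟶ p) : A.grp p →+ A.grp q := (A.A.map f.op).hom

/-- The group `A(X)`. -/
abbrev tot (X : Over k) (hX : 𝒱 X) : Type w := A.grp (total h𝒱 X hX)

/-- The pullback `f^A : A(X) → A(X')` along `f : X' ⟶ X`. -/
abbrev totPullback {X' X : Over k} (hX' : 𝒱 X') (hX : 𝒱 X) (f : X' ⟶ X) :
    A.tot X hX →+ A.tot X' hX' :=
  A.pullback (totalMap h𝒱 hX' hX f)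

/-- Extension of supports `e^A : A_Z(X) → A(X)`. -/
abbrev extSupport (p : SupportPair 𝒱) : A.grp p →+ A.tot p.X p.mem :=
  A.pullback (forgetSupport h𝒱 p)

/-- Restriction `j^A : A(X) → A(X ∖ Z)`. -/
abbrev restrict (p : SupportPair 𝒱) : A.tot p.X p.mem →+ A.tot (openCompl p.X p.Z) p.mem_compl :=
  A.pullback (inclCompl h𝒱 p)

/-- The boundary map `∂ : A(X ∖ Z) → A_Z(X)`. -/
abbrev boundary (p : SupportPair 𝒱) : A.tot (openCompl p.X p.Z) p.mem_compl →+ A.grp p :=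
  (A.bd p).hom

end CohomologyTheory

/-- The closed subset `N⁺` of `GF = HGr_S(r; 𝒪 ⊕ E ⊕ 𝒪, ψ)`. -/
abbrev NPlus (S : Over k) {E : BigModule S.left} {φ : E.AltForm} {r : ℕ} {GF : Over S.left}
    (eF : (φ.hyp.hgr r).RepresentableBy GF) : Closeds (toBase S GF).left :=
  (BigModule.nPlus (BigModule.taut eF) (BigModule.taut_isSubbundle eF) : Closeds GF.left)

end Cohomology

end QuatGrass

end Definitions

open QuatGrass QuatGrass.BigModule QuatGrass.SupportPair

/-! Away from `N⁺` the last coordinate maps `U` onto `𝒪`. Let `Q` be the scheme of pairs of such a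
`U` and a section `w = (a, x, 1)` of `U`. It is an affine bundle over `Y`: local unit sections
exist, and the segments joining them to `w` contract it. Mayer–Vietoris and homotopy invariance
therefore give `A(Y) ≅ A(Q)`. Since `ψ` is nondegenerate on `U`, the last coordinate on `U` is
`ψ(v₀, ·)` for a unique `v₀` in `U`. From `ψ(v₀, v₀) = 0` and `ψ(v₀, w) = 1` one finds `v₀ = (1 +
φ(x, y), y, 0)`. Hence `U` is the sum of the lines of `w` and `v₀` and of the vectors `(φ(x, z), z,
0)` with `z` in a symplectic subbundle `U'` of rank `2r - 2` orthogonal to `y`. So `Q` parametrizes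
the `(U', a, x, y)` with `y` orthogonal to `U'`. Scaling `(a, x, y)` by `t` contracts `Q` to `HGr(r
- 1, E)`, embedded by `U' ↦ 𝒪 ⊕ U' ⊕ 𝒪` (`SubSheaf.exists_eq_hypLift`,
`SubSheaf.hypLift_isSymplectic`, `exists_homotopy`). This proves (b). For `r = 1` the base of the
contraction is `S` itself, and (a) follows.

For (c), consider the open locus `O` where the form that `φ` induces on the middle components is
nondegenerate on `U`. There `U` is the graph of `z ↦ (φ(x, z), z, φ(y, z))` over a symplectic `U'`
in `E`, with unique `x`, `y` in `U'` (`SubSheaf.exists_eq_graph`). The locus `N⁻` is `x = 0`, which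
is the total space `V` of the tautological bundle, and `N⁺` is `y = 0`. Thus `O` is open in a vector
bundle `W` over `V`, with fibre coordinate `x`, and contains the whole inverse image in `W` of the
zero section of `V`, because `ψ` restricts to `φ` on a graph with `y = 0`. Excision for the
inclusions of `O` in `HGr(r, F)` and in `W`, and homotopy invariance of `W` over `V`, give the
isomorphism with supports (`exists_neighbourhood`, `CohomologyTheory.bijective_pullback_tautGraph`).
As `f` factors through `O` as a section of the projection to `V`, the isomorphism is `f^A`. The long
exact sequence is then the localization sequence transported along `f^A` and `σ^A`.

Everything has to lie in `𝒱`. A quaternionic Grassmannian is open in a Grassmannian and affine over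
the base, being locally the scheme of matrices of self-adjoint projectors of fixed rank
(`isAffineHom_hgr`). A bundle of sections on which a functional `f` equals one is open in the bundle
of lines and affine over its base (`exists_unitSections`). This covers `Q`, vector bundles and the
affine line. All schemes are handled through their functors of points, so that representability of
Grassmannians is also proved. -/

noncomputable section

/-! ### Open subschemes, Zariski gluing and functions -/

namespace QuatGrass

variable {S : Scheme.{u}}

instance isOpenImmersion_openIncl_left (T : Over S) (W : T.left.Opens) :
    IsOpenImmersion (openIncl T W).left :=
  inferInstanceAs (IsOpenImmersion W.ι)

instance mono_of_isOpenImmersion_left {N T : Over S} (j : N ⟶ T) [IsOpenImmersion j.left] :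
    Mono j :=
  Over.mono_of_mono_left j

/-- A morphism whose image lies in the image of an open immersion factors through it. -/
lemma exists_lift_of_range {N T T' : Over S} (j : N ⟶ T) [IsOpenImmersion j.left] (h : T' ⟶ T)
    (hr : ∀ t, h.left t ∈ Set.range j.left) : ∃ h' : T' ⟶ N, h' ≫ j = h := by
  have hr' : Set.range h.left ⊆ Set.range j.left := by rintro _ ⟨t, rfl⟩; exact hr t
  refine ⟨Over.homMk (IsOpenImmersion.lift j.left h.left hr') ?_, ?_⟩
  · rw [← Over.w j, IsOpenImmersion.lift_fac_assoc, Over.w]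
  · ext1
    exact IsOpenImmersion.lift_fac _ _ _

lemma exists_lift_openSub {T T' : Over S} (W : T.left.Opens) (h : T' ⟶ T)
    (hW : ∀ t, h.left t ∈ W) : ∃ h' : T' ⟶ openSub T W, h' ≫ openIncl T W = h :=
  exists_lift_of_range (openIncl T W) h fun t => by
    change _ ∈ Set.range W.ι
    rw [Scheme.Opens.range_ι]
    exact hW t

lemma range_openIncl (T : Over S) (W : T.left.Opens) :
    Set.range (openIncl T W).left = (W : Set T.left) :=
  Scheme.Opens.range_ι W

lemma openIncl_mem {T T' : Over S} {W : T.left.Opens} (h : T' ⟶ openSub T W) (t : T'.left) :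
    (h ≫ openIncl T W).left t ∈ W := by
  have : (openIncl T W).left (h.left t) ∈ Set.range (openIncl T W).left := ⟨_, rfl⟩
  rw [range_openIncl] at this
  simpa using this

/-- Base change of an open immersion. -/
lemma exists_preimage_nhd {N T T' : Over S} (j : N ⟶ T) [IsOpenImmersion j.left] (h : T' ⟶ T) :
    ∃ h' : openSub T' (h.left ⁻¹ᵁ j.left.opensRange) ⟶ N,
      h' ≫ j = openIncl T' _ ≫ h := by
  apply exists_lift_of_range
  intro t
  have := openIncl_mem (𝟙 (openSub T' (h.left ⁻¹ᵁ j.left.opensRange))) t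
  simpa using this

lemma exists_nhd_lift {N T : Over S} (h : N ⟶ T) (W : T.left.Opens) (t : N.left)
    (ht : h.left t ∈ W) : ∃ W' : N.left.Opens, t ∈ W' ∧
      ∃ h' : openSub N W' ⟶ openSub T W, h' ≫ openIncl T W = openIncl N W' ≫ h := by
  obtain ⟨h', hh'⟩ := exists_preimage_nhd (openIncl T W) h
  refine ⟨_, ?_, h', hh'⟩
  change h.left t ∈ Set.range (openIncl T W).left
  rw [range_openIncl]
  exact ht

lemma exists_opens_of_mem_zariskiTopology {X : Scheme.{u}} {R : Sieve X}
    (hR : R ∈ Scheme.zariskiTopology X) (x : X) : ∃ W : X.Opens, x ∈ W ∧ R W.ι := by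
  obtain ⟨𝒰, h𝒰⟩ := Scheme.exists_cover_of_mem_grothendieckTopology hR
  have hi : IsOpenImmersion (𝒰.f (𝒰.idx x)) := 𝒰.map_prop _
  refine ⟨(𝒰.f (𝒰.idx x)).opensRange, 𝒰.covers x, ?_⟩
  have : (𝒰.f (𝒰.idx x)).opensRange.ι = (𝒰.f (𝒰.idx x)).isoOpensRange.inv ≫ 𝒰.f (𝒰.idx x) := by
    rw [Scheme.Hom.isoOpensRange_inv_comp]
  rw [this]
  exact R.downward_closed (h𝒰 _ _ (Presieve.ofArrows.mk (f := 𝒰.f) (𝒰.idx x))) _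

lemma mem_zariskiTopology_of_opens {X : Scheme.{u}} {R : Sieve X}
    (h : ∀ x : X, ∃ W : X.Opens, x ∈ W ∧ R W.ι) : R ∈ Scheme.zariskiTopology X := by
  choose W hW hR using h
  rw [Scheme.mem_grothendieckTopology_iff]
  refine ⟨X.openCoverOfIsOpenCover W ?_, ?_⟩
  · rw [TopologicalSpace.IsOpenCover, eq_top_iff]
    intro x _
    exact Opens.mem_iSup.2 ⟨x, hW x⟩
  · rintro _ _ ⟨i⟩
    exact hR i

section Sheaf

variable {F : (Over S)ᵒᵖ ⥤ Type w}

lemma openSub_sieve_mem (T : Over S) (W : T.left → T.left.Opens) (hW : ∀ t, t ∈ W t) :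
    Sieve.ofArrows _ (fun t => openIncl T (W t)) ∈ Scheme.zariskiTopology.over S T := by
  rw [GrothendieckTopology.mem_over_iff]
  refine mem_zariskiTopology_of_opens fun t => ⟨W t, hW t, ?_⟩
  rw [Sieve.overEquiv_iff]
  exact Sieve.ofArrows_mk _ (fun t => openIncl T (W t)) t

lemma sheaf_glue (hF : Presieve.IsSheaf (Scheme.zariskiTopology.over S) F) (T : Over S)
    (W : T.left → T.left.Opens) (hW : ∀ t, t ∈ W t) (x : ∀ t, F.obj (op (openSub T (W t))))
    (hx : ∀ (t t' : T.left) (T' : Over S) (a : T' ⟶ openSub T (W t)) (b : T' ⟶ openSub T (W t')),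
      a ≫ openIncl T (W t) = b ≫ openIncl T (W t') → F.map a.op (x t) = F.map b.op (x t')) :
    ∃! y, ∀ t, F.map (openIncl T (W t)).op y = x t := by
  have h := hF _ (openSub_sieve_mem T W hW)
  rw [Sieve.ofArrows, ← Presieve.isSheafFor_iff_generate, Presieve.isSheafFor_arrows_iff] at h
  exact h x fun t t' T' a b hab => hx t t' T' a b hab

lemma sheaf_sep (hF : Presieve.IsSheaf (Scheme.zariskiTopology.over S) F) {T : Over S}
    {x y : F.obj (op T)} (h : ∀ t : T.left, ∃ W : T.left.Opens, t ∈ W ∧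
      F.map (openIncl T W).op x = F.map (openIncl T W).op y) : x = y := by
  choose W hW hxy using h
  refine (sheaf_glue hF T W hW (fun t => F.map (openIncl T (W t)).op y) ?_).unique hxy
    fun _ => rfl
  intro t t' T' a b hab
  rw [← Functor.map_comp_apply, ← Functor.map_comp_apply, ← op_comp, ← op_comp, hab]

/-- Every covering sieve contains a family of open neighbourhoods indexed by the points, so gluing
is needed for such families only; separatedness carries the result to the other members of the
sieve. -/
lemma isSheaf_of_glue
    (h : ∀ (T : Over S) (W : T.left → T.left.Opens) (_ : ∀ t, t ∈ W t)
      (x : ∀ t, F.obj (op (openSub T (W t))))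
      (_ : ∀ (t t' : T.left) (T' : Over S) (a : T' ⟶ openSub T (W t))
        (b : T' ⟶ openSub T (W t')), a ≫ openIncl T (W t) = b ≫ openIncl T (W t') →
        F.map a.op (x t) = F.map b.op (x t')),
      ∃ y, ∀ t, F.map (openIncl T (W t)).op y = x t)
    (hsep : ∀ (T : Over S) (x y : F.obj (op T)), (∀ t : T.left, ∃ W : T.left.Opens, t ∈ W ∧
      F.map (openIncl T W).op x = F.map (openIncl T W).op y) → x = y) :
    Presieve.IsSheaf (Scheme.zariskiTopology.over S) F := by
  have key : ∀ (T : Over S) (R : Sieve T) (_ : R ∈ Scheme.zariskiTopology.over S T) (t : T.left),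
      ∃ W : T.left.Opens, t ∈ W ∧ R (openIncl T W) := by
    intro T R hR t
    rw [GrothendieckTopology.mem_over_iff] at hR
    obtain ⟨W, htW, hW⟩ := exists_opens_of_mem_zariskiTopology hR t
    rw [Sieve.overEquiv_iff] at hW
    exact ⟨W, htW, hW⟩
  intro T R hR x hx
  choose W hW hRW using key T R hR
  obtain ⟨y, hy⟩ := h T W hW (fun t => x _ (hRW t)) fun t t' T' a b hab =>
    hx a b (hRW t) (hRW t') hab
  refine ⟨y, fun T' f hf => ?_, fun y' hy' => hsep _ _ _ fun t => ⟨W t, hW t, ?_⟩⟩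
  · refine hsep _ _ _ fun t' => ?_
    have hj : Set.range (openIncl T (W (f.left t'))).left = (W (f.left t') : Set T.left) :=
      range_openIncl _ _
    obtain ⟨h', hh'⟩ := exists_preimage_nhd (openIncl T (W (f.left t'))) f
    refine ⟨f.left ⁻¹ᵁ (openIncl T (W (f.left t'))).left.opensRange, ?_, ?_⟩
    · change f.left t' ∈ Set.range (openIncl T (W (f.left t'))).left
      rw [hj]
      exact hW _
    · rw [← Functor.map_comp_apply, ← op_comp, ← hh', op_comp, Functor.map_comp_apply, hy]
      exact hx _ _ _ _ hh'
  · rw [hy, hy' _ (hRW t)]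

end Sheaf

/-! ### Functions -/

/-- Sections are determined by their germs, and an open immersion induces isomorphisms on stalks. -/
lemma fun_sep {T : Over S} {f g : Fun T} (h : ∀ t : T.left, ∃ W : T.left.Opens, t ∈ W ∧
    resFun (openIncl T W) f = resFun (openIncl T W) g) : f = g := by
  refine TopCat.Presheaf.section_ext T.left.sheaf ⊤ f g fun t ht => ?_
  obtain ⟨W, htW, hW⟩ := h t
  let x : W.toScheme := ⟨t, htW⟩
  have h1 := fun z => Scheme.Hom.germ_stalkMap_apply W.ι ⊤ x trivial z
  have h2 : W.ι.stalkMap x (T.left.presheaf.germ ⊤ t trivial f) =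
      W.ι.stalkMap x (T.left.presheaf.germ ⊤ t trivial g) :=
    (h1 f).trans ((congrArg (W.toScheme.presheaf.germ ⊤ x trivial) hW).trans (h1 g).symm)
  exact (ConcreteCategory.bijective_of_isIso (W.ι.stalkMap x)).injective h2

/-- Basic opens commute with pullback, and a function is a unit when its basic open is everything.
This turns invertibility of determinants into conditions on points. -/
lemma isUnit_resFun_iff {T T' : Over S} (h : T' ⟶ T) (f : Fun T) :
    IsUnit (resFun h f) ↔ ∀ t, h.left t ∈ T.left.basicOpen f := by
  have hpre : h.left ⁻¹ᵁ T.left.basicOpen f = T'.left.basicOpen (resFun h f) :=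
    Scheme.preimage_basicOpen_top h.left f
  have : (∀ t, h.left t ∈ T.left.basicOpen f) ↔ T'.left.basicOpen (resFun h f) = ⊤ := by
    rw [← hpre, eq_top_iff]
    exact ⟨fun H t _ => H t, fun H t => H (Set.mem_univ t)⟩
  rw [this]
  refine ⟨fun hu => Scheme.basicOpen_of_isUnit _ hu, fun hu => ?_⟩
  refine RingedSpace.isUnit_of_isUnit_germ _ _ _ fun x hx => ?_
  exact (Scheme.mem_basicOpen_top _ _ x).1 (hu.symm ▸ hx)

lemma isField_fun_pt (T : Over S) (t : T.left) : IsField (Fun (pt T t)) :=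
  (Scheme.ΓSpecIso (T.left.residueField t)).commRingCatIsoToRingEquiv.toMulEquiv.isField
    (Field.toIsField _)

end QuatGrass

/-! ### Open loci of local conditions; universal bases -/

namespace QuatGrass

variable {S : Scheme.{u}}

/-- A condition on `T`-schemes which is local and, locally on `T`, cut out by an open subset is
cut out by an open subset. -/
lemma exists_open_locus {T : Over S} (C : ∀ {T' : Over S}, (T' ⟶ T) → Prop)
    (hres : ∀ {T'' T' : Over S} (g : T'' ⟶ T') (h : T' ⟶ T), C h → C (g ≫ h))
    (hsheaf : ∀ {T' : Over S} (h : T' ⟶ T),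
      (∀ t : T'.left, ∃ W : T'.left.Opens, t ∈ W ∧ C (openIncl T' W ≫ h)) → C h)
    (hloc : ∀ t : T.left, ∃ W : T.left.Opens, t ∈ W ∧ ∃ O : (openSub T W).left.Opens,
      ∀ (T' : Over S) (h : T' ⟶ openSub T W), C (h ≫ openIncl T W) ↔ ∀ t, h.left t ∈ O) :
    ∃ O : T.left.Opens, ∀ (T' : Over S) (h : T' ⟶ T), C h ↔ ∀ t, h.left t ∈ O := by
  choose W hW O hO using hloc
  have hpt : ∀ (t₀ t : T.left) (ht : t ∈ W t₀),
      C (ptIncl T t) ↔ (⟨t, ht⟩ : W t₀) ∈ O t₀ := by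
    intro t₀ t ht
    obtain ⟨h, hh, hx⟩ := exists_lift_pt (W t₀) t ht
    rw [← hh, hO]
    refine ⟨fun H => ?_, fun H s => (hx s).symm ▸ H⟩
    have := H (default : Spec (T.left.residueField t))
    rwa [hx] at this
  -- The locus can only be the set of points at whose residue field the condition holds. `hpt`
  -- identifies it with `O t₀` inside each `W t₀`, which also shows that it is open.
  let V : T.left.Opens := ⟨{t | C (ptIncl T t)}, by
    rw [isOpen_iff_forall_mem_open]
    intro t ht
    refine ⟨((W t).ι ''ᵁ (O t) : T.left.Opens), ?_, Opens.isOpen _,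
      ⟨⟨t, hW t⟩, (hpt t t (hW t)).1 ht, rfl⟩⟩
    rintro _ ⟨s, hs, rfl⟩
    exact (hpt t _ s.2).2 hs⟩
  have key : ∀ (t₀ : T.left) (s : W t₀), (W t₀).ι s ∈ V ↔ s ∈ O t₀ := fun t₀ s => hpt t₀ _ s.2
  refine ⟨V, fun T' h => ?_⟩
  have aux : ∀ t' : T'.left, ∃ h' : openSub T' (h.left ⁻¹ᵁ W (h.left t')) ⟶
      openSub T (W (h.left t')), h' ≫ openIncl T _ = openIncl T' _ ≫ h := fun t' =>
    exists_lift_openSub _ _ fun t => by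
      have := openIncl_mem (𝟙 (openSub T' (h.left ⁻¹ᵁ W (h.left t')))) t
      simpa using this
  have aux2 : ∀ (t' : T'.left) (h' : openSub T' (h.left ⁻¹ᵁ W (h.left t')) ⟶
      openSub T (W (h.left t'))), h' ≫ openIncl T _ = openIncl T' _ ≫ h →
      ∀ s, h'.left s ∈ O (h.left t') ↔ h.left ((openIncl T' _).left s) ∈ V := by
    intro t' h' hh' s
    have : (h' ≫ openIncl T _).left s = (openIncl T' _ ≫ h).left s := by rw [hh']
    change (W (h.left t')).ι (h'.left s) = h.left ((openIncl T' _).left s) at this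
    refine (key _ _).symm.trans ?_
    rw [this]
  constructor
  · intro hC t'
    obtain ⟨h', hh'⟩ := aux t'
    have h1 := hres (openIncl T' (h.left ⁻¹ᵁ W (h.left t'))) h hC
    rw [← hh', hO] at h1
    exact (aux2 t' h' hh' ⟨t', hW _⟩).1 (h1 _)
  · intro hV
    refine hsheaf h fun t' => ⟨h.left ⁻¹ᵁ W (h.left t'), hW (h.left t'), ?_⟩
    obtain ⟨h', hh'⟩ := aux t'
    rw [← hh', hO]
    exact fun s => (aux2 t' h' hh' s).2 (hV _)

namespace BigModule

variable {M : BigModule S}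

lemma sep (hM : Presieve.IsSheaf (Scheme.zariskiTopology.over S) M.toFunctor) {T : Over S}
    {x y : M.sec T} (h : ∀ t : T.left, ∃ W : T.left.Opens, t ∈ W ∧
      M.res (openIncl T W) x = M.res (openIncl T W) y) : x = y :=
  sheaf_sep hM h

lemma glue (hM : Presieve.IsSheaf (Scheme.zariskiTopology.over S) M.toFunctor) {T : Over S}
    (W : T.left → T.left.Opens) (hW : ∀ t, t ∈ W t) (x : ∀ t, M.sec (openSub T (W t)))
    (hx : ∀ (t t' : T.left) (T' : Over S) (a : T' ⟶ openSub T (W t)) (b : T' ⟶ openSub T (W t')),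
      a ≫ openIncl T (W t) = b ≫ openIncl T (W t') → M.res a (x t) = M.res b (x t')) :
    ∃ y, ∀ t, M.res (openIncl T (W t)) y = x t :=
  (sheaf_glue hM T W hW x hx).exists

/-- Sections which are unique and exist locally exist. -/
lemma glue_of_unique (hM : Presieve.IsSheaf (Scheme.zariskiTopology.over S) M.toFunctor)
    {T : Over S} (P : ∀ {T' : Over S}, (T' ⟶ T) → M.sec T' → Prop)
    (hres : ∀ {T'' T' : Over S} (g : T'' ⟶ T') (h : T' ⟶ T) (x : M.sec T'),
      P h x → P (g ≫ h) (M.res g x))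
    (huniq : ∀ {T' : Over S} (h : T' ⟶ T) (x y : M.sec T'), P h x → P h y → x = y)
    (hloc : ∀ t : T.left, ∃ W : T.left.Opens, t ∈ W ∧ ∃ x, P (openIncl T W) x) :
    ∃ x : M.sec T, ∀ t : T.left, ∃ W : T.left.Opens, t ∈ W ∧
      P (openIncl T W) (M.res (openIncl T W) x) := by
  choose W hW x hx using hloc
  obtain ⟨y, hy⟩ := glue hM W hW x fun t t' T' a b hab => by
    refine huniq (a ≫ openIncl T (W t)) _ _ (hres _ _ _ (hx t)) ?_
    rw [hab]
    exact hres _ _ _ (hx t')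
  exact ⟨y, fun t => ⟨W t, hW t, (hy t).symm ▸ hx t⟩⟩

lemma res_sum {T' T : Over S} (h : T' ⟶ T) {ι : Type*} (s : Finset ι) (c : ι → Fun T)
    (x : ι → M.sec T) :
    M.res h (∑ i ∈ s, c i • x i) = ∑ i ∈ s, resFun h (c i) • M.res h (x i) := by
  rw [map_sum]
  exact Finset.sum_congr rfl fun i _ => M.res_smul _ _ _

section Basis

variable {ι : Type} [Fintype ι] {T : Over S} {b : ι → M.sec T}

lemma IsBasis.comp_res (hb : M.IsBasis b) {T' : Over S} (h : T' ⟶ T) :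
    M.IsBasis fun i => M.res h (b i) := by
  intro T'' g
  simpa only [M.res_comp] using hb T'' (g ≫ h)

/-- The basis of the module of sections given by a universal basis. -/
def IsBasis.basis (hb : M.IsBasis b) : Module.Basis ι (Fun T) (M.sec T) :=
  have h : Function.Bijective (Fintype.linearCombination (Fun T) b) := by
    have := hb T (𝟙 T)
    simp only [M.res_id] at this
    exact this
  Module.Basis.mk (v := b) (linearIndependent_iff_injective_fintypeLinearCombination.2 h.1) (by
    rw [← Fintype.range_linearCombination, LinearMap.range_eq_top.2 h.2])

@[simp]
lemma IsBasis.basis_apply (hb : M.IsBasis b) (i : ι) : hb.basis i = b i := by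
  rw [IsBasis.basis, Module.Basis.mk_apply]

lemma isBasis_of_basis (B : ∀ (T' : Over S) (_ : T' ⟶ T), Module.Basis ι (Fun T') (M.sec T'))
    (hB : ∀ (T' : Over S) (h : T' ⟶ T) (i : ι), B T' h i = M.res h (b i)) : M.IsBasis b := by
  intro T' h
  have : (fun c : ι → Fun T' => ∑ i, c i • M.res h (b i)) = (B T' h).equivFun.symm := by
    funext c
    simp [Module.Basis.equivFun_symm_apply, hB]
  rw [this]
  exact (B T' h).equivFun.symm.bijective

lemma IsBasis.repr_res (hb : M.IsBasis b) {T' : Over S} (h : T' ⟶ T) (x : M.sec T) (i : ι) :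
    (hb.comp_res h).basis.repr (M.res h x) i = resFun h (hb.basis.repr x i) := by
  have h1 : M.res h x = ∑ i, resFun h (hb.basis.repr x i) • (hb.comp_res h).basis i := by
    conv_lhs => rw [← hb.basis.sum_repr x]
    rw [res_sum]
    simp
  rw [h1, Module.Basis.repr_sum_self]

lemma IsBasis.det_res [DecidableEq ι] (hb : M.IsBasis b) {T' : Over S} (h : T' ⟶ T) (c : ι → M.sec T) :
    (hb.comp_res h).basis.det (fun i => M.res h (c i)) = resFun h (hb.basis.det c) := by
  rw [Module.Basis.det_apply, Module.Basis.det_apply, RingHom.map_det]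
  congr 1
  ext i j
  exact hb.repr_res h (c j) i

/-- Determinants commute with pullback and units pull back to units, so being a basis over all
`T`-schemes is decided by one function on `T`. -/
lemma IsBasis.isBasis_iff_det [DecidableEq ι] (hb : M.IsBasis b) (c : ι → M.sec T) :
    M.IsBasis c ↔ IsUnit (hb.basis.det c) := by
  constructor
  · intro hc
    have := hb.basis.isUnit_det hc.basis
    rwa [show ⇑hc.basis = c from funext hc.basis_apply] at this
  · intro hu
    have hu' : ∀ (T' : Over S) (h : T' ⟶ T),
        IsUnit ((hb.comp_res h).basis.det (fun i => M.res h (c i))) := fun T' h => by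
      rw [hb.det_res]
      exact hu.map _
    have h2 := fun T' h => (Module.Basis.is_basis_iff_det _).2 (hu' T' h)
    exact isBasis_of_basis (fun T' h => Module.Basis.mk (h2 T' h).1 (h2 T' h).2.ge) (by simp)

end Basis

end BigModule

end QuatGrass

/-! ### Gram determinants, frames and locally symplectic subsheaves -/

namespace QuatGrass

/-- A bilinear form on a free module is perfect if and only if its Gram determinant is a unit. -/
lemma bijective_iff_isUnit_gram {R V ι : Type*} [CommRing R] [AddCommGroup V] [Module R V]
    [Fintype ι] [DecidableEq ι] (B : Module.Basis ι R V) (f : V →ₗ[R] V →ₗ[R] R) :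
    Function.Bijective f ↔ IsUnit (Matrix.of fun i k => f (B i) (B k)).det := by
  have hm : LinearMap.toMatrix B B.dualBasis f = (Matrix.of fun i k => f (B i) (B k)).transpose := by
    ext i k
    rw [LinearMap.toMatrix_apply, Matrix.transpose_apply, Matrix.of_apply,
      Module.Basis.dualBasis_repr]
  rw [← Matrix.det_transpose, ← hm]
  constructor
  · intro h
    exact (LinearEquiv.ofBijective f h).isUnit_det B B.dualBasis
  · intro h
    exact (LinearEquiv.ofIsUnitDet h).bijective

variable {S : Scheme.{u}}

/-- The inclusion of an open subscheme into a larger one. -/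
lemma exists_openSub_le {T : Over S} {W W' : T.left.Opens} (h : W' ≤ W) :
    ∃ j : openSub T W' ⟶ openSub T W, j ≫ openIncl T W = openIncl T W' :=
  exists_lift_openSub W (openIncl T W') fun t => h (by
    have := openIncl_mem (𝟙 (openSub T W')) t
    simpa using this)

namespace BigModule

variable {M : BigModule S}

lemma IsVectorBundle.exists_basis {d : ℕ} (hM : M.IsVectorBundle d) (T : Over S) (t : T.left) :
    ∃ W : T.left.Opens, t ∈ W ∧ ∃ b : Fin d → M.sec (openSub T W), M.IsBasis b := by
  obtain ⟨W, htW, b, hb⟩ := hM.locallyFree (T.hom t)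
  let j : Over.mk W.ι ⟶ Over.mk (𝟙 S) := Over.homMk W.ι
  have hj : IsOpenImmersion j.left := inferInstanceAs (IsOpenImmersion W.ι)
  obtain ⟨h', -⟩ := exists_preimage_nhd j (Over.homMk T.hom : T ⟶ Over.mk (𝟙 S))
  refine ⟨_, ?_, _, hb.comp_res h'⟩
  change T.hom t ∈ Set.range W.ι
  rw [Scheme.Opens.range_ι]
  exact htW

variable (M) in
/-- A natural linear functional on the pullback of `M` to `T`. -/
structure Functional (T : Over S) where
  /-- The functional on sections over a `T`-scheme. -/
  app : ∀ {T' : Over S} (_ : T' ⟶ T), M.sec T' →ₗ[Fun T'] Fun T'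
  app_res : ∀ {T'' T' : Over S} (g : T'' ⟶ T') (h : T' ⟶ T) (x : M.sec T'),
    app (g ≫ h) (M.res g x) = resFun g (app h x)

variable (M) in
/-- A natural linear endomorphism of the pullback of `M` to `T`. -/
structure Endo (T : Over S) where
  /-- The endomorphism on sections over a `T`-scheme. -/
  app : ∀ {T' : Over S} (_ : T' ⟶ T), M.sec T' →ₗ[Fun T'] M.sec T'
  app_res : ∀ {T'' T' : Over S} (g : T'' ⟶ T') (h : T' ⟶ T) (x : M.sec T'),
    app (g ≫ h) (M.res g x) = M.res g (app h x)

/-- The pullback of a functional. -/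
def Functional.pull {T T₁ : Over S} (f : M.Functional T) (g : T₁ ⟶ T) : M.Functional T₁ where
  app h := f.app (h ≫ g)
  app_res a h x := by rw [Category.assoc]; exact f.app_res a (h ≫ g) x

/-- The functional `φ(x, ·)`. -/
def AltForm.functional (φ : M.AltForm) {T : Over S} (x : M.sec T) : M.Functional T where
  app h := φ.form _ (M.res h x)
  app_res g h y := by rw [M.res_comp, φ.res_form]

lemma AltForm.neg (φ : M.AltForm) {T : Over S} (x y : M.sec T) :
    φ.form T x y = - φ.form T y x := by
  have h := φ.alt T (x + y)
  simp only [map_add, LinearMap.add_apply, φ.alt, zero_add, add_zero] at h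
  exact eq_neg_of_add_eq_zero_right h

namespace SubSheaf

variable {T N N' : Over S} {U : M.SubSheaf T} {ι : Type}

/-- The sections `u i` of `M` over the `T`-scheme `N` form a basis of `U`, universally. -/
structure IsFrame (U : M.SubSheaf T) (j : N ⟶ T) (u : ι → M.sec N) : Prop where
  li : ∀ (T' : Over S) (h : T' ⟶ N), LinearIndependent (Fun T') fun i => M.res h (u i)
  span : ∀ (T' : Over S) (h : T' ⟶ N),
    U.sec (h ≫ j) = Submodule.span (Fun T') (Set.range fun i => M.res h (u i))

lemma IsFrame.comp_res {j : N ⟶ T} {u : ι → M.sec N} (hu : U.IsFrame j u) (h : N' ⟶ N) :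
    U.IsFrame (h ≫ j) fun i => M.res h (u i) where
  li T' g := by simpa only [M.res_comp] using hu.li T' (g ≫ h)
  span T' g := by simpa only [M.res_comp, Category.assoc] using hu.span T' (g ≫ h)

lemma IsFrame.pull {j : N ⟶ T} {g : N' ⟶ T} {h : N ⟶ N'} {u : ι → M.sec N} (hu : U.IsFrame j u)
    (hj : h ≫ g = j) : (U.pull g).IsFrame h u where
  li := hu.li
  span T' a := by
    change U.sec ((a ≫ h) ≫ g) = _
    rw [Category.assoc, hj]
    exact hu.span T' a

lemma IsFrame.span_self {j : N ⟶ T} {u : ι → M.sec N} (hu : U.IsFrame j u) :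
    U.sec j = Submodule.span (Fun N) (Set.range u) := by
  have := hu.span N (𝟙 N)
  simpa only [M.res_id, Category.id_comp] using this

lemma IsFrame.li_self {j : N ⟶ T} {u : ι → M.sec N} (hu : U.IsFrame j u) :
    LinearIndependent (Fun N) u := by
  have := hu.li N (𝟙 N)
  simpa only [M.res_id] using this

lemma IsFrame.mem {j : N ⟶ T} {u : ι → M.sec N} (hu : U.IsFrame j u) (i : ι) : u i ∈ U.sec j := by
  rw [hu.span_self]
  exact Submodule.subset_span ⟨i, rfl⟩

/-- The basis of the module of sections given by a frame. -/
def IsFrame.basis {j : N ⟶ T} {u : ι → M.sec N} (hu : U.IsFrame j u) :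
    Module.Basis ι (Fun N) (U.sec j) :=
  (Module.Basis.span hu.li_self).map (LinearEquiv.ofEq _ _ hu.span_self.symm)

@[simp]
lemma IsFrame.basis_apply {j : N ⟶ T} {u : ι → M.sec N} (hu : U.IsFrame j u) (i : ι) :
    (hu.basis i : M.sec N) = u i := by
  simp [IsFrame.basis, Module.Basis.span_apply]

/-- The Gram matrix of a family of sections. -/
def gram (φ : M.AltForm) {T : Over S} (u : ι → M.sec T) : Matrix ι ι (Fun T) :=
  Matrix.of fun i k => φ.form T (u i) (u k)

lemma gram_res [Fintype ι] [DecidableEq ι] (φ : M.AltForm) (u : ι → M.sec N) (h : N' ⟶ N) :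
    (gram φ fun i => M.res h (u i)).det = resFun h (gram φ u).det := by
  rw [RingHom.map_det]
  congr 1
  ext i k
  exact φ.res_form h _ _

/-- The frame is a basis of the sections, so perfectness of the restricted form becomes
invertibility of one function. -/
lemma IsFrame.bijective_iff [Fintype ι] [DecidableEq ι] {j : N ⟶ T} {u : ι → M.sec N}
    (hu : U.IsFrame j u) (φ : M.AltForm) :
    Function.Bijective ((φ.form N).domRestrict₁₂ (U.sec j) (U.sec j)) ↔
      IsUnit (gram φ u).det := by
  have : gram φ u = Matrix.of fun i k =>
      (φ.form N).domRestrict₁₂ (U.sec j) (U.sec j) (hu.basis i) (hu.basis k) := by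
    ext i k
    change φ.form N (u i) (u k) = φ.form N (hu.basis i : M.sec N) (hu.basis k : M.sec N)
    rw [hu.basis_apply, hu.basis_apply]
  rw [bijective_iff_isUnit_gram hu.basis, this]

/-- `U` locally has a frame of length `m` with invertible Gram matrix. -/
def IsLocSymp (U : M.SubSheaf T) (φ : M.AltForm) (m : ℕ) : Prop :=
  ∀ t : T.left, ∃ W : T.left.Opens, t ∈ W ∧ ∃ u : Fin m → M.sec (openSub T W),
    U.IsFrame (openIncl T W) u ∧ IsUnit (gram φ u).det

variable {m : ℕ} {φ : M.AltForm}

lemma IsSubbundle.exists_frame (hU : U.IsSubbundle m) (t : T.left) :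
    ∃ W : T.left.Opens, t ∈ W ∧ IsAffine (openSub T W).left ∧
      ∃ (l : ℕ) (b : Fin m ⊕ Fin l → M.sec (openSub T W)), M.IsBasis b ∧
        U.IsFrame (openIncl T W) fun i => b (Sum.inl i) := by
  obtain ⟨W, htW, l, b, hb, hspan⟩ := hU t
  have hf : U.IsFrame (openIncl T W) fun i => b (Sum.inl i) := by
    refine ⟨fun T' h => ?_, hspan⟩
    have := (hb.comp_res h).basis.linearIndependent.comp (Sum.inl : Fin m → _) Sum.inl_injective
    simpa [Function.comp_def] using this
  obtain ⟨W', hW', htW', hle⟩ := exists_isAffineOpen_mem_and_subset (x := t) (U := W) htW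
  obtain ⟨j, hj⟩ := exists_openSub_le (T := T) hle
  refine ⟨W', htW', hW', l, _, hb.comp_res j, ?_⟩
  have := hf.comp_res j
  rwa [hj] at this

/-- `IsLocSymp` is the working form of nondegeneracy: it is local and stable under pullback by
construction, whereas `IsSymplectic` tests the sections over affine schemes, where no frame need
exist. -/
lemma IsSubbundle.isLocSymp (hU : U.IsSubbundle m) (hs : U.IsSymplectic φ) :
    U.IsLocSymp φ m := by
  intro t
  obtain ⟨W, htW, hW, l, b, hb, hf⟩ := hU.exists_frame t
  exact ⟨W, htW, _, hf, (hf.bijective_iff φ).1 (hs _ _ hW)⟩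

/-- A frame near the image of a point. -/
lemma IsLocSymp.exists_frame (hU : U.IsLocSymp φ m) (h : N ⟶ T) (t : N.left) :
    ∃ W : N.left.Opens, t ∈ W ∧ ∃ u : Fin m → M.sec (openSub N W),
      U.IsFrame (openIncl N W ≫ h) u ∧ IsUnit (gram φ u).det := by
  obtain ⟨W, htW, u, hu, hg⟩ := hU (h.left t)
  obtain ⟨W', htW', h', hh'⟩ := exists_nhd_lift h W t htW
  refine ⟨W', htW', fun i => M.res h' (u i), ?_, ?_⟩
  · rw [← hh']
    exact hu.comp_res h'
  · rw [gram_res]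
    exact hg.map _

lemma IsLocSymp.pull (hU : U.IsLocSymp φ m) (h : N ⟶ T) : (U.pull h).IsLocSymp φ m := by
  intro t
  obtain ⟨W, htW, u, hu, hg⟩ := hU.exists_frame h t
  exact ⟨W, htW, u, hu.pull rfl, hg⟩

lemma IsLocSymp.of_local
    (h : ∀ t : T.left, ∃ W : T.left.Opens, t ∈ W ∧ (U.pull (openIncl T W)).IsLocSymp φ m) :
    U.IsLocSymp φ m := by
  intro t
  obtain ⟨W, htW, hW⟩ := h t
  obtain ⟨W', htW', u, hu, hg⟩ := hW ⟨t, htW⟩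
  let W'' : T.left.Opens := W.ι ''ᵁ W'
  obtain ⟨j, hj⟩ : ∃ j : openSub T W'' ⟶ openSub (openSub T W) W',
      j ≫ openIncl (openSub T W) W' ≫ openIncl T W = openIncl T W'' := by
    have hoi : IsOpenImmersion (openIncl (openSub T W) W' ≫ openIncl T W).left := by
      rw [Over.comp_left]
      infer_instance
    refine exists_lift_of_range _ _ fun t => ?_
    have h1 := openIncl_mem (𝟙 (openSub T W'')) t
    rw [Category.id_comp] at h1
    obtain ⟨s, hs, hs'⟩ := h1
    exact ⟨⟨s, hs⟩, hs'⟩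
  refine ⟨W'', ⟨⟨t, htW⟩, htW', rfl⟩, fun i => M.res j (u i), ?_, ?_⟩
  · have : U.IsFrame (j ≫ openIncl (openSub T W) W' ≫ openIncl T W) fun i => M.res j (u i) :=
      ⟨(hu.comp_res j).li, fun T' a => by
        have := (hu.comp_res j).span T' a
        change U.sec ((a ≫ j ≫ openIncl _ _) ≫ openIncl T W) = _ at this
        simpa only [Category.assoc] using this⟩
    rwa [hj] at this
  · rw [gram_res]
    exact hg.map _

/-- A section of `U` which is orthogonal to `U` vanishes. -/
lemma IsLocSymp.eq_zero (hM : Presieve.IsSheaf (Scheme.zariskiTopology.over S) M.toFunctor)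
    (hU : U.IsLocSymp φ m) {h : N ⟶ T} {x : M.sec N} (hx : x ∈ U.sec h)
    (h0 : ∀ (N' : Over S) (g : N' ⟶ N) (v : M.sec N'), v ∈ U.sec (g ≫ h) →
      φ.form N' (M.res g x) v = 0) : x = 0 := by
  refine sep hM fun t => ?_
  obtain ⟨W, htW, u, hu, hg⟩ := hU.exists_frame h t
  refine ⟨W, htW, ?_⟩
  have hb := ((hu.bijective_iff φ).2 hg).1
  have := @hb ⟨_, U.res_mem (openIncl N W) h x hx⟩ 0 (by
    ext v
    exact (h0 _ _ _ v.2).trans (by simp))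
  rw [map_zero]
  exact congrArg Subtype.val this

/-- This uniqueness is what allows sections of `U` found locally to be glued. -/
lemma IsLocSymp.ext (hM : Presieve.IsSheaf (Scheme.zariskiTopology.over S) M.toFunctor)
    (hU : U.IsLocSymp φ m) {h : N ⟶ T} {x y : M.sec N} (hx : x ∈ U.sec h) (hy : y ∈ U.sec h)
    (h0 : ∀ (N' : Over S) (g : N' ⟶ N) (v : M.sec N'), v ∈ U.sec (g ≫ h) →
      φ.form N' (M.res g x) v = φ.form N' (M.res g y) v) : x = y := by
  refine sub_eq_zero.1 (hU.eq_zero hM (Submodule.sub_mem _ hx hy) fun N' g v hv => ?_)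
  rw [map_sub, map_sub, LinearMap.sub_apply, h0 N' g v hv, sub_self]

/-- On a locally symplectic subsheaf every functional is represented by a unique section. -/
lemma IsLocSymp.exists_repr (hM : Presieve.IsSheaf (Scheme.zariskiTopology.over S) M.toFunctor)
    (hU : U.IsLocSymp φ m) (f : M.Functional T) :
    ∃ u ∈ U.sec (𝟙 T), ∀ (N : Over S) (h : N ⟶ T) (v : M.sec N), v ∈ U.sec h →
      φ.form N (M.res h u) v = f.app h v := by
  -- The representing property is required after every pullback. It is then stable under restriction
  -- and determines the section, so that the local solutions given by invertible Gram matrices glue.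
  let P : ∀ {N : Over S}, (N ⟶ T) → M.sec N → Prop := fun {N} h x => x ∈ U.sec h ∧
    ∀ (N' : Over S) (g : N' ⟶ N) (v : M.sec N'), v ∈ U.sec (g ≫ h) →
      φ.form N' (M.res g x) v = f.app (g ≫ h) v
  obtain ⟨x, hx⟩ := glue_of_unique hM P
    (fun g h x hx => ⟨U.res_mem g h x hx.1, fun N' g' v hv => by
      rw [← M.res_comp, ← Category.assoc]
      rw [← Category.assoc] at hv
      exact hx.2 _ _ _ hv⟩)
    (fun h x y hx hy => hU.ext hM hx.1 hy.1 fun N' g v hv => by rw [hx.2 _ _ _ hv, hy.2 _ _ _ hv])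
    (fun t => by
      obtain ⟨W, htW, u, hu, hg⟩ := hU t
      obtain ⟨⟨x, hx⟩, hx'⟩ := ((hu.bijective_iff φ).2 hg).2
        ((f.app (openIncl T W)).domRestrict (U.sec (openIncl T W)))
      refine ⟨W, htW, x, hx, fun N' g v hv => ?_⟩
      have h1 : ∀ i, φ.form _ x (u i) = f.app (openIncl T W) (u i) := fun i =>
        LinearMap.congr_fun hx' ⟨u i, hu.mem i⟩
      rw [hu.span] at hv
      induction hv using Submodule.span_induction with
      | mem y hy =>
        obtain ⟨i, rfl⟩ := hy
        rw [φ.res_form, f.app_res, h1]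
      | zero => rw [map_zero, map_zero]
      | add y z _ _ hy hz => rw [map_add, map_add, hy, hz]
      | smul a y _ hy => rw [map_smul, map_smul, hy])
  refine ⟨x, U.local_mem _ _ fun t => ?_, fun N h v hv => ?_⟩
  · obtain ⟨W, htW, h1, -⟩ := hx t
    exact ⟨W, htW, by rwa [Category.comp_id]⟩
  · refine fun_sep fun t => ?_
    obtain ⟨W, htW, -, h2⟩ := hx (h.left t)
    obtain ⟨W', htW', h', hh'⟩ := exists_nhd_lift h W t htW
    refine ⟨W', htW', ?_⟩
    · rw [← φ.res_form, ← f.app_res, ← M.res_comp, ← hh', M.res_comp]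
      refine h2 _ _ _ ?_
      rw [hh']
      exact U.res_mem _ _ _ hv

end SubSheaf

end BigModule

end QuatGrass

/-! ### Projectors and subbundles -/

namespace QuatGrass

/-- The ring of functions on the spectrum of a residue field carries only its commutative ring
structure. A field structure extending it gives access to linear algebra without changing the
modules. -/
lemma exists_field_of_isField (R : Type*) [i : CommRing R] (h : IsField R) :
    ∃ F : Field R, F.toCommRing = i := ⟨h.toField, rfl⟩

/-- The vectors `p b` span the image of `p` and the vectors `b - p b` span its kernel; the union of
bases chosen from the two families is a basis of `V`. The members are expressions in `b` and `p`, so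
they also make sense in a neighbourhood of a point. -/
lemma exists_adapted_basis_of_field {K V : Type*} [Field K] [AddCommGroup V] [Module K V] {d m : ℕ}
    (b : Module.Basis (Fin d) K V) (U : Submodule K V) (p : V →ₗ[K] V) (hp : ∀ x, p x ∈ U)
    (hp' : ∀ x ∈ U, p x = x) (hm : Module.finrank K U = m) :
    ∃ (l : ℕ) (_ : m + l = d) (k : Fin m → Fin d) (k' : Fin l → Fin d),
      LinearIndependent K (Sum.elim (fun i => p (b (k i))) fun j => b (k' j) - p (b (k' j))) ∧
      Submodule.span K (Set.range
        (Sum.elim (fun i => p (b (k i))) fun j => b (k' j) - p (b (k' j)))) = ⊤ := by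
  have : FiniteDimensional K V := b.finiteDimensional_of_finite
  let q : V →ₗ[K] V := LinearMap.id - p
  have hq : ∀ x, q x = x - p x := fun x => rfl
  have h1 : Submodule.span K (Set.range (p ∘ b)) = U := by
    rw [Set.range_comp, ← Submodule.map_span, b.span_eq, Submodule.map_top]
    ext x
    exact ⟨by rintro ⟨y, rfl⟩; exact hp y, fun hx => ⟨x, hp' x hx⟩⟩
  have h2 : Submodule.span K (Set.range (q ∘ b)) = LinearMap.ker p := by
    rw [Set.range_comp, ← Submodule.map_span, b.span_eq, Submodule.map_top]
    ext x
    rw [LinearMap.mem_ker]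
    constructor
    · rintro ⟨y, rfl⟩
      rw [hq, map_sub, hp' _ (hp y), sub_self]
    · exact fun hx => ⟨x, by rw [hq, hx, sub_zero]⟩
  have h3 : ∀ (s : Set V) (W : Submodule K V), Submodule.span K s = W →
      ∃ f : Fin (Module.finrank K W) → V, (∀ i, f i ∈ s) ∧ Submodule.span K (Set.range f) = W ∧
        LinearIndependent K f := by
    rintro s _ rfl
    exact Submodule.exists_fun_fin_finrank_span_eq K s
  obtain ⟨f, hf, hfs, hfl⟩ := h3 _ _ h1
  obtain ⟨g, hg, hgs, hgl⟩ := h3 _ _ h2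
  subst hm
  choose k hk using hf
  choose k' hk' using hg
  have hr : LinearMap.range p = U := by
    ext x
    exact ⟨by rintro ⟨y, rfl⟩; exact hp y, fun hx => ⟨x, hp' x hx⟩⟩
  have hdim : Module.finrank K U + Module.finrank K (LinearMap.ker p) = d := by
    have := p.finrank_range_add_finrank_ker
    rwa [hr, Module.finrank_eq_card_basis b, Fintype.card_fin] at this
  have hf' : (fun i => p (b (k i))) = f := funext hk
  have hg' : (fun j => b (k' j) - p (b (k' j))) = g := funext hk'
  refine ⟨_, hdim, k, k', ?_, ?_⟩
  · rw [hf', hg']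
    refine hfl.sum_type hgl ?_
    rw [hfs, hgs, Submodule.disjoint_def]
    intro x hx hx'
    rw [← hp' x hx]
    exact hx'
  · rw [hf', hg', Set.Sum.elim_range, Submodule.span_union, hfs, hgs, eq_top_iff]
    intro x _
    rw [Submodule.mem_sup]
    exact ⟨p x, hp x, x - p x, by rw [LinearMap.mem_ker, map_sub, hp' _ (hp x), sub_self], by abel⟩

lemma exists_adapted_basis {K V : Type*} [CommRing K] (hK : IsField K) [AddCommGroup V]
    [Module K V] {d m : ℕ}
    (b : Module.Basis (Fin d) K V) (U : Submodule K V) (p : V →ₗ[K] V) (hp : ∀ x, p x ∈ U)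
    (hp' : ∀ x ∈ U, p x = x) (hm : Module.finrank K U = m) :
    ∃ (l : ℕ) (_ : m + l = d) (k : Fin m → Fin d) (k' : Fin l → Fin d),
      LinearIndependent K (Sum.elim (fun i => p (b (k i))) fun j => b (k' j) - p (b (k' j))) ∧
      Submodule.span K (Set.range
        (Sum.elim (fun i => p (b (k i))) fun j => b (k' j) - p (b (k' j)))) = ⊤ := by
  obtain ⟨F, rfl⟩ := exists_field_of_isField K hK
  exact exists_adapted_basis_of_field b U p hp hp' hm

variable {S : Scheme.{u}}

namespace BigModule

variable {M : BigModule S}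

lemma IsBasis.reindex {ι κ : Type} [Fintype ι] [Fintype κ] {T : Over S} {b : ι → M.sec T}
    (hb : M.IsBasis b) (e : κ ≃ ι) : M.IsBasis fun i => b (e i) :=
  isBasis_of_basis (fun T' h => (hb.comp_res h).basis.reindex e.symm) fun T' h i => by
    simp [Module.Basis.reindex_apply]

namespace SubSheaf

variable {T N N' : Over S} {U : M.SubSheaf T} {m d : ℕ} {φ : M.AltForm}

/-- A subsheaf which is the image of a natural projector, and has constant rank at the points, is
a subbundle. -/
theorem isSubbundle_of_proj (hM : M.IsVectorBundle d) (p : M.Endo T)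
    (hp : ∀ (N : Over S) (h : N ⟶ T) (x : M.sec N), p.app h x ∈ U.sec h)
    (hp' : ∀ (N : Over S) (h : N ⟶ T) (x : M.sec N), x ∈ U.sec h → p.app h x = x)
    (hm : ∀ t : T.left, Module.finrank (Fun (pt T t)) (U.sec (ptIncl T t)) = m) :
    U.IsSubbundle m := by
  intro t
  obtain ⟨W, htW, b, hb⟩ := hM.exists_basis T t
  obtain ⟨h, hh, hx⟩ := exists_lift_pt W t htW
  -- The indices are chosen at the residue field of `t`; the same expressions then define the family
  -- `c` over `W`.
  obtain ⟨l, hl, k, k', hli, hsp⟩ := exists_adapted_basis (isField_fun_pt T t)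
    (hb.comp_res h).basis (U.sec (ptIncl T t)) (p.app (ptIncl T t)) (hp _ _) (hp' _ _) (hm t)
  let j := openIncl T W
  let c : Fin m ⊕ Fin l → M.sec (openSub T W) :=
    Sum.elim (fun i => p.app j (b (k i))) fun i => b (k' i) - p.app j (b (k' i))
  have hc : ∀ (N : Over S) (g : N ⟶ openSub T W), (fun i => M.res g (c i)) =
      Sum.elim (fun i => p.app (g ≫ j) (M.res g (b (k i))))
        fun i => M.res g (b (k' i)) - p.app (g ≫ j) (M.res g (b (k' i))) := by
    intro N g
    funext i
    rcases i with i | i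
    · exact (p.app_res g j _).symm
    · change M.res g (_ - _) = _
      rw [map_sub, ← p.app_res]
      rfl
  let e : Fin m ⊕ Fin l ≃ Fin d := finSumFinEquiv.trans (finCongr hl)
  let s : W.toScheme := ⟨t, htW⟩
  have hb' := hb.reindex e
  -- the family `c` is a basis at the point `t`
  obtain ⟨O, htO, hO⟩ : ∃ O : T.left.Opens, t ∈ O ∧ ∃ g : openSub T O ⟶ openSub T W,
      g ≫ j = openIncl T O ∧ M.IsBasis fun i => M.res g (c i) := by
    classical
    have h1 : IsUnit ((hb'.comp_res h).basis.det fun i => M.res h (c i)) := by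
      refine (Module.Basis.is_basis_iff_det _).1 ?_
      rw [hc]
      simp only [IsBasis.basis_apply] at hli hsp
      change h ≫ j = _ at hh
      rw [hh]
      exact ⟨hli, hsp⟩
    rw [hb'.det_res] at h1
    have hn : Nontrivial (Fun (pt T t)) := (isField_fun_pt T t).nontrivial
    have h2 : s ∈ (openSub T W).left.basicOpen (hb'.basis.det c) :=
      (resFun_pt_ne_zero_iff h s (fun a => hx a) _).1 h1.ne_zero
    -- The determinant of `c` with respect to `b` does not vanish at `t`, and where it does not
    -- vanish `c` is a universal basis.
    let O : T.left.Opens := W.ι ''ᵁ (openSub T W).left.basicOpen (hb'.basis.det c)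
    have hOW : O ≤ W := by
      rintro _ ⟨a, -, rfl⟩
      exact a.2
    obtain ⟨g, hg⟩ := exists_openSub_le hOW
    refine ⟨O, ⟨s, h2, rfl⟩, g, hg, ?_⟩
    rw [(hb'.comp_res g).isBasis_iff_det, hb'.det_res, isUnit_resFun_iff]
    intro a
    have h3 := openIncl_mem (𝟙 (openSub T O)) a
    rw [Category.id_comp, ← hg] at h3
    obtain ⟨a', ha', haa'⟩ := h3
    have h4 : a' = g.left a := W.ι.isOpenEmbedding.injective haa'
    rwa [← h4]
  obtain ⟨g, hg, hgc⟩ := hO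
  refine ⟨O, htO, l, _, hgc, fun T' a => ?_⟩
  simp only [← M.res_comp]
  rw [show (fun i : Fin m => M.res (a ≫ g) (c (Sum.inl i))) =
    fun i => p.app ((a ≫ g) ≫ j) (M.res (a ≫ g) (b (k i))) from
      funext fun i => congrFun (hc _ (a ≫ g)) (Sum.inl i), ← hg, ← Category.assoc]
  refine le_antisymm (fun x hx => ?_) (Submodule.span_le.2 ?_)
  · have hB := (hgc.comp_res a).basis.sum_repr x
    simp only [IsBasis.basis_apply, ← M.res_comp] at hB
    -- Applying `p` to the expansion of `x` in `c` fixes the first `m` members and kills the others,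
    -- which have the form `b - p b`.
    rw [← hp' _ _ x hx, ← hB, map_sum]
    refine Submodule.sum_mem _ fun i _ => ?_
    rw [map_smul]
    refine Submodule.smul_mem _ _ ?_
    rw [congrFun (hc _ (a ≫ g)) i]
    rcases i with i | i
    · rw [Sum.elim_inl, hp' _ _ _ (hp _ _ _)]
      exact Submodule.subset_span ⟨i, rfl⟩
    · rw [Sum.elim_inr, map_sub, hp' _ _ _ (hp _ _ _), sub_self]
      exact Submodule.zero_mem _
  · rintro _ ⟨i, rfl⟩
    exact hp _ _ _

/-- The orthogonal projector onto a locally symplectic subsheaf. -/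
theorem IsLocSymp.exists_proj
    (hM : Presieve.IsSheaf (Scheme.zariskiTopology.over S) M.toFunctor) (hU : U.IsLocSymp φ m) :
    ∃ p : M.Endo T, (∀ (N : Over S) (h : N ⟶ T) (x : M.sec N), p.app h x ∈ U.sec h) ∧
      (∀ (N : Over S) (h : N ⟶ T) (x : M.sec N), x ∈ U.sec h → p.app h x = x) ∧
      ∀ (N : Over S) (h : N ⟶ T) (x v : M.sec N), v ∈ U.sec h →
        φ.form N (p.app h x) v = φ.form N x v := by
  have key : ∀ (N : Over S) (h : N ⟶ T) (x : M.sec N), ∃ u ∈ U.sec h,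
      ∀ (N' : Over S) (g : N' ⟶ N) (v : M.sec N'), v ∈ U.sec (g ≫ h) →
        φ.form N' (M.res g u) v = φ.form N' (M.res g x) v := by
    intro N h x
    -- The projection of `x` is the section of `U` that represents the functional `φ(x, ·)` on `U`.
    obtain ⟨u, hu, hu'⟩ := (hU.pull h).exists_repr hM (φ.functional x)
    refine ⟨u, ?_, hu'⟩
    change u ∈ U.sec (𝟙 N ≫ h) at hu
    rwa [Category.id_comp] at hu
  choose p hp hp' using key
  -- Linearity, naturality and idempotence of the projector all come from this uniqueness.
  have huniq : ∀ (N : Over S) (h : N ⟶ T) (x y : M.sec N), y ∈ U.sec h →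
      (∀ (N' : Over S) (g : N' ⟶ N) (v : M.sec N'), v ∈ U.sec (g ≫ h) →
        φ.form N' (M.res g y) v = φ.form N' (M.res g x) v) → p N h x = y :=
    fun N h x y hy hy' => hU.ext hM (hp N h x) hy fun N' g v hv => by
      rw [hp' N h x N' g v hv, hy' N' g v hv]
  refine ⟨⟨fun {N} h => { toFun := p N h, map_add' := fun x y => ?_, map_smul' := fun a x => ?_ },
    fun {N' N} g h x => ?_⟩, fun N h x => hp N h x, fun N h x hx => huniq N h x x hx ?_, ?_⟩
  · refine huniq _ _ _ _ (Submodule.add_mem _ (hp _ _ _) (hp _ _ _)) fun N' g v hv => ?_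
    rw [map_add, map_add, LinearMap.add_apply, hp' _ _ _ _ _ _ hv, hp' _ _ _ _ _ _ hv,
      map_add, map_add, LinearMap.add_apply]
  · refine huniq _ _ _ _ (Submodule.smul_mem _ _ (hp _ _ _)) fun N' g v hv => ?_
    rw [M.res_smul, map_smul, LinearMap.smul_apply, RingHom.id_apply, hp' _ _ _ _ _ _ hv,
      M.res_smul, map_smul, LinearMap.smul_apply]
  · refine huniq _ _ _ _ (U.res_mem _ _ _ (hp _ _ _)) fun N'' g' v hv => ?_
    rw [← M.res_comp, ← M.res_comp]
    rw [← Category.assoc] at hv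
    exact hp' _ _ _ _ _ _ hv
  · exact fun _ _ _ _ => rfl
  · intro N h x v hv
    have := hp' N h x N (𝟙 N) v (by rwa [Category.id_comp])
    rwa [M.res_id, M.res_id] at this

lemma IsLocSymp.finrank_pt (hU : U.IsLocSymp φ m) (t : T.left) :
    Module.finrank (Fun (pt T t)) (U.sec (ptIncl T t)) = m := by
  obtain ⟨W, htW, u, hu, -⟩ := hU t
  obtain ⟨h, hh, -⟩ := exists_lift_pt W t htW
  have hn : Nontrivial (Fun (pt T t)) := (isField_fun_pt T t).nontrivial
  have hu' := hu.comp_res h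
  rw [hh] at hu'
  rw [Module.finrank_eq_card_basis hu'.basis, Fintype.card_fin]

/-- The image of a self-adjoint projector is symplectic. -/
lemma isSymplectic_of_proj (hφ : φ.IsNondegenerate) (p : M.Endo T)
    (hp : ∀ (N : Over S) (h : N ⟶ T) (x : M.sec N), p.app h x ∈ U.sec h)
    (hp' : ∀ (N : Over S) (h : N ⟶ T) (x : M.sec N), x ∈ U.sec h → p.app h x = x)
    (hpφ : ∀ (N : Over S) (h : N ⟶ T) (x v : M.sec N), v ∈ U.sec h →
        φ.form N (p.app h x) v = φ.form N x v) : U.IsSymplectic φ := by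
  intro N h hN
  constructor
  · rw [injective_iff_map_eq_zero]
    rintro ⟨x, hx⟩ h0
    refine Subtype.ext ((hφ N hN).1 ?_)
    rw [ZeroMemClass.coe_zero, map_zero]
    ext y
    have h1 : φ.form N x (p.app h y) = 0 := LinearMap.congr_fun h0 ⟨p.app h y, hp _ _ _⟩
    rw [φ.neg, hpφ _ _ _ _ hx, ← φ.neg] at h1
    exact h1
  · intro f
    -- A functional on `U` is extended by the projector, represented by nondegeneracy of `φ` on all
    -- of `M`, and the representing section is projected back to `U`.
    obtain ⟨x, hx⟩ := (hφ N hN).2 (f.comp ((p.app h).codRestrict (U.sec h) (hp N h)))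
    refine ⟨⟨p.app h x, hp _ _ _⟩, ?_⟩
    ext ⟨v, hv⟩
    change φ.form N (p.app h x) v = _
    rw [hpφ _ _ _ _ hv, hx]
    exact congrArg f (Subtype.ext (hp' _ _ _ hv))

/-- Over an affine scheme the sections of `U` need not be free, so Gram determinants do not apply
directly; the orthogonal projector reduces the claim to nondegeneracy of `φ`. -/
lemma IsLocSymp.isSymplectic
    (hM : Presieve.IsSheaf (Scheme.zariskiTopology.over S) M.toFunctor) (hφ : φ.IsNondegenerate)
    (hU : U.IsLocSymp φ m) : U.IsSymplectic φ := by
  obtain ⟨p, hp, hp', hpφ⟩ := hU.exists_proj hM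
  exact isSymplectic_of_proj hφ p hp hp' hpφ

/-- The locus where a form is nondegenerate on a subbundle is open. -/
theorem IsSubbundle.exists_sympl_locus (hU : U.IsSubbundle m) (φ : M.AltForm) :
    ∃ O : T.left.Opens, (∀ (N : Over S) (h : N ⟶ T),
      (U.pull h).IsLocSymp φ m ↔ ∀ t, h.left t ∈ O) ∧
      ∀ t : T.left, ∃ W : T.left.Opens, t ∈ W ∧ IsAffine (openSub T W).left ∧
        ∃ f : Fun (openSub T W), ∀ s : W.toScheme, W.ι s ∈ O ↔ s ∈ (openSub T W).left.basicOpen f := by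
  -- Where a frame `u` is given, the locus is that of its Gram determinant. For another local frame
  -- `u'` the condition is equivalent, since both express that the form on `U` is perfect.
  have hframe : ∀ (N N' : Over S) (j : N ⟶ T) (u : Fin m → M.sec N) (h : N' ⟶ N),
      U.IsFrame j u → ((U.pull (h ≫ j)).IsLocSymp φ m ↔ ∀ t, h.left t ∈ N.left.basicOpen
        (gram φ u).det) := by
    intro N N' j u h hu
    rw [← isUnit_resFun_iff, ← gram_res]
    have hu2 : (U.pull (h ≫ j)).IsFrame (𝟙 N') fun i => M.res h (u i) :=
      (hu.comp_res h).pull (Category.id_comp _)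
    constructor
    · intro hs
      rw [← resFun_id (gram φ _).det, isUnit_resFun_iff]
      intro t
      obtain ⟨W, htW, u', hu', hg⟩ := hs t
      have h3 : (U.pull (h ≫ j)).IsFrame (openIncl N' W) _ := (Category.comp_id (openIncl N' W)) ▸
        hu2.comp_res (openIncl N' W)
      have h4 := (h3.bijective_iff φ).1 ((hu'.bijective_iff φ).2 hg)
      rw [gram_res, isUnit_resFun_iff] at h4
      exact h4 ⟨t, htW⟩
    · intro hg t
      have h3 : (U.pull (h ≫ j)).IsFrame (openIncl N' ⊤) _ := (Category.comp_id (openIncl N' ⊤)) ▸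
        hu2.comp_res (openIncl N' ⊤)
      refine ⟨⊤, trivial, _, h3, ?_⟩
      rw [gram_res]
      exact hg.map _
  obtain ⟨O, hO⟩ := exists_open_locus (T := T) (fun h => (U.pull h).IsLocSymp φ m)
    (fun g h hh => by rw [pull_comp]; exact hh.pull g)
    (fun h hh => IsLocSymp.of_local fun t => by
      obtain ⟨W, htW, hW⟩ := hh t
      refine ⟨W, htW, ?_⟩
      rwa [← pull_comp])
    (fun t => by
      obtain ⟨W, htW, -, l, b, -, hu⟩ := hU.exists_frame t
      exact ⟨W, htW, _, fun N h => hframe _ _ _ _ h hu⟩)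
  refine ⟨O, hO, fun t => ?_⟩
  obtain ⟨W, htW, hW, l, b, -, hu⟩ := hU.exists_frame t
  refine ⟨W, htW, hW, (gram φ fun i => b (Sum.inl i)).det, fun s => ?_⟩
  have h1 := hframe _ _ _ _ (ptIncl (openSub T W) s) hu
  rw [hO] at h1
  have h2 : ∀ a, (ptIncl (openSub T W) s).left a = s := fun a =>
    Scheme.fromSpecResidueField_apply _ _
  have h3 : ∀ a, (ptIncl (openSub T W) s ≫ openIncl T W).left a = W.ι s := fun a =>
    congrArg W.ι (h2 a)
  simp only [h2, h3] at h1
  have : Nonempty (pt (openSub T W) s).left :=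
    ⟨(default : Spec ((openSub T W).left.residueField s))⟩
  rwa [forall_const, forall_const] at h1

end SubSheaf

end BigModule

end QuatGrass

namespace QuatGrass

variable {S : Scheme.{u}}

/-! ### Representability of Zariski sheaves on `S`-schemes -/

section LocalLift

universe v

/-- Lifts to a scheme which represents a subfunctor exist if they exist locally. -/
lemma exists_lift_of_local {F : (Over S)ᵒᵖ ⥤ Type v}
    (hF : Presieve.IsSheaf (Scheme.zariskiTopology.over S) F)
    {X T : Over S} (ξ : F.obj (op X)) (y : F.obj (op T))
    (hmono : ∀ (T : Over S) (a b : T ⟶ X), F.map a.op ξ = F.map b.op ξ → a = b)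
    (h : ∀ t : T.left, ∃ W : T.left.Opens, t ∈ W ∧ ∃ a : openSub T W ⟶ X,
      F.map a.op ξ = F.map (openIncl T W).op y) : ∃ a : T ⟶ X, F.map a.op ξ = y := by
  choose W hW a ha using h
  have hX : Presieve.IsSheaf (Scheme.zariskiTopology.over S) (yoneda.obj X) :=
    GrothendieckTopology.Subcanonical.isSheaf_of_isRepresentable _
  obtain ⟨c, hc, -⟩ := sheaf_glue hX T W hW a fun t t' T' b b' hb => by
    refine hmono _ _ _ ?_
    change F.map (b ≫ a t).op ξ = F.map (b' ≫ a t').op ξ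
    rw [op_comp, op_comp, F.map_comp, F.map_comp, ConcreteCategory.comp_apply,
      ConcreteCategory.comp_apply, ha, ha, ← ConcreteCategory.comp_apply,
      ← ConcreteCategory.comp_apply, ← F.map_comp, ← F.map_comp, ← op_comp, ← op_comp, hb]
  refine ⟨c, sheaf_sep hF fun t => ⟨W t, hW t, ?_⟩⟩
  rw [← ha, ← ConcreteCategory.comp_apply, ← F.map_comp, ← op_comp]
  have h1 : openIncl T (W t) ≫ c = a t := hc t
  rw [h1]

end LocalLift

section Representability

universe v

variable (F : (Over S)ᵒᵖ ⥤ Type v) [∀ T, Small.{u} (F.obj T)]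

/-- The functor `X ↦ ∐ F(g)` on schemes, the sum being over all `g : X ⟶ S`. -/
def total : Scheme.{u}ᵒᵖ ⥤ Type u where
  obj X := Σ g : X.unop ⟶ S, Shrink.{u} (F.obj (op (Over.mk g)))
  map f := ↾(fun a => ⟨f.unop ≫ a.1, equivShrink _ (F.map
    (Over.homMk f.unop : Over.mk (f.unop ≫ a.1) ⟶ Over.mk a.1).op ((equivShrink _).symm a.2))⟩)
  map_id X := by
    refine ConcreteCategory.hom_ext _ _ fun ⟨g, a⟩ => ?_
    obtain ⟨a, rfl⟩ := (equivShrink _).surjective a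
    -- The structure morphism `𝟙 ≫ g` is equal to `g` only propositionally; generalizing it to a
    -- variable `g'` permits substitution inside the sigma type.
    have : ∀ (g' : X.unop ⟶ S) (hg' : 𝟙 _ ≫ g = g'), (⟨g', equivShrink _ (F.map
        (Over.homMk (𝟙 _) hg' : Over.mk g' ⟶ Over.mk g).op a)⟩ :
        Σ g : X.unop ⟶ S, Shrink.{u} (F.obj (op (Over.mk g)))) = ⟨g, equivShrink _ a⟩ := by
      intro g' hg'
      obtain rfl : g = g' := by rw [← hg', Category.id_comp]
      congr 2
      rw [show (Over.homMk (𝟙 _) hg' : Over.mk g ⟶ Over.mk g) = 𝟙 _ by ext1; rfl, op_id,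
        F.map_id]
      rfl
    have h2 := this _ rfl
    change (⟨_, equivShrink _ (F.map _ ((equivShrink _).symm (equivShrink _ a)))⟩ :
      Σ g : X.unop ⟶ S, Shrink.{u} (F.obj (op (Over.mk g)))) = ⟨g, equivShrink _ a⟩
    rw [Equiv.symm_apply_apply]
    exact h2
  map_comp {X Y Z} f f' := by
    refine ConcreteCategory.hom_ext _ _ fun ⟨g, a⟩ => ?_
    obtain ⟨a, rfl⟩ := (equivShrink _).surjective a
    have : ∀ (g' : Z.unop ⟶ S) (hg' : f'.unop ≫ f.unop ≫ g = g'), (⟨g', equivShrink _ (F.map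
        (Over.homMk (f'.unop ≫ f.unop) (by simpa using hg') : Over.mk g' ⟶ Over.mk g).op a)⟩ :
        Σ g : Z.unop ⟶ S, Shrink.{u} (F.obj (op (Over.mk g)))) =
        ⟨f'.unop ≫ f.unop ≫ g, equivShrink _ (F.map (Over.homMk f'.unop :
          Over.mk (f'.unop ≫ f.unop ≫ g) ⟶ Over.mk (f.unop ≫ g)).op
          (F.map (Over.homMk f.unop : Over.mk (f.unop ≫ g) ⟶ Over.mk g).op a))⟩ := by
      rintro g' rfl
      congr 2
      rw [← Functor.map_comp_apply, ← op_comp]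
      rfl
    have h2 := this _ (Category.assoc _ _ _).symm
    change (⟨_, equivShrink _ (F.map _ ((equivShrink _).symm (equivShrink _ a)))⟩ :
      Σ g : Z.unop ⟶ S, Shrink.{u} (F.obj (op (Over.mk g)))) = ⟨_, equivShrink _ (F.map _
        ((equivShrink _).symm (equivShrink _ (F.map _ ((equivShrink _).symm (equivShrink _ a))))))⟩
    rw [Equiv.symm_apply_apply, Equiv.symm_apply_apply]
    exact h2

variable {F}

/-- An element of `F(T)`, as an element of the total functor. -/
def toTotal {T : Over S} (y : F.obj (op T)) : (total F).obj (op T.left) :=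
  ⟨T.hom, equivShrink _ y⟩

lemma toTotal_injective {T : Over S} {y y' : F.obj (op T)} (h : toTotal y = toTotal y') :
    y = y' :=
  (equivShrink _).injective (eq_of_heq (Sigma.mk.inj h).2)

lemma exists_toTotal {T : Over S} (a : (total F).obj (op T.left)) (ha : a.1 = T.hom) :
    ∃ y : F.obj (op T), toTotal y = a := by
  obtain ⟨g, a⟩ := a
  obtain ⟨a, rfl⟩ := (equivShrink _).surjective a
  have : ∀ (g' : T.left ⟶ S) (_ : g = g'), ∃ y : F.obj (op (Over.mk g')),
      (⟨g', equivShrink _ y⟩ : Σ g : T.left ⟶ S, Shrink.{u} (F.obj (op (Over.mk g)))) =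
        ⟨g, equivShrink _ a⟩ := by
    rintro g' rfl
    exact ⟨a, rfl⟩
  exact this _ ha

lemma total_map_toTotal {T T' : Over S} (h : T' ⟶ T) (y : F.obj (op T)) :
    (total F).map h.left.op (toTotal y) = toTotal (F.map h.op y) := by
  have : ∀ (X : Scheme.{u}) (l : X ⟶ T.left) (g : X ⟶ S) (w : l ≫ T.hom = g),
      (total F).map l.op (toTotal y) =
        toTotal (T := Over.mk g) (F.map (Over.homMk l w : Over.mk g ⟶ T).op y) := by
    rintro X l _ rfl
    change (⟨_, equivShrink _ (F.map _ ((equivShrink _).symm (equivShrink _ y)))⟩ :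
      Σ g : X ⟶ S, Shrink.{u} (F.obj (op (Over.mk g)))) = ⟨_, _⟩
    rw [Equiv.symm_apply_apply]
    rfl
  exact this _ _ _ (Over.w h)

/-- The first components glue because `S` represents a sheaf. They make `X` an `S`-scheme, over
which the second components glue because `F` is a sheaf. -/
lemma isSheaf_total (hF : Presieve.IsSheaf (Scheme.zariskiTopology.over S) F) :
    Presieve.IsSheaf Scheme.zariskiTopology (total F) := by
  have hS : Presieve.IsSheaf Scheme.zariskiTopology (yoneda.obj S) :=
    GrothendieckTopology.Subcanonical.isSheaf_of_isRepresentable _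
  intro X R hR x hx
  obtain ⟨g, hg, hgu⟩ := hS R hR (fun Y f hf => (x f hf).1) (by
    intro Y₁ Y₂ Z g₁ g₂ f₁ f₂ h₁ h₂ hh
    exact congrArg Sigma.fst (hx g₁ g₂ h₁ h₂ hh))
  let T : Over S := Over.mk g
  let R' : Sieve T := (Sieve.overEquiv T).symm R
  have hR' : R' ∈ Scheme.zariskiTopology.over S T := by
    rw [GrothendieckTopology.mem_over_iff]
    change Sieve.overEquiv T ((Sieve.overEquiv T).symm R) ∈ _
    exact ((Sieve.overEquiv T).apply_symm_apply R).symm ▸ hR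
  have hmem : ∀ {T' : Over S} (h : T' ⟶ T), R' h ↔ R h.left := fun h =>
    Sieve.overEquiv_symm_iff R h
  have hex : ∀ (T' : Over S) (h : T' ⟶ T) (hh : R' h), ∃ y : F.obj (op T'),
      toTotal y = x h.left ((hmem h).1 hh) := fun T' h hh =>
    exists_toTotal _ ((hg h.left ((hmem h).1 hh)).symm.trans (Over.w h))
  choose y hy using hex
  obtain ⟨z, hz, hzu⟩ := hF R' hR' (fun T' h hh => y T' h hh) (by
    intro Y₁ Y₂ Z g₁ g₂ f₁ f₂ h₁ h₂ hh
    refine toTotal_injective ?_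
    rw [← total_map_toTotal, ← total_map_toTotal, hy, hy]
    exact hx _ _ _ _ (by rw [← Over.comp_left, hh, Over.comp_left]))
  refine ⟨toTotal z, fun Y f hf => ?_, fun a ha => ?_⟩
  · let h : Over.mk (f ≫ g) ⟶ T := Over.homMk f
    have hh : R' h := (hmem h).2 hf
    have := hz h hh
    exact (total_map_toTotal h z).trans ((congrArg toTotal this).trans (hy _ h hh))
  · have ha1 : a.1 = g := hgu _ fun Y f hf => by
      have := ha f hf
      exact congrArg Sigma.fst this
    obtain ⟨z', hz'⟩ := exists_toTotal (T := T) a ha1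
    rw [← hz']
    congr 1
    refine hzu _ fun T' h hh => toTotal_injective ?_
    rw [hy, ← total_map_toTotal, hz']
    exact ha _ _

/-- A Zariski sheaf which is covered by representable open subfunctors is representable. -/
theorem exists_representableBy (hF : Presieve.IsSheaf (Scheme.zariskiTopology.over S) F)
    {I : Type u} (X : I → Over S) (ξ : ∀ i, F.obj (op (X i)))
    (hmono : ∀ (i : I) (T : Over S) (a b : T ⟶ X i), F.map a.op (ξ i) = F.map b.op (ξ i) → a = b)
    (hopen : ∀ (i : I) (T : Over S) (y : F.obj (op T)), ∃ O : T.left.Opens,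
      ∀ (T' : Over S) (h : T' ⟶ T), (∃ a : T' ⟶ X i, F.map a.op (ξ i) = F.map h.op y) ↔
        ∀ t, h.left t ∈ O)
    (hcover : ∀ (T : Over S) (y : F.obj (op T)) (t : T.left), ∃ W : T.left.Opens, t ∈ W ∧
      ∃ (i : I) (a : openSub T W ⟶ X i), F.map a.op (ξ i) = F.map (openIncl T W).op y) :
    ∃ G : Over S, Nonempty (F.RepresentableBy G) := by
  -- By Yoneda the charts are morphisms to the total functor. If they are open immersions and
  -- jointly locally surjective, the total functor is representable by a scheme.
  let f : ∀ i, yoneda.obj (X i).left ⟶ total F := fun i => yonedaEquiv.symm (toTotal (ξ i))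
  have hf : ∀ i (Z : Scheme.{u}) (a : Z ⟶ (X i).left),
      (f i).app (op Z) a = (total F).map a.op (toTotal (ξ i)) := fun i Z a => by
    rfl
  have hfo : ∀ (i : I) (T : Over S) (a : T ⟶ X i),
      (f i).app (op T.left) a.left = toTotal (F.map a.op (ξ i)) := fun i T a => by
    rw [hf, total_map_toTotal]
  -- a point of a chart, as a morphism of `S`-schemes
  have hfo' : ∀ (i : I) (T : Over S) (a : T.left ⟶ (X i).left) (y : F.obj (op T)),
      (f i).app (op T.left) a = toTotal y → ∃ a' : T ⟶ X i, a'.left = a ∧ F.map a'.op (ξ i) = y := by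
    intro i T a y h
    have h1 : a ≫ (X i).hom = T.hom := congrArg Sigma.fst h
    refine ⟨Over.homMk a h1, rfl, toTotal_injective ?_⟩
    rw [← hfo, ← h]
    rfl
  have hopen' : ∀ i, IsOpenImmersion.presheaf (f i) := by
    intro i
    refine MorphismProperty.relative.of_exists fun Z g => ?_
    let T : Over S := Over.mk (yonedaEquiv g).1
    obtain ⟨y, hy⟩ := exists_toTotal (T := T) (yonedaEquiv g) rfl
    obtain ⟨O, hO⟩ := hopen i T y
    obtain ⟨c, hc⟩ := (hO _ (openIncl T O)).2 fun t => by
      simpa using openIncl_mem (𝟙 (openSub T O)) t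
    have hg : ∀ (Y : Scheme.{u}) (b : Y ⟶ Z), g.app (op Y) b = (total F).map b.op (toTotal y) := by
      intro Y b
      rw [hy, yonedaEquiv_apply]
      have := ConcreteCategory.congr_hom (g.naturality b.op) (𝟙 Z)
      refine Eq.trans ?_ this
      change g.app (op Y) b = g.app (op Y) (b ≫ 𝟙 Z)
      rw [Category.comp_id]
    -- The fibre product of the chart with `g` is the open subscheme `O` on which `y` comes from the
    -- chart, and `c` is its map to the chart.
    refine ⟨O.toScheme, yoneda.map c.left, O.ι, ?_, inferInstance⟩
    refine IsPullback.of_forall_isPullback_app fun Y => ?_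
    rw [Types.isPullback_iff]
    refine ⟨?_, ?_, ?_⟩
    · ext b
      change (f i).app Y (b ≫ c.left) = g.app Y (b ≫ O.ι)
      have h1 := hfo i _ ((Over.homMk b : Over.mk (b ≫ (openSub T O).hom) ⟶ openSub T O) ≫ c)
      have h2 := total_map_toTotal ((Over.homMk b : Over.mk (b ≫ (openSub T O).hom) ⟶
        openSub T O) ≫ openIncl T O) y
      rw [op_comp, F.map_comp, ConcreteCategory.comp_apply, hc] at h1
      rw [op_comp, F.map_comp, ConcreteCategory.comp_apply] at h2
      exact (h1.trans h2.symm).trans (hg _ _).symm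
    · rintro b b' ⟨-, h⟩
      exact (cancel_mono O.ι).1 h
    · intro a b hab
      let T' : Over S := Over.mk (b ≫ T.hom)
      let h : T' ⟶ T := Over.homMk b
      have h1 : (f i).app (op T'.left) a = toTotal (F.map h.op y) := by
        rw [← total_map_toTotal]
        exact hab.trans (hg _ _)
      obtain ⟨a', rfl, ha'⟩ := hfo' i T' a _ h1
      obtain ⟨h', hh'⟩ := exists_lift_openSub O h ((hO _ h).1 ⟨a', ha'⟩)
      refine ⟨h'.left, ?_, congrArg CommaMorphism.left hh'⟩
      have h2 : h' ≫ c = a' := hmono i _ _ _ (by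
        rw [ha', op_comp, F.map_comp, ConcreteCategory.comp_apply, hc,
          ← ConcreteCategory.comp_apply, ← F.map_comp, ← op_comp, hh'])
      exact congrArg CommaMorphism.left h2
  have hsurj : Presheaf.IsLocallySurjective Scheme.zariskiTopology (Sigma.desc f) := by
    refine ⟨fun {Z} s => mem_zariskiTopology_of_opens fun z => ?_⟩
    obtain ⟨y, hy⟩ := exists_toTotal (T := Over.mk s.1) s rfl
    obtain ⟨W, hzW, i, a, ha⟩ := hcover _ y z
    refine ⟨W, hzW, (Limits.Sigma.ι (fun i => yoneda.obj (X i).left) i).app _ a.left, ?_⟩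
    have h1 : (f i).app (op W.toScheme) a.left = (total F).map W.ι.op s := by
      have h2 : (total F).map W.ι.op s = (total F).map W.ι.op (toTotal y) := congrArg _ hy.symm
      refine (hfo i _ a).trans (Eq.trans ?_ h2.symm)
      rw [ha]
      exact (total_map_toTotal (openIncl _ W) y).symm
    rw [← h1, ← NatTrans.comp_app_apply, Sigma.ι_desc]
  let FS : Sheaf Scheme.zariskiTopology.{u} (Type u) :=
    ⟨total F, (isSheaf_iff_isSheaf_of_type _ _).2 (isSheaf_total hF)⟩
  obtain ⟨G, ⟨e⟩⟩ := Scheme.LocalRepresentability.isRepresentable (F := FS) (f := f) hopen'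
  change (total F).RepresentableBy G at e
  -- The first component of the universal element makes the representing scheme an `S`-scheme, and
  -- the second is the universal element of `F`.
  let T : Over S := Over.mk (e.homEquiv (𝟙 G)).1
  obtain ⟨y, hy⟩ := exists_toTotal (T := T) (e.homEquiv (𝟙 G)) rfl
  have he : ∀ {T' : Over S} (h : T' ⟶ T), e.homEquiv h.left = toTotal (F.map h.op y) := by
    intro T' h
    rw [← total_map_toTotal, hy, ← e.homEquiv_comp]
    exact congrArg e.homEquiv (Category.comp_id _).symm
  refine ⟨T, ⟨⟨fun {T'} => Equiv.ofBijective (fun h => F.map h.op y) ⟨fun h h' hh => ?_,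
    fun x => ?_⟩, fun h h' => ?_⟩⟩⟩
  · have : e.homEquiv h.left = e.homEquiv h'.left := by
      rw [he, he]
      exact congrArg toTotal hh
    ext1
    exact e.homEquiv.injective this
  · have h1 : (e.homEquiv.symm (toTotal x)) ≫ T.hom = T'.hom := by
      have := congrArg Sigma.fst (e.homEquiv_comp (e.homEquiv.symm (toTotal x)) (𝟙 G))
      rw [Category.comp_id, Equiv.apply_symm_apply] at this
      exact this.symm
    refine ⟨Over.homMk (e.homEquiv.symm (toTotal x)) h1, toTotal_injective ?_⟩
    have h2 := he (Over.homMk (e.homEquiv.symm (toTotal x)) h1)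
    rw [← h2]
    exact Equiv.apply_symm_apply _ _
  · exact (ConcreteCategory.congr_hom (F.map_comp h'.op h.op) y)

end Representability

end QuatGrass

/-! ### Affine space, gluing of subsheaves and charts of Grassmannians -/

namespace QuatGrass

section Dual

variable {R V ι : Type*} [CommRing R] [AddCommGroup V] [Module R V] [Fintype ι] [DecidableEq ι]

/-- The hypotheses say that the transpose of `P` is a right inverse of the matrix. -/
lemma isUnit_det_of_dual (f : ι → V →ₗ[R] R) (u e : ι → V) (P : ι → ι → R)
    (hP : ∀ i, ∑ i', P i i' • u i' = e i) (hf : ∀ i i', f i (e i') = if i' = i then 1 else 0) :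
    IsUnit (Matrix.of fun i i' => f i (u i')).det := by
  refine Matrix.isUnit_det_of_right_inverse (B := Matrix.of fun i i' => P i' i) ?_
  ext i i'
  have h2 := hf i i'
  rw [← hP, map_sum] at h2
  rw [Matrix.mul_apply, Matrix.one_apply]
  simp only [eq_comm (a := i)]
  rw [← h2]
  refine Finset.sum_congr rfl fun j _ => ?_
  rw [map_smul, smul_eq_mul, mul_comm]
  rfl

lemma dual_of_isUnit_det (f : ι → V →ₗ[R] R) (u : ι → V)
    (h : IsUnit (Matrix.of fun i i' => f i (u i')).det) (i i' : ι) :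
    f i (∑ j, (Matrix.of fun i i' => f i (u i'))⁻¹ j i' • u j) = if i' = i then 1 else 0 := by
  have h2 := congrFun (congrFun (Matrix.mul_nonsing_inv _ h) i) i'
  rw [Matrix.mul_apply, Matrix.one_apply] at h2
  simp only [eq_comm (a := i)] at h2
  rw [← h2, map_sum]
  refine Finset.sum_congr rfl fun j _ => ?_
  rw [map_smul, smul_eq_mul, mul_comm]
  rfl

end Dual

variable {S : Scheme.{u}}

/-! ### Grassmannian bundles -/

/-- The affine space over `N` with coordinates indexed by `ι`. -/
lemma exists_affineSpace (N : Over S) (ι : Type) : ∃ (A : Over S) (π : A ⟶ N) (c : ι → Fun A),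
    IsAffineHom π.left ∧ ∀ (T : Over S) (h : T ⟶ N) (a : ι → Fun T),
      ∃! g : T ⟶ A, g ≫ π = h ∧ ∀ i, resFun g (c i) = a i := by
  let p := 𝔸(ULift.{u} ι; N.left) ↘ N.left
  let π : Over.mk (p ≫ N.hom) ⟶ N := Over.homMk p
  refine ⟨Over.mk (p ≫ N.hom), π, fun i => AffineSpace.coord N.left (ULift.up i),
    inferInstanceAs (IsAffineHom (𝔸(ULift.{u} ι; N.left) ↘ N.left)), fun T h a => ?_⟩
  have hg : AffineSpace.homOfVector h.left (fun i : ULift.{u} ι => a i.down) ≫ p = h.left :=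
    AffineSpace.homOfVector_over _ _
  let g : T ⟶ Over.mk (p ≫ N.hom) := Over.homMk
    (AffineSpace.homOfVector h.left (fun i : ULift.{u} ι => a i.down)) (by
      change _ ≫ p ≫ N.hom = _
      rw [reassoc_of% hg, Over.w])
  refine ⟨g, ⟨by ext1; exact hg, fun i => AffineSpace.homOfVector_appTop_coord _ _ _⟩, ?_⟩
  rintro g' ⟨h1, h2⟩
  ext1
  refine AffineSpace.hom_ext ?_ fun i => ?_
  · exact (congrArg CommaMorphism.left h1).trans hg.symm
  · refine (h2 i.down).trans (Eq.symm ?_)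
    exact AffineSpace.homOfVector_appTop_coord h.left (fun i : ULift.{u} ι => a i.down) i

lemma exists_openSub_image {T : Over S} (W : T.left.Opens) (W' : (openSub T W).left.Opens) :
    ∃ j : openSub T (W.ι ''ᵁ W') ⟶ openSub (openSub T W) W',
      j ≫ openIncl (openSub T W) W' ≫ openIncl T W = openIncl T (W.ι ''ᵁ W') := by
  have hoi : IsOpenImmersion (openIncl (openSub T W) W' ≫ openIncl T W).left := by
    rw [Over.comp_left]
    infer_instance
  refine exists_lift_of_range _ _ fun t => ?_
  have h1 := openIncl_mem (𝟙 (openSub T (W.ι ''ᵁ W'))) t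
  rw [Category.id_comp] at h1
  obtain ⟨s, hs, hs'⟩ := h1
  exact ⟨⟨s, hs⟩, hs'⟩

/-- The locus where a morphism factors through an open subscheme on which `f` is invertible. -/
lemma exists_lift_isUnit_iff {N T : Over S} (j : N ⟶ T) [IsOpenImmersion j.left] (f : Fun N) :
    ∃ O : T.left.Opens, ∀ (T' : Over S) (h : T' ⟶ T),
      (∃ h' : T' ⟶ N, h' ≫ j = h ∧ IsUnit (resFun h' f)) ↔ ∀ t, h.left t ∈ O := by
  refine ⟨j.left ''ᵁ N.left.basicOpen f, fun T' h => ⟨?_, fun H => ?_⟩⟩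
  · rintro ⟨h', rfl, hu⟩ t
    exact ⟨h'.left t, (isUnit_resFun_iff _ _).1 hu t, rfl⟩
  · obtain ⟨h', hh'⟩ := exists_lift_of_range j h fun t => by
      obtain ⟨s, -, hs⟩ := H t
      exact ⟨s, hs⟩
    refine ⟨h', hh', (isUnit_resFun_iff _ _).2 fun t => ?_⟩
    obtain ⟨s, hs, hs'⟩ := H t
    rw [← hh'] at hs'
    have : s = h'.left t := j.left.isOpenEmbedding.injective hs'
    exact this ▸ hs

namespace BigModule

variable {M : BigModule S}

section Coord

variable {ι : Type} [Fintype ι] {N T : Over S} {b : ι → M.sec N}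

/-- The coordinate functionals of a basis. -/
def IsBasis.coord (hb : M.IsBasis b) (i : ι) : M.Functional N where
  app h := (hb.comp_res h).basis.coord i
  app_res {T'' T'} g h x := by
    have : (hb.comp_res (g ≫ h)).basis = ((hb.comp_res h).comp_res g).basis := by
      refine Module.Basis.eq_of_apply_eq fun i => ?_
      simp [M.res_comp]
    rw [this]
    exact (hb.comp_res h).repr_res g x i

lemma IsBasis.coord_self [DecidableEq ι] (hb : M.IsBasis b) (h : T ⟶ N) (i k : ι) :
    (hb.coord i).app h (M.res h (b k)) = if k = i then 1 else 0 := by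
  have h1 := (hb.comp_res h).basis.repr_self_apply k i
  rw [IsBasis.basis_apply] at h1
  exact h1

lemma IsBasis.sum_coord (hb : M.IsBasis b) (h : T ⟶ N) (x : M.sec T) :
    ∑ i, (hb.coord i).app h x • M.res h (b i) = x := by
  have h1 := (hb.comp_res h).basis.sum_repr x
  simp only [IsBasis.basis_apply] at h1
  exact h1

end Coord

namespace SubSheaf

variable {T N N' : Over S} {U U' : M.SubSheaf T} {m : ℕ}

/-- The common kernel of a family of functionals. -/
def ker {κ : Type} (f : κ → M.Functional T) : M.SubSheaf T where
  sec h := ⨅ i, LinearMap.ker ((f i).app h)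
  res_mem g h x hx := by
    simp only [Submodule.mem_iInf, LinearMap.mem_ker] at hx ⊢
    intro i
    rw [(f i).app_res, hx, map_zero]
  local_mem h x hx := by
    simp only [Submodule.mem_iInf, LinearMap.mem_ker] at hx ⊢
    intro i
    refine fun_sep fun t => ?_
    obtain ⟨W, hW, h1⟩ := hx t
    refine ⟨W, hW, ?_⟩
    rw [← (f i).app_res, map_zero, h1]

lemma mem_ker {κ : Type} {f : κ → M.Functional T} {h : N ⟶ T} {x : M.sec N} :
    x ∈ (ker f).sec h ↔ ∀ i, (f i).app h x = 0 := by
  simp [ker, Submodule.mem_iInf]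

lemma IsFrame.eq {ι : Type} {u : ι → M.sec T} (hu : U.IsFrame (𝟙 T) u)
    (hu' : U'.IsFrame (𝟙 T) u) : U = U' := by
  ext T' h x
  have h1 := hu.span T' h
  have h2 := hu'.span T' h
  rw [Category.comp_id] at h1 h2
  rw [h1, h2]

lemma isSubbundle_of_isBasis {l : ℕ} {b : Fin m ⊕ Fin l → M.sec T} (hb : M.IsBasis b)
    (hu : U.IsFrame (𝟙 T) fun i => b (Sum.inl i)) : U.IsSubbundle m := fun t =>
  ⟨⊤, trivial, l, _, hb.comp_res (openIncl T ⊤), fun T' h => by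
    have := (hu.comp_res (openIncl T ⊤)).span T' h
    rwa [Category.comp_id] at this⟩

lemma IsBasis.isFrame_inl {κ κ' : Type} [Fintype κ] [Fintype κ'] {b : κ ⊕ κ' → M.sec T}
    (hb : M.IsBasis b) :
    (ker fun j => hb.coord (Sum.inr j)).IsFrame (𝟙 T) fun i => b (Sum.inl i) := by
  classical
  refine ⟨fun T' h => ?_, fun T' h => ?_⟩
  · have := (hb.comp_res h).basis.linearIndependent.comp (Sum.inl : κ → _) Sum.inl_injective
    simpa [Function.comp_def] using this
  · rw [Category.comp_id]
    refine le_antisymm (fun x hx => ?_) (Submodule.span_le.2 ?_)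
    · rw [mem_ker] at hx
      have := hb.sum_coord h x
      rw [Fintype.sum_sum_type] at this
      simp only [hx, zero_smul, Finset.sum_const_zero, add_zero] at this
      rw [← this]
      exact Submodule.sum_mem _ fun i _ => Submodule.smul_mem _ _ (Submodule.subset_span ⟨i, rfl⟩)
    · rintro _ ⟨i, rfl⟩
      refine mem_ker.2 fun j => ?_
      rw [hb.coord_self, if_neg Sum.inl_ne_inr]

/-- Change of frames. -/
lemma IsFrame.change {ι : Type} [Fintype ι] [DecidableEq ι] {j : N ⟶ T} {u u' : ι → M.sec N}
    (hu : U.IsFrame j u) (A : Matrix ι ι (Fun N)) (hA : IsUnit A.det)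
    (hu' : ∀ k, u' k = ∑ i, A i k • u i) : U.IsFrame j u' := by
  have key : ∀ (T' : Over S) (h : T' ⟶ N), (LinearIndependent (Fun T') fun i => M.res h (u' i)) ∧
      U.sec (h ≫ j) = Submodule.span (Fun T') (Set.range fun i => M.res h (u' i)) := by
    intro T' h
    let B := (hu.comp_res h).basis
    let v : ι → U.sec (h ≫ j) := fun k => ∑ i, resFun h (A i k) • B i
    have hv : ∀ k, (v k : M.sec T') = M.res h (u' k) := fun k => by
      rw [hu', res_sum]
      simp [v, B]
    have hdet : IsUnit (B.det v) := by
      have : B.toMatrix v = (resFun h).mapMatrix A := by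
        ext i k
        rw [Module.Basis.toMatrix_apply, Module.Basis.repr_sum_self]
        rfl
      rw [Module.Basis.det_apply, this, ← RingHom.map_det]
      exact hA.map _
    obtain ⟨h1, h2⟩ := (Module.Basis.is_basis_iff_det B).2 hdet
    have hv' : (fun k => M.res h (u' k)) = (U.sec (h ≫ j)).subtype ∘ v := funext fun k => (hv k).symm
    rw [hv']
    refine ⟨h1.map' _ (Submodule.ker_subtype _), ?_⟩
    rw [Set.range_comp, ← Submodule.map_span, h2, Submodule.map_top, Submodule.range_subtype]
  exact ⟨fun T' h => (key T' h).1, fun T' h => (key T' h).2⟩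

lemma IsFrame.eq_sum {ι : Type} [Fintype ι] [DecidableEq ι] {j : N ⟶ T} {u : ι → M.sec N}
    (hu : U.IsFrame j u) (f : ι → (M.sec N →ₗ[Fun N] Fun N))
    (hf : ∀ i k, f i (u k) = if k = i then 1 else 0) {x : M.sec N} (hx : x ∈ U.sec j) :
    x = ∑ i, f i x • u i := by
  rw [hu.span_self] at hx
  obtain ⟨c, rfl⟩ := (Submodule.mem_span_range_iff_exists_fun _).1 hx
  refine Finset.sum_congr rfl fun i _ => ?_
  congr 1
  rw [map_sum]
  simp [hf]

lemma sec_le_of_local (h : ∀ t : T.left, ∃ W : T.left.Opens, t ∈ W ∧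
      ∀ (N : Over S) (g : N ⟶ openSub T W), U.sec (g ≫ openIncl T W) ≤ U'.sec (g ≫ openIncl T W))
    (h' : N ⟶ T) : U.sec h' ≤ U'.sec h' := by
  intro x hx
  refine U'.local_mem _ _ fun t => ?_
  obtain ⟨W, htW, hW⟩ := h (h'.left t)
  obtain ⟨W', htW', g, hg⟩ := exists_nhd_lift h' W t htW
  refine ⟨W', htW', ?_⟩
  have := U.res_mem (openIncl N W') _ _ hx
  rw [← hg] at this ⊢
  exact hW _ _ this

lemma eq_of_le_of_le (h : ∀ (N : Over S) (g : N ⟶ T), U.sec g ≤ U'.sec g)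
    (h' : ∀ (N : Over S) (g : N ⟶ T), U'.sec g ≤ U.sec g) : U = U' := by
  ext N g x
  exact ⟨fun hx => h N g hx, fun hx => h' N g hx⟩

lemma eq_of_local (h : ∀ t : T.left, ∃ W : T.left.Opens, t ∈ W ∧
    U.pull (openIncl T W) = U'.pull (openIncl T W)) : U = U' := by
  refine eq_of_le_of_le (fun N g => sec_le_of_local (fun t => ?_) g)
    (fun N g => sec_le_of_local (fun t => ?_) g)
  all_goals
    obtain ⟨W, htW, hW⟩ := h t
    refine ⟨W, htW, fun N g => le_of_eq ?_⟩
  · exact congrArg (fun V => V.sec g) hW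
  · exact congrArg (fun V => V.sec g) hW.symm

/-- Glueing of subsheaves. -/
def glue (W : T.left → T.left.Opens) (V : ∀ t, M.SubSheaf (openSub T (W t))) : M.SubSheaf T where
  sec {N} h :=
    { carrier := {x | ∀ (t : T.left) (N' : Over S) (g : N' ⟶ N) (a : N' ⟶ openSub T (W t)),
        a ≫ openIncl T (W t) = g ≫ h → M.res g x ∈ (V t).sec a}
      add_mem' := fun hx hy t N' g a e => by
        rw [map_add]
        exact Submodule.add_mem _ (hx t N' g a e) (hy t N' g a e)
      zero_mem' := fun t N' g a e => by
        rw [map_zero]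
        exact Submodule.zero_mem _
      smul_mem' := fun c x hx t N' g a e => by
        rw [M.res_smul]
        exact Submodule.smul_mem _ _ (hx t N' g a e) }
  res_mem g h x hx t N' g' a e := by
    rw [← M.res_comp]
    exact hx t N' _ a (by rw [e, Category.assoc])
  local_mem {N} h x hx t N' g a e := by
    refine (V t).local_mem _ _ fun s => ?_
    obtain ⟨W', hsW', hW'⟩ := hx (g.left s)
    obtain ⟨W'', hsW'', g', hg'⟩ := exists_nhd_lift g W' s hsW'
    refine ⟨W'', hsW'', ?_⟩
    have := hW' t _ g' (openIncl N' W'' ≫ a) (by rw [Category.assoc, e, reassoc_of% hg'])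
    rwa [← M.res_comp, hg', M.res_comp] at this

lemma pull_glue (W : T.left → T.left.Opens) (V : ∀ t, M.SubSheaf (openSub T (W t)))
    (hV : ∀ (t t' : T.left) (N : Over S) (a : N ⟶ openSub T (W t)) (b : N ⟶ openSub T (W t')),
      a ≫ openIncl T (W t) = b ≫ openIncl T (W t') → (V t).pull a = (V t').pull b) (t : T.left) :
    (glue W V).pull (openIncl T (W t)) = V t := by
  refine eq_of_le_of_le (fun N g x hx => ?_) (fun N g x hx t' N' g' a e => ?_)
  · have := hx t N (𝟙 N) g (Category.id_comp _).symm
    rwa [M.res_id] at this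
  · have h1 : M.res g' x ∈ ((V t).pull (g' ≫ g)).sec (𝟙 N') := by
      change _ ∈ (V t).sec (𝟙 N' ≫ g' ≫ g)
      rw [Category.id_comp]
      exact (V t).res_mem _ _ _ hx
    rw [hV t t' N' (g' ≫ g) a (by rw [e, Category.assoc])] at h1
    change _ ∈ (V t').sec (𝟙 N' ≫ a) at h1
    rwa [Category.id_comp] at h1

lemma IsSubbundle.of_local
    (h : ∀ t : T.left, ∃ W : T.left.Opens, t ∈ W ∧ (U.pull (openIncl T W)).IsSubbundle m) :
    U.IsSubbundle m := by
  intro t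
  obtain ⟨W, htW, hW⟩ := h t
  obtain ⟨W', htW', l, b, hb, hs⟩ := hW ⟨t, htW⟩
  obtain ⟨j, hj⟩ := exists_openSub_image W W'
  refine ⟨W.ι ''ᵁ W', ⟨⟨t, htW⟩, htW', rfl⟩, l, _, hb.comp_res j, fun N a => ?_⟩
  have := hs N (a ≫ j)
  change U.sec (((a ≫ j) ≫ openIncl _ _) ≫ openIncl T W) = _ at this
  rw [Category.assoc, Category.assoc, hj] at this
  simpa only [M.res_comp] using this

/-- Local frames consist of sections over open subschemes of `T` and generate all other sections.
Consequently the subbundles over `T` form a small set, as representability requires. -/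
lemma IsSubbundle.ext (hU : U.IsSubbundle m) (hU' : U'.IsSubbundle m)
    (h : ∀ W : T.left.Opens, U.sec (openIncl T W) = U'.sec (openIncl T W)) : U = U' := by
  have key : ∀ {U U' : M.SubSheaf T}, U.IsSubbundle m →
      (∀ W : T.left.Opens, U.sec (openIncl T W) = U'.sec (openIncl T W)) →
      ∀ (N : Over S) (g : N ⟶ T), U.sec g ≤ U'.sec g := by
    intro U U' hU h N g
    refine sec_le_of_local (fun t => ?_) g
    obtain ⟨W, htW, -, l, b, -, hu⟩ := hU.exists_frame t
    refine ⟨W, htW, fun N a => ?_⟩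
    rw [hu.span, Submodule.span_le]
    rintro _ ⟨i, rfl⟩
    exact U'.res_mem _ _ _ ((h W) ▸ hu.mem i)
  exact eq_of_le_of_le (key hU h) (key hU' fun W => (h W).symm)

end SubSheaf

variable (M) in
lemma small_grassmannian (m : ℕ) (T : (Over S)ᵒᵖ) : Small.{u} ((M.grassmannian m).obj T) := by
  let f : (M.grassmannian m).obj T → ∀ W : T.unop.left.Opens, Set (M.sec (openSub T.unop W)) :=
    fun U W => U.1.sec (openIncl T.unop W)
  refine small_of_injective (f := f) fun U U' h => Subtype.ext (U.2.ext U'.2 fun W => ?_)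
  exact SetLike.coe_injective (congrFun h W)

variable (M) in
lemma isSheaf_grassmannian (m : ℕ) :
    Presieve.IsSheaf (Scheme.zariskiTopology.over S) (M.grassmannian m) := by
  refine isSheaf_of_glue (fun T W hW V hV => ?_) (fun T V V' h => ?_)
  · have h1 := SubSheaf.pull_glue W (fun t => (V t).1) fun t t' N a b e =>
      congrArg Subtype.val (hV t t' N a b e)
    refine ⟨⟨SubSheaf.glue W fun t => (V t).1, SubSheaf.IsSubbundle.of_local fun t =>
      ⟨W t, hW t, by rw [h1]; exact (V t).2⟩⟩, fun t => Subtype.ext (h1 t)⟩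
  · refine Subtype.ext (SubSheaf.eq_of_local fun t => ?_)
    obtain ⟨W, hW, h1⟩ := h t
    exact ⟨W, hW, congrArg Subtype.val h1⟩

/-- The standard charts of the Grassmannian bundle. -/
lemma exists_chart {N : Over S} (hN : ∀ (T : Over S) (a b : T ⟶ N), a = b) {m l : ℕ}
    {b : Fin m ⊕ Fin l → M.sec N} (hb : M.IsBasis b) :
    ∃ (X : Over S) (_ : X ⟶ N) (ξ : M.SubSheaf X), ξ.IsSubbundle m ∧
      (∀ (T : Over S) (a a' : T ⟶ X), ξ.pull a = ξ.pull a' → a = a') ∧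
      ∀ (T : Over S) (U : M.SubSheaf T) (u : Fin m → M.sec T) (_ : U.IsFrame (𝟙 T) u)
        (k : T ⟶ N), (∃ a : T ⟶ X, ξ.pull a = U) ↔
          IsUnit (Matrix.of fun i i' => (hb.coord (Sum.inl i)).app k (u i')).det := by
  -- The chart consists of the subbundles which project isomorphically to the span of the first `m`
  -- basis vectors. Such a subbundle is the graph of an `m × l` matrix `c`, with normalized frame
  -- `e₁`.
  obtain ⟨A, π, c, -, hA⟩ := exists_affineSpace N (Fin m × Fin l)
  let e₁ : Fin m → M.sec A := fun i =>
    M.res π (b (Sum.inl i)) + ∑ j, c (i, j) • M.res π (b (Sum.inr j))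
  let e : Fin m ⊕ Fin l → M.sec A := Sum.elim e₁ fun j => M.res π (b (Sum.inr j))
  have he₁ : ∀ (T : Over S) (a : T ⟶ A) (k : T ⟶ N) (i : Fin m), M.res a (e₁ i) =
      M.res k (b (Sum.inl i)) + ∑ j, resFun a (c (i, j)) • M.res k (b (Sum.inr j)) := by
    intro T a k i
    rw [hN _ k (a ≫ π), map_add, res_sum]
    simp only [M.res_comp]
  have hl : ∀ (T : Over S) (a : T ⟶ A) (k : T ⟶ N) (i i' : Fin m),
      (hb.coord (Sum.inl i)).app k (M.res a (e₁ i')) = if i' = i then 1 else 0 := by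
    intro T a k i i'
    rw [he₁ T a k, map_add, map_sum]
    simp [hb.coord_self]
  have hr : ∀ (T : Over S) (a : T ⟶ A) (k : T ⟶ N) (j : Fin l) (i : Fin m),
      (hb.coord (Sum.inr j)).app k (M.res a (e₁ i)) = resFun a (c (i, j)) := by
    intro T a k j i
    rw [he₁ T a k, map_add, map_sum]
    simp [hb.coord_self]
  have he : M.IsBasis e := by
    rw [(hb.comp_res π).isBasis_iff_det, Module.Basis.det_apply]
    -- With respect to `b` the family `e` has a block triangular matrix with identity diagonal
    -- blocks.
    have : (hb.comp_res π).basis.toMatrix e =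
        Matrix.fromBlocks 1 0 (Matrix.of fun j i => c (i, j)) 1 := by
      have h0 : ∀ i, (hb.coord i).app π = (hb.comp_res π).basis.coord i := fun _ => rfl
      have h1 := hl A (𝟙 A) π
      have h2 := hr A (𝟙 A) π
      simp only [M.res_id, resFun_id] at h1 h2
      ext i i'
      rw [Module.Basis.toMatrix_apply]
      rcases i with i | i <;> rcases i' with i' | i'
      · exact (h1 i i').trans (by rw [Matrix.fromBlocks_apply₁₁, Matrix.one_apply]; simp [eq_comm])
      · exact (hb.coord_self π (Sum.inl i) (Sum.inr i')).trans (by simp)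
      · exact (h2 i i').trans (by simp)
      · exact (hb.coord_self π (Sum.inr i) (Sum.inr i')).trans (by
          rw [Matrix.fromBlocks_apply₂₂, Matrix.one_apply]; simp [eq_comm])
    rw [this, Matrix.det_fromBlocks_zero₁₂, Matrix.det_one, Matrix.det_one, one_mul]
    exact isUnit_one
  have hfr := SubSheaf.IsBasis.isFrame_inl he
  let ξ := SubSheaf.ker fun j => he.coord (Sum.inr j)
  change ξ.IsFrame (𝟙 A) e₁ at hfr
  have hfr' : ∀ (T : Over S) (a : T ⟶ A), (ξ.pull a).IsFrame (𝟙 T) fun i => M.res a (e₁ i) :=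
    fun T a => (hfr.comp_res a).pull (by rw [Category.id_comp, Category.comp_id])
  refine ⟨A, π, ξ, SubSheaf.isSubbundle_of_isBasis he hfr, fun T a a' h => ?_,
    fun T U u hu k => ⟨?_, fun hdet => ?_⟩⟩
  -- The normalized frame is the one dual to the first `m` coordinates, hence determined by the
  -- subbundle, and its remaining coordinates recover the matrix `c`.
  · have h1 : ∀ i, M.res a (e₁ i) = M.res a' (e₁ i) := fun i => by
      have hmem := (hfr' T a).mem i
      rw [h] at hmem
      have := (hfr' T a').eq_sum (fun i => (hb.coord (Sum.inl i)).app (a ≫ π))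
        (fun i i' => hl T a' _ i i') hmem
      rw [this]
      simp [hl]
    refine (hA T (a ≫ π) fun p => resFun a (c p)).unique ⟨rfl, fun _ => rfl⟩
      ⟨hN _ _ _, fun p => ?_⟩
    rw [← hr T a (a ≫ π), ← hr T a' (a ≫ π), h1]
  · rintro ⟨a, rfl⟩
    have h1 : ∀ i, ∃ P : Fin m → Fun T, ∑ i', P i' • u i' = M.res a (e₁ i) := fun i => by
      have hmem := (hfr' T a).mem i
      rw [hu.span_self] at hmem
      exact (Submodule.mem_span_range_iff_exists_fun _).1 hmem
    choose P hP using h1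
    exact isUnit_det_of_dual (fun i => (hb.coord (Sum.inl i)).app k) u _ P hP (hl T a k)
  -- The inverse of `D` normalizes the frame `u`; the other coordinates of the new frame `e'` are
  -- those of the required point of the chart.
  · let D := Matrix.of fun i i' => (hb.coord (Sum.inl i)).app k (u i')
    have hD : IsUnit D.det := hdet
    let e' : Fin m → M.sec T := fun i => ∑ i', D⁻¹ i' i • u i'
    have h1 : ∀ i i', (hb.coord (Sum.inl i)).app k (e' i') = if i' = i then 1 else 0 :=
      dual_of_isUnit_det (fun i => (hb.coord (Sum.inl i)).app k) u hD
    obtain ⟨a, ⟨-, ha⟩, -⟩ := hA T k fun p => (hb.coord (Sum.inr p.2)).app k (e' p.1)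
    have h2 : ∀ i, M.res a (e₁ i) = e' i := fun i => by
      rw [← hb.sum_coord k (M.res a (e₁ i)), ← hb.sum_coord k (e' i)]
      refine Finset.sum_congr rfl fun q _ => ?_
      rcases q with q | q
      · rw [hl, h1]
      · rw [hr, ha]
    refine ⟨a, (hfr' T a).eq ?_⟩
    simp only [h2]
    exact hu.change _ (Matrix.isUnit_nonsing_inv_det D hD) fun _ => rfl

end BigModule

end QuatGrass

/-! ### Existence of Grassmannian and quaternionic Grassmannian bundles -/

namespace QuatGrass

/-- The coordinate matrix of `u` has rank `m`, so `m` of its rows are linearly independent. The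
bijection `e` lists these rows first. -/
lemma exists_minor_of_field {K V : Type*} [Field K] [AddCommGroup V] [Module K V] {d m : ℕ}
    (B : Module.Basis (Fin d) K V) {u : Fin m → V} (hu : LinearIndependent K u) :
    ∃ (l : ℕ) (e : Fin m ⊕ Fin l ≃ Fin d),
      IsUnit (Matrix.of fun i i' => B.coord (e (Sum.inl i)) (u i')).det := by
  classical
  let A : Matrix (Fin d) (Fin m) K := Matrix.of fun k i => B.coord k (u i)
  have hA : LinearIndependent K A.col := hu.map' B.equivFun.toLinearMap (LinearEquiv.ker _)
  have hr : Module.finrank K (Submodule.span K (Set.range A.row)) = m := by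
    rw [← A.rank_eq_finrank_span_row, ← A.rank_transpose]
    have := LinearIndependent.rank_matrix (M := A.transpose) hA
    simpa using this
  have h3 : ∀ n, Module.finrank K (Submodule.span K (Set.range A.row)) = n →
      ∃ f : Fin n → Fin m → K, (∀ i, f i ∈ Set.range A.row) ∧ LinearIndependent K f := by
    rintro _ rfl
    obtain ⟨f, hf, -, hfl⟩ := Submodule.exists_fun_fin_finrank_span_eq K (Set.range A.row)
    exact ⟨f, hf, hfl⟩
  obtain ⟨f, hf, hfl⟩ := h3 m hr
  choose k hk using hf
  have hki : Function.Injective k := fun i i' h => hfl.injective (by rw [← hk, ← hk, h])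
  let e : Fin m ⊕ Fin (Fintype.card ↥(Set.range k)ᶜ) ≃ Fin d :=
    (Equiv.sumCongr (Equiv.ofInjective k hki) (Fintype.equivFin _).symm).trans
      (Equiv.Set.sumCompl (Set.range k))
  refine ⟨_, e, ?_⟩
  have he : ∀ i, e (Sum.inl i) = k i := fun i => by simp [e]
  rw [← Matrix.isUnit_iff_isUnit_det, ← Matrix.linearIndependent_rows_iff_isUnit]
  convert hfl using 1
  funext i
  rw [← hk]
  funext i'
  simp only [Matrix.row_apply, Matrix.of_apply, he, A]

lemma exists_minor {K V : Type*} [CommRing K] (hK : IsField K) [AddCommGroup V] [Module K V]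
    {d m : ℕ} (B : Module.Basis (Fin d) K V) {u : Fin m → V} (hu : LinearIndependent K u) :
    ∃ (l : ℕ) (e : Fin m ⊕ Fin l ≃ Fin d),
      IsUnit (Matrix.of fun i i' => B.coord (e (Sum.inl i)) (u i')).det := by
  obtain ⟨F, rfl⟩ := exists_field_of_isField K hK
  exact exists_minor_of_field B hu

variable {S : Scheme.{u}}

lemma subsingleton_hom_openBase (W : S.Opens) (T : Over S) (a b : T ⟶ Over.mk W.ι) : a = b := by
  ext1
  exact (cancel_mono W.ι).1 ((Over.w a).trans (Over.w b).symm)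

lemma exists_lift_openBase (W : S.Opens) (T : Over S) (h : ∀ t, T.hom t ∈ W) :
    Nonempty (T ⟶ Over.mk W.ι) := by
  have hr : Set.range T.hom ⊆ Set.range W.ι := by
    rw [Scheme.Opens.range_ι]
    rintro _ ⟨t, rfl⟩
    exact h t
  exact ⟨Over.homMk (IsOpenImmersion.lift W.ι T.hom hr) (IsOpenImmersion.lift_fac _ _ _)⟩

lemma hom_mem_of_openBase {W : S.Opens} {T : Over S} (k : T ⟶ Over.mk W.ι) (t : T.left) :
    T.hom t ∈ W := by
  rw [← Over.w k]
  exact (k.left t).2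

namespace BigModule

variable {M : BigModule S}

lemma IsBasis.coord_reindex {ι κ : Type} [Fintype ι] [Fintype κ] {N T : Over S} {b : ι → M.sec N}
    (hb : M.IsBasis b) (e : κ ≃ ι) (k : T ⟶ N) (q : κ) :
    ((hb.reindex e).coord q).app k = (hb.coord (e q)).app k := by
  have : ((hb.reindex e).comp_res k).basis = (hb.comp_res k).basis.reindex e.symm := by
    refine Module.Basis.eq_of_apply_eq fun i => ?_
    simp [Module.Basis.reindex_apply]
  ext x
  change (((hb.reindex e).comp_res k).basis.repr x) q = (hb.comp_res k).basis.repr x (e q)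
  rw [this, Module.Basis.repr_reindex_apply]
  simp

/-- The Grassmannian bundles of a vector bundle exist. -/
theorem IsVectorBundle.exists_grassmannian {d : ℕ} (hM : M.IsVectorBundle d) (m : ℕ) :
    ∃ G, Nonempty ((M.grassmannian m).RepresentableBy G) := by
  let I := Σ (W : S.Opens) (l : ℕ), {b : Fin m ⊕ Fin l → M.sec (Over.mk W.ι) // M.IsBasis b}
  have hch := fun i : I => exists_chart (subsingleton_hom_openBase i.1) i.2.2.2
  choose X π ξ hξ hmono hiff using hch
  -- Near `t`, the subbundle lies in the chart exactly where `T` maps to the open set `i.1` of `S`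
  -- and a certain minor of its frame is invertible. Both are open conditions.
  have hloc : ∀ (i : I) (T : Over S) (V : M.SubSheaf T) (_ : V.IsSubbundle m) (t : T.left),
      ∃ W : T.left.Opens, t ∈ W ∧ ∃ O : (openSub T W).left.Opens,
      ∀ (T' : Over S) (h : T' ⟶ openSub T W),
        (∃ a : T' ⟶ X i, (ξ i).pull a = V.pull (h ≫ openIncl T W)) ↔ ∀ t, h.left t ∈ O := by
    intro i T V hV t
    obtain ⟨W, htW, -, l, b, -, hu⟩ := hV.exists_frame t
    let O₁ : (openSub T W).left.Opens := (openSub T W).hom ⁻¹ᵁ i.1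
    let j := openIncl (openSub T W) O₁
    obtain ⟨k⟩ := exists_lift_openBase i.1 (openSub (openSub T W) O₁) fun t => by
      have := openIncl_mem (𝟙 (openSub (openSub T W) O₁)) t
      rw [Category.id_comp] at this
      exact this
    let f := (Matrix.of fun q q' => (i.2.2.2.coord (Sum.inl q)).app k
      (M.res j (b (Sum.inl q')))).det
    obtain ⟨O, hO⟩ := exists_lift_isUnit_iff j f
    refine ⟨W, htW, O, fun T' h => ?_⟩
    rw [← hO]
    have hfr : (V.pull (h ≫ openIncl T W)).IsFrame (𝟙 T') fun q => M.res h (b (Sum.inl q)) :=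
      (hu.comp_res h).pull (Category.id_comp _)
    have hdet : ∀ h' : T' ⟶ _, h' ≫ j = h → resFun h' f =
        (Matrix.of fun q q' => (i.2.2.2.coord (Sum.inl q)).app (h' ≫ k)
          (M.res h (b (Sum.inl q')))).det := by
      rintro h' rfl
      rw [RingHom.map_det]
      congr 1
      ext q q'
      simp only [RingHom.mapMatrix_apply, Matrix.map_apply, Matrix.of_apply]
      rw [M.res_comp, Functional.app_res]
    constructor
    · intro ha
      have ⟨a, _⟩ := ha
      obtain ⟨h', hh'⟩ := exists_lift_openSub O₁ h fun t => by
        have h1 := hom_mem_of_openBase (a ≫ π i) t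
        rw [← Over.w h] at h1
        exact h1
      refine ⟨h', hh', ?_⟩
      rw [hdet h' hh']
      exact (hiff i T' _ _ hfr (h' ≫ k)).1 ha
    · rintro ⟨h', hh', h2⟩
      rw [hdet h' hh'] at h2
      exact (hiff i T' _ _ hfr (h' ≫ k)).2 h2
  have hmono' : ∀ (i : I) (T : Over S) (a b : T ⟶ X i),
      (M.grassmannian m).map a.op ⟨ξ i, hξ i⟩ = (M.grassmannian m).map b.op ⟨ξ i, hξ i⟩ → a = b :=
    fun i T a b h => hmono i T a b (congrArg Subtype.val h)
  have hopen : ∀ (i : I) (T : Over S) (y : (M.grassmannian m).obj (op T)), ∃ O : T.left.Opens,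
      ∀ (T' : Over S) (h : T' ⟶ T), (∃ a : T' ⟶ X i, (ξ i).pull a = y.1.pull h) ↔
        ∀ t, h.left t ∈ O := by
    intro i T y
    refine exists_open_locus (fun {T'} h => ∃ a : T' ⟶ X i, (ξ i).pull a = y.1.pull h) ?_ ?_
      (hloc i T y.1 y.2)
    · rintro T'' T' g h ⟨a, ha⟩
      exact ⟨g ≫ a, by rw [SubSheaf.pull_comp, ha, SubSheaf.pull_comp]⟩
    · intro T' h hh
      obtain ⟨a, ha⟩ := exists_lift_of_local (isSheaf_grassmannian M m) ⟨ξ i, hξ i⟩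
        ⟨y.1.pull h, y.2.pull h⟩ (hmono' i) fun t => by
          obtain ⟨W, htW, a, ha⟩ := hh t
          exact ⟨W, htW, a, Subtype.ext (ha.trans (SubSheaf.pull_comp _ _ _))⟩
      exact ⟨a, congrArg Subtype.val ha⟩
  have := small_grassmannian M m
  refine exists_representableBy (isSheaf_grassmannian M m) X (fun i => ⟨ξ i, hξ i⟩) hmono' ?_ ?_
  · intro i T y
    obtain ⟨O, hO⟩ := hopen i T y
    exact ⟨O, fun T' h => by
      rw [← hO]
      exact exists_congr fun a => Subtype.ext_iff⟩
  · intro T y t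
    obtain ⟨W₀, htW₀, b₀, hb₀⟩ := hM.locallyFree (T.hom t)
    obtain ⟨W, htW, -, l', b', -, hu⟩ := y.2.exists_frame t
    obtain ⟨p, hp, -⟩ := exists_lift_pt W t htW
    have hu' := hu.comp_res p
    rw [hp] at hu'
    obtain ⟨k⟩ := exists_lift_openBase W₀ (pt T t) fun s => by
      change T.hom (T.left.fromSpecResidueField t s) ∈ W₀
      rwa [Scheme.fromSpecResidueField_apply]
    -- At the residue field of `t` some minor is invertible. Reordering the basis accordingly gives
    -- a chart that contains `y` at `t`, hence also in a neighbourhood.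
    obtain ⟨l, e, he⟩ := exists_minor (isField_fun_pt T t) (hb₀.comp_res k).basis hu'.li_self
    let i : I := ⟨W₀, l, _, hb₀.reindex e⟩
    obtain ⟨O, hO⟩ := hopen i T y
    have htO : t ∈ O := by
      have h1 := (hO _ (ptIncl T t)).1 ((hiff i _ _ _ (hu'.pull (Category.id_comp _)) k).2 (by
        convert he using 4 with q q'
        exact funext fun q' => LinearMap.congr_fun (hb₀.coord_reindex e k (Sum.inl q)) _))
      have h2 := h1 (default : Spec (T.left.residueField t))
      rwa [show (ptIncl T t).left _ = t from Scheme.fromSpecResidueField_apply _ _] at h2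
    obtain ⟨a, ha⟩ := (hO _ (openIncl T O)).2 fun t => by
      have := openIncl_mem (𝟙 (openSub T O)) t
      rwa [Category.id_comp] at this
    exact ⟨O, htO, i, a, Subtype.ext ha⟩

end BigModule

/-- A subfunctor of a representable functor which is given by an open condition is
representable. -/
def openRepresentableBy {F : (Over S)ᵒᵖ ⥤ Type w} {G : Over S} (e : F.RepresentableBy G)
    {F' : (Over S)ᵒᵖ ⥤ Type w} (i : F' ⟶ F) (hi : ∀ T, Function.Injective (i.app T))
    (O : G.left.Opens) (hO : ∀ (T : Over S) (x : F.obj (op T)),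
      (∃ y, i.app (op T) y = x) ↔ ∀ t, (e.homEquiv.symm x).left t ∈ O) :
    F'.RepresentableBy (openSub G O) :=
  have h1 : ∀ {T : Over S} (h : T ⟶ openSub G O),
      ∃ y, i.app (op T) y = e.homEquiv (h ≫ openIncl G O) := fun h => by
    rw [hO, Equiv.symm_apply_apply]
    exact openIncl_mem h
  { homEquiv := fun {T} => Equiv.ofBijective (fun h => (h1 h).choose) (by
      constructor
      · intro h h' hh
        have := congrArg (i.app (op T)) hh
        dsimp only at this
        rw [(h1 h).choose_spec, (h1 h').choose_spec] at this
        exact (cancel_mono (openIncl G O)).1 (e.homEquiv.injective this)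
      · intro y
        obtain ⟨h, hh⟩ := exists_lift_openSub O (e.homEquiv.symm (i.app (op T) y))
          ((hO _ _).1 ⟨y, rfl⟩)
        refine ⟨h, hi _ ?_⟩
        dsimp only
        rw [(h1 h).choose_spec, hh, Equiv.apply_symm_apply])
    homEquiv_comp := fun {T T'} f g => by
      refine hi _ ?_
      have h2 := ConcreteCategory.congr_hom (i.naturality f.op) (h1 g).choose
      refine (h1 (f ≫ g)).choose_spec.trans (Eq.trans ?_ h2.symm)
      change _ = F.map f.op (i.app _ (h1 g).choose)
      rw [(h1 g).choose_spec, Category.assoc, e.homEquiv_comp] }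

namespace BigModule

variable {M : BigModule S} {φ : M.AltForm}

/-- The quaternionic Grassmannian bundle is an open subscheme of the Grassmannian bundle. -/
theorem exists_hgr_openSub {d : ℕ} (hM : M.IsVectorBundle d) (hφ : φ.IsNondegenerate) (r : ℕ) :
    ∃ (G : Over S) (_ : (M.grassmannian (2 * r)).RepresentableBy G) (O : G.left.Opens),
      Nonempty ((φ.hgr r).RepresentableBy (openSub G O)) := by
  obtain ⟨G, ⟨e⟩⟩ := hM.exists_grassmannian (2 * r)
  have hU := (e.homEquiv (𝟙 G)).2
  obtain ⟨O, hO, -⟩ := hU.exists_sympl_locus φ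
  let i : φ.hgr r ⟶ M.grassmannian (2 * r) :=
    { app := fun T => ↾(fun U => ⟨U.1, U.2.1⟩), naturality := fun _ _ _ => rfl }
  refine ⟨G, e, O, ⟨openRepresentableBy e i (fun T U U' h => Subtype.ext ?_) O fun T x => ?_⟩⟩
  · exact congrArg (fun V => V.1) h
  · obtain ⟨g, rfl⟩ := e.homEquiv.surjective x
    rw [Equiv.symm_apply_apply, ← hO]
    have h1 : (e.homEquiv g).1 = (e.homEquiv (𝟙 G)).1.pull g := by
      have := e.homEquiv_comp g (𝟙 G)
      rw [Category.comp_id] at this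
      exact congrArg Subtype.val this
    rw [← h1]
    constructor
    · rintro ⟨U, hU⟩
      rw [← hU]
      exact U.2.1.isLocSymp U.2.2
    · intro h
      exact ⟨⟨_, (e.homEquiv g).2, h.isSymplectic hM.isSheaf hφ⟩, rfl⟩

end BigModule

end QuatGrass

namespace QuatGrass

variable {S : Scheme.{u}}

/-! ### Closed subschemes and affine morphisms through functors of points -/

/-- The closed subscheme where given functions vanish. -/
lemma exists_closedSub (N : Over S) {κ : Type} (f : κ → Fun N) : ∃ (Z : Over S) (z : Z ⟶ N),
    IsClosedImmersion z.left ∧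
      ∀ (T : Over S) (h : T ⟶ N), (∃ h', h' ≫ z = h) ↔ ∀ i, resFun h (f i) = 0 := by
  obtain ⟨A, π, c, hπ, hA⟩ := exists_affineSpace N κ
  -- The functions `f` and the zero functions are two sections of affine space over `N`. A section
  -- of an affine morphism is a closed immersion, so the fibre product of the two sections, where
  -- they agree, is closed in `N`.
  obtain ⟨s, ⟨hs, hsc⟩, -⟩ := hA N (𝟙 N) f
  obtain ⟨s₀, ⟨hs₀, hs₀c⟩, -⟩ := hA N (𝟙 N) 0
  have hsec : ∀ s : N ⟶ A, s ≫ π = 𝟙 N → IsClosedImmersion s.left := fun s hs => by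
    have h1 : s.left ≫ π.left = 𝟙 _ := congrArg CommaMorphism.left hs
    have h2 : IsClosedImmersion (s.left ≫ π.left) := by rw [h1]; infer_instance
    exact IsClosedImmersion.of_comp s.left π.left
  have hs₀' := hsec s₀ hs₀
  let z : Over.mk (pullback.fst s.left s₀.left ≫ N.hom) ⟶ N := Over.homMk (pullback.fst _ _)
  refine ⟨_, z, inferInstanceAs (IsClosedImmersion (pullback.fst s.left s₀.left)), fun T h => ?_⟩
  have hsnd : pullback.snd s.left s₀.left = pullback.fst s.left s₀.left := by
    have h1 : s.left ≫ π.left = 𝟙 _ := congrArg CommaMorphism.left hs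
    have h2 : s₀.left ≫ π.left = 𝟙 _ := congrArg CommaMorphism.left hs₀
    have := congrArg (· ≫ π.left) (pullback.condition (f := s.left) (g := s₀.left))
    simp only [Category.assoc, h1, h2, Category.comp_id] at this
    exact this.symm
  constructor
  · rintro ⟨h', rfl⟩ i
    have hz : z ≫ s = z ≫ s₀ := by
      ext1
      change pullback.fst s.left s₀.left ≫ s.left = pullback.fst s.left s₀.left ≫ s₀.left
      rw [pullback.condition, hsnd]
    rw [← hsc, ← resFun_comp, Category.assoc, hz, ← Category.assoc, resFun_comp, hs₀c]
    exact map_zero _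
  · intro h0
    have h1 : h ≫ s = h ≫ s₀ := (hA T h 0).unique
      ⟨by rw [Category.assoc, hs, Category.comp_id], fun i => by rw [resFun_comp, hsc, h0]; rfl⟩
      ⟨by rw [Category.assoc, hs₀, Category.comp_id], fun i => by
        rw [resFun_comp, hs₀c]; exact map_zero _⟩
    let l : T.left ⟶ pullback s.left s₀.left :=
      pullback.lift h.left h.left (congrArg CommaMorphism.left h1)
    refine ⟨Over.homMk l ?_, ?_⟩
    · change l ≫ pullback.fst _ _ ≫ N.hom = _
      rw [pullback.lift_fst_assoc, Over.w]
    · ext1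
      exact pullback.lift_fst _ _ _

/-- A property of morphisms which is local on the target can be checked on pullback squares, given
through functors of points. -/
lemma of_local_pullback (P : MorphismProperty Scheme.{u}) [IsZariskiLocalAtTarget P]
    {X Y : Over S} (f : X ⟶ Y)
    (h : ∀ y : Y.left, ∃ W : Y.left.Opens, y ∈ W ∧ ∃ (Z : Over S) (x : Z ⟶ X)
      (z : Z ⟶ openSub Y W), P z.left ∧ x ≫ f = z ≫ openIncl Y W ∧
      (∀ (T : Over S) (a : T ⟶ X) (b : T ⟶ openSub Y W), a ≫ f = b ≫ openIncl Y W →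
        ∃ c : T ⟶ Z, c ≫ x = a ∧ c ≫ z = b) ∧
      ∀ (T : Over S) (c c' : T ⟶ Z), c ≫ x = c' ≫ x → c ≫ z = c' ≫ z → c = c') : P f.left := by
  refine IsZariskiLocalAtTarget.of_forall_exists_morphismRestrict fun y => ?_
  obtain ⟨W, hyW, Z, x, z, hz, hsq, hex, huniq⟩ := h y
  refine ⟨W, hyW, ?_⟩
  have hsq' : x.left ≫ f.left = z.left ≫ W.ι := congrArg CommaMorphism.left hsq
  have hZ : x.left ≫ X.hom = Z.hom := Over.w x
  have hd : ∀ s : PullbackCone f.left W.ι, ∃ l : s.pt ⟶ Z.left, l ≫ x.left = s.fst ∧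
      l ≫ z.left = s.snd := fun s => by
    let T : Over S := Over.mk (s.fst ≫ X.hom)
    let a : T ⟶ X := Over.homMk s.fst
    let b : T ⟶ openSub Y W := Over.homMk s.snd (by
      change s.snd ≫ W.ι ≫ Y.hom = s.fst ≫ X.hom
      rw [← s.condition_assoc, Over.w])
    obtain ⟨c, h1, h2⟩ := hex T a b (by ext1; exact s.condition)
    exact ⟨c.left, congrArg CommaMorphism.left h1, congrArg CommaMorphism.left h2⟩
  choose l hl hl' using hd
  have hpb : IsPullback x.left z.left f.left W.ι := by
    refine ⟨⟨hsq'⟩, ⟨PullbackCone.IsLimit.mk _ l hl hl' fun s m h1 h2 => ?_⟩⟩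
    let T : Over S := Over.mk (s.fst ≫ X.hom)
    let c : T ⟶ Z := Over.homMk m (by rw [← hZ, reassoc_of% h1]; rfl)
    let c' : T ⟶ Z := Over.homMk (l s) (by rw [← hZ, reassoc_of% (hl s)]; rfl)
    refine congrArg CommaMorphism.left (huniq T c c' ?_ ?_)
    · ext1
      exact h1.trans (hl s).symm
    · ext1
      exact h2.trans (hl' s).symm
  have hpb' := (isPullback_morphismRestrict f.left W).flip
  have hi : (hpb'.isoIsPullback _ _ hpb).hom ≫ z.left = f.left ∣_ W :=
    IsPullback.isoIsPullback_hom_snd _ _ _ _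
  rw [← hi, P.cancel_left_of_respectsIso]
  exact hz

/-- A monomorphism which is locally on the target cut out by functions is a closed immersion. -/
lemma isClosedImmersion_of_local {X Y : Over S} (f : X ⟶ Y) [Mono f]
    (h : ∀ y : Y.left, ∃ W : Y.left.Opens, y ∈ W ∧ ∃ (κ : Type) (g : κ → Fun (openSub Y W)),
      ∀ (T : Over S) (b : T ⟶ openSub Y W), (∃ a : T ⟶ X, a ≫ f = b ≫ openIncl Y W) ↔
        ∀ i, resFun b (g i) = 0) : IsClosedImmersion f.left := by
  refine of_local_pullback @IsClosedImmersion f fun y => ?_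
  obtain ⟨W, hyW, κ, g, hg⟩ := h y
  obtain ⟨Z, z, hz, hZ⟩ := exists_closedSub _ g
  obtain ⟨x, hx⟩ := (hg Z z).2 ((hZ Z z).1 ⟨𝟙 Z, Category.id_comp z⟩)
  refine ⟨W, hyW, Z, x, z, hz, hx, fun T a b hab => ?_, fun T c c' _ h2 => ?_⟩
  · obtain ⟨c, hc⟩ := (hZ T b).2 ((hg T b).1 ⟨a, hab⟩)
    refine ⟨c, ?_, hc⟩
    rw [← cancel_mono f, Category.assoc, hx, reassoc_of% hc, hab]
  · have : Mono z := Over.mono_of_mono_left z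
    exact (cancel_mono z).1 h2

variable (S) in
/-- The terminal `S`-scheme. -/
abbrev base : Over S := Over.mk (𝟙 S)

/-- The morphism to the terminal `S`-scheme. -/
abbrev toTerminal (T : Over S) : T ⟶ base S := Over.homMk T.hom

lemma subsingleton_hom_base {T : Over S} (a b : T ⟶ base S) : a = b := by
  ext1
  have h1 := Over.w a
  have h2 := Over.w b
  dsimp at h1 h2
  rw [Category.comp_id] at h1 h2
  rw [h1, h2]

/-- An `S`-scheme whose functor of points is, locally on `S`, given by a system of equations in
affine space is affine over `S`. -/
lemma isAffineHom_of_local (G : Over S)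
    (h : ∀ s : S, ∃ W : S.Opens, s ∈ W ∧ ∃ (ι κ : Type)
      (a : ∀ {T : Over S}, (T ⟶ G) → (T ⟶ openSub (base S) W) → ι → Fun T)
      (p : ∀ {T : Over S}, (T ⟶ openSub (base S) W) → (ι → Fun T) → κ → Fun T),
      (∀ {T' T : Over S} (g : T' ⟶ T) (h : T ⟶ G) (k : T ⟶ openSub (base S) W) (i : ι),
        a (g ≫ h) (g ≫ k) i = resFun g (a h k i)) ∧
      (∀ {T' T : Over S} (g : T' ⟶ T) (k : T ⟶ openSub (base S) W) (v : ι → Fun T) (i : κ),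
        p (g ≫ k) (fun i => resFun g (v i)) i = resFun g (p k v i)) ∧
      (∀ {T : Over S} (h h' : T ⟶ G) (k : T ⟶ openSub (base S) W), a h k = a h' k → h = h') ∧
      ∀ {T : Over S} (k : T ⟶ openSub (base S) W) (v : ι → Fun T),
        (∃ h, a h k = v) ↔ ∀ i, p k v i = 0) : IsAffineHom G.hom := by
  have hloc : IsZariskiLocalAtTarget @IsAffineHom :=
    @HasAffineProperty.instIsZariskiLocalAtTarget _ _ instHasAffinePropertyIsAffineHomIsAffine
  refine of_local_pullback @IsAffineHom (toTerminal G) fun s => ?_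
  obtain ⟨W, hsW, ι, κ, a, p, ha, hp, hinj, hiff⟩ := h s
  -- The base change of `G` to `W` is identified with the closed subscheme `Z` of affine space
  -- defined by the equations `p`: a point goes to its coordinates `a`, and `x` is the point given
  -- by the universal solution.
  obtain ⟨A, π, c, hπ, hA⟩ := exists_affineSpace (openSub (base S) W) ι
  obtain ⟨Z, z, hz, hZ⟩ := exists_closedSub A (p π c)
  obtain ⟨x, hx⟩ := (hiff (z ≫ π) fun i => resFun z (c i)).2 fun i => by
    rw [hp]
    exact (hZ Z z).1 ⟨𝟙 Z, Category.id_comp z⟩ i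
  have hmono : Mono z := Over.mono_of_mono_left z
  have hx' : ∀ (T : Over S) (g : T ⟶ Z) (i : ι), a (g ≫ x) (g ≫ z ≫ π) i = resFun (g ≫ z) (c i) :=
    fun T g i => by rw [ha, hx, resFun_comp]
  refine ⟨W, hsW, Z, x, z ≫ π, ?_, subsingleton_hom_base _ _, fun T h k _ => ?_,
    fun T g g' h1 h2 => ?_⟩
  · rw [Over.comp_left]
    infer_instance
  · obtain ⟨g, ⟨hg, hgc⟩, -⟩ := hA T k (a h k)
    have h1 : ∀ i, resFun g (p π c i) = 0 := fun i => by
      rw [← hp, hg]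
      simp only [hgc]
      exact (hiff k _).1 ⟨h, rfl⟩ i
    obtain ⟨g', rfl⟩ := (hZ T g).2 h1
    refine ⟨g', ?_, by rw [← Category.assoc, hg]⟩
    refine hinj _ _ k (funext fun i => ?_)
    rw [← hgc, ← hx', ← Category.assoc, hg]
  · refine (cancel_mono z).1 ((hA T (g' ≫ z ≫ π) (a (g' ≫ x) (g' ≫ z ≫ π))).unique
      ⟨by rw [Category.assoc]; exact h2, fun i => ?_⟩
      ⟨by rw [Category.assoc], fun i => ?_⟩)
    · rw [← hx', h1, h2]
    · rw [← hx']

/-! ### Characteristic polynomials of projectors -/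

section Projector

/-- In the basis `B` the matrix of `p` is block upper triangular with diagonal blocks `1` and `0`.
-/
lemma charpoly_proj {R V : Type*} [CommRing R] [AddCommGroup V] [Module R V] [Module.Free R V]
    [Module.Finite R V] {m l : ℕ} (B : Module.Basis (Fin m ⊕ Fin l) R V) (p : V →ₗ[R] V)
    (hp : ∀ i, p (B (Sum.inl i)) = B (Sum.inl i))
    (hp' : ∀ j, p (B (Sum.inr j)) ∈ Submodule.span R (Set.range fun i => B (Sum.inl i))) :
    p.charpoly = (Polynomial.X - 1) ^ m * Polynomial.X ^ l := by
  choose P hP using fun j => (Submodule.mem_span_range_iff_exists_fun _).1 (hp' j)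
  have h1 : LinearMap.toMatrix B B p = Matrix.fromBlocks 1 (Matrix.of fun i j => P j i) 0 0 := by
    ext i i'
    rw [LinearMap.toMatrix_apply]
    rcases i' with i' | i'
    · rw [hp, Module.Basis.repr_self]
      rcases i with i | i <;> simp [Matrix.one_apply, Finsupp.single_apply, eq_comm]
    · rw [← hP, map_sum]
      rcases i with i | i <;> simp [Finsupp.single_apply]
  rw [← LinearMap.charpoly_toMatrix p B, h1, Matrix.charpoly_fromBlocks_zero₂₁,
    Matrix.charpoly_one, Matrix.charpoly_zero]
  simp

/-- The rank of a projector is the multiplicity of `1` as a root of its characteristic polynomial.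
The factor `X ^ m` replaces the exponent `d - m`, which would be truncated for `m > d`. -/
lemma finrank_of_charpoly_of_field {K V : Type*} [Field K] [AddCommGroup V] [Module K V] {d m : ℕ}
    (b : Module.Basis (Fin d) K V) (U : Submodule K V) (p : V →ₗ[K] V) (hp : ∀ x, p x ∈ U)
    (hp' : ∀ x ∈ U, p x = x)
    (hc : (LinearMap.toMatrix b b p).charpoly * Polynomial.X ^ m = (Polynomial.X - 1) ^ m * Polynomial.X ^ d) :
    Module.finrank K U = m := by
  obtain ⟨l, hl, k, k', hli, hsp⟩ := exists_adapted_basis_of_field b U p hp hp' rfl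
  have : Module.Finite K V := Module.Finite.of_basis b
  rw [LinearMap.charpoly_toMatrix] at hc
  have hdim := hp
  let B := Module.Basis.mk hli hsp.ge
  have hB : p.charpoly = (Polynomial.X - 1) ^ Module.finrank K U * Polynomial.X ^ l := by
    refine charpoly_proj B p (fun i => ?_) fun j => ?_
    · simp only [B, Module.Basis.mk_apply, Sum.elim_inl]
      exact hp' _ (hp _)
    · simp only [B, Module.Basis.mk_apply, Sum.elim_inr]
      rw [map_sub, hp' _ (hp _), sub_self]
      exact Submodule.zero_mem _
  rw [hB] at hc
  have h1 := congrArg (Polynomial.rootMultiplicity 1) hc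
  have hX : ∀ n, Polynomial.rootMultiplicity (1 : K) (Polynomial.X ^ n) = 0 := fun n =>
    Polynomial.rootMultiplicity_eq_zero (by simp [Polynomial.IsRoot])
  have hX1 : ∀ n, Polynomial.rootMultiplicity (1 : K) ((Polynomial.X - 1) ^ n) = n := fun n => by
    have := Polynomial.rootMultiplicity_X_sub_C_pow (1 : K) n
    rwa [map_one] at this
  have hne : (Polynomial.X - 1 : Polynomial K) ≠ 0 := by
    have := Polynomial.X_sub_C_ne_zero (1 : K)
    rwa [map_one] at this
  rw [mul_assoc, ← pow_add, Polynomial.rootMultiplicity_mul (mul_ne_zero (pow_ne_zero _ hne)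
    (pow_ne_zero _ Polynomial.X_ne_zero)), Polynomial.rootMultiplicity_mul (mul_ne_zero (pow_ne_zero _ hne)
    (pow_ne_zero _ Polynomial.X_ne_zero)), hX, hX, hX1, hX1] at h1
  simpa using h1

lemma finrank_of_charpoly {K V : Type*} [CommRing K] (hK : IsField K) [AddCommGroup V] [Module K V]
    {d m : ℕ} (b : Module.Basis (Fin d) K V) (U : Submodule K V) (p : V →ₗ[K] V)
    (hp : ∀ x, p x ∈ U) (hp' : ∀ x ∈ U, p x = x)
    (hc : (LinearMap.toMatrix b b p).charpoly * Polynomial.X ^ m = (Polynomial.X - 1) ^ m * Polynomial.X ^ d) :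
    Module.finrank K U = m := by
  obtain ⟨F, rfl⟩ := exists_field_of_isField K hK
  exact finrank_of_charpoly_of_field b U p hp hp' hc

end Projector

end QuatGrass

/-! ### Quaternionic Grassmannians are affine over the base and lie in `𝒱` -/

namespace QuatGrass

variable {S : Scheme.{u}}

namespace BigModule

variable {M : BigModule S} {φ : M.AltForm}

lemma classified_comp {r : ℕ} {G : Over S} (e : (φ.hgr r).RepresentableBy G) {T T' : Over S}
    (g : T' ⟶ T) (h : T ⟶ G) : classified e (g ≫ h) = (classified e h).pull g :=
  congrArg Subtype.val (e.homEquiv_comp g h)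

lemma classified_eq_pull {r : ℕ} {G : Over S} (e : (φ.hgr r).RepresentableBy G) {T : Over S}
    (h : T ⟶ G) : classified e h = (taut e).pull h := by
  have := classified_comp e h (𝟙 G)
  rwa [Category.comp_id] at this

lemma hom_ext_of_classified {r : ℕ} {G : Over S} (e : (φ.hgr r).RepresentableBy G) {T : Over S}
    {h h' : T ⟶ G} (H : classified e h = classified e h') : h = h' :=
  e.homEquiv.injective (Subtype.ext H)

/-- The subsheaf of the fixed points of an endomorphism. -/
def SubSheaf.fixed (hM : Presieve.IsSheaf (Scheme.zariskiTopology.over S) M.toFunctor) {T : Over S}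
    (q : M.Endo T) : M.SubSheaf T where
  sec h := LinearMap.ker (q.app h - LinearMap.id)
  res_mem g h x hx := by
    rw [LinearMap.mem_ker, LinearMap.sub_apply, LinearMap.id_apply, sub_eq_zero] at hx ⊢
    rw [q.app_res, hx]
  local_mem {N} h x hx := by
    rw [LinearMap.mem_ker, LinearMap.sub_apply, LinearMap.id_apply, sub_eq_zero]
    refine sep hM fun t => ?_
    obtain ⟨W, hW, h1⟩ := hx t
    refine ⟨W, hW, ?_⟩
    rwa [LinearMap.mem_ker, LinearMap.sub_apply, LinearMap.id_apply, sub_eq_zero, q.app_res] at h1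

lemma SubSheaf.mem_fixed (hM : Presieve.IsSheaf (Scheme.zariskiTopology.over S) M.toFunctor)
    {T N : Over S} (q : M.Endo T) (h : N ⟶ T) (x : M.sec N) :
    x ∈ (SubSheaf.fixed hM q).sec h ↔ q.app h x = x := by
  change x ∈ LinearMap.ker _ ↔ _
  rw [LinearMap.mem_ker, LinearMap.sub_apply, LinearMap.id_apply, sub_eq_zero]

section Endo

variable {d : ℕ} {N T : Over S} {b : Fin d → M.sec N} (hb : M.IsBasis b)

/-- The endomorphism with a given matrix. -/
def IsBasis.endo (k : T ⟶ N) (v : Fin d × Fin d → Fun T) : M.Endo T where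
  app g := ∑ i, (∑ j, resFun g (v (i, j)) • (hb.coord j).app (g ≫ k)).smulRight
    (M.res (g ≫ k) (b i))
  app_res {T'' T'} g h x := by
    simp only [LinearMap.sum_apply, LinearMap.smulRight_apply, LinearMap.smul_apply, smul_eq_mul]
    rw [res_sum]
    refine Finset.sum_congr rfl fun i _ => ?_
    rw [map_sum, Category.assoc, M.res_comp]
    congr 1
    refine Finset.sum_congr rfl fun j _ => ?_
    rw [Functional.app_res, map_mul, resFun_comp]

lemma IsBasis.endo_apply (k : T ⟶ N) (v : Fin d × Fin d → Fun T) {T' : Over S} (g : T' ⟶ T)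
    (j : Fin d) : (hb.endo k v).app g (M.res (g ≫ k) (b j)) =
      ∑ i, resFun g (v (i, j)) • M.res (g ≫ k) (b i) := by
  change (∑ i, (∑ j, resFun g (v (i, j)) • (hb.coord j).app (g ≫ k)).smulRight
    (M.res (g ≫ k) (b i))) _ = _
  simp only [LinearMap.sum_apply, LinearMap.smulRight_apply, LinearMap.smul_apply, smul_eq_mul,
    hb.coord_self]
  simp

lemma IsBasis.hom_ext (hb : M.IsBasis b) {V : Type*} [AddCommGroup V] [Module (Fun T) V] (k : T ⟶ N)
    {f f' : M.sec T →ₗ[Fun T] V} (h : ∀ i, f (M.res k (b i)) = f' (M.res k (b i))) : f = f' :=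
  (hb.comp_res k).basis.ext fun i => by simpa using h i

/-- The matrix of an endomorphism. -/
def IsBasis.mat (q : M.Endo T) (k : T ⟶ N) : Fin d × Fin d → Fun T := fun i =>
  (hb.coord i.1).app k (q.app (𝟙 T) (M.res k (b i.2)))

end Endo

section Equations

open Matrix

/-- The polynomial whose coefficients vanish for the matrices of projectors of rank `m`. -/
def projPoly {R : Type*} [CommRing R] {d : ℕ} (m : ℕ) (v : Fin d × Fin d → R) : Polynomial R :=
  (Matrix.of fun i j => v (i, j)).charpoly * Polynomial.X ^ m -
    (Polynomial.X - 1) ^ m * Polynomial.X ^ d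

lemma projPoly_map {R R' : Type*} [CommRing R] [CommRing R'] {d : ℕ} (m : ℕ)
    (v : Fin d × Fin d → R) (f : R →+* R') : projPoly m (fun i => f (v i)) = (projPoly m v).map f := by
  have : (Matrix.of fun i j => f (v (i, j))) = (Matrix.of fun i j => v (i, j)).map f := rfl
  rw [projPoly, projPoly, this, Matrix.charpoly_map]
  simp

/-- The equations for the matrices of self-adjoint projectors of rank `m`. -/
def projEqn {R : Type*} [CommRing R] {d : ℕ} (m : ℕ) (f : Fin d → Fin d → R)
    (v : Fin d × Fin d → R) : (Fin d × Fin d) ⊕ (Fin d × Fin d) ⊕ ℕ → R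
  | Sum.inl i => ∑ l, v (l, i.2) * v (i.1, l) - v i
  | Sum.inr (Sum.inl i) => ∑ l, v (l, i.1) * f l i.2 - ∑ l, v (l, i.2) * f i.1 l
  | Sum.inr (Sum.inr n) => (projPoly m v).coeff n

lemma projEqn_map {R R' : Type*} [CommRing R] [CommRing R'] {d : ℕ} (m : ℕ) (f : Fin d → Fin d → R)
    (v : Fin d × Fin d → R) (g : R →+* R') (i : (Fin d × Fin d) ⊕ (Fin d × Fin d) ⊕ ℕ) :
    projEqn m (fun i j => g (f i j)) (fun i => g (v i)) i = g (projEqn m f v i) := by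
  rcases i with i | i | n
  · simp [projEqn]
  · simp [projEqn]
  · simp [projEqn, projPoly_map]

end Equations

open SubSheaf

variable {d m : ℕ} {N T : Over S} {b : Fin d → M.sec N}

/-- The vanishing of a coefficient is local, and near each point `U` has a frame which is part of a
basis. Comparing the lengths of two bases over a non-zero ring gives `m + l = d`. -/
lemma projPoly_eq_zero (hb : M.IsBasis b) {U : M.SubSheaf T} (hU : U.IsSubbundle m) (p : M.Endo T)
    (hp : ∀ (N : Over S) (h : N ⟶ T) (x : M.sec N), p.app h x ∈ U.sec h)
    (hp' : ∀ (N : Over S) (h : N ⟶ T) (x : M.sec N), x ∈ U.sec h → p.app h x = x) (k : T ⟶ N) :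
    projPoly m (hb.mat p k) = 0 := by
  ext n
  rw [Polynomial.coeff_zero]
  refine fun_sep fun t => ?_
  obtain ⟨W, htW, -, l, c, hc, hu⟩ := hU.exists_frame t
  refine ⟨W, htW, ?_⟩
  let g := openIncl T W
  rw [map_zero, ← Polynomial.coeff_map, ← projPoly_map]
  have hmat : (Matrix.of fun i j => resFun g (hb.mat p k (i, j))) =
      LinearMap.toMatrix (hb.comp_res (g ≫ k)).basis (hb.comp_res (g ≫ k)).basis (p.app g) := by
    ext i j
    rw [LinearMap.toMatrix_apply, IsBasis.basis_apply, Matrix.of_apply, IsBasis.mat,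
      ← Functional.app_res, ← p.app_res, Category.comp_id, M.res_comp]
    rfl
  have hfree : Module.Free (Fun (openSub T W)) (M.sec (openSub T W)) := .of_basis hc.basis
  have hfin : Module.Finite (Fun (openSub T W)) (M.sec (openSub T W)) := .of_basis hc.basis
  have hnt : Nontrivial (Fun (openSub T W)) := by
    obtain ⟨h, -⟩ := exists_lift_pt W t htW
    have := (isField_fun_pt T t).nontrivial
    exact (resFun h).domain_nontrivial
  have hd : m + l = d := by
    have h1 := Module.finrank_eq_card_basis hc.basis
    have h2 := Module.finrank_eq_card_basis (hb.comp_res (g ≫ k)).basis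
    rw [h1] at h2
    simpa using h2
  rw [projPoly, hmat, LinearMap.charpoly_toMatrix, charpoly_proj hc.basis (p.app g), ← hd, pow_add]
  · rw [mul_assoc, mul_comm (Polynomial.X ^ l), sub_self, Polynomial.coeff_zero]
  · intro i
    rw [IsBasis.basis_apply]
    exact hp' _ _ _ (hu.mem i)
  · intro j
    have := hp _ g (hc.basis (Sum.inr j))
    rw [hu.span_self] at this
    simpa using this

/-- Both sides are equal to `φ(p x, p y)`. -/
lemma adjoint_of_proj {U : M.SubSheaf T} (p : M.Endo T)
    (hp : ∀ (N : Over S) (h : N ⟶ T) (x : M.sec N), p.app h x ∈ U.sec h)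
    (hpφ : ∀ (N : Over S) (h : N ⟶ T) (x v : M.sec N), v ∈ U.sec h →
        φ.form N (p.app h x) v = φ.form N x v) {N : Over S} (h : N ⟶ T) (x y : M.sec N) :
    φ.form N (p.app h x) y = φ.form N x (p.app h y) := by
  rw [φ.neg, ← hpφ _ _ y _ (hp N h x), ← φ.neg, hpφ _ _ x _ (hp N h y)]

/-- Quaternionic Grassmannian bundles are affine over the base. -/
theorem isAffineHom_hgr (hM : M.IsVectorBundle d) (hφ : φ.IsNondegenerate) {r : ℕ} {G : Over S}
    (e : (φ.hgr r).RepresentableBy G) : IsAffineHom G.hom := by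
  have hsub := taut_isSubbundle e
  have hsymp : (taut e).IsSymplectic φ := (e.homEquiv (𝟙 G)).2.2
  have hloc := hsub.isLocSymp hsymp
  obtain ⟨p, hp, hp', hpφ⟩ := hloc.exists_proj hM.isSheaf
  have hmem : ∀ {T : Over S} (h : T ⟶ G) (x : M.sec T), x ∈ (taut e).sec h ↔ p.app h x = x :=
    fun h x => ⟨hp' _ _ _, fun hx => hx ▸ hp _ _ _⟩
  refine isAffineHom_of_local G fun s => ?_
  obtain ⟨W, hsW, b, hb⟩ := hM.exists_basis (base S) s
  -- The coordinates of a symplectic subbundle are the matrix entries of its orthogonal projector in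
  -- the basis `b`.
  let a : ∀ {T : Over S}, (T ⟶ G) → (T ⟶ openSub (base S) W) → Fin d × Fin d → Fun T :=
    fun {T} h k i => (hb.coord i.1).app k (p.app h (M.res k (b i.2)))
  have hcol : ∀ {T : Over S} (h : T ⟶ G) (k : T ⟶ openSub (base S) W) (j : Fin d),
      p.app h (M.res k (b j)) = ∑ i, a h k (i, j) • M.res k (b i) := fun h k j =>
    (hb.sum_coord k _).symm
  have hnat : ∀ {T' T : Over S} (g : T' ⟶ T) (h : T ⟶ G) (k : T ⟶ openSub (base S) W)
      (i : Fin d × Fin d), a (g ≫ h) (g ≫ k) i = resFun g (a h k i) := fun g h k i => by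
    change (hb.coord i.1).app (g ≫ k) (p.app (g ≫ h) (M.res (g ≫ k) (b i.2))) = _
    rw [M.res_comp, p.app_res, Functional.app_res]
  refine ⟨W, hsW, _, _, a, fun {T} k v =>
    projEqn (2 * r) (fun i j => φ.form T (M.res k (b i)) (M.res k (b j))) v, hnat, ?_, ?_, ?_⟩
  · intro T' T g k v i
    dsimp only
    rw [← projEqn_map]
    simp only [M.res_comp, φ.res_form]
  · intro T h h' k hh
    refine hom_ext_of_classified e ?_
    rw [classified_eq_pull, classified_eq_pull]
    ext T' g x
    change x ∈ (taut e).sec (g ≫ h) ↔ x ∈ (taut e).sec (g ≫ h')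
    have : p.app (g ≫ h) = p.app (g ≫ h') := hb.hom_ext (g ≫ k) fun j => by
      rw [hcol, hcol]
      simp only [hnat, hh]
    rw [hmem, hmem, this]
  · intro T k v
    constructor
    · rintro ⟨h, rfl⟩ i
      rcases i with ⟨i, j⟩ | ⟨i, j⟩ | n
      · have h1 := congrArg ((hb.coord i).app k) (hp' _ _ _ (hp _ h (M.res k (b j))))
        conv_lhs at h1 => rw [hcol, map_sum, map_sum]
        simp only [map_smul, smul_eq_mul] at h1
        exact sub_eq_zero.2 h1
      · have h1 := adjoint_of_proj p hp hpφ h (M.res k (b i)) (M.res k (b j))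
        rw [hcol, hcol, map_sum, map_sum, LinearMap.sum_apply] at h1
        simp only [map_smul, smul_eq_mul, LinearMap.smul_apply] at h1
        exact sub_eq_zero.2 h1
      · have h1 := projPoly_eq_zero hb (hsub.pull h) ⟨fun g => p.app (g ≫ h), fun g g' x => by
          rw [Category.assoc, p.app_res]⟩ (fun N g => hp N (g ≫ h)) (fun N g => hp' N (g ≫ h)) k
        have h2 : hb.mat (⟨fun g => p.app (g ≫ h), fun g g' x => by
          rw [Category.assoc, p.app_res]⟩ : M.Endo T) k = a h k := by
          funext i
          change (hb.coord i.1).app k (p.app (𝟙 T ≫ h) (M.res k (b i.2))) = _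
          rw [Category.id_comp]
        rw [h2] at h1
        change (projPoly _ _).coeff n = 0
        rw [h1, Polynomial.coeff_zero]
    · intro heq
      have heq' : ∀ {T' : Over S} (g : T' ⟶ T), ∀ i, projEqn (2 * r)
          (fun i j => φ.form T' (M.res (g ≫ k) (b i)) (M.res (g ≫ k) (b j)))
          (fun i => resFun g (v i)) i = 0 := fun g i => by
        have h1 := congrArg (resFun g) (heq i)
        dsimp only at h1
        rw [← projEqn_map, map_zero] at h1
        simpa only [M.res_comp, φ.res_form] using h1
      -- Conversely, a solution of the equations defines a self-adjoint idempotent `q`. The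
      -- characteristic polynomial gives its fixed subsheaf rank `2 * r` at every point, so this is
      -- a symplectic subbundle, and by uniqueness `q` is its orthogonal projector.
      let q := hb.endo k v
      have hq : ∀ {T' : Over S} (g : T' ⟶ T) (j : Fin d), q.app g (M.res (g ≫ k) (b j)) =
          ∑ i, resFun g (v (i, j)) • M.res (g ≫ k) (b i) := fun g j => hb.endo_apply k v g j
      have hqq : ∀ {T' : Over S} (g : T' ⟶ T) (x : M.sec T'), q.app g (q.app g x) = q.app g x := by
        intro T' g x
        have : q.app g ∘ₗ q.app g = q.app g := hb.hom_ext (g ≫ k) fun j => by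
          rw [LinearMap.comp_apply, hq, map_sum]
          simp only [map_smul, hq, Finset.smul_sum, smul_smul]
          rw [Finset.sum_comm]
          refine Finset.sum_congr rfl fun i _ => ?_
          rw [← Finset.sum_smul]
          congr 1
          exact sub_eq_zero.1 (heq' g (Sum.inl (i, j)))
        exact LinearMap.congr_fun this x
      have hqadj : ∀ {T' : Over S} (g : T' ⟶ T) (x y : M.sec T'),
          φ.form T' (q.app g x) y = φ.form T' x (q.app g y) := by
        intro T' g x y
        have : (φ.form T').comp (q.app g) = (φ.form T').compl₂ (q.app g) :=
          hb.hom_ext (g ≫ k) fun i => hb.hom_ext (g ≫ k) fun j => by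
            rw [LinearMap.comp_apply, LinearMap.compl₂_apply, hq, hq, map_sum, map_sum,
              LinearMap.sum_apply]
            simp only [map_smul, smul_eq_mul, LinearMap.smul_apply]
            exact sub_eq_zero.1 (heq' g (Sum.inr (Sum.inl (i, j))))
        exact LinearMap.congr_fun₂ this x y
      let U := fixed hM.isSheaf q
      have hU1 : ∀ (N : Over S) (g : N ⟶ T) (x : M.sec N), q.app g x ∈ U.sec g := fun N g x =>
        (mem_fixed hM.isSheaf q g _).2 (hqq g x)
      have hU2 : ∀ (N : Over S) (g : N ⟶ T) (x : M.sec N), x ∈ U.sec g → q.app g x = x :=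
        fun N g x hx => (mem_fixed hM.isSheaf q g _).1 hx
      have hUs : U.IsSubbundle (2 * r) := by
        refine isSubbundle_of_proj hM q hU1 hU2 fun t => ?_
        let g := ptIncl T t
        refine finrank_of_charpoly (isField_fun_pt T t) (hb.comp_res (g ≫ k)).basis _ (q.app g)
          (hU1 _ _) (hU2 _ _) ?_
        have hmat : LinearMap.toMatrix (hb.comp_res (g ≫ k)).basis (hb.comp_res (g ≫ k)).basis
            (q.app g) = Matrix.of fun i j => resFun g (v (i, j)) := by
          ext i j
          rw [LinearMap.toMatrix_apply, IsBasis.basis_apply, Matrix.of_apply, hq]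
          have : (∑ i, resFun g (v (i, j)) • M.res (g ≫ k) (b i)) =
              ∑ i, resFun g (v (i, j)) • (hb.comp_res (g ≫ k)).basis i := by simp
          rw [this, Module.Basis.repr_sum_self]
        rw [hmat, ← sub_eq_zero]
        ext n
        exact heq' g (Sum.inr (Sum.inr n))
      have hUφ : U.IsSymplectic φ := isSymplectic_of_proj hφ q hU1 hU2 fun N g x w hw => by
        rw [hqadj, hU2 _ _ _ hw]
      let h := e.homEquiv.symm ⟨U, hUs, hUφ⟩
      have hh : (taut e).pull h = U := by
        rw [← classified_eq_pull]
        exact congrArg Subtype.val (e.homEquiv.apply_symm_apply _)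
      have hh' : ∀ {N : Over S} (g : N ⟶ T), (taut e).sec (g ≫ h) = U.sec g := fun g =>
        congrArg (fun V => V.sec g) hh
      have hpq : ∀ x, p.app h x = q.app (𝟙 T) x := by
        intro x
        refine hloc.ext hM.isSheaf (hp _ _ _) ?_ fun N g w hw => ?_
        · have := hh' (𝟙 T)
          rw [Category.id_comp] at this
          rw [this]
          exact hU1 _ _ _
        · rw [← p.app_res, ← q.app_res, hpφ _ _ _ _ hw, Category.comp_id, hqadj]
          rw [hh'] at hw
          rw [hU2 _ _ _ hw]
      refine ⟨h, funext fun ⟨i, j⟩ => ?_⟩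
      change (hb.coord i).app k (p.app h (M.res k (b j))) = v (i, j)
      have h1 := hq (𝟙 T) j
      rw [Category.id_comp] at h1
      rw [hpq, h1, map_sum]
      simp [hb.coord_self, resFun_id]

end BigModule

section Membership

variable {k : Scheme.{u}} {𝒱 : ObjectProperty (Over k)}

/-- An isomorphism is an open immersion, so the condition on quasi-compact open subschemes covers
it. -/
lemma IsAdmissible.of_iso (h𝒱 : IsAdmissible 𝒱) {X Y : Over k} (hX : 𝒱 X) (i : Y ≅ X) : 𝒱 Y := by
  have h1 : IsIso i.hom.left := inferInstanceAs (IsIso ((Over.forget k).map i.hom))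
  have := h𝒱.compactSpace X hX
  refine h𝒱.opens X Y i.hom hX inferInstance ?_
  exact (Scheme.homeoOfIso (asIso i.hom.left)).symm.compactSpace

lemma compactSpace_of_isAffineHom {X Y : Scheme.{u}} (f : X ⟶ Y) [IsAffineHom f] [CompactSpace Y] :
    CompactSpace X :=
  QuasiCompact.compactSpace_of_compactSpace f

/-- Quaternionic Grassmannian bundles over schemes in `𝒱` are in `𝒱`. -/
theorem IsAdmissible.hgr_mem (h𝒱 : IsAdmissible 𝒱) {S : Over k} (hS : 𝒱 S) {M : BigModule S.left}
    {d : ℕ} (hM : M.IsVectorBundle d) {φ : M.AltForm} (hφ : φ.IsNondegenerate) {r : ℕ}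
    {G : Over S.left} (e : (φ.hgr r).RepresentableBy G) : 𝒱 (toBase S G) := by
  obtain ⟨G₀, e₀, O, ⟨e'⟩⟩ := exists_hgr_openSub hM hφ r
  have hG := isAffineHom_hgr hM hφ e
  let i : G ≅ openSub G₀ O := e.uniqueUpToIso e'
  have hi : IsIso i.hom.left := inferInstanceAs (IsIso ((Over.forget _).map i.hom))
  have hc := h𝒱.compactSpace S hS
  refine h𝒱.grassmannian S hS M d (2 * r) hM G₀ ⟨e₀⟩ G (i.hom ≫ openIncl G₀ O) ?_
    (compactSpace_of_isAffineHom G.hom) hG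
  rw [Over.comp_left]
  infer_instance

end Membership

end QuatGrass

namespace QuatGrass

/-! ### Affine bundles of sections of a subbundle -/

namespace BigModule

section Line

variable {S : Scheme.{u}} {M : BigModule S} {d : ℕ} {T : Over S}

/-- Locally `x` and `v` are multiples of one generator of `L`, and `f v = 1` makes `f x` the factor
between them. -/
lemma mem_line_iff (hM : Presieve.IsSheaf (Scheme.zariskiTopology.over S) M.toFunctor)
    {L : M.SubSheaf T} (hL : L.IsSubbundle 1) (f : M.Functional T) {v : M.sec T}
    (hv : v ∈ L.sec (𝟙 T)) (hf : f.app (𝟙 T) v = 1) {N : Over S} (h : N ⟶ T) (x : M.sec N) :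
    x ∈ L.sec h ↔ x = f.app h x • M.res h v := by
  have hv' : ∀ {N : Over S} (h : N ⟶ T), M.res h v ∈ L.sec h := fun h => by
    have := L.res_mem h _ _ hv
    rwa [Category.comp_id] at this
  have hf' : ∀ {N : Over S} (h : N ⟶ T), f.app h (M.res h v) = 1 := fun h => by
    have := f.app_res h (𝟙 T) v
    rwa [Category.comp_id, hf, map_one] at this
  constructor
  · intro hx
    refine sep hM fun t => ?_
    obtain ⟨W, htW, -, l, b, -, hu⟩ := (hL.pull h).exists_frame t
    refine ⟨W, htW, ?_⟩
    let j := openIncl N W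
    have h1 : ∀ y, y ∈ L.sec (j ≫ h) → ∃ c, y = c • b (Sum.inl 0) := fun y hy => by
      have : (L.pull h).sec j = _ := hu.span_self
      change y ∈ (L.pull h).sec j at hy
      rw [this, Set.range_unique, Submodule.mem_span_singleton] at hy
      obtain ⟨c, hc⟩ := hy
      exact ⟨c, hc.symm⟩
    obtain ⟨c, hc⟩ := h1 _ (L.res_mem j h x hx)
    obtain ⟨c', hc'⟩ := h1 _ (hv' (j ≫ h))
    have h2 := hf' (j ≫ h)
    rw [hc', map_smul, smul_eq_mul] at h2
    rw [M.res_smul, ← f.app_res, ← M.res_comp, hc, hc', map_smul, smul_smul, smul_eq_mul, mul_assoc,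
      mul_comm _ c', h2, mul_one]
  · intro hx
    rw [hx]
    exact Submodule.smul_mem _ _ (hv' h)

/-- The projector onto the line spanned by a section `v` with `f v = 1`. -/
def lineEndo (f : M.Functional T) (v : M.sec T) : M.Endo T where
  app h := (f.app h).smulRight (M.res h v)
  app_res g h x := by
    rw [LinearMap.smulRight_apply, LinearMap.smulRight_apply, M.res_smul, f.app_res, M.res_comp]

/-- The line spanned by a section on which a functional takes the value one. -/
lemma exists_line (hM : M.IsVectorBundle d) (f : M.Functional T) {v : M.sec T}
    (hf : f.app (𝟙 T) v = 1) : ∃ L : M.SubSheaf T, L.IsSubbundle 1 ∧ v ∈ L.sec (𝟙 T) := by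
  have hf' : ∀ {N : Over S} (h : N ⟶ T), f.app h (M.res h v) = 1 := fun h => by
    have := f.app_res h (𝟙 T) v
    rwa [Category.comp_id, hf, map_one] at this
  let L := SubSheaf.fixed hM.isSheaf (lineEndo f v)
  have hL : ∀ {N : Over S} (h : N ⟶ T) (x : M.sec N), x ∈ L.sec h ↔ f.app h x • M.res h v = x :=
    fun h x => SubSheaf.mem_fixed hM.isSheaf _ h x
  have hv : ∀ {N : Over S} (h : N ⟶ T), M.res h v ∈ L.sec h := fun h => by
    rw [hL, hf', one_smul]
  refine ⟨L, SubSheaf.isSubbundle_of_proj hM (lineEndo f v) (fun N h x => ?_)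
    (fun N h x hx => (SubSheaf.mem_fixed hM.isSheaf _ h x).1 hx) fun t => ?_, ?_⟩
  · exact Submodule.smul_mem _ _ (hv h)
  · have hfr : L.IsFrame (𝟙 T) fun _ : Fin 1 => v := by
      refine ⟨fun T' h => ?_, fun T' h => ?_⟩
      · rw [Fintype.linearIndependent_iff]
        intro g hg i
        have h1 := congrArg (f.app h) hg
        rw [Fin.sum_univ_one, map_smul, hf', map_zero, smul_eq_mul, mul_one] at h1
        rwa [Subsingleton.elim i 0]
      · rw [Category.comp_id, Set.range_const]
        ext x
        rw [hL, Submodule.mem_span_singleton]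
        refine ⟨fun h1 => ⟨_, h1⟩, ?_⟩
        rintro ⟨c, rfl⟩
        rw [map_smul, hf', smul_eq_mul, mul_one]
    have hn : Nontrivial (Fun (pt T t)) := (isField_fun_pt T t).nontrivial
    have := hfr.comp_res (ptIncl T t)
    rw [Category.comp_id] at this
    rw [Module.finrank_eq_card_basis this.basis, Fintype.card_fin]
  · have := hv (𝟙 T)
    rwa [M.res_id] at this

/-- The scheme of the sections of a vector bundle on which a functional takes the value one. -/
theorem exists_unitSections (hM : M.IsVectorBundle d) (f : M.Functional (base S)) :
    ∃ (P G : Over S) (j : P ⟶ G) (w : M.sec P), Nonempty ((M.grassmannian 1).RepresentableBy G) ∧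
      IsOpenImmersion j.left ∧ IsAffineHom P.hom ∧ f.app (toTerminal P) w = 1 ∧
      ∀ (T : Over S) (v : M.sec T), f.app (toTerminal T) v = 1 → ∃! h : T ⟶ P, M.res h w = v := by
  obtain ⟨G, ⟨e⟩⟩ := hM.exists_grassmannian 1
  let L := (e.homEquiv (𝟙 G)).1
  have hL : L.IsSubbundle 1 := (e.homEquiv (𝟙 G)).2
  have hcl : ∀ {T : Over S} (g : T ⟶ G), (e.homEquiv g).1 = L.pull g := fun g => by
    have := congrArg Subtype.val (e.homEquiv_comp g (𝟙 G))
    rwa [Category.comp_id] at this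
  have hfres : ∀ {T' T : Over S} (g : T' ⟶ T) (x : M.sec T),
      f.app (toTerminal T') (M.res g x) = resFun g (f.app (toTerminal T) x) := fun g x => by
    rw [← f.app_res, subsingleton_hom_base (g ≫ toTerminal _)]
  have hline : ∀ {T : Over S} (g : T ⟶ G) (v : M.sec T), v ∈ L.sec g →
      f.app (toTerminal T) v = 1 → ∀ {N : Over S} (h : N ⟶ T) (x : M.sec N),
      x ∈ L.sec (h ≫ g) ↔ x = f.app (toTerminal N) x • M.res h v := by
    intro T g v hv hfv N h x
    have := mem_line_iff hM.isSheaf (hL.pull g) (f.pull (toTerminal T)) (v := v)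
      (by change v ∈ L.sec (𝟙 T ≫ g); rwa [Category.id_comp])
      (by change f.app (𝟙 T ≫ toTerminal T) v = 1; rwa [Category.id_comp]) h x
    change x ∈ L.sec (h ≫ g) ↔ x = f.app (h ≫ toTerminal T) x • M.res h v at this
    rwa [subsingleton_hom_base (h ≫ toTerminal T) (toTerminal N)] at this
  have huniq : ∀ {T : Over S} (g : T ⟶ G) (v v' : M.sec T), v ∈ L.sec g →
      f.app (toTerminal T) v = 1 → v' ∈ L.sec g → f.app (toTerminal T) v' = 1 → v' = v := by
    intro T g v v' hv hfv hv' hfv'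
    have := (hline g v hv hfv (𝟙 T) v').1 (by rwa [Category.id_comp])
    rwa [hfv', one_smul, M.res_id] at this
  -- A section with value one is the same as the line it spans together with the fact that `f` is an
  -- isomorphism on this line. The scheme sought is thus the open locus in the bundle of lines where
  -- `f` generates.
  obtain ⟨O, hO⟩ := exists_open_locus (T := G)
    (fun {T} g => ∃ v ∈ L.sec g, f.app (toTerminal T) v = 1)
    (fun g h ⟨v, hv, hfv⟩ => ⟨M.res g v, L.res_mem g h v hv, by rw [hfres, hfv, map_one]⟩)
    (fun {T} h hh => by
      obtain ⟨x, hx⟩ := glue_of_unique (T := T) hM.isSheaf (fun {N} (g : N ⟶ T) x =>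
        x ∈ L.sec (g ≫ h) ∧ f.app (toTerminal N) x = 1)
        (fun g g' x hx => ⟨by
          have := L.res_mem g _ _ hx.1
          rwa [← Category.assoc] at this, by rw [hfres, hx.2, map_one]⟩)
        (fun g x y hx hy => huniq (g ≫ h) _ _ hy.1 hy.2 hx.1 hx.2) hh
      refine ⟨x, L.local_mem _ _ fun t => ?_, fun_sep fun t => ?_⟩
      · obtain ⟨W, htW, hW⟩ := hx t
        exact ⟨W, htW, hW.1⟩
      · obtain ⟨W, htW, hW⟩ := hx t
        exact ⟨W, htW, by rw [← hfres, hW.2, map_one]⟩)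
    (fun t => by
      obtain ⟨W, htW, -, l, b, -, hu⟩ := hL.exists_frame t
      refine ⟨W, htW, _, fun T h => Iff.trans ?_
        (isUnit_resFun_iff h (f.app (toTerminal _) (b (Sum.inl 0))))⟩
      rw [hu.span, Set.range_unique, ← hfres]
      constructor
      · rintro ⟨v, hv, hfv⟩
        rw [Submodule.mem_span_singleton] at hv
        obtain ⟨c, rfl⟩ := hv
        rw [map_smul, smul_eq_mul] at hfv
        exact IsUnit.of_mul_eq_one_right _ hfv
      · intro hunit
        obtain ⟨c, hc⟩ := hunit.exists_left_inv
        refine ⟨c • M.res h (b (Sum.inl 0)),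
          Submodule.smul_mem _ _ (Submodule.mem_span_singleton_self _), ?_⟩
        rw [map_smul, smul_eq_mul, hc])
  obtain ⟨w, hw, hfw⟩ := (hO _ (openIncl G O)).2 fun t => by
    have := openIncl_mem (𝟙 (openSub G O)) t
    rwa [Category.id_comp] at this
  have huniv : ∀ (T : Over S) (v : M.sec T), f.app (toTerminal T) v = 1 →
      ∃! h : T ⟶ openSub G O, M.res h w = v := by
    intro T v hv
    obtain ⟨L', hL', hvL'⟩ := exists_line hM (f.pull (toTerminal T)) (v := v) (by
      change f.app (𝟙 T ≫ toTerminal T) v = 1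
      rwa [Category.id_comp])
    let g := e.homEquiv.symm ⟨L', hL'⟩
    have hg : L.pull g = L' := by
      rw [← hcl]
      exact congrArg Subtype.val (e.homEquiv.apply_symm_apply _)
    have hvg : v ∈ L.sec g := by
      rw [← hg] at hvL'
      change v ∈ L.sec (𝟙 T ≫ g) at hvL'
      rwa [Category.id_comp] at hvL'
    obtain ⟨h, hh⟩ := exists_lift_openSub O g ((hO _ g).1 ⟨v, hvg, hv⟩)
    refine ⟨h, huniq g _ _ hvg hv ?_ (by rw [hfres, hfw, map_one]), ?_⟩
    · rw [← hh]
      exact L.res_mem _ _ _ hw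
    · rintro h' rfl
      refine (cancel_mono (openIncl G O)).1 (e.homEquiv.injective (Subtype.ext ?_))
      rw [hcl, hcl]
      ext N a x
      change x ∈ L.sec (a ≫ h' ≫ openIncl G O) ↔ x ∈ L.sec (a ≫ h ≫ openIncl G O)
      rw [hline (h' ≫ openIncl G O) _ (L.res_mem _ _ _ hw) (by rw [hfres, hfw, map_one]) a x, hh,
        hline g _ hvg hv]
  refine ⟨openSub G O, G, openIncl G O, w, ⟨e⟩, inferInstance,
    isAffineHom_of_local _ fun s => ?_, hfw, huniv⟩
  -- In local coordinates the condition `f w = 1` is a single linear equation, whence affineness.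
  obtain ⟨W, hsW, b, hb⟩ := hM.exists_basis (base S) s
  have hfsum : ∀ {T : Over S} (k : T ⟶ openSub (base S) W) (x : M.sec T),
      f.app (toTerminal T) x =
        ∑ i, (hb.coord i).app k x * f.app (toTerminal T) (M.res k (b i)) := by
    intro T k x
    conv_lhs => rw [← hb.sum_coord k x, map_sum]
    simp only [map_smul, smul_eq_mul]
  refine ⟨W, hsW, Fin d, Fin 1, fun {T} h k i => (hb.coord i).app k (M.res h w),
    fun {T} k v _ => ∑ i, v i * f.app (toTerminal T) (M.res k (b i)) - 1, ?_, ?_, ?_, ?_⟩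
  · intro T' T g h k i
    dsimp only
    rw [M.res_comp, Functional.app_res]
  · intro T' T g k v i
    dsimp only
    rw [map_sub, map_one, map_sum]
    simp only [map_mul, M.res_comp, hfres]
  · intro T h h' k hh
    refine (huniv T (M.res h' w) (by rw [hfres, hfw, map_one])).unique ?_ rfl
    rw [← hb.sum_coord k (M.res h w), ← hb.sum_coord k (M.res h' w)]
    exact Finset.sum_congr rfl fun i _ => by
      have := congrFun hh i
      dsimp only at this
      rw [this]
  · intro T k v
    constructor
    · rintro ⟨h, rfl⟩ i
      dsimp only
      rw [← hfsum, hfres, hfw, map_one, sub_self]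
    · intro h0
      let x := ∑ i, v i • M.res k (b i)
      have hx : ∀ i, (hb.coord i).app k x = v i := fun i => by
        simp only [x, map_sum, map_smul, hb.coord_self]
        simp
      obtain ⟨h, hh, -⟩ := huniv T x (by
        rw [hfsum k]
        simp only [hx]
        exact sub_eq_zero.1 (h0 0))
      exact ⟨h, funext fun i => by dsimp only; rw [hh, hx]⟩

end Line

section AsBundle

variable {S : Scheme.{u}} {M : BigModule S} {G : Over S}

/-- A `G`-scheme, as an `S`-scheme. -/
abbrev restrictBase (G : Over S) (X : Over G.left) : Over S := (Over.map G.hom).obj X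

/-- The structure morphism of a `G`-scheme, as a morphism of `S`-schemes. -/
abbrev restrictBaseHom (G : Over S) (X : Over G.left) : restrictBase G X ⟶ G := Over.homMk X.hom

lemma map_restrictBaseHom {X' X : Over G.left} (h : X' ⟶ X) :
    (Over.map G.hom).map h ≫ restrictBaseHom G X = restrictBaseHom G X' := by
  ext1
  exact Over.w h

/-- A subsheaf of the pullback of `M` to `G`, as a presheaf of modules on `G`-schemes. -/
def SubSheaf.asBundle (U : M.SubSheaf G) : BigModule G.left where
  sec X := U.sec (restrictBaseHom G X)
  addCommGroup X := inferInstanceAs (AddCommGroup (U.sec (restrictBaseHom G X)))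
  module X := inferInstanceAs (Module (Fun (restrictBase G X)) (U.sec (restrictBaseHom G X)))
  res {X' X} h :=
    { toFun := fun x => ⟨M.res ((Over.map G.hom).map h) x.1, by
        have := U.res_mem ((Over.map G.hom).map h) _ _ x.2
        rwa [map_restrictBaseHom] at this⟩
      map_zero' := Subtype.ext (map_zero _)
      map_add' := fun x y => Subtype.ext (map_add _ _ _) }
  res_smul h a x := Subtype.ext (M.res_smul _ _ _)
  res_id x := Subtype.ext (by
    change M.res ((Over.map G.hom).map (𝟙 _)) x.1 = x.1
    rw [(Over.map G.hom).map_id, M.res_id])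
  res_comp g h x := Subtype.ext (by
    change M.res ((Over.map G.hom).map (g ≫ h)) x.1 = _
    rw [(Over.map G.hom).map_comp, M.res_comp]
    rfl)

/-- Sections glue in `M`, and the glued section lies in `U` because membership is local; local
frames of `U` are the bases. In this way the conditions on `𝒱`, which speak of bundles over a
scheme, apply to subbundles over `G`. -/
lemma SubSheaf.isVectorBundle_asBundle
    (hM : Presieve.IsSheaf (Scheme.zariskiTopology.over S) M.toFunctor) {U : M.SubSheaf G} {m : ℕ}
    (hU : U.IsSubbundle m) : U.asBundle.IsVectorBundle m := by
  have hM' : Presieve.IsSheaf (Scheme.zariskiTopology.over G.left)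
      ((Over.map G.hom).op ⋙ M.toFunctor) :=
    Functor.op_comp_isSheaf_of_types (J := Scheme.zariskiTopology.over G.left)
      (K := Scheme.zariskiTopology.over S) (Over.map G.hom)
      ⟨_, (isSheaf_iff_isSheaf_of_type _ _).2 hM⟩
  refine ⟨isSheaf_of_glue (fun X W hW x hx => ?_) fun X x y h => ?_, fun t => ?_⟩
  · obtain ⟨y, hy, -⟩ := sheaf_glue hM' X W hW (fun t => (x t).1) fun t t' X' a b hab =>
      congrArg Subtype.val (hx t t' X' a b hab)
    refine ⟨⟨y, U.local_mem _ _ fun t => ⟨W t, hW t, ?_⟩⟩, fun t => Subtype.ext (hy t)⟩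
    -- An open subscheme of a `G`-scheme becomes an `S`-scheme in two ways, whose structure
    -- morphisms differ by associativity only.
    let i : openSub (restrictBase G X) (W t) ⟶ restrictBase G (openSub X (W t)) :=
      Over.homMk (𝟙 _) (by
        change 𝟙 _ ≫ (((W t).ι ≫ X.hom) ≫ G.hom) = (W t).ι ≫ X.hom ≫ G.hom
        rw [Category.id_comp, Category.assoc])
    have hi : i ≫ (Over.map G.hom).map (openIncl X (W t)) =
        openIncl (restrictBase G X) (W t) := by
      ext1
      exact Category.id_comp _
    have h0 : i ≫ restrictBaseHom G (openSub X (W t)) =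
        openIncl (restrictBase G X) (W t) ≫ restrictBaseHom G X := by
      rw [← map_restrictBaseHom (openIncl X (W t)), reassoc_of% hi]
    have h1 := U.res_mem i _ _ (x t).2
    rw [h0] at h1
    have h3 : M.res ((Over.map G.hom).map (openIncl X (W t))) y = (x t).1 := hy t
    have h2 := M.res_comp i ((Over.map G.hom).map (openIncl X (W t))) y
    rw [hi, h3] at h2
    exact h2.symm ▸ h1
  · refine Subtype.ext (sheaf_sep hM' fun t => ?_)
    obtain ⟨W, hW, h1⟩ := h t
    exact ⟨W, hW, congrArg Subtype.val h1⟩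
  · obtain ⟨W, htW, -, l, b, -, hu⟩ := hU.exists_frame t
    refine ⟨W, htW, fun i => ⟨b (Sum.inl i), hu.mem i⟩, ?_⟩
    have hfr : ∀ (X : Over G.left) (h : X ⟶ Over.mk W.ι), U.IsFrame (restrictBaseHom G X)
        fun i => M.res ((Over.map G.hom).map h) (b (Sum.inl i)) := fun X h => by
      have h1 := hu.comp_res ((Over.map G.hom).map h)
      have h2 : (Over.map G.hom).map h ≫ openIncl G W = restrictBaseHom G X :=
        map_restrictBaseHom h
      rwa [h2] at h1
    exact isBasis_of_basis (fun X h => (hfr X h).basis) fun X h i =>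
      Subtype.ext ((hfr X h).basis_apply i)

/-- The affine bundle of the sections of a subbundle on which a functional takes the value one. -/
theorem SubSheaf.IsSubbundle.exists_unitSections
    (hM : Presieve.IsSheaf (Scheme.zariskiTopology.over S) M.toFunctor) {U : M.SubSheaf G} {m : ℕ}
    (hU : U.IsSubbundle m) (f : M.Functional G) :
    ∃ (P : Over G.left) (B : BigModule G.left) (_ : B.IsVectorBundle m) (Γ : Over G.left)
      (j : P ⟶ Γ) (w : M.sec (restrictBase G P)), Nonempty ((B.grassmannian 1).RepresentableBy Γ) ∧
      IsOpenImmersion j.left ∧ IsAffineHom P.hom ∧ w ∈ U.sec (restrictBaseHom G P) ∧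
      f.app (restrictBaseHom G P) w = 1 ∧
      ∀ (T : Over S) (g : T ⟶ G) (v : M.sec T), v ∈ U.sec g → f.app g v = 1 →
        ∃! h : T ⟶ restrictBase G P, h ≫ restrictBaseHom G P = g ∧ M.res h w = v := by
  have hB := SubSheaf.isVectorBundle_asBundle hM hU
  let f' : U.asBundle.Functional (base G.left) :=
    { app := fun {X} _ => (f.app (restrictBaseHom G X)).comp (U.sec (restrictBaseHom G X)).subtype
      app_res := fun {X' X} g _ x => by
        have := f.app_res ((Over.map G.hom).map g) (restrictBaseHom G X) x.1
        rw [map_restrictBaseHom] at this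
        exact this }
  obtain ⟨P, Γ, j, w, he, hj, haff, hw, huniv⟩ := BigModule.exists_unitSections hB f'
  refine ⟨P, _, hB, Γ, j, w.1, he, hj, haff, w.2, hw, fun T g v hv hfv => ?_⟩
  let X : Over G.left := Over.mk g.left
  -- `T` and `restrictBase G X` have the same underlying scheme. The identities `i` and `i'` pass
  -- between the given structure morphism and the one factored through `g`.
  let i : T ⟶ restrictBase G X := Over.homMk (𝟙 _) ((Category.id_comp _).trans (Over.w g))
  let i' : restrictBase G X ⟶ T := Over.homMk (𝟙 _) ((Category.id_comp _).trans (Over.w g).symm)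
  have hi : i ≫ restrictBaseHom G X = g := by
    ext1
    exact Category.id_comp _
  have hi' : i' ≫ g = restrictBaseHom G X := by
    ext1
    exact Category.id_comp _
  have hii : i ≫ i' = 𝟙 T := by
    ext1
    exact Category.id_comp _
  have hv' := U.res_mem i' g v hv
  rw [hi'] at hv'
  have hfv' := f.app_res i' g v
  rw [hi', hfv, map_one] at hfv'
  obtain ⟨h, hh, hu⟩ := huniv X ⟨_, hv'⟩ hfv'
  have hh' : M.res ((Over.map G.hom).map h) w.1 = M.res i' v := congrArg Subtype.val hh
  refine ⟨i ≫ (Over.map G.hom).map h, ⟨?_, ?_⟩, ?_⟩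
  · rw [Category.assoc, map_restrictBaseHom, hi]
  · rw [M.res_comp, hh', ← M.res_comp, hii, M.res_id]
  · rintro h₂ ⟨h2, h3⟩
    let h₂' : X ⟶ P := Over.homMk h₂.left (congrArg CommaMorphism.left h2)
    have h4 : (Over.map G.hom).map h₂' = i' ≫ h₂ := by
      ext1
      exact (Category.id_comp _).symm
    have h5 : h₂' = h := hu h₂' (Subtype.ext (by
      change M.res ((Over.map G.hom).map h₂') w.1 = M.res i' v
      rw [h4, M.res_comp, h3]))
    ext1
    exact (congrArg CommaMorphism.left h5).trans (Category.id_comp _).symm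

end AsBundle

end BigModule

/-- The affine bundle of the sections of a subbundle on which a functional takes the value one is
in `𝒱` if its base is. -/
theorem IsAdmissible.exists_unitSections {k : Scheme.{u}} {𝒱 : ObjectProperty (Over k)}
    (h𝒱 : IsAdmissible 𝒱) {S : Over k} {M : BigModule S.left}
    (hM : Presieve.IsSheaf (Scheme.zariskiTopology.over S.left) M.toFunctor) {G : Over S.left}
    {U : M.SubSheaf G} {m : ℕ} (hU : U.IsSubbundle m) (f : M.Functional G) :
    ∃ (P : Over S.left) (π : P ⟶ G) (w : M.sec P), w ∈ U.sec π ∧ f.app π w = 1 ∧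
      (∀ (T : Over S.left) (g : T ⟶ G) (v : M.sec T), v ∈ U.sec g → f.app g v = 1 →
        ∃! h : T ⟶ P, h ≫ π = g ∧ M.res h w = v) ∧ IsAffineHom π.left ∧
      (𝒱 (toBase S G) → 𝒱 (toBase S P)) := by
  obtain ⟨P, B, hB, Γ, j, w, he, hj, haff, hw, hfw, huniv⟩ := hU.exists_unitSections hM f
  refine ⟨restrictBase G P, restrictBaseHom G P, w, hw, hfw, huniv, haff, fun hG => ?_⟩
  have hc : CompactSpace G.left := h𝒱.compactSpace _ hG
  have h1 := h𝒱.grassmannian (toBase S G) hG B m 1 hB Γ he P j hj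
    (compactSpace_of_isAffineHom P.hom) haff
  refine h𝒱.of_iso h1 (Over.isoMk (Iso.refl _) ?_)
  change 𝟙 _ ≫ P.hom ≫ G.hom ≫ S.hom = (P.hom ≫ G.hom) ≫ S.hom
  rw [Category.id_comp, Category.assoc]

end QuatGrass

/-! ### Cohomology theories: five lemma, excision, Mayer–Vietoris -/

namespace QuatGrass

variable {k : Scheme.{u}} {𝒱 : ObjectProperty (Over k)} {h𝒱 : IsAdmissible 𝒱}

lemma IsAdmissible.openSub_mem (h𝒱 : IsAdmissible 𝒱) {X : Over k} (hX : 𝒱 X) {W : X.left.Opens}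
    (hW : IsCompact (W : Set X.left)) : 𝒱 (openSub X W) :=
  h𝒱.opens X (openSub X W) (openIncl X W) hX (inferInstanceAs (IsOpenImmersion W.ι))
    (isCompact_iff_compactSpace.1 hW)

lemma IsAdmissible.openCompl_mem (h𝒱 : IsAdmissible 𝒱) {X : Over k} (hX : 𝒱 X)
    {Z : Closeds X.left} (hZ : IsCompact (Z : Set X.left)ᶜ) : 𝒱 (openCompl X Z) :=
  h𝒱.openSub_mem hX hZ

namespace CohomologyTheory

variable (A : CohomologyTheory.{w} h𝒱)

lemma pullback_comp {p q r : SupportPair 𝒱} (f : r ⟶ q) (g : q ⟶ p) (a : A.grp p) :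
    A.pullback (f ≫ g) a = A.pullback f (A.pullback g a) := by
  simp only [pullback, op_comp, Functor.map_comp]
  rfl

lemma pullback_id {p : SupportPair 𝒱} (a : A.grp p) : A.pullback (𝟙 p) a = a := by
  simp only [pullback, op_id, (A.A).map_id]
  rfl

lemma totPullback_comp {X'' X' X : Over k} (h'' : 𝒱 X'') (h' : 𝒱 X') (h : 𝒱 X) (f : X'' ⟶ X')
    (g : X' ⟶ X) (a : A.tot X h) :
    A.totPullback h'' h (f ≫ g) a = A.totPullback h'' h' f (A.totPullback h' h g a) :=
  A.pullback_comp (totalMap h𝒱 h'' h' f) (totalMap h𝒱 h' h g) a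

lemma totPullback_id {X : Over k} (h : 𝒱 X) (a : A.tot X h) : A.totPullback h h (𝟙 X) a = a :=
  A.pullback_id a

/-- The pullback along `q` is an isomorphism. -/
def Inverts {X' X : Over k} (q : X' ⟶ X) : Prop :=
  ∀ (hX' : 𝒱 X') (hX : 𝒱 X), Function.Bijective (A.totPullback hX' hX q)

variable {A}

lemma Inverts.comp {X'' X' X : Over k} {f : X'' ⟶ X'} {g : X' ⟶ X} (hX' : 𝒱 X')
    (hf : A.Inverts f) (hg : A.Inverts g) : A.Inverts (f ≫ g) := fun h'' h => by
  rw [show ⇑(A.totPullback h'' h (f ≫ g)) = A.totPullback h'' hX' f ∘ A.totPullback hX' h g from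
    funext (A.totPullback_comp h'' hX' h f g)]
  exact (hf h'' hX').comp (hg hX' h)

lemma Inverts.of_comp_right {X'' X' X : Over k} {f : X'' ⟶ X'} {g : X' ⟶ X} (h : 𝒱 X)
    (hg : A.Inverts g) (hfg : A.Inverts (f ≫ g)) : A.Inverts f := fun h'' h' => by
  refine (Function.Bijective.of_comp_iff _ (hg h' h)).1 ?_
  rw [← show ⇑(A.totPullback h'' h (f ≫ g)) = A.totPullback h'' h' f ∘ A.totPullback h' h g from
    funext (A.totPullback_comp h'' h' h f g)]
  exact hfg h'' h

variable (A)

lemma inverts_id (X : Over k) : A.Inverts (𝟙 X) := fun h _ => by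
  rw [show ⇑(A.totPullback h h (𝟙 X)) = id from funext (A.totPullback_id h)]
  exact Function.bijective_id

lemma inverts_of_isIso {X' X : Over k} (i : X' ⟶ X) [IsIso i] : A.Inverts i := fun h' h => by
  refine Function.bijective_iff_has_inverse.2 ⟨A.totPullback h h' (inv i), fun a => ?_, fun a => ?_⟩
  · rw [← A.totPullback_comp, IsIso.inv_hom_id, A.totPullback_id]
  · rw [← A.totPullback_comp, IsIso.hom_inv_id, A.totPullback_id]

lemma inverts_of_comp_eq {X X' Y Y' : Over k} {q : X' ⟶ X} {p : Y' ⟶ Y} (i : X' ⟶ Y') [IsIso i]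
    (j : X ⟶ Y) [IsIso j] (h : i ≫ p = q ≫ j) (hX : 𝒱 X) (hq : A.Inverts q) : A.Inverts p := by
  have h1 : A.Inverts (i ≫ p) := h ▸ hq.comp hX (A.inverts_of_isIso j)
  have h2 : p = inv i ≫ i ≫ p := by simp
  intro hY' hY
  have hX' : 𝒱 X' := h𝒱.of_iso hY' (asIso i)
  rw [h2]
  exact (A.inverts_of_isIso (inv i)).comp hX' h1 hY' hY

section FiveLemma

variable {q p : SupportPair 𝒱} (f : q ⟶ p) (g : openCompl q.X q.Z ⟶ openCompl p.X p.Z)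

lemma extSupport_pullback (a : A.grp p) :
    A.extSupport q (A.pullback f a) = A.totPullback q.mem p.mem f.f (A.extSupport p a) := by
  have h : forgetSupport h𝒱 q ≫ f = totalMap h𝒱 q.mem p.mem f.f ≫ forgetSupport h𝒱 p :=
    Hom.ext ((Category.id_comp f.f).trans (Category.comp_id f.f).symm)
  rw [extSupport, ← A.pullback_comp, h, A.pullback_comp]

lemma boundary_totPullback (hg : g ≫ openComplIncl p.X p.Z = openComplIncl q.X q.Z ≫ f.f)
    (a : A.tot (openCompl p.X p.Z) p.mem_compl) :
    A.boundary q (A.totPullback q.mem_compl p.mem_compl g a) = A.pullback f (A.boundary p a) :=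
  ConcreteCategory.congr_hom (A.bd_natural f g hg) a

lemma restrict_totPullback (hg : g ≫ openComplIncl p.X p.Z = openComplIncl q.X q.Z ≫ f.f)
    (a : A.tot p.X p.mem) :
    A.restrict q (A.totPullback q.mem p.mem f.f a) =
      A.totPullback q.mem_compl p.mem_compl g (A.restrict p a) := by
  have h : inclCompl h𝒱 q ≫ totalMap h𝒱 q.mem p.mem f.f =
      totalMap h𝒱 q.mem_compl p.mem_compl g ≫ inclCompl h𝒱 p := Hom.ext hg.symm
  rw [restrict, ← A.pullback_comp, h, A.pullback_comp]

/-- Five lemma for `A(X) → A(X ∖ Z) → A_Z(X) → A(X) → A(X ∖ Z)`. -/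
lemma bijective_pullback_of_inverts
    (hg : g ≫ openComplIncl p.X p.Z = openComplIncl q.X q.Z ≫ f.f) (h1 : A.Inverts f.f)
    (h2 : A.Inverts g) : Function.Bijective (A.pullback f) :=
  AddMonoidHom.bijective_of_surjective_of_bijective_of_bijective_of_injective
    (A.restrict p) (A.boundary p) (A.extSupport p) (A.restrict p)
    (A.restrict q) (A.boundary q) (A.extSupport q) (A.restrict q)
    (A.totPullback q.mem p.mem f.f) (A.totPullback q.mem_compl p.mem_compl g) (A.pullback f)
    (A.totPullback q.mem p.mem f.f) (A.totPullback q.mem_compl p.mem_compl g)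
    (AddMonoidHom.ext (A.restrict_totPullback f g hg))
    (AddMonoidHom.ext (A.boundary_totPullback f g hg))
    (AddMonoidHom.ext (A.extSupport_pullback f))
    (AddMonoidHom.ext (A.restrict_totPullback f g hg))
    (A.exact_j_bd p) (A.exact_bd_e p) (A.exact_e_j p)
    (A.exact_j_bd q) (A.exact_bd_e q) (A.exact_e_j q)
    (h1 _ _).2 (h2 _ _) (h1 _ _) (h2 _ _).1

/-- Five lemma for `A(X ∖ Z) → A_Z(X) → A(X) → A(X ∖ Z) → A_Z(X)`. -/
lemma inverts_of_bijective_pullback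
    (hg : g ≫ openComplIncl p.X p.Z = openComplIncl q.X q.Z ≫ f.f)
    (h1 : Function.Bijective (A.pullback f)) (h2 : A.Inverts g) : A.Inverts f.f := fun _ _ =>
  AddMonoidHom.bijective_of_surjective_of_bijective_of_bijective_of_injective
    (A.boundary p) (A.extSupport p) (A.restrict p) (A.boundary p)
    (A.boundary q) (A.extSupport q) (A.restrict q) (A.boundary q)
    (A.totPullback q.mem_compl p.mem_compl g) (A.pullback f)
    (A.totPullback q.mem p.mem f.f) (A.totPullback q.mem_compl p.mem_compl g) (A.pullback f)
    (AddMonoidHom.ext (A.boundary_totPullback f g hg))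
    (AddMonoidHom.ext (A.extSupport_pullback f))
    (AddMonoidHom.ext (A.restrict_totPullback f g hg))
    (AddMonoidHom.ext (A.boundary_totPullback f g hg))
    (A.exact_bd_e p) (A.exact_e_j p) (A.exact_j_bd p)
    (A.exact_bd_e q) (A.exact_e_j q) (A.exact_j_bd q)
    (h2 _ _).2 h1 (h2 _ _) h1.1

end FiveLemma

/-- Zariski excision. -/
lemma bijective_pullback_of_isOpenImmersion {q p : SupportPair 𝒱} (f : q ⟶ p)
    [hf : IsOpenImmersion f.f.left] (hZ : (q.Z : Set q.X.left) = f.f.left ⁻¹' (p.Z : Set p.X.left))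
    (hr : (p.Z : Set p.X.left) ⊆ Set.range f.f.left) : Function.Bijective (A.pullback f) := by
  refine A.excision f inferInstance hZ ?_
  -- The base change to the reduced subscheme `Z` is an open immersion, and it is surjective because
  -- `Z` lies in the image of `f`.
  rw [isIso_iff_isOpenImmersion_and_surjective]
  refine ⟨inferInstance, ⟨?_⟩⟩
  rw [← Set.range_eq_univ, Scheme.Pullback.range_snd, Set.eq_univ_iff_forall]
  intro z
  apply hr
  have h1 : (Scheme.IdealSheafData.vanishingIdeal p.Z).subschemeι z ∈
      Set.range (Scheme.IdealSheafData.vanishingIdeal p.Z).subschemeι := ⟨z, rfl⟩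
  rw [Scheme.IdealSheafData.range_subschemeι] at h1
  simpa using h1

/-- The pullback along every base change of `q` to the open subscheme `W` is an isomorphism. -/
def InvertsOver {X' X : Over k} (q : X' ⟶ X) (W : X.left.Opens) : Prop :=
  ∀ (N N' : Over k) (j : N ⟶ X) (j' : N' ⟶ X') (q' : N' ⟶ N), IsOpenImmersion j.left →
    IsOpenImmersion j'.left → Set.range j.left = W → Set.range j'.left = q.left ⁻¹' W →
    q' ≫ j = j' ≫ q → A.Inverts q'

variable {A}

lemma exists_iso_of_range_eq {X N₁ N₂ : Over k} (j₁ : N₁ ⟶ X) (j₂ : N₂ ⟶ X)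
    [IsOpenImmersion j₁.left] [IsOpenImmersion j₂.left]
    (h : Set.range j₁.left = Set.range j₂.left) : ∃ i : N₁ ⟶ N₂, IsIso i ∧ i ≫ j₂ = j₁ := by
  obtain ⟨i, hi⟩ := exists_lift_of_range j₂ j₁ fun t => h ▸ ⟨t, rfl⟩
  obtain ⟨i', hi'⟩ := exists_lift_of_range j₁ j₂ fun t => h ▸ ⟨t, rfl⟩
  have m₁ : Mono j₁ := (Over.forget k).mono_of_mono_map (inferInstanceAs (Mono j₁.left))
  have m₂ : Mono j₂ := (Over.forget k).mono_of_mono_map (inferInstanceAs (Mono j₂.left))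
  refine ⟨i, ⟨i', ?_, ?_⟩, hi⟩
  · rw [← cancel_mono j₁, Category.assoc, hi', hi, Category.id_comp]
  · rw [← cancel_mono j₂, Category.assoc, hi, hi', Category.id_comp]

/-- One model of the base change suffices, since open immersions with the same image are isomorphic
over `X`. -/
lemma Inverts.invertsOver {X' X N N' : Over k} {q : X' ⟶ X} {W : X.left.Opens} {j : N ⟶ X}
    {j' : N' ⟶ X'} {q' : N' ⟶ N} (h : A.Inverts q') [hj : IsOpenImmersion j.left]
    [hj' : IsOpenImmersion j'.left] (hr : Set.range j.left = W)
    (hr' : Set.range j'.left = q.left ⁻¹' W) (hq : q' ≫ j = j' ≫ q) : A.InvertsOver q W := by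
  intro N₁ N₁' j₁ j₁' q₁ hj₁ hj₁' hr₁ hr₁' hq₁ hN₁' hN₁
  obtain ⟨i, hi, hij⟩ := exists_iso_of_range_eq j j₁ (hr.trans hr₁.symm)
  obtain ⟨i', hi', hij'⟩ := exists_iso_of_range_eq j' j₁' (hr'.trans hr₁'.symm)
  refine A.inverts_of_comp_eq (q := q') i' i ?_ (h𝒱.of_iso hN₁ (asIso i)) h hN₁' hN₁
  have m₁ : Mono j₁ := (Over.forget k).mono_of_mono_map (inferInstanceAs (Mono j₁.left))
  rw [← cancel_mono j₁, Category.assoc, Category.assoc, hq₁, reassoc_of% hij', hij, hq]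

/-- The base change of a morphism to an open subscheme. -/
abbrev restrictOpen {X' X : Over k} (q : X' ⟶ X) (W : X.left.Opens) :
    openSub X' (q.left ⁻¹ᵁ W) ⟶ openSub X W :=
  Over.homMk (q.left ∣_ W) (by
    change (q.left ∣_ W) ≫ W.ι ≫ X.hom = (q.left ⁻¹ᵁ W).ι ≫ X'.hom
    rw [← Over.w q, morphismRestrict_ι_assoc])

lemma restrictOpen_openIncl {X' X : Over k} (q : X' ⟶ X) (W : X.left.Opens) :
    restrictOpen q W ≫ openIncl X W = openIncl X' (q.left ⁻¹ᵁ W) ≫ q := by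
  ext1
  exact morphismRestrict_ι q.left W

lemma InvertsOver.inverts {X' X : Over k} {q : X' ⟶ X} (h : A.InvertsOver q ⊤) : A.Inverts q :=
  h X X' (𝟙 X) (𝟙 X') q (inferInstanceAs (IsOpenImmersion (𝟙 X.left)))
    (inferInstanceAs (IsOpenImmersion (𝟙 X'.left))) (by simp) (by simp) (by simp)

lemma InvertsOver.inverts_restrictOpen {X' X : Over k} {q : X' ⟶ X} {W : X.left.Opens}
    (h : A.InvertsOver q W) : A.Inverts (restrictOpen q W) :=
  h _ _ (openIncl X W) (openIncl X' (q.left ⁻¹ᵁ W)) _ (inferInstanceAs (IsOpenImmersion W.ι))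
    (inferInstanceAs (IsOpenImmersion (q.left ⁻¹ᵁ W).ι)) (range_openIncl X W)
    (range_openIncl X' _) (restrictOpen_openIncl q W)

lemma Inverts.invertsOver_of_restrictOpen {X' X : Over k} {q : X' ⟶ X} {W : X.left.Opens}
    (h : A.Inverts (restrictOpen q W)) : A.InvertsOver q W :=
  h.invertsOver (hj := inferInstanceAs (IsOpenImmersion W.ι))
    (hj' := inferInstanceAs (IsOpenImmersion (q.left ⁻¹ᵁ W).ι)) (range_openIncl X W)
    (range_openIncl X' _) (restrictOpen_openIncl q W)

/-- The Mayer–Vietoris property. -/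
lemma inverts_of_sup_eq_top {X' X : Over k} {q : X' ⟶ X} [QuasiCompact q.left] {W₁ W₂ : X.left.Opens}
    (hW₁ : IsCompact (W₁ : Set X.left)) (hW₂ : IsCompact (W₂ : Set X.left)) (hW : W₁ ⊔ W₂ = ⊤)
    (h₁ : A.InvertsOver q W₁) (h₂ : A.InvertsOver q W₂) (h₁₂ : A.InvertsOver q (W₁ ⊓ W₂)) :
    A.Inverts q := by
  intro hX' hX
  have hqs := h𝒱.quasiSeparatedSpace X hX
  have hW₁₂ : IsCompact (W₁ ⊓ W₂ : Set X.left) :=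
    QuasiSeparatedSpace.inter_isCompact _ _ W₁.2 hW₁ W₂.2 hW₂
  have hpre : ∀ {W : Set X.left}, IsOpen W → IsCompact W → IsCompact (q.left ⁻¹' W) :=
    fun hW hc => QuasiCompact.isCompact_preimage _ hW hc
  -- `Z` is contained in `W₁`, so excision replaces `A_Z(X)` by `A_Z(W₁)`. There the complement of
  -- `Z` is `W₁ ⊓ W₂`, and the five lemma gives the isomorphism with supports. A second use, over
  -- `X` with complement `W₂`, concludes.
  let Z : Closeds X.left := W₂.compl
  have hZ : (Z : Set X.left)ᶜ = W₂ := compl_compl _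
  let Z' : Closeds X'.left := Z.preimage q.left.continuous
  have hZ' : (Z' : Set X'.left)ᶜ = q.left ⁻¹' W₂ := compl_compl _
  let p : SupportPair 𝒱 := ⟨X, Z, hX, h𝒱.openCompl_mem hX (hZ ▸ hW₂)⟩
  let p' : SupportPair 𝒱 := ⟨X', Z', hX', h𝒱.openCompl_mem hX' (hZ' ▸ hpre W₂.2 hW₂)⟩
  let W₁' := q.left ⁻¹ᵁ W₁
  -- Quasi-compactness of the complement of `Z` inside `V` is what makes the restricted pairs
  -- admissible.
  have hcap : ∀ {Y : Over k} (V : Y.left.Opens) (C : Closeds Y.left),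
      IsCompact ((V : Set Y.left) ∩ (C : Set Y.left)ᶜ) →
      IsCompact ((C.preimage (openIncl Y V).left.continuous : Closeds _) :
        Set (openSub Y V).left)ᶜ := by
    intro Y V C hc
    have he : Topology.IsOpenEmbedding (openIncl Y V).left := V.ι.isOpenEmbedding
    rw [he.isInducing.isCompact_iff]
    convert hc
    ext y
    constructor
    · rintro ⟨x, hx, rfl⟩
      exact ⟨(range_openIncl Y V).subset ⟨x, rfl⟩, hx⟩
    · rintro ⟨h, hy⟩
      obtain ⟨x, rfl⟩ := (range_openIncl Y V).superset h
      exact ⟨x, hy, rfl⟩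
  let p₁ : SupportPair 𝒱 := ⟨openSub X W₁, Z.preimage (openIncl X W₁).left.continuous,
    h𝒱.openSub_mem hX hW₁, h𝒱.openCompl_mem (h𝒱.openSub_mem hX hW₁)
      (hcap W₁ Z (hZ ▸ hW₁₂))⟩
  let p₁' : SupportPair 𝒱 := ⟨openSub X' W₁', Z'.preimage (openIncl X' W₁').left.continuous,
    h𝒱.openSub_mem hX' (hpre W₁.2 hW₁), h𝒱.openCompl_mem
      (h𝒱.openSub_mem hX' (hpre W₁.2 hW₁)) (hcap W₁' Z' (hZ' ▸ hpre (W₁ ⊓ W₂).2 hW₁₂))⟩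
  let f : p' ⟶ p := Hom.mk q fun _ h => h
  let j : p₁ ⟶ p := Hom.mk (openIncl X W₁) fun _ h => h
  let j' : p₁' ⟶ p' := Hom.mk (openIncl X' W₁') fun _ h => h
  have hsq := restrictOpen_openIncl q W₁
  have hsq' : ∀ x, (openIncl X W₁).left ((restrictOpen q W₁).left x) =
      q.left ((openIncl X' W₁').left x) := fun x => by
    rw [← Scheme.Hom.comp_apply, ← Scheme.Hom.comp_apply]
    exact congrArg (fun h : openSub X' W₁' ⟶ X => h.left x) hsq
  let f₁ : p₁' ⟶ p₁ := Hom.mk (restrictOpen q W₁) fun x h => by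
    change q.left ((openIncl X' W₁').left x) ∈ Z
    rw [← hsq']
    exact h
  have hcomm : f₁ ≫ j = j' ≫ f := Hom.ext hsq
  have hrange : ∀ x, x ∈ Z → x ∈ W₁ := fun x hx => by
    have : x ∈ W₁ ⊔ W₂ := hW ▸ trivial
    exact this.resolve_right hx
  have hj : Function.Bijective (A.pullback j) :=
    A.bijective_pullback_of_isOpenImmersion j (hf := inferInstanceAs (IsOpenImmersion W₁.ι)) rfl
      fun x hx => (range_openIncl X W₁).superset (hrange x hx)
  have hj' : Function.Bijective (A.pullback j') :=
    A.bijective_pullback_of_isOpenImmersion j' (hf := inferInstanceAs (IsOpenImmersion W₁'.ι)) rfl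
      fun x hx => (range_openIncl X' W₁').superset (hrange _ hx)
  obtain ⟨g₁, hg₁⟩ : ∃ g₁ : openCompl p₁'.X p₁'.Z ⟶ openCompl p₁.X p₁.Z,
      g₁ ≫ openComplIncl p₁.X p₁.Z = openComplIncl p₁'.X p₁'.Z ≫ f₁.f := by
    refine exists_lift_openSub _ _ fun t => ?_
    have h1 := openIncl_mem (𝟙 (openCompl p₁'.X p₁'.Z)) t
    rw [Category.id_comp] at h1
    intro h2
    refine h1 ?_
    change q.left ((openIncl X' W₁').left _) ∈ Z
    rw [← hsq']
    exact h2
  obtain ⟨g, hg⟩ : ∃ g : openCompl p'.X p'.Z ⟶ openCompl p.X p.Z,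
      g ≫ openComplIncl p.X p.Z = openComplIncl p'.X p'.Z ≫ f.f := by
    refine exists_lift_openSub _ _ fun t => ?_
    have h1 := openIncl_mem (𝟙 (openCompl p'.X p'.Z)) t
    rw [Category.id_comp] at h1
    exact h1
  have hgi : A.Inverts g := h₂ _ _ _ _ g (inferInstanceAs (IsOpenImmersion (Scheme.Opens.ι Z.compl)))
    (inferInstanceAs (IsOpenImmersion (Scheme.Opens.ι Z'.compl))) ((range_openIncl X Z.compl).trans hZ)
    ((range_openIncl X' Z'.compl).trans hZ') hg
  have hr : ∀ {Y : Over k} (V : Y.left.Opens) (C : Closeds Y.left),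
      Set.range (openComplIncl (openSub Y V) (C.preimage (openIncl Y V).left.continuous) ≫
        openIncl Y V).left = (V : Set Y.left) ∩ (C : Set Y.left)ᶜ := by
    intro Y V C
    rw [Over.comp_left, Scheme.Hom.comp_base, TopCat.coe_comp, Set.range_comp, range_openIncl]
    ext y
    constructor
    · rintro ⟨x, hx, rfl⟩
      exact ⟨(range_openIncl Y V).subset ⟨x, rfl⟩, hx⟩
    · rintro ⟨h, hy⟩
      obtain ⟨x, rfl⟩ := (range_openIncl Y V).superset h
      exact ⟨x, hy, rfl⟩
  have hg₁i : A.Inverts g₁ := by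
    refine h₁₂ _ _ (openComplIncl p₁.X p₁.Z ≫ openIncl X W₁)
      (openComplIncl p₁'.X p₁'.Z ≫ openIncl X' W₁') g₁ ?_ ?_ ?_ ?_ ?_
    · exact inferInstanceAs (IsOpenImmersion (Scheme.Opens.ι p₁.Z.compl ≫ W₁.ι))
    · exact inferInstanceAs (IsOpenImmersion (Scheme.Opens.ι p₁'.Z.compl ≫ W₁'.ι))
    · rw [hr W₁ Z, hZ]
      rfl
    · rw [hr W₁' Z', hZ']
      rfl
    · rw [reassoc_of% hg₁, hsq, Category.assoc]
  have hf₁ : Function.Bijective (A.pullback f₁) :=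
    A.bijective_pullback_of_inverts f₁ g₁ hg₁ h₁.inverts_restrictOpen hg₁i
  have hf : Function.Bijective (A.pullback f) := by
    refine (Function.Bijective.of_comp_iff' hj' _).1 ?_
    rw [← show ⇑(A.pullback (j' ≫ f)) = A.pullback j' ∘ A.pullback f from
      funext (A.pullback_comp j' f), ← hcomm,
      show ⇑(A.pullback (f₁ ≫ j)) = A.pullback f₁ ∘ A.pullback j from
      funext (A.pullback_comp f₁ j)]
    exact hf₁.comp hj
  exact A.inverts_of_bijective_pullback f g hg hf hgi hX' hX

end CohomologyTheory

end QuatGrass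

/-! ### The bundle `𝒪 ⊕ M ⊕ 𝒪`, the affine line and homotopies -/

namespace QuatGrass

section FunSheaf

variable {S : Scheme.{u}}

/-- Functions are morphisms to the affine line, and representable functors are Zariski sheaves. -/
lemma fun_glue {T : Over S} (W : T.left → T.left.Opens) (hW : ∀ t, t ∈ W t)
    (x : ∀ t, Fun (openSub T (W t)))
    (hx : ∀ (t t' : T.left) (T' : Over S) (a : T' ⟶ openSub T (W t)) (b : T' ⟶ openSub T (W t')),
      a ≫ openIncl T (W t) = b ≫ openIncl T (W t') → resFun a (x t) = resFun b (x t')) :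
    ∃ y, ∀ t, resFun (openIncl T (W t)) y = x t := by
  obtain ⟨A, π, c, -, hA⟩ := exists_affineSpace (base S) Unit
  choose g hg _ using fun t => hA _ (toTerminal (openSub T (W t))) (fun _ => x t)
  have hsh := GrothendieckTopology.Subcanonical.isSheaf_of_isRepresentable
    (J := Scheme.zariskiTopology.over S) (yoneda.obj A)
  obtain ⟨y, hy, -⟩ := sheaf_glue hsh T W hW g fun t t' T' a b hab =>
    (hA T' (toTerminal T') fun _ => resFun a (x t)).unique
      ⟨subsingleton_hom_base _ _, fun i => by
        change resFun (a ≫ g t) _ = _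
        rw [resFun_comp, (hg t).2]⟩
      ⟨subsingleton_hom_base _ _, fun i => by
        change resFun (b ≫ g t') _ = _
        rw [resFun_comp, (hg t').2, hx t t' T' a b hab]⟩
  refine ⟨resFun y (c ()), fun t => ?_⟩
  rw [← resFun_comp, ← (hg t).2 ()]
  exact congrArg (fun h : openSub T (W t) ⟶ A => resFun h (c ())) (hy t)

end FunSheaf

namespace BigModule

section HypBasis

variable {R N ι : Type*} [CommRing R] [AddCommGroup N] [Module R N]

/-- The basis of `R ⊕ N ⊕ R` given by a basis of `N`. -/
def hypBasis (b : Module.Basis ι R N) : Module.Basis (Unit ⊕ (ι ⊕ Unit)) R (R × N × R) :=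
  (Module.Basis.singleton Unit R).prod (b.prod (Module.Basis.singleton Unit R))

lemma hypBasis_apply (b : Module.Basis ι R N) (i : Unit ⊕ (ι ⊕ Unit)) :
    hypBasis b i = (Sum.elim (fun _ => (1, 0, 0)) (Sum.elim (fun i => (0, b i, 0))
      fun _ => (0, 0, 1)) : _ → R × N × R) i := by
  rcases i with i | i | i <;>
    refine Prod.ext ?_ (Prod.ext ?_ ?_) <;> simp [hypBasis]

/-- If `x` represents `l` on `N`, then `(l (0, 0, 1), x, -l (1, 0, 0))` represents `l`; for
injectivity one pairs with the coordinate vectors. -/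
lemma bijective_hypForm {f : N →ₗ[R] N →ₗ[R] R} (hf : Function.Bijective f) :
    Function.Bijective (hypForm f) := by
  obtain ⟨hi, hs⟩ := hf
  have hdef : ∀ v v' : R × N × R,
      hypForm f v v' = v.1 * v'.2.2 + f v.2.1 v'.2.1 - v.2.2 * v'.1 := fun _ _ => rfl
  refine ⟨(injective_iff_map_eq_zero _).2 fun v hv => ?_, fun l => ?_⟩
  · have h : ∀ v' : R × N × R, v.1 * v'.2.2 + f v.2.1 v'.2.1 - v.2.2 * v'.1 = 0 :=
      fun v' => LinearMap.congr_fun hv v'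
    refine Prod.ext ?_ (Prod.ext ?_ ?_)
    · simpa using h (0, 0, 1)
    · refine (injective_iff_map_eq_zero _).1 hi _ (LinearMap.ext fun y => ?_)
      simpa using h (0, y, 0)
    · simpa using h (1, 0, 0)
  · obtain ⟨x, hx⟩ := hs (l ∘ₗ LinearMap.inr _ _ _ ∘ₗ LinearMap.inl _ _ _)
    refine ⟨(l (0, 0, 1), x, - l (1, 0, 0)), LinearMap.ext fun v => ?_⟩
    have hx' : f x v.2.1 = l (0, v.2.1, 0) := LinearMap.congr_fun hx v.2.1
    have hv : v = v.1 • ((1, 0, 0) : R × N × R) + (0, v.2.1, 0) + v.2.2 • ((0, 0, 1) : R × N × R) := by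
      refine Prod.ext ?_ (Prod.ext ?_ ?_) <;> simp
    rw [hdef]
    conv_rhs => rw [hv]
    rw [map_add, map_add, map_smul, map_smul, hx', smul_eq_mul, smul_eq_mul]
    ring

end HypBasis

section Hyp

variable {S : Scheme.{u}} {M : BigModule S} {d : ℕ}

lemma isSheaf_hyp (hM : Presieve.IsSheaf (Scheme.zariskiTopology.over S) M.toFunctor) :
    Presieve.IsSheaf (Scheme.zariskiTopology.over S) M.hyp.toFunctor := by
  refine isSheaf_of_glue (fun T W hW x hx => ?_) fun T x y h => ?_
  · obtain ⟨a, ha⟩ := fun_glue W hW (fun t => (x t).1) fun t t' T' a b hab =>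
      congrArg Prod.fst (hx t t' T' a b hab)
    obtain ⟨y, hy⟩ := glue hM W hW (fun t => (x t).2.1) fun t t' T' a b hab =>
      congrArg (fun v => v.2.1) (hx t t' T' a b hab)
    obtain ⟨b, hb⟩ := fun_glue W hW (fun t => (x t).2.2) fun t t' T' a b hab =>
      congrArg (fun v => v.2.2) (hx t t' T' a b hab)
    exact ⟨(a, y, b), fun t => Prod.ext (ha t) (Prod.ext (hy t) (hb t))⟩
  · refine Prod.ext (fun_sep fun t => ?_) (Prod.ext (sep hM fun t => ?_) (fun_sep fun t => ?_))
    · obtain ⟨W, hW, h'⟩ := h t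
      exact ⟨W, hW, congrArg Prod.fst h'⟩
    · obtain ⟨W, hW, h'⟩ := h t
      exact ⟨W, hW, congrArg (fun v => v.2.1) h'⟩
    · obtain ⟨W, hW, h'⟩ := h t
      exact ⟨W, hW, congrArg (fun v => v.2.2) h'⟩

lemma IsVectorBundle.hyp (hM : M.IsVectorBundle d) : M.hyp.IsVectorBundle (d + 2) := by
  refine ⟨isSheaf_hyp hM.isSheaf, fun s => ?_⟩
  obtain ⟨W, hW, b, hb⟩ := hM.locallyFree s
  have hb' : M.hyp.IsBasis (Sum.elim (fun _ => (1, 0, 0)) (Sum.elim (fun i => (0, b i, 0))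
      fun _ => (0, 0, 1)) : Unit ⊕ (Fin d ⊕ Unit) → M.hyp.sec (Over.mk W.ι)) := by
    refine isBasis_of_basis (fun T' h => hypBasis (hb.comp_res h).basis) fun T' h i => ?_
    refine (hypBasis_apply _ i).trans ?_
    rcases i with i | i | i
    · exact Prod.ext (map_one (resFun h)).symm
        (Prod.ext (map_zero (M.res h)).symm (map_zero (resFun h)).symm)
    · exact Prod.ext (map_zero (resFun h)).symm
        (Prod.ext (IsBasis.basis_apply _ i) (map_zero (resFun h)).symm)
    · exact Prod.ext (map_zero (resFun h)).symm
        (Prod.ext (map_zero (M.res h)).symm (map_one (resFun h)).symm)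
  exact ⟨W, hW, _, hb'.reindex (Fintype.equivOfCardEq (by simp; omega))⟩

lemma AltForm.IsNondegenerate.hyp {φ : M.AltForm} (hφ : φ.IsNondegenerate) :
    φ.hyp.IsNondegenerate := fun T hT => bijective_hypForm (hφ T hT)

variable (M) in
/-- The third coordinate on `𝒪 ⊕ M ⊕ 𝒪`. -/
def last (T : Over S) : M.hyp.Functional T where
  app {T'} _ := (LinearMap.snd (Fun T') (M.sec T') (Fun T')).comp
    (LinearMap.snd (Fun T') (Fun T') (M.sec T' × Fun T'))
  app_res _ _ _ := rfl

variable (S) in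
/-- The zero bundle. -/
def zero : BigModule S where
  sec _ := PUnit
  res _ := 0
  res_smul _ _ _ := rfl
  res_id _ := rfl
  res_comp _ _ _ := rfl

lemma isVectorBundle_zero : (zero S).IsVectorBundle 0 := by
  refine ⟨isSheaf_of_glue (fun T W hW x hx => ⟨PUnit.unit, fun t => rfl⟩) fun T x y h => rfl,
    fun s => ⟨⊤, trivial, Fin.elim0, fun T h => ?_⟩⟩
  exact ⟨fun a b _ => Subsingleton.elim _ _, fun x => ⟨Fin.elim0, rfl⟩⟩

/-- The subsheaf of all sections. -/
def SubSheaf.top (T : Over S) : M.SubSheaf T where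
  sec _ := ⊤
  res_mem _ _ _ _ := trivial
  local_mem _ _ _ := trivial

lemma SubSheaf.isSubbundle_top (hM : M.IsVectorBundle d) (T : Over S) :
    (SubSheaf.top T : M.SubSheaf T).IsSubbundle d := by
  intro t
  obtain ⟨W, hW, b, hb⟩ := hM.exists_basis T t
  refine ⟨W, hW, 0, fun i => b (i.elim id Fin.elim0),
    hb.reindex (Equiv.sumEmpty (Fin d) (Fin 0)), fun T' h => ?_⟩
  refine ((hb.comp_res h).basis.span_eq.symm.trans ?_)
  congr 2
  funext i
  exact IsBasis.basis_apply _ i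

end Hyp

end BigModule

section AffineLine

variable {k : Scheme.{u}}

/-- The coordinate on the affine line. -/
abbrev lineCoord (X : Over k) : Fun (affineLine X) := AffineSpace.coord X.left PUnit.unit

lemma existsUnique_hom_affineLine {X T : Over k} (h : T ⟶ X) (a : Fun T) :
    ∃! g : T ⟶ affineLine X, g ≫ affineLineProj X = h ∧ resFun g (lineCoord X) = a := by
  have hg : AffineSpace.homOfVector h.left (fun _ : PUnit.{u + 1} => a) ≫
      (𝔸(PUnit.{u + 1}; X.left) ↘ X.left) = h.left := AffineSpace.homOfVector_over _ _
  refine ⟨Over.homMk (AffineSpace.homOfVector h.left fun _ : PUnit.{u + 1} => a) ?_,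
    ⟨?_, ?_⟩, fun g' ⟨h1, h2⟩ => ?_⟩
  · change _ ≫ (𝔸(PUnit.{u + 1}; X.left) ↘ X.left) ≫ X.hom = _
    rw [reassoc_of% hg, Over.w]
  · ext1
    exact hg
  · exact AffineSpace.homOfVector_appTop_coord _ _ _
  · ext1
    refine AffineSpace.hom_ext (Eq.trans ?_ hg.symm) fun i => ?_
    · exact congrArg CommaMorphism.left h1
    · exact Eq.trans h2 (AffineSpace.homOfVector_appTop_coord h.left (fun _ => a) i).symm

/-- The affine line over an `S`-scheme, regarded as a `k`-scheme. -/
lemma exists_iso_affineLine (S : Over k) (P : Over S.left) :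
    ∃ i : toBase S (affineLine P) ≅ affineLine (toBase S P),
      i.hom ≫ affineLineProj (toBase S P) = toBaseMap S (affineLineProj P) := by
  refine ⟨Over.isoMk (Iso.refl _) ?_, ?_⟩
  · change 𝟙 _ ≫ (𝔸(PUnit.{u + 1}; P.left) ↘ P.left) ≫ P.hom ≫ S.hom =
      ((𝔸(PUnit.{u + 1}; P.left) ↘ P.left) ≫ P.hom) ≫ S.hom
    rw [Category.id_comp, Category.assoc]
  · ext1
    exact Category.id_comp _

variable {𝒱 : ObjectProperty (Over k)}

/-- The sections `(a, 0, 1)` of `𝒪 ⊕ 0 ⊕ 𝒪` with last component one are parametrized by the affine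
line, which is therefore open in a bundle of lines and affine over `X`. -/
theorem IsAdmissible.affineLine_mem (h𝒱 : IsAdmissible 𝒱) {X : Over k} (hX : 𝒱 X) :
    𝒱 (affineLine X) := by
  have hM := (isVectorBundle_zero (S := X.left)).hyp
  have hX' : 𝒱 (toBase X (QuatGrass.base X.left)) :=
    h𝒱.of_iso hX (Over.isoMk (Iso.refl _) (by
      change 𝟙 _ ≫ X.hom = 𝟙 _ ≫ X.hom
      rfl))
  obtain ⟨P, π, w, -, hw, huniv, -, hP⟩ := h𝒱.exists_unitSections hM.isSheaf
    (SubSheaf.isSubbundle_top hM (QuatGrass.base X.left)) ((zero X.left).last (QuatGrass.base X.left))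
  obtain ⟨i, ⟨-, hi⟩, -⟩ := existsUnique_hom_affineLine (X := QuatGrass.base X.left) (T := P)
    (toTerminal P) w.1
  obtain ⟨j, ⟨-, hj⟩, -⟩ := huniv (affineLine (QuatGrass.base X.left)) (toTerminal _)
    (lineCoord (QuatGrass.base X.left), PUnit.unit, 1) trivial rfl
  have hij : i ≫ j = 𝟙 P := by
    refine (huniv P (toTerminal P) w trivial hw).unique ⟨subsingleton_hom_base _ _, ?_⟩
      ⟨subsingleton_hom_base _ _, BigModule.res_id _ w⟩
    rw [BigModule.res_comp, hj]
    refine Prod.ext hi (Prod.ext rfl ?_)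
    exact (map_one (resFun i)).trans hw.symm
  have hji : j ≫ i = 𝟙 _ := by
    refine (existsUnique_hom_affineLine (toTerminal _) (lineCoord (QuatGrass.base X.left))).unique
      ⟨subsingleton_hom_base _ _, ?_⟩ ⟨subsingleton_hom_base _ _, resFun_id _⟩
    rw [resFun_comp, hi]
    exact congrArg Prod.fst hj
  refine h𝒱.of_iso (hP hX') (?_ ≪≫ (Over.map X.hom).mapIso ⟨j, i, hji, hij⟩)
  refine Over.isoMk (Iso.refl _) ?_
  change 𝟙 _ ≫ ((𝔸(PUnit.{u + 1}; X.left) ↘ X.left) ≫ 𝟙 _) ≫ X.hom =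
    (𝔸(PUnit.{u + 1}; X.left) ↘ X.left) ≫ X.hom
  rw [Category.id_comp, Category.comp_id]

namespace CohomologyTheory

variable {h𝒱 : IsAdmissible 𝒱} (A : CohomologyTheory.{w} h𝒱) {S : Over k}

lemma inverts_affineLineProj (P : Over S.left) : A.Inverts (toBaseMap S (affineLineProj P)) := by
  obtain ⟨i, hi⟩ := exists_iso_affineLine S P
  intro h' h
  have h'' := h𝒱.affineLine_mem h
  rw [← hi]
  exact (A.inverts_of_isIso i.hom).comp h'' (fun h₁ h₂ => A.homotopy _ h₂ h₁) h' h

lemma toBase_affineLine_mem (h𝒱 : IsAdmissible 𝒱) {P : Over S.left} (hP : 𝒱 (toBase S P)) :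
    𝒱 (toBase S (affineLine P)) :=
  h𝒱.of_iso (h𝒱.affineLine_mem hP) (exists_iso_affineLine S P).choose

/-- Homotopic morphisms induce the same pullback. -/
lemma totPullback_eq_of_homotopy {P Y : Over S.left} (hP : 𝒱 (toBase S P)) (hY : 𝒱 (toBase S Y))
    (H : affineLine P ⟶ Y) (s₀ s₁ : P ⟶ affineLine P) (h₀ : s₀ ≫ affineLineProj P = 𝟙 P)
    (h₁ : s₁ ≫ affineLineProj P = 𝟙 P) (a : A.tot _ hY) :
    A.totPullback hP hY (toBaseMap S (s₀ ≫ H)) a = A.totPullback hP hY (toBaseMap S (s₁ ≫ H)) a := by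
  have hL := toBase_affineLine_mem h𝒱 hP
  have h : ∀ s : P ⟶ affineLine P, s ≫ affineLineProj P = 𝟙 P → ∀ b : A.tot _ hP,
      A.totPullback hP hL (toBaseMap S s)
        (A.totPullback hL hP (toBaseMap S (affineLineProj P)) b) = b := by
    intro s hs b
    rw [← A.totPullback_comp, ← Functor.map_comp, hs, (Over.map S.hom).map_id, A.totPullback_id]
  -- The pullback of `a` along `H` comes from a class `b` on `P`, to which every section of the
  -- projection restricts it.
  obtain ⟨b, hb⟩ := (A.inverts_affineLineProj P hL hP).2 (A.totPullback hL hY (toBaseMap S H) a)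
  rw [toBaseMap, toBaseMap, Functor.map_comp, Functor.map_comp, A.totPullback_comp hP hL hY,
    A.totPullback_comp hP hL hY, ← hb, h s₀ h₀, h s₁ h₁]

/-- A morphism with a section to which the identity is homotopic induces an isomorphism. -/
lemma inverts_of_homotopy {P Y : Over S.left} (π : P ⟶ Y) (s : Y ⟶ P) (hs : s ≫ π = 𝟙 Y)
    (H : affineLine P ⟶ P) (s₀ s₁ : P ⟶ affineLine P) (h₀ : s₀ ≫ affineLineProj P = 𝟙 P)
    (h₁ : s₁ ≫ affineLineProj P = 𝟙 P) (hH₀ : s₀ ≫ H = π ≫ s) (hH₁ : s₁ ≫ H = 𝟙 P) :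
    A.Inverts (toBaseMap S π) := fun hP hY => by
  refine Function.bijective_iff_has_inverse.2
    ⟨A.totPullback hY hP (toBaseMap S s), fun a => ?_, fun a => ?_⟩
  · rw [← A.totPullback_comp, ← Functor.map_comp, hs, (Over.map S.hom).map_id, A.totPullback_id]
  · rw [← A.totPullback_comp, ← Functor.map_comp, ← hH₀,
      A.totPullback_eq_of_homotopy hP hP H s₀ s₁ h₀ h₁, hH₁]
    exact (congrArg (fun f => A.totPullback hP hP f a) ((Over.map S.hom).map_id P)).trans
      (A.totPullback_id hP a)

end CohomologyTheory

end AffineLine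

end QuatGrass

/-! ### Homotopy invariance for affine bundles -/

namespace QuatGrass

variable {k : Scheme.{u}} {𝒱 : ObjectProperty (Over k)} {h𝒱 : IsAdmissible 𝒱}

namespace CohomologyTheory

variable {A : CohomologyTheory.{w} h𝒱}

lemma invertsOver_bot {X' X : Over k} (q : X' ⟶ X) : A.InvertsOver q ⊥ := by
  intro N N' j j' q' _ _ hr _ _
  have : IsEmpty N.left := ⟨fun x => (hr.subset ⟨x, rfl⟩ : j.left x ∈ (⊥ : X.left.Opens))⟩
  have h1 : IsIso ((Over.forget k).map q') := isIso_of_isEmpty q'.left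
  have h2 : IsIso q' := isIso_of_reflects_iso q' (Over.forget k)
  exact A.inverts_of_isIso q'

lemma InvertsOver.restrict {X' X : Over k} {q : X' ⟶ X} {W W' : X.left.Opens}
    (h : A.InvertsOver q (W ⊓ W')) : A.InvertsOver (restrictOpen q W) (W.ι ⁻¹ᵁ W') := by
  intro N N' j j' q' hj hj' hr hr' hq
  have key : ∀ {Y N : Over k} (V V' : Y.left.Opens) (i : N ⟶ openSub Y V),
      Set.range i.left = (openIncl Y V).left ⁻¹' (V' : Set Y.left) →
      Set.range (i ≫ openIncl Y V).left = ((V ⊓ V' : Y.left.Opens) : Set Y.left) := by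
    intro Y N V V' i hi
    rw [Over.comp_left, Scheme.Hom.comp_base, TopCat.coe_comp, Set.range_comp, hi,
      Set.image_preimage_eq_inter_range, range_openIncl, Set.inter_comm]
    rfl
  refine h N N' (j ≫ openIncl X W) (j' ≫ openIncl X' _) q' ?_ ?_ (key W W' j hr)
    (key (q.left ⁻¹ᵁ W) (q.left ⁻¹ᵁ W') j' ?_) ?_
  · exact inferInstanceAs (IsOpenImmersion (j.left ≫ W.ι))
  · exact inferInstanceAs (IsOpenImmersion (j'.left ≫ (q.left ⁻¹ᵁ W).ι))
  · rw [hr']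
    ext x
    change (W.ι ((q.left ∣_ W) x)) ∈ W' ↔ q.left ((q.left ⁻¹ᵁ W).ι x) ∈ W'
    rw [← Scheme.Hom.comp_apply, morphismRestrict_ι, Scheme.Hom.comp_apply]
  · rw [reassoc_of% hq, restrictOpen_openIncl, Category.assoc]

/-- A quasi-compact morphism which induces isomorphisms over the quasi-compact open subschemes of
the members of a basis of the topology does so over all quasi-compact open subschemes. -/
theorem invertsOver_of_local {X' X : Over k} (hX : 𝒱 X) (q : X' ⟶ X) [hq : QuasiCompact q.left]
    (h : ∀ x : X.left, ∃ W : X.left.Opens, x ∈ W ∧ IsCompact (W : Set X.left) ∧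
      ∀ W' ≤ W, IsCompact (W' : Set X.left) → A.InvertsOver q W')
    (W : X.left.Opens) (hW : IsCompact (W : Set X.left)) : A.InvertsOver q W := by
  have hqs := h𝒱.quasiSeparatedSpace X hX
  have hinter : ∀ {V V' : X.left.Opens}, IsCompact (V : Set X.left) → IsCompact (V' : Set X.left) →
      IsCompact ((V ⊓ V' : X.left.Opens) : Set X.left) := fun {V V'} hV hV' =>
    QuasiSeparatedSpace.inter_isCompact _ _ V.2 hV V'.2 hV'
  -- The induction over compact subsets must carry along all quasi-compact open subsets of `V`,
  -- because Mayer–Vietoris also needs the intersections.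
  suffices h' : ∃ V : X.left.Opens, (W : Set X.left) ⊆ V ∧ IsCompact (V : Set X.left) ∧
      ∀ W' ≤ V, IsCompact (W' : Set X.left) → A.InvertsOver q W' by
    obtain ⟨V, hV, -, hV'⟩ := h'
    exact hV' W hV hW
  refine hW.induction_on (p := fun s => ∃ V : X.left.Opens, s ⊆ V ∧ IsCompact (V : Set X.left) ∧
      ∀ W' ≤ V, IsCompact (W' : Set X.left) → A.InvertsOver q W') ?_ ?_ ?_ ?_
  · refine ⟨⊥, Set.empty_subset _, isCompact_empty, fun W' hW' _ => ?_⟩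
    rw [le_bot_iff.1 hW']
    exact invertsOver_bot q
  · rintro s t hst ⟨V, hV, hV'⟩
    exact ⟨V, hst.trans hV, hV'⟩
  · rintro s t ⟨V₁, hs, hc₁, h₁⟩ ⟨V₂, ht, hc₂, h₂⟩
    refine ⟨V₁ ⊔ V₂, Set.union_subset_union hs ht, hc₁.union hc₂, fun W' hW' hc => ?_⟩
    have hcomp : ∀ {V : X.left.Opens}, IsCompact (V : Set X.left) →
        IsCompact ((W'.ι ⁻¹ᵁ V : W'.toScheme.Opens) : Set W'.toScheme) := by
      intro V hV
      rw [W'.ι.isOpenEmbedding.isInducing.isCompact_iff]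
      change IsCompact (W'.ι '' (W'.ι ⁻¹' V))
      rw [Set.image_preimage_eq_inter_range, Scheme.Opens.range_ι, Set.inter_comm]
      exact hinter hc hV
    have hqc : QuasiCompact (restrictOpen q W').left :=
      inferInstanceAs (QuasiCompact (q.left ∣_ W'))
    refine (inverts_of_sup_eq_top (q := restrictOpen q W') (W₁ := W'.ι ⁻¹ᵁ V₁)
      (W₂ := W'.ι ⁻¹ᵁ V₂) (hcomp hc₁) (hcomp hc₂) ?_ ?_ ?_ ?_).invertsOver_of_restrictOpen
    · rw [eq_top_iff]
      exact fun x _ => hW' x.2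
    · exact (h₁ _ inf_le_right (hinter hc hc₁)).restrict
    · exact (h₂ _ inf_le_right (hinter hc hc₂)).restrict
    · exact (h₁ _ (inf_le_right.trans inf_le_left)
        (hinter hc (hinter hc₁ hc₂))).restrict (W' := V₁ ⊓ V₂)
  · intro x _
    obtain ⟨V, hxV, hV⟩ := h x
    exact ⟨V, mem_nhdsWithin_of_mem_nhds (V.2.mem_nhds hxV), V, subset_rfl, hV⟩

end CohomologyTheory

namespace BigModule

variable {S : Scheme.{u}} {M : BigModule S}

/-- The scheme `P` over `G` parametrizes the sections of the subsheaf `U` on which the functional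
`f` takes the value one. -/
structure IsUnitSections {G P : Over S} (U : M.SubSheaf G) (f : M.Functional G) (π : P ⟶ G)
    (w : M.sec P) : Prop where
  mem : w ∈ U.sec π
  app_eq_one : f.app π w = 1
  existsUnique : ∀ {T : Over S} (g : T ⟶ G) (v : M.sec T), v ∈ U.sec g → f.app g v = 1 →
    ∃! h : T ⟶ P, h ≫ π = g ∧ M.res h w = v

namespace IsUnitSections

variable {G P : Over S} {U : M.SubSheaf G} {f : M.Functional G} {π : P ⟶ G} {w : M.sec P}

lemma hom_ext (hP : IsUnitSections U f π w) {T : Over S} {h h' : T ⟶ P} (h1 : h ≫ π = h' ≫ π)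
    (h2 : M.res h w = M.res h' w) : h = h' := by
  refine (hP.existsUnique (h' ≫ π) (M.res h' w) (U.res_mem _ _ _ hP.mem) ?_).unique ⟨h1, h2⟩
    ⟨rfl, rfl⟩
  rw [f.app_res, hP.app_eq_one, map_one]

lemma restrict (hP : IsUnitSections U f π w) {G' P' : Over S} {i : G' ⟶ G} {i' : P' ⟶ P}
    {π' : P' ⟶ G'} (hi : ∀ {T : Over S} (a b : T ⟶ G'), a ≫ i = b ≫ i → a = b)
    (hi' : ∀ {T : Over S} (a b : T ⟶ P'), a ≫ i' = b ≫ i' → a = b) (h : π' ≫ i = i' ≫ π)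
    (hl : ∀ {T : Over S} (a : T ⟶ G') (b : T ⟶ P), a ≫ i = b ≫ π → ∃ c : T ⟶ P', c ≫ i' = b) :
    IsUnitSections (U.pull i) (f.pull i) π' (M.res i' w) where
  mem := by
    change _ ∈ U.sec (π' ≫ i)
    rw [h]
    exact U.res_mem _ _ _ hP.mem
  app_eq_one := by
    change f.app (π' ≫ i) _ = _
    rw [h, f.app_res, hP.app_eq_one, map_one]
  existsUnique {T} g v hv hfv := by
    obtain ⟨b, ⟨hb, hb'⟩, -⟩ := hP.existsUnique (g ≫ i) v hv hfv
    obtain ⟨c, rfl⟩ := hl g b hb.symm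
    refine ⟨c, ⟨hi _ _ ?_, ?_⟩, fun c' ⟨h1, h2⟩ => hi' _ _ (hP.hom_ext ?_ ?_)⟩
    · rw [Category.assoc, h, ← Category.assoc, hb]
    · rw [← M.res_comp, hb']
    · rw [Category.assoc, ← h, ← Category.assoc, h1, hb]
    · rw [hb', M.res_comp, h2]

end IsUnitSections

end BigModule

namespace CohomologyTheory

variable (A : CohomologyTheory.{w} h𝒱) {S : Over k} {M : BigModule S.left} {G P : Over S.left}
  {U : M.SubSheaf G} {f : M.Functional G} {π : P ⟶ G} {w : M.sec P}

/-- On the segment `(1 - t) v + t w` the functional keeps the value one, so this segment contracts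
`P` to the section given by `v`. -/
lemma inverts_of_isUnitSections_of_section (hP : IsUnitSections U f π w) {v : M.sec G}
    (hv : v ∈ U.sec (𝟙 G)) (hfv : f.app (𝟙 G) v = 1) : A.Inverts (toBaseMap S π) := by
  obtain ⟨s, ⟨hs, hsv⟩, -⟩ := hP.existsUnique (𝟙 G) v hv hfv
  let p : affineLine P ⟶ P := affineLineProj P
  let t : Fun (affineLine P) := lineCoord P
  have hmem : ∀ {T : Over S.left} (g : T ⟶ G), M.res g v ∈ U.sec g ∧ f.app g (M.res g v) = 1 := by
    intro T g
    have h1 := U.res_mem g _ _ hv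
    have h2 := f.app_res g (𝟙 G) v
    rw [Category.comp_id] at h1 h2
    exact ⟨h1, by rw [h2, hfv, map_one]⟩
  have hmem' : M.res p w ∈ U.sec (p ≫ π) ∧ f.app (p ≫ π) (M.res p w) = 1 :=
    ⟨U.res_mem _ _ _ hP.mem, by rw [f.app_res, hP.app_eq_one, map_one]⟩
  obtain ⟨H, ⟨hH, hHw⟩, -⟩ := hP.existsUnique (p ≫ π) ((1 - t) • M.res (p ≫ π) v + t • M.res p w)
    (Submodule.add_mem _ (Submodule.smul_mem _ _ (hmem _).1) (Submodule.smul_mem _ _ hmem'.1)) (by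
      rw [map_add, map_smul, map_smul, (hmem _).2, hmem'.2, smul_eq_mul, smul_eq_mul]
      ring)
  obtain ⟨s₀, ⟨h₀, ht₀⟩, -⟩ := existsUnique_hom_affineLine (𝟙 P) 0
  obtain ⟨s₁, ⟨h₁, ht₁⟩, -⟩ := existsUnique_hom_affineLine (𝟙 P) 1
  have h₀' : s₀ ≫ p = 𝟙 P := h₀
  have h₁' : s₁ ≫ p = 𝟙 P := h₁
  refine A.inverts_of_homotopy π s hs H s₀ s₁ h₀ h₁ (hP.hom_ext ?_ ?_) (hP.hom_ext ?_ ?_)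
  · rw [Category.assoc, hH, reassoc_of% h₀', Category.assoc, hs, Category.comp_id]
  · rw [M.res_comp, hHw, map_add, M.res_smul, M.res_smul, ← M.res_comp, ← M.res_comp,
      reassoc_of% h₀', map_sub, map_one, ht₀, sub_zero, one_smul, zero_smul, add_zero, M.res_comp,
      hsv]
  · rw [Category.assoc, hH, reassoc_of% h₁', Category.id_comp]
  · rw [M.res_comp, hHw, map_add, M.res_smul, M.res_smul, ← M.res_comp, ← M.res_comp,
      h₁', map_sub, map_one, ht₁, sub_self, one_smul, zero_smul, zero_add]

/-- Homotopy invariance for affine bundles of unit sections. -/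
theorem invertsOver_of_isUnitSections (hG : 𝒱 (toBase S G)) (hπ : IsAffineHom π.left)
    (hP : IsUnitSections U f π w)
    (h : ∀ x : G.left, ∃ W : G.left.Opens, x ∈ W ∧ ∃ v ∈ U.sec (openIncl G W),
      f.app (openIncl G W) v = 1) (W : G.left.Opens) (hW : IsCompact (W : Set G.left)) :
    A.InvertsOver (toBaseMap S π) W := by
  have hqc : QuasiCompact (toBaseMap S π).left := inferInstanceAs (QuasiCompact π.left)
  refine invertsOver_of_local hG (toBaseMap S π) (fun x => ?_) W hW
  obtain ⟨W₀, hx, v, hv, hfv⟩ := h x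
  obtain ⟨W₁, hW₁, hx₁, hle⟩ := exists_isAffineOpen_mem_and_subset (x := x) (U := W₀) hx
  -- The unit section over `W₀` restricts to every open subset `W'` of `W₁`, so the bundle is
  -- contractible over each of them and the local criterion applies.
  refine ⟨W₁, hx₁, hW₁.isCompact, fun W' hW' _ => ?_⟩
  obtain ⟨j, hj⟩ := exists_openSub_le (T := G) (hW'.trans hle)
  let i : openSub G W' ⟶ G := openIncl G W'
  let i' : openSub P (π.left ⁻¹ᵁ W') ⟶ P := openIncl P (π.left ⁻¹ᵁ W')
  have hii : IsOpenImmersion i.left := inferInstanceAs (IsOpenImmersion W'.ι)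
  have hii' : IsOpenImmersion i'.left := inferInstanceAs (IsOpenImmersion (π.left ⁻¹ᵁ W').ι)
  have hmi : Mono i := (Over.forget _).mono_of_mono_map (inferInstanceAs (Mono i.left))
  have hmi' : Mono i' := (Over.forget _).mono_of_mono_map (inferInstanceAs (Mono i'.left))
  let π' : openSub P (π.left ⁻¹ᵁ W') ⟶ openSub G W' := restrictOpen π W'
  have hsq : π' ≫ i = i' ≫ π := restrictOpen_openIncl π W'
  have hP' := hP.restrict (i := i) (i' := i') (π' := π') (fun a b => (cancel_mono i).1)
    (fun a b => (cancel_mono i').1) hsq fun {T} a b hab => exists_lift_openSub _ b fun t => by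
      have h1 := openIncl_mem a t
      rw [show a ≫ openIncl G W' = b ≫ π from hab] at h1
      exact h1
  have hv' : M.res j v ∈ (U.pull i).sec (𝟙 _) := by
    have h1 := U.res_mem j _ _ hv
    rw [hj] at h1
    change _ ∈ U.sec (𝟙 _ ≫ i)
    rwa [Category.id_comp]
  have hfv' : (f.pull i).app (𝟙 _) (M.res j v) = 1 := by
    have h1 := f.app_res j (openIncl G W₀) v
    rw [hj, hfv, map_one] at h1
    change f.app (𝟙 _ ≫ i) _ = _
    rwa [Category.id_comp]
  refine (A.inverts_of_isUnitSections_of_section hP' hv' hfv').invertsOver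
    (j := toBaseMap S i) (j' := toBaseMap S i') (hj := hii) (hj' := hii') (range_openIncl G W') (range_openIncl P _)
    (by rw [← Functor.map_comp, ← Functor.map_comp, hsq])

end CohomologyTheory

end QuatGrass

/-! ### Symplectic subbundles of `𝒪 ⊕ M ⊕ 𝒪` containing `(a, x, 1)` -/

namespace QuatGrass

namespace BigModule

section Algebra

variable {R N : Type*} [CommRing R] [AddCommGroup N] [Module R N] (f : N →ₗ[R] N →ₗ[R] R)

lemma hypForm_apply (v v' : R × N × R) :
    hypForm f v v' = v.1 * v'.2.2 + f v.2.1 v'.2.1 - v.2.2 * v'.1 := rfl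

/-- The embedding of `N` as the vectors of `N ⊕ R` orthogonal to `(a, x, 1)`. -/
def hypEmb (x : N) : N →ₗ[R] R × N × R :=
  (f x).prod (LinearMap.id.prod 0)

lemma hypEmb_apply (x z : N) : hypEmb f x z = (f x z, z, 0) := rfl

/-- The coefficient of `(1 + f x y, y, 0)` with respect to the decomposition of `R ⊕ N ⊕ R` as the
sum of the lines spanned by `(a, x, 1)` and `(1 + f x y, y, 0)` and the image of `hypEmb f x`. -/
def hypCoeff (a : R) (x : N) : R × N × R →ₗ[R] R where
  toFun v := v.1 - v.2.2 * a - f x v.2.1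
  map_add' v v' := by simp; ring
  map_smul' c v := by simp; ring

lemma hypCoeff_apply (a : R) (x : N) (v : R × N × R) :
    hypCoeff f a x v = v.1 - v.2.2 * a - f x v.2.1 := rfl

/-- The component in `N` with respect to the same decomposition. -/
def hypShear (a : R) (x y : N) : R × N × R →ₗ[R] N where
  toFun v := v.2.1 - v.2.2 • x - hypCoeff f a x v • y
  map_add' v v' := by
    rw [map_add, add_smul, Prod.snd_add, Prod.snd_add, Prod.fst_add, add_smul]; abel
  map_smul' c v := by
    simp only [map_smul, Prod.smul_snd, Prod.smul_fst, smul_assoc, smul_sub, RingHom.id_apply]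

lemma hypShear_apply (a : R) (x y : N) (v : R × N × R) :
    hypShear f a x y v = v.2.1 - v.2.2 • x - hypCoeff f a x v • y := rfl

variable {f} (hf : ∀ x, f x x = 0) (a : R) (x y z z' : N)

lemma alt_neg (hf : ∀ x, f x x = 0) (x y : N) : f x y = - f y x := by
  have h := hf (x + y)
  simp only [map_add, LinearMap.add_apply, hf, zero_add, add_zero] at h
  exact eq_neg_of_add_eq_zero_right h

/-- The other two summands have last component zero, which determines the coefficient of `(a, x,
1)`. On vectors `(α, z, 0)` the expression `α - f x z` vanishes on the image of `hypEmb f x` and is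
one on `(1 + f x y, y, 0)`, which determines the second coefficient. -/
lemma hyp_decomp (hf : ∀ x, f x x = 0) (v : R × N × R) :
    v = v.2.2 • (a, x, 1) + hypCoeff f a x v • (1 + f x y, y, 0) +
      hypEmb f x (hypShear f a x y v) := by
  have h1 : f x (hypShear f a x y v) = f x v.2.1 - hypCoeff f a x v * f x y := by
    rw [hypShear_apply, map_sub, map_sub, map_smul, map_smul, hf, smul_zero, sub_zero, smul_eq_mul]
  refine Prod.ext ?_ (Prod.ext ?_ ?_)
  · change v.1 = v.2.2 * a + hypCoeff f a x v * (1 + f x y) + f x (hypShear f a x y v)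
    rw [h1, hypCoeff_apply]
    ring
  · change v.2.1 = v.2.2 • x + hypCoeff f a x v • y + hypShear f a x y v
    rw [hypShear_apply]
    abel
  · simp [hypEmb_apply]

lemma hypCoeff_emb : hypCoeff f a x (hypEmb f x z) = 0 := by
  simp [hypCoeff_apply, hypEmb_apply]

lemma hypCoeff_unit (hf : ∀ x, f x x = 0) : hypCoeff f a x (a, x, 1) = 0 := by
  simp [hypCoeff_apply, hf]

lemma hypCoeff_dual : hypCoeff f a x (1 + f x y, y, 0) = 1 := by
  simp [hypCoeff_apply]

lemma hypShear_emb : hypShear f a x y (hypEmb f x z) = z := by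
  rw [hypShear_apply, hypCoeff_emb]
  simp [hypEmb_apply]

lemma hypShear_unit (hf : ∀ x, f x x = 0) : hypShear f a x y (a, x, 1) = 0 := by
  rw [hypShear_apply, hypCoeff_unit a x hf]
  simp

lemma hypShear_dual : hypShear f a x y (1 + f x y, y, 0) = 0 := by
  rw [hypShear_apply, hypCoeff_dual]
  simp

lemma hypForm_emb_emb : hypForm f (hypEmb f x z) (hypEmb f x z') = f z z' := by
  simp [hypForm_apply, hypEmb_apply]

lemma hypForm_unit_emb : hypForm f (a, x, 1) (hypEmb f x z) = 0 := by
  simp [hypForm_apply, hypEmb_apply]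

lemma hypForm_dual_emb : hypForm f (1 + f x y, y, 0) (hypEmb f x z) = f y z := by
  simp [hypForm_apply, hypEmb_apply]

lemma hypForm_alt (hf : ∀ x, f x x = 0) (v : R × N × R) : hypForm f v v = 0 := by
  rw [hypForm_apply, hf]
  ring

lemma hypForm_dual_unit (hf : ∀ x, f x x = 0) : hypForm f (1 + f x y, y, 0) (a, x, 1) = 1 := by
  simp [hypForm_apply, alt_neg hf y x]

/-- A submodule which is the inverse image of `U'` under `hypShear` is isomorphic to
`R ⊕ R ⊕ U'`. -/
lemma finrank_hypShear (hf : ∀ x, f x x = 0) (hR : IsField R) [Module.Finite R N]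
    {U : Submodule R (R × N × R)} {U' : Submodule R N}
    (h : ∀ v, v ∈ U ↔ hypShear f a x y v ∈ U') :
    Module.finrank R U = Module.finrank R U' + 2 := by
  let e : U ≃ₗ[R] R × R × U' :=
    { toFun := fun v => (v.1.2.2, hypCoeff f a x v.1, ⟨hypShear f a x y v.1, (h v.1).1 v.2⟩)
      map_add' := fun v v' => by
        refine Prod.ext rfl (Prod.ext (map_add _ _ _) (Subtype.ext (map_add _ _ _)))
      map_smul' := fun c v => by
        refine Prod.ext rfl (Prod.ext (map_smul _ _ _) (Subtype.ext (map_smul _ _ _)))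
      invFun := fun v => ⟨v.1 • (a, x, 1) + v.2.1 • (1 + f x y, y, 0) + hypEmb f x v.2.2.1, by
        rw [h, map_add, map_add, map_smul, map_smul, hypShear_unit a x y hf, hypShear_dual,
          hypShear_emb, smul_zero, smul_zero, zero_add, zero_add]
        exact v.2.2.2⟩
      left_inv := fun v => Subtype.ext (hyp_decomp a x y hf v.1).symm
      right_inv := fun v => by
        refine Prod.ext ?_ (Prod.ext ?_ (Subtype.ext ?_))
        · simp [hypEmb_apply]
        · change hypCoeff f a x _ = _
          rw [map_add, map_add, map_smul, map_smul, hypCoeff_unit a x hf, hypCoeff_dual,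
            hypCoeff_emb]
          simp
        · change hypShear f a x y _ = _
          rw [map_add, map_add, map_smul, map_smul, hypShear_unit a x y hf, hypShear_dual,
            hypShear_emb]
          simp }
  obtain ⟨F, rfl⟩ := exists_field_of_isField R hR
  rw [e.finrank_eq, Module.finrank_prod, Module.finrank_prod, Module.finrank_self]
  ring

/-- The orthogonal projection to the inverse image of a submodule under `hypShear`, in terms of
the orthogonal projection to the submodule. -/
def hypProj (f : N →ₗ[R] N →ₗ[R] R) (a : R) (x y : N) (p : N →ₗ[R] N) : R × N × R →ₗ[R] R × N × R where
  toFun v := (v.2.2 + f y (hypShear f a x y v)) • (a, x, 1) +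
    hypCoeff f a x v • (1 + f x y, y, 0) + hypEmb f x (p (hypShear f a x y v))
  map_add' v v' := by
    simp only [map_add, Prod.snd_add, add_smul]
    abel
  map_smul' c v := by
    simp only [map_smul, Prod.smul_snd, smul_eq_mul, RingHom.id_apply, smul_add, ← mul_smul,
      ← mul_add]

lemma hypProj_apply (p : N →ₗ[R] N) (v : R × N × R) :
    hypProj f a x y p v = (v.2.2 + f y (hypShear f a x y v)) • (a, x, 1) +
      hypCoeff f a x v • (1 + f x y, y, 0) + hypEmb f x (p (hypShear f a x y v)) := rfl

lemma hypShear_proj (hf : ∀ x, f x x = 0) (p : N →ₗ[R] N) (v : R × N × R) :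
    hypShear f a x y (hypProj f a x y p v) = p (hypShear f a x y v) := by
  rw [hypProj_apply, map_add, map_add, map_smul, map_smul, hypShear_unit a x y hf, hypShear_dual,
    hypShear_emb, smul_zero, smul_zero, zero_add, zero_add]

/-- For `s = hypShear f a x y v` outside `U'` the vector `(1 + f x y, y, 0)` need not be orthogonal
to `hypEmb f x s`. The extra term `f y s` in the coefficient of `(a, x, 1)` compensates for this. -/
lemma hypForm_proj (hf : ∀ x, f x x = 0) (p : N →ₗ[R] N) {U' : Submodule R N}
    (hy : ∀ z ∈ U', f y z = 0) (hp : ∀ z, p z ∈ U') (hpf : ∀ z, ∀ z' ∈ U', f (p z) z' = f z z')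
    (v v' : R × N × R) (hv' : hypShear f a x y v' ∈ U') :
    hypForm f (hypProj f a x y p v) v' = hypForm f v v' := by
  rw [← sub_eq_zero, ← LinearMap.sub_apply, ← map_sub]
  have h : hypProj f a x y p v - v = f y (hypShear f a x y v) • (a, x, 1) +
      hypEmb f x (p (hypShear f a x y v) - hypShear f a x y v) := by
    rw [hypProj_apply, add_smul, map_sub, sub_eq_iff_eq_add]
    refine Eq.trans ?_ (congrArg (_ + ·) (hyp_decomp a x y hf v).symm)
    abel
  have hneg := alt_neg (hypForm_alt hf)
  have h2 : hypForm f (a, x, 1) (1 + f x y, y, 0) = -1 := by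
    rw [hneg, hypForm_dual_unit a x y hf]
  have h3 : ∀ z, hypForm f (hypEmb f x z) (a, x, 1) = 0 := fun z => by
    rw [hneg, hypForm_unit_emb, neg_zero]
  have h4 : ∀ z, hypForm f (hypEmb f x z) (1 + f x y, y, 0) = - f y z := fun z => by
    rw [hneg, hypForm_dual_emb]
  rw [h, hyp_decomp a x y hf v']
  simp only [map_add, map_smul, LinearMap.add_apply, LinearMap.smul_apply, hypForm_alt hf,
    hypForm_unit_emb, hypForm_emb_emb, h2, h3, h4, smul_eq_mul, map_sub, LinearMap.sub_apply,
    hy _ (hp _), hpf _ _ hv']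
  ring

end Algebra

section Lift

variable {S : Scheme.{u}} {M : BigModule S} {φ : M.AltForm} {T N N' : Over S} {m d : ℕ}

lemma SubSheaf.res_mem_of_id {U : M.SubSheaf T} {v : M.sec T} (hv : v ∈ U.sec (𝟙 T)) (h : N ⟶ T) :
    M.res h v ∈ U.sec h := by
  have := U.res_mem h _ _ hv
  rwa [Category.comp_id] at this

lemma IsVectorBundle.finite_pt (hM : M.IsVectorBundle d) (T : Over S) (t : T.left) :
    Module.Finite (Fun (pt T t)) (M.sec (pt T t)) := by
  obtain ⟨W, hW, b, hb⟩ := hM.exists_basis T t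
  obtain ⟨h, -⟩ := exists_lift_pt W t hW
  exact Module.Finite.of_basis (hb.comp_res h).basis

/-- A section of `𝒪 ⊕ M ⊕ 𝒪`. -/
def vec (a : Fun T) (x : M.sec T) (b : Fun T) : M.hyp.sec T := (a, x, b)

lemma res_vec (h : N ⟶ T) (a : Fun T) (x : M.sec T) (b : Fun T) :
    M.hyp.res h (vec a x b) = vec (resFun h a) (M.res h x) (resFun h b) := rfl

lemma hyp_form_vec (φ : M.AltForm) (a a' : Fun T) (x x' : M.sec T) (b b' : Fun T) :
    φ.hyp.form T (vec a x b) (vec a' x' b') = a * b' + φ.form T x x' - b * a' := rfl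

namespace AltForm

variable (φ)

/-- The embedding of `M` as the vectors of `M ⊕ 𝒪` orthogonal to `(a, x, 1)`. -/
def emb (x : M.sec T) : M.sec T →ₗ[Fun T] M.hyp.sec T := hypEmb (φ.form T) x

/-- The coefficient of `(1 + φ(x, y), y, 0)` with respect to the decomposition of `𝒪 ⊕ M ⊕ 𝒪` as
the sum of the lines spanned by `(a, x, 1)` and `(1 + φ(x, y), y, 0)` and the image of `φ.emb x`. -/
def coeff (a : Fun T) (x : M.sec T) : M.hyp.sec T →ₗ[Fun T] Fun T := hypCoeff (φ.form T) a x

/-- The component in `M` with respect to the same decomposition. -/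
def shear (a : Fun T) (x y : M.sec T) : M.hyp.sec T →ₗ[Fun T] M.sec T :=
  hypShear (φ.form T) a x y

/-- The vector orthogonal to the image of `φ.emb x` if `y` is zero. -/
def dual (x y : M.sec T) : M.hyp.sec T := vec (1 + φ.form T x y) y 0

lemma emb_apply (x z : M.sec T) : φ.emb x z = vec (φ.form T x z) z 0 := rfl

lemma decomp (a : Fun T) (x y : M.sec T) (v : M.hyp.sec T) :
    v = v.2.2 • vec a x 1 + φ.coeff a x v • φ.dual x y + φ.emb x (φ.shear a x y v) :=
  hyp_decomp a x y (φ.alt T) v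

lemma emb_res (h : N ⟶ T) (x z : M.sec T) :
    φ.emb (M.res h x) (M.res h z) = M.hyp.res h (φ.emb x z) := by
  rw [emb_apply, emb_apply, res_vec, φ.res_form, map_zero]

lemma coeff_res (h : N ⟶ T) (a : Fun T) (x : M.sec T) (v : M.hyp.sec T) :
    φ.coeff (resFun h a) (M.res h x) (M.hyp.res h v) = resFun h (φ.coeff a x v) := by
  change resFun h v.1 - resFun h v.2.2 * resFun h a - φ.form N (M.res h x) (M.res h v.2.1) =
    resFun h (v.1 - v.2.2 * a - φ.form T x v.2.1)
  rw [map_sub, map_sub, map_mul, φ.res_form]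

lemma shear_res (h : N ⟶ T) (a : Fun T) (x y : M.sec T) (v : M.hyp.sec T) :
    φ.shear (resFun h a) (M.res h x) (M.res h y) (M.hyp.res h v) = M.res h (φ.shear a x y v) := by
  change M.res h v.2.1 - resFun h v.2.2 • M.res h x -
    φ.coeff (resFun h a) (M.res h x) (M.hyp.res h v) • M.res h y =
      M.res h (v.2.1 - v.2.2 • x - φ.coeff a x v • y)
  rw [coeff_res, map_sub, map_sub, M.res_smul, M.res_smul]

lemma dual_res (h : N ⟶ T) (x y : M.sec T) :
    φ.dual (M.res h x) (M.res h y) = M.hyp.res h (φ.dual x y) := by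
  rw [dual, dual, res_vec, φ.res_form, map_add, map_one, map_zero]

/-- The orthogonal projection to the inverse image of a subbundle under `φ.shear a x y`, in terms
of the orthogonal projection to the subbundle. -/
def shearProj (a : Fun T) (x y : M.sec T) (p : M.sec T →ₗ[Fun T] M.sec T) :
    M.hyp.sec T →ₗ[Fun T] M.hyp.sec T := hypProj (φ.form T) a x y p

lemma shearProj_apply (a : Fun T) (x y : M.sec T) (p : M.sec T →ₗ[Fun T] M.sec T)
    (v : M.hyp.sec T) : φ.shearProj a x y p v =
      (v.2.2 + φ.form T y (φ.shear a x y v)) • vec a x 1 + φ.coeff a x v • φ.dual x y +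
        φ.emb x (p (φ.shear a x y v)) := rfl

lemma hyp_form_emb_emb (x z z' : M.sec T) :
    φ.hyp.form T (φ.emb x z) (φ.emb x z') = φ.form T z z' := hypForm_emb_emb x z z'

lemma hyp_form_vec_emb (a : Fun T) (x z : M.sec T) :
    φ.hyp.form T (vec a x 1) (φ.emb x z) = 0 := hypForm_unit_emb a x z

lemma hyp_form_dual_emb (x y z : M.sec T) :
    φ.hyp.form T (φ.dual x y) (φ.emb x z) = φ.form T y z := hypForm_dual_emb x y z

lemma shear_emb (a : Fun T) (x y z : M.sec T) : φ.shear a x y (φ.emb x z) = z :=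
  hypShear_emb a x y z

end AltForm

/-- The subsheaf of `𝒪 ⊕ M ⊕ 𝒪` which is the sum of the lines spanned by `(a, x, 1)` and
`(1 + φ(x, y), y, 0)` and of the vectors `(φ(x, z), z, 0)` with `z` in `U'`. -/
def SubSheaf.hypLift (φ : M.AltForm) (U' : M.SubSheaf T) (a : Fun T) (x y : M.sec T) :
    M.hyp.SubSheaf T where
  sec h := (U'.sec h).comap (φ.shear (resFun h a) (M.res h x) (M.res h y))
  res_mem g h v hv := by
    rw [Submodule.mem_comap, resFun_comp, M.res_comp, M.res_comp, φ.shear_res]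
    exact U'.res_mem g h _ hv
  local_mem {N} h v hv := U'.local_mem h _ fun t => by
    obtain ⟨W, htW, hW⟩ := hv t
    refine ⟨W, htW, ?_⟩
    rwa [Submodule.mem_comap, resFun_comp, M.res_comp, M.res_comp, φ.shear_res] at hW

lemma SubSheaf.mem_hypLift {U' : M.SubSheaf T} {a : Fun T} {x y : M.sec T} {h : N ⟶ T}
    {v : M.hyp.sec N} : v ∈ (SubSheaf.hypLift φ U' a x y).sec h ↔
      φ.shear (resFun h a) (M.res h x) (M.res h y) v ∈ U'.sec h := Iff.rfl

lemma SubSheaf.hypLift_pull (U' : M.SubSheaf T) (a : Fun T) (x y : M.sec T) (h : N ⟶ T) :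
    (SubSheaf.hypLift φ U' a x y).pull h =
      SubSheaf.hypLift φ (U'.pull h) (resFun h a) (M.res h x) (M.res h y) := by
  ext N' g v
  change φ.shear (resFun (g ≫ h) a) (M.res (g ≫ h) x) (M.res (g ≫ h) y) v ∈ U'.sec (g ≫ h) ↔
    φ.shear (resFun g (resFun h a)) (M.res g (M.res h x)) (M.res g (M.res h y)) v ∈
      U'.sec (g ≫ h)
  rw [resFun_comp, M.res_comp, M.res_comp]

lemma SubSheaf.unit_mem_hypLift (U' : M.SubSheaf T) (a : Fun T) (x y : M.sec T) :
    vec a x 1 ∈ (SubSheaf.hypLift φ U' a x y).sec (𝟙 T) := by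
  rw [SubSheaf.mem_hypLift, resFun_id, M.res_id, M.res_id,
    show φ.shear a x y (vec a x 1) = 0 from hypShear_unit a x y (φ.alt T)]
  exact Submodule.zero_mem _

/-- The lift of a symplectic subbundle is a symplectic subbundle. -/
theorem SubSheaf.hypLift_isSymplectic (hM : M.IsVectorBundle d) (hφ : φ.IsNondegenerate)
    {U' : M.SubSheaf T} (hU' : U'.IsSubbundle m) (hs : U'.IsSymplectic φ) (a : Fun T)
    (x y : M.sec T) (hy : ∀ (N : Over S) (h : N ⟶ T), ∀ z ∈ U'.sec h, φ.form N (M.res h y) z = 0) :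
    (SubSheaf.hypLift φ U' a x y).IsSubbundle (m + 2) ∧
      (SubSheaf.hypLift φ U' a x y).IsSymplectic φ.hyp := by
  have hU's := hU'.isLocSymp hs
  obtain ⟨p, hp, hp', hpφ⟩ := hU's.exists_proj hM.isSheaf
  let P : M.hyp.Endo T :=
    { app := fun h => φ.shearProj (resFun h a) (M.res h x) (M.res h y) (p.app h)
      app_res := fun g h v => by
        rw [φ.shearProj_apply, φ.shearProj_apply, map_add, map_add, M.hyp.res_smul,
          M.hyp.res_smul, resFun_comp, M.res_comp, M.res_comp, φ.shear_res, φ.coeff_res, p.app_res,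
          φ.emb_res, φ.dual_res, φ.res_form, res_vec, map_one, map_add]
        rfl }
  have hP : ∀ (N : Over S) (h : N ⟶ T) (v : M.hyp.sec N),
      P.app h v ∈ (SubSheaf.hypLift φ U' a x y).sec h := fun N h v => by
    rw [SubSheaf.mem_hypLift, show φ.shear _ _ _ (P.app h v) = p.app h _ from
      hypShear_proj _ _ _ (φ.alt N) _ v]
    exact hp N h _
  have hP' : ∀ (N : Over S) (h : N ⟶ T) (v : M.hyp.sec N),
      v ∈ (SubSheaf.hypLift φ U' a x y).sec h → P.app h v = v := fun N h v hv => by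
    rw [SubSheaf.mem_hypLift] at hv
    refine (φ.shearProj_apply _ _ _ _ v).trans ?_
    -- On the lift the correction `φ(y, ·)` vanishes, since `y` is orthogonal to `U'`, and what
    -- remains is the decomposition of `v`.
    rw [hp' _ _ _ hv, hy _ _ _ hv, add_zero, ← φ.decomp]
  refine ⟨isSubbundle_of_proj hM.hyp P hP hP' fun t => ?_,
    isSymplectic_of_proj hφ.hyp P hP hP' fun N h v v' hv' =>
      hypForm_proj _ _ _ (φ.alt N) _ (hy N h) (hp N h) (fun z z' hz' => hpφ N h z z' hz') v v' hv'⟩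
  have := hM.finite_pt T t
  rw [← hU's.finrank_pt t]
  exact finrank_hypShear _ _ _ (φ.alt _) (isField_fun_pt T t) fun v => Iff.rfl

/-- The subsheaf of the `z` with `(φ(x, z), z, 0)` in `U`. -/
def SubSheaf.hypDescent (φ : M.AltForm) (U : M.hyp.SubSheaf T) (x : M.sec T) : M.SubSheaf T where
  sec h := (U.sec h).comap (φ.emb (M.res h x))
  res_mem g h v hv := by
    rw [Submodule.mem_comap, M.res_comp, φ.emb_res]
    exact U.res_mem g h _ hv
  local_mem {N} h v hv := U.local_mem h _ fun t => by
    obtain ⟨W, htW, hW⟩ := hv t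
    refine ⟨W, htW, ?_⟩
    rwa [Submodule.mem_comap, M.res_comp, φ.emb_res] at hW

lemma SubSheaf.mem_hypDescent {U : M.hyp.SubSheaf T} {x : M.sec T} {h : N ⟶ T} {z : M.sec N} :
    z ∈ (SubSheaf.hypDescent φ U x).sec h ↔ φ.emb (M.res h x) z ∈ U.sec h := Iff.rfl

/-- A symplectic subbundle of `𝒪 ⊕ M ⊕ 𝒪` containing `(a, x, 1)` is the lift of a symplectic
subbundle of `M`. -/
theorem SubSheaf.exists_eq_hypLift (hM : M.IsVectorBundle d) (hφ : φ.IsNondegenerate)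
    {U : M.hyp.SubSheaf T} (hU : U.IsSubbundle (m + 2)) (hs : U.IsSymplectic φ.hyp) {a : Fun T}
    {x : M.sec T} (hw : vec a x 1 ∈ U.sec (𝟙 T)) :
    (SubSheaf.hypDescent φ U x).IsSubbundle m ∧ (SubSheaf.hypDescent φ U x).IsSymplectic φ ∧
      ∃ y : M.sec T, (∀ (N : Over S) (h : N ⟶ T), ∀ z ∈ (SubSheaf.hypDescent φ U x).sec h,
        φ.form N (M.res h y) z = 0) ∧
      SubSheaf.hypLift φ (SubSheaf.hypDescent φ U x) a x y = U := by
  have hUs := hU.isLocSymp hs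
  -- `v₀` represents the last coordinate on `U`. Pairing it with itself gives last component zero,
  -- and pairing it with `(a, x, 1)` gives first component `1 + φ(x, y)`.
  obtain ⟨v₀, hv₀, hv₀'⟩ := hUs.exists_repr (isSheaf_hyp hM.isSheaf) (M.last T)
  obtain ⟨P, hP, hP', hPφ⟩ := hUs.exists_proj (isSheaf_hyp hM.isSheaf)
  obtain ⟨y, rfl⟩ : ∃ y, v₀ = φ.dual x y := by
    have h1 := hv₀' T (𝟙 T) v₀ hv₀
    have h2 := hv₀' T (𝟙 T) _ hw
    rw [M.hyp.res_id] at h1 h2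
    rw [φ.hyp.alt] at h1
    replace h1 : 0 = v₀.2.2 := h1
    replace h2 : v₀.1 * 1 + φ.form T v₀.2.1 x - v₀.2.2 * a = 1 := h2
    refine ⟨v₀.2.1, Prod.ext ?_ (Prod.ext rfl h1.symm)⟩
    change v₀.1 = 1 + φ.form T x v₀.2.1
    rw [φ.neg v₀.2.1 x, ← h1] at h2
    linear_combination h2
  have hdual : ∀ {N : Over S} (h : N ⟶ T), φ.dual (M.res h x) (M.res h y) ∈ U.sec h :=
    fun {N} h => φ.dual_res h x y ▸ U.res_mem_of_id hv₀ h
  have hunit : ∀ {N : Over S} (h : N ⟶ T), vec (resFun h a) (M.res h x) 1 ∈ U.sec h :=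
    fun {N} h => by
      have h1 := U.res_mem_of_id hw h
      rwa [res_vec, map_one] at h1
  have hmem : ∀ {N : Over S} (h : N ⟶ T) (v : M.hyp.sec N), v ∈ U.sec h ↔
      φ.shear (resFun h a) (M.res h x) (M.res h y) v ∈ (SubSheaf.hypDescent φ U x).sec h :=
    fun {N} h v => by
      rw [SubSheaf.mem_hypDescent]
      have h1 := φ.decomp (resFun h a) (M.res h x) (M.res h y) v
      have h2 := Submodule.add_mem (U.sec h) (Submodule.smul_mem _ v.2.2 (hunit h))
        (Submodule.smul_mem _ (φ.coeff (resFun h a) (M.res h x) v) (hdual h))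
      constructor
      · intro hv
        rw [h1] at hv
        exact (Submodule.add_mem_iff_right _ h2).1 hv
      · intro hv
        rw [h1]
        exact (Submodule.add_mem_iff_right _ h2).2 hv
  have hperp : ∀ (N : Over S) (h : N ⟶ T), ∀ z ∈ (SubSheaf.hypDescent φ U x).sec h,
      φ.form N (M.res h y) z = 0 := fun N h z hz => by
    have h1 := hv₀' N h _ hz
    rw [← φ.dual_res, φ.hyp_form_dual_emb] at h1
    exact h1
  -- The projector embeds `z`, projects to `U` and takes the component in `M`. The components along
  -- the two lines are orthogonal to the embedded descent, so self-adjointness is inherited from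
  -- `P`.
  let p : M.Endo T :=
    { app := fun h => (φ.shear (resFun h a) (M.res h x) (M.res h y)).comp
        ((P.app h).comp (φ.emb (M.res h x)))
      app_res := fun g h z => by
        rw [LinearMap.comp_apply, LinearMap.comp_apply, LinearMap.comp_apply, LinearMap.comp_apply,
          resFun_comp, M.res_comp, M.res_comp, φ.emb_res, P.app_res, φ.shear_res] }
  have hp : ∀ (N : Over S) (h : N ⟶ T) (z : M.sec N),
      p.app h z ∈ (SubSheaf.hypDescent φ U x).sec h := fun N h z => (hmem h _).1 (hP _ _ _)
  have hp' : ∀ (N : Over S) (h : N ⟶ T) (z : M.sec N),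
      z ∈ (SubSheaf.hypDescent φ U x).sec h → p.app h z = z := fun N h z hz => by
    change φ.shear _ _ _ (P.app h (φ.emb _ z)) = z
    rw [hP' N h _ hz, φ.shear_emb]
  refine ⟨isSubbundle_of_proj hM p hp hp' fun t => ?_,
    isSymplectic_of_proj hφ p hp hp' fun N h z z' hz' => ?_, y, hperp,
    SubSheaf.ext (by funext N h; ext v; exact (hmem h v).symm)⟩
  · have := hM.finite_pt T t
    have h1 := finrank_hypShear _ _ _ (φ.alt _) (isField_fun_pt T t) (hmem (ptIncl T t))
    have h2 := hUs.finrank_pt t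
    exact Nat.add_right_cancel (h1.symm.trans h2)
  · have h1 := hPφ N h (φ.emb (M.res h x) z) _ hz'
    rw [φ.hyp_form_emb_emb, φ.decomp (resFun h a) (M.res h x) (M.res h y)
      (P.app h (φ.emb (M.res h x) z)), map_add, map_add, map_smul, map_smul, LinearMap.add_apply,
      LinearMap.add_apply, LinearMap.smul_apply, LinearMap.smul_apply, φ.hyp_form_vec_emb,
      φ.hyp_form_dual_emb, hperp N h z' hz', φ.hyp_form_emb_emb, smul_zero, smul_zero, zero_add,
      zero_add] at h1
    exact h1

end Lift

end BigModule

end QuatGrass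

/-! ### Graphs over symplectic subbundles; the closed set `N⁺`; total spaces -/

namespace QuatGrass

lemma bijective_of_equiv {R V V' : Type*} [CommRing R] [AddCommGroup V] [Module R V]
    [AddCommGroup V'] [Module R V'] (e : V ≃ₗ[R] V') {B : V →ₗ[R] V →ₗ[R] R}
    {B' : V' →ₗ[R] V' →ₗ[R] R} (h : ∀ x y, B' (e x) (e y) = B x y) (hB : Function.Bijective B) :
    Function.Bijective B' := by
  refine ⟨(injective_iff_map_eq_zero _).2 fun x hx => ?_, fun l => ?_⟩
  · obtain ⟨x, rfl⟩ := e.surjective x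
    rw [(injective_iff_map_eq_zero _).1 hB.1 x (LinearMap.ext fun y => ?_), map_zero]
    rw [← h, hx]
    rfl
  · obtain ⟨x, hx⟩ := hB.2 (l ∘ₗ e.toLinearMap)
    refine ⟨e x, LinearMap.ext fun y => ?_⟩
    obtain ⟨y, rfl⟩ := e.surjective y
    rw [h, hx]
    rfl

namespace BigModule

variable {S : Scheme.{u}} {M : BigModule S} {φ : M.AltForm} {T N N' : Over S} {m d : ℕ}

section Graph

/-- The component in `M` of a section of `𝒪 ⊕ M ⊕ 𝒪`. -/
def mid (T : Over S) : M.hyp.sec T →ₗ[Fun T] M.sec T :=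
  (LinearMap.fst (Fun T) (M.sec T) (Fun T)).comp
    (LinearMap.snd (Fun T) (Fun T) (M.sec T × Fun T))

lemma mid_res (h : N ⟶ T) (v : M.hyp.sec T) : mid N (M.hyp.res h v) = M.res h (mid T v) := rfl

/-- The form on `𝒪 ⊕ M ⊕ 𝒪` induced by a form on `M`. -/
def AltForm.comap (φ : M.AltForm) : M.hyp.AltForm where
  form T := (φ.form T).compl₁₂ (mid T) (mid T)
  alt T _ := φ.alt T _
  res_form h _ _ := φ.res_form h _ _

lemma AltForm.comap_form (φ : M.AltForm) (v v' : M.hyp.sec T) :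
    φ.comap.form T v v' = φ.form T (mid T v) (mid T v') := rfl

/-- The section of `𝒪 ⊕ M ⊕ 𝒪` with component `z` in the graph of `(φ(x, ·), φ(y, ·))`. -/
def AltForm.graphVec (φ : M.AltForm) (x y : M.sec T) : M.sec T →ₗ[Fun T] M.hyp.sec T :=
  (φ.form T x).prod (LinearMap.id.prod (φ.form T y))

lemma AltForm.graphVec_apply (φ : M.AltForm) (x y z : M.sec T) :
    φ.graphVec x y z = vec (φ.form T x z) z (φ.form T y z) := rfl

lemma AltForm.graphVec_res (φ : M.AltForm) (h : N ⟶ T) (x y z : M.sec T) :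
    φ.graphVec (M.res h x) (M.res h y) (M.res h z) = M.hyp.res h (φ.graphVec x y z) := by
  rw [graphVec_apply, graphVec_apply, res_vec, φ.res_form, φ.res_form]

/-- The graph of `(φ(x, ·), φ(y, ·))` over a subsheaf of `M`. -/
def SubSheaf.graph (φ : M.AltForm) (hM : Presieve.IsSheaf (Scheme.zariskiTopology.over S) M.toFunctor)
    (U' : M.SubSheaf T) (x y : M.sec T) : M.hyp.SubSheaf T where
  sec {N} h := (U'.sec h).map (φ.graphVec (M.res h x) (M.res h y))
  res_mem := by
    rintro N' N g h _ ⟨z, hz, rfl⟩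
    refine ⟨M.res g z, U'.res_mem g h z hz, ?_⟩
    rw [M.res_comp, M.res_comp, φ.graphVec_res]
  local_mem {N} h v hv := by
    refine ⟨mid N v, U'.local_mem h _ fun t => ?_, ?_⟩
    · obtain ⟨W, hW, z, hz, hzv⟩ := hv t
      refine ⟨W, hW, ?_⟩
      rw [← mid_res, ← hzv]
      exact hz
    · refine sep (isSheaf_hyp hM) fun t => ?_
      obtain ⟨W, hW, z, hz, hzv⟩ := hv t
      refine ⟨W, hW, ?_⟩
      rw [← φ.graphVec_res, ← M.res_comp, ← M.res_comp, ← mid_res, ← hzv]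
      rfl

variable {hM : Presieve.IsSheaf (Scheme.zariskiTopology.over S) M.toFunctor}

lemma SubSheaf.mem_graph {U' : M.SubSheaf T} {x y : M.sec T} {h : N ⟶ T} {v : M.hyp.sec N} :
    v ∈ (SubSheaf.graph φ hM U' x y).sec h ↔
      mid N v ∈ U'.sec h ∧ φ.graphVec (M.res h x) (M.res h y) (mid N v) = v := by
  constructor
  · rintro ⟨z, hz, rfl⟩
    exact ⟨hz, rfl⟩
  · rintro ⟨h1, h2⟩
    exact ⟨_, h1, h2⟩

lemma SubSheaf.graph_pull (U' : M.SubSheaf T) (x y : M.sec T) (h : N ⟶ T) :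
    (SubSheaf.graph φ hM U' x y).pull h =
      SubSheaf.graph φ hM (U'.pull h) (M.res h x) (M.res h y) := by
  ext N' g v
  change v ∈ (U'.sec (g ≫ h)).map (φ.graphVec (M.res (g ≫ h) x) (M.res (g ≫ h) y)) ↔
    v ∈ (U'.sec (g ≫ h)).map (φ.graphVec (M.res g (M.res h x)) (M.res g (M.res h y)))
  rw [M.res_comp, M.res_comp]

/-- The graph over a subsheaf is isomorphic to the subsheaf. -/
def SubSheaf.graphEquiv (φ : M.AltForm) (U' : M.SubSheaf T) (x y : M.sec T) (h : N ⟶ T) :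
    U'.sec h ≃ₗ[Fun N] (SubSheaf.graph φ hM U' x y).sec h where
  toFun z := ⟨φ.graphVec (M.res h x) (M.res h y) z.1, z.1, z.2, rfl⟩
  map_add' _ _ := Subtype.ext (map_add _ _ _)
  map_smul' _ _ := Subtype.ext (map_smul _ _ _)
  invFun v := ⟨mid N v.1, (SubSheaf.mem_graph.1 v.2).1⟩
  left_inv _ := rfl
  right_inv v := Subtype.ext (SubSheaf.mem_graph.1 v.2).2

/-- A projector onto the graph takes the middle component, projects it to `U'` and lifts it to the
graph. -/
theorem SubSheaf.IsSubbundle.graph (hMb : M.IsVectorBundle d) {U' : M.SubSheaf T}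
    (hU' : U'.IsSubbundle m) (hs : U'.IsSymplectic φ) (x y : M.sec T) :
    (SubSheaf.graph φ hM U' x y).IsSubbundle m := by
  have hU's := hU'.isLocSymp hs
  obtain ⟨p, hp, hp', -⟩ := hU's.exists_proj hM
  let P : M.hyp.Endo T :=
    { app := fun {N} h => (φ.graphVec (M.res h x) (M.res h y)).comp ((p.app h).comp (mid N))
      app_res := fun g h v => by
        rw [LinearMap.comp_apply, LinearMap.comp_apply, LinearMap.comp_apply, LinearMap.comp_apply,
          M.res_comp, M.res_comp, mid_res, p.app_res, φ.graphVec_res] }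
  refine isSubbundle_of_proj hMb.hyp P (fun N h v => ⟨_, hp N h _, rfl⟩) ?_ fun t => ?_
  · rintro N h _ ⟨z, hz, rfl⟩
    change φ.graphVec _ _ (p.app h z) = _
    rw [hp' N h z hz]
  · rw [← (SubSheaf.graphEquiv φ U' x y (ptIncl T t)).finrank_eq]
    exact hU's.finrank_pt t

lemma SubSheaf.IsSymplectic.graph_comap {U' : M.SubSheaf T} (hs : U'.IsSymplectic φ)
    (x y : M.sec T) : (SubSheaf.graph φ hM U' x y).IsSymplectic φ.comap := fun N h hN =>
  bijective_of_equiv (SubSheaf.graphEquiv φ U' x y h) (fun _ _ => rfl) (hs N h hN)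

/-- The correction to `φ` vanishes if `x` or `y` is zero. This is why the graphs belonging to `N⁻`
and `N⁺` are symplectic without further conditions. -/
lemma AltForm.hyp_form_graphVec (φ : M.AltForm) (x y z z' : M.sec T) :
    φ.hyp.form T (φ.graphVec x y z) (φ.graphVec x y z') =
      φ.form T z z' + (φ.form T x z * φ.form T y z' - φ.form T y z * φ.form T x z') := by
  rw [graphVec_apply, graphVec_apply, hyp_form_vec]
  ring

lemma SubSheaf.IsSymplectic.graph_zero_left {U' : M.SubSheaf T} (hs : U'.IsSymplectic φ)
    (y : M.sec T) : (SubSheaf.graph φ hM U' 0 y).IsSymplectic φ.hyp := fun N h hN =>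
  bijective_of_equiv (SubSheaf.graphEquiv φ U' 0 y h) (fun z z' => by
    refine (φ.hyp_form_graphVec _ _ _ _).trans ?_
    simp only [map_zero, LinearMap.zero_apply, zero_mul, mul_zero, sub_zero, add_zero]
    rfl) (hs N h hN)

lemma SubSheaf.IsSymplectic.graph_zero_right {U' : M.SubSheaf T} (hs : U'.IsSymplectic φ)
    (x : M.sec T) : (SubSheaf.graph φ hM U' x 0).IsSymplectic φ.hyp := fun N h hN =>
  bijective_of_equiv (SubSheaf.graphEquiv φ U' x 0 h) (fun z z' => by
    refine (φ.hyp_form_graphVec _ _ _ _).trans ?_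
    simp only [map_zero, LinearMap.zero_apply, zero_mul, mul_zero, sub_zero, add_zero]
    rfl) (hs N h hN)

/-- The data defining a graph are determined by the graph. -/
lemma SubSheaf.graph_injective {U' U'' : M.SubSheaf T} (hU' : U'.IsLocSymp φ m) {x y x' y' : M.sec T}
    (hx : x ∈ U'.sec (𝟙 T)) (hy : y ∈ U'.sec (𝟙 T)) (hx' : x' ∈ U''.sec (𝟙 T))
    (hy' : y' ∈ U''.sec (𝟙 T))
    (h : SubSheaf.graph φ hM U' x y = SubSheaf.graph φ hM U'' x' y') :
    U' = U'' ∧ x = x' ∧ y = y' := by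
  have h1 : U' = U'' := by
    refine SubSheaf.eq_of_le_of_le (fun N g z hz => ?_) fun N g z hz => ?_
    · have h2 : φ.graphVec (M.res g x) (M.res g y) z ∈ (SubSheaf.graph φ hM U' x y).sec g :=
        ⟨z, hz, rfl⟩
      rw [h] at h2
      exact (SubSheaf.mem_graph.1 h2).1
    · have h2 : φ.graphVec (M.res g x') (M.res g y') z ∈ (SubSheaf.graph φ hM U'' x' y').sec g :=
        ⟨z, hz, rfl⟩
      rw [← h] at h2
      exact (SubSheaf.mem_graph.1 h2).1
  subst h1
  have h2 : ∀ (N : Over S) (g : N ⟶ T) (v : M.sec N), v ∈ U'.sec (g ≫ 𝟙 T) →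
      φ.graphVec (M.res g x') (M.res g y') v = φ.graphVec (M.res g x) (M.res g y) v := by
    intro N g v hv
    rw [Category.comp_id] at hv
    have h3 : φ.graphVec (M.res g x) (M.res g y) v ∈ (SubSheaf.graph φ hM U' x y).sec g :=
      ⟨v, hv, rfl⟩
    rw [h] at h3
    exact (SubSheaf.mem_graph.1 h3).2
  exact ⟨rfl, hU'.ext hM hx hx' fun N g v hv => congrArg Prod.fst (h2 N g v hv).symm,
    hU'.ext hM hy hy' fun N g v hv => congrArg (fun t => t.2.2) (h2 N g v hv).symm⟩

/-- A subbundle on which the form induced by `φ` is nondegenerate is a graph. -/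
theorem SubSheaf.exists_eq_graph (hMb : M.IsVectorBundle d) (hφ : φ.IsNondegenerate)
    {U : M.hyp.SubSheaf T} (hU : U.IsLocSymp φ.comap m) :
    ∃ (U' : M.SubSheaf T) (x y : M.sec T), U'.IsSubbundle m ∧ U'.IsSymplectic φ ∧
      x ∈ U'.sec (𝟙 T) ∧ y ∈ U'.sec (𝟙 T) ∧ SubSheaf.graph φ hM U' x y = U := by
  have hH := isSheaf_hyp hM
  -- The form `φ.comap` is degenerate on `𝒪 ⊕ M ⊕ 𝒪`, but it has an orthogonal projector `P` onto
  -- `U`, which depends on middle components only. Hence a section of `U` is recovered from its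
  -- middle component, and `U` is isomorphic to its image `U'` in `M`.
  obtain ⟨P, hP, hP', hPφ⟩ := hU.exists_proj hH
  let j : ∀ N : Over S, M.sec N →ₗ[Fun N] M.hyp.sec N := fun N =>
    (LinearMap.inr _ _ _).comp (LinearMap.inl _ _ _)
  have hj : ∀ {N' N : Over S} (g : N' ⟶ N) (z : M.sec N), j N' (M.res g z) = M.hyp.res g (j N z) :=
    fun g z => Prod.ext (map_zero (resFun g)).symm (Prod.ext rfl (map_zero (resFun g)).symm)
  have hPj : ∀ (N : Over S) (h : N ⟶ T) (v : M.hyp.sec N), v ∈ U.sec h →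
      P.app h (j N (mid N v)) = v := fun N h v hv =>
    hU.ext hH (hP N h _) hv fun N' g v' hv' => by
      rw [← P.app_res, hPφ N' _ _ _ hv']
      rfl
  let p : M.Endo T :=
    { app := fun {N} h => (mid N).comp ((P.app h).comp (j N))
      app_res := fun g h z => by
        rw [LinearMap.comp_apply, LinearMap.comp_apply, LinearMap.comp_apply, LinearMap.comp_apply,
          hj, P.app_res, mid_res] }
  let U' : M.SubSheaf T := SubSheaf.fixed hM p
  have hmem : ∀ (N : Over S) (h : N ⟶ T) (z : M.sec N), z ∈ U'.sec h ↔ mid N (P.app h (j N z)) = z :=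
    fun N h z => SubSheaf.mem_fixed hM p h z
  have hmid : ∀ (N : Over S) (h : N ⟶ T) (v : M.hyp.sec N), v ∈ U.sec h → mid N v ∈ U'.sec h :=
    fun N h v hv => by rw [hmem, hPj N h v hv]
  have hp : ∀ (N : Over S) (h : N ⟶ T) (z : M.sec N), p.app h z ∈ U'.sec h :=
    fun N h z => hmid N h _ (hP N h _)
  have hp' : ∀ (N : Over S) (h : N ⟶ T) (z : M.sec N), z ∈ U'.sec h → p.app h z = z :=
    fun N h z hz => (hmem N h z).1 hz
  have hsub : U'.IsSubbundle m := isSubbundle_of_proj hMb p hp hp' fun t => by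
    have h1 := hU.finrank_pt t
    rw [← h1]
    let e : U'.sec (ptIncl T t) ≃ₗ[Fun (pt T t)] U.sec (ptIncl T t) :=
      { toFun := fun z => ⟨P.app _ (j _ z.1), hP _ _ _⟩
        map_add' := fun z z' => Subtype.ext (by simp)
        map_smul' := fun c z => Subtype.ext (by simp)
        invFun := fun v => ⟨mid _ v.1, hmid _ _ _ v.2⟩
        left_inv := fun z => Subtype.ext ((hmem _ _ _).1 z.2)
        right_inv := fun v => Subtype.ext (hPj _ _ _ v.2) }
    exact e.finrank_eq
  have hsymp : U'.IsSymplectic φ := isSymplectic_of_proj hφ p hp hp' fun N h z z' hz' => by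
    have h1 := hPφ N h (j N z) (P.app h (j N z')) (hP N h _)
    rw [φ.comap_form, φ.comap_form, (hmem N h z').1 hz'] at h1
    exact h1
  -- On `U'` the outer components of `U` are functionals `α` and `β` of the middle component;
  -- nondegeneracy represents them by sections `x` and `y` of `U'`.
  let α : M.Functional T :=
    { app := fun {N} h => (LinearMap.fst _ _ _).comp ((P.app h).comp (j N))
      app_res := fun g h z => by
        change (P.app (g ≫ h) (j _ (M.res g z))).1 = _
        rw [hj, P.app_res]
        rfl }
  let β : M.Functional T :=
    { app := fun {N} h => ((LinearMap.snd _ _ _).comp (LinearMap.snd _ _ _)).comp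
        ((P.app h).comp (j N))
      app_res := fun g h z => by
        change (P.app (g ≫ h) (j _ (M.res g z))).2.2 = _
        rw [hj, P.app_res]
        rfl }
  have hU's := hsub.isLocSymp hsymp
  obtain ⟨x, hx, hxα⟩ := hU's.exists_repr hM α
  obtain ⟨y, hy, hyβ⟩ := hU's.exists_repr hM β
  have hgr : ∀ (N : Over S) (h : N ⟶ T) (z : M.sec N), z ∈ U'.sec h →
      φ.graphVec (M.res h x) (M.res h y) z = P.app h (j N z) := fun N h z hz => by
    rw [φ.graphVec_apply, hxα N h z hz, hyβ N h z hz]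
    exact Prod.ext rfl (Prod.ext ((hmem N h z).1 hz).symm rfl)
  refine ⟨U', x, y, hsub, hsymp, hx, hy, SubSheaf.eq_of_le_of_le ?_ fun N h v hv => ?_⟩
  · rintro N h _ ⟨z, hz, rfl⟩
    rw [hgr N h z hz]
    exact hP N h _
  · rw [SubSheaf.mem_graph]
    refine ⟨hmid N h v hv, ?_⟩
    rw [hgr N h _ (hmid N h v hv), hPj N h v hv]

end Graph

section NPlus

variable {U : M.hyp.SubSheaf T} {ι : Type}

/-- The residue field at `x` may be larger than the one at its image in `T`, but the vanishing of
functions of a frame at a point does not depend on it. Hence `nPlus` commutes with pullback. -/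
lemma forall_eq_zero_iff_of_isFrame {W : T.left.Opens} {u : ι → M.hyp.sec (openSub T W)}
    (hu : U.IsFrame (openIncl T W) u) (h : N ⟶ T) (x : N.left) (hx : h.left x ∈ W) :
    (∀ v ∈ U.sec (ptIncl N x ≫ h), v.2.2 = 0) ↔
      ∀ i, (⟨h.left x, hx⟩ : W) ∉ (openSub T W).left.basicOpen (u i).2.2 := by
  obtain ⟨g, hg⟩ := exists_lift_openSub W (ptIncl N x ≫ h) fun s => by
    change h.left (N.left.fromSpecResidueField x s) ∈ W
    rwa [Scheme.fromSpecResidueField_apply]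
  have hgx : ∀ s, g.left s = (⟨h.left x, hx⟩ : W) := fun s => by
    refine Subtype.ext ?_
    have h1 : (openIncl T W).left (g.left s) = (ptIncl N x ≫ h).left s := by
      rw [← hg]
      rfl
    refine h1.trans ?_
    change h.left (N.left.fromSpecResidueField x s) = _
    rw [Scheme.fromSpecResidueField_apply]
  rw [← hg, hu.span]
  have h2 : ∀ i, resFun g (u i).2.2 = 0 ↔
      (⟨h.left x, hx⟩ : W) ∉ (openSub T W).left.basicOpen (u i).2.2 := fun i =>
    (not_iff_comm.1 (resFun_pt_ne_zero_iff g _ hgx _)).symm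
  constructor
  · intro h3 i
    rw [← h2]
    exact h3 _ (Submodule.subset_span ⟨i, rfl⟩)
  · intro h3 v hv
    have h4 : Submodule.span (Fun (pt N x)) (Set.range fun i => M.hyp.res g (u i)) ≤
        LinearMap.ker ((M.last T).app (ptIncl N x ≫ h)) := by
      rw [Submodule.span_le]
      rintro _ ⟨i, rfl⟩
      exact (h2 i).2 (h3 i)
    exact h4 hv

lemma mem_nPlus_iff (hU : U.IsSubbundle m) (x : T.left) :
    x ∈ nPlus U hU ↔ ∀ v ∈ U.sec (ptIncl T x), v.2.2 = 0 := Iff.rfl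

lemma mem_nPlus_iff_of_isFrame (hU : U.IsSubbundle m) {W : T.left.Opens}
    {u : ι → M.hyp.sec (openSub T W)} (hu : U.IsFrame (openIncl T W) u) (x : W) :
    (x : T.left) ∈ nPlus U hU ↔ ∀ i, x ∉ (openSub T W).left.basicOpen (u i).2.2 := by
  rw [mem_nPlus_iff, ← Category.comp_id (ptIncl T (x : T.left))]
  exact forall_eq_zero_iff_of_isFrame hu (𝟙 T) x (by simp)

lemma mem_nPlus_pull_iff (hU : U.IsSubbundle m) (h : N ⟶ T) (x : N.left) :
    x ∈ nPlus (U.pull h) (hU.pull h) ↔ h.left x ∈ nPlus U hU := by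
  obtain ⟨W, hW, -, l, b, -, hu⟩ := hU.exists_frame (h.left x)
  rw [mem_nPlus_iff_of_isFrame hU hu ⟨h.left x, hW⟩]
  exact forall_eq_zero_iff_of_isFrame hu h x hW

/-- The last component on the graph is `φ(y, ·)`, which by nondegeneracy on `U'` vanishes at `t`
only if `y` does. -/
lemma mem_nPlus_graph_iff {hM : Presieve.IsSheaf (Scheme.zariskiTopology.over S) M.toFunctor}
    {U' : M.SubSheaf T} {x y : M.sec T} (hs : U'.IsSymplectic φ) (hy : y ∈ U'.sec (𝟙 T))
    (hG : (SubSheaf.graph φ hM U' x y).IsSubbundle m) (t : T.left) :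
    t ∈ nPlus _ hG ↔ M.res (ptIncl T t) y = 0 := by
  rw [mem_nPlus_iff]
  constructor
  · intro h
    have hy' := U'.res_mem_of_id hy (ptIncl T t)
    have h1 := (injective_iff_map_eq_zero _).1 (hs _ (ptIncl T t) (inferInstanceAs
      (IsAffine (Spec _)))).1 ⟨_, hy'⟩ (LinearMap.ext fun z => h _ ⟨z.1, z.2, rfl⟩)
    exact congrArg Subtype.val h1
  · rintro h _ ⟨z, -, rfl⟩
    change φ.form _ (M.res (ptIncl T t) y) z = 0
    rw [h, map_zero, LinearMap.zero_apply]

lemma isCompact_of_local {X : Scheme.{u}} [CompactSpace X] (O : Set X)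
    (h : ∀ x : X, ∃ W : X.Opens, x ∈ W ∧ IsCompact (O ∩ W)) : IsCompact O := by
  choose W hW hc using h
  obtain ⟨s, hs⟩ := isCompact_univ.elim_finite_subcover (fun x => (W x : Set X)) (fun x => (W x).2)
    fun x _ => Set.mem_iUnion.2 ⟨x, hW x⟩
  have : O = ⋃ x ∈ s, O ∩ W x := by
    rw [← Set.inter_iUnion₂, eq_comm, Set.inter_eq_left]
    exact (Set.subset_univ O).trans hs
  rw [this]
  exact s.isCompact_biUnion fun x _ => hc x

/-- On an affine open set with a frame the complement is a finite union of basic open sets. This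
puts complements of `N⁺` into `𝒱`. -/
lemma isCompact_compl_nPlus [CompactSpace T.left] (hU : U.IsSubbundle m) :
    IsCompact (nPlus U hU : Set T.left)ᶜ := by
  refine isCompact_of_local _ fun t => ?_
  obtain ⟨W, hW, haff, l, b, -, hu⟩ := hU.exists_frame t
  refine ⟨W, hW, ?_⟩
  have h1 : (nPlus U hU : Set T.left)ᶜ ∩ W =
      W.ι '' ⋃ i, {z | z ∈ (openSub T W).left.basicOpen (b (Sum.inl i)).2.2} := by
    ext y
    constructor
    · rintro ⟨hy, hyW⟩
      have h2 := (mem_nPlus_iff_of_isFrame hU hu ⟨y, hyW⟩).not.1 hy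
      push Not at h2
      obtain ⟨i, hi⟩ := h2
      exact ⟨⟨y, hyW⟩, Set.mem_iUnion.2 ⟨i, hi⟩, rfl⟩
    · rintro ⟨z, hz, rfl⟩
      obtain ⟨i, hi⟩ := Set.mem_iUnion.1 hz
      exact ⟨fun h => (mem_nPlus_iff_of_isFrame hU hu z).1 h i hi, z.2⟩
  rw [h1]
  refine IsCompact.image (isCompact_iUnion fun i => ?_) W.ι.continuous
  exact ((isAffineOpen_top (openSub T W).left).basicOpen _).isCompact

/-- Outside `nPlus U` there are locally sections of `U` with last component one. -/
lemma exists_last_eq_one (hU : U.IsSubbundle m) (x : T.left) (hx : x ∉ nPlus U hU) :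
    ∃ W : T.left.Opens, x ∈ W ∧ ∃ v ∈ U.sec (openIncl T W), v.2.2 = 1 := by
  obtain ⟨W, hW, -, l, b, -, hu⟩ := hU.exists_frame x
  have h1 := (mem_nPlus_iff_of_isFrame hU hu ⟨x, hW⟩).not.1 hx
  push Not at h1
  obtain ⟨i, hi⟩ := h1
  let c : Fun (openSub T W) := (b (Sum.inl i)).2.2
  let O : (openSub T W).left.Opens := (openSub T W).left.basicOpen c
  obtain ⟨j, hj⟩ := exists_openSub_image W O
  let k := j ≫ openIncl (openSub T W) O
  have hk : k ≫ openIncl T W = openIncl T (W.ι ''ᵁ O) := by rw [Category.assoc, hj]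
  have hunit : IsUnit (resFun k c) := (isUnit_resFun_iff k c).2 fun t => openIncl_mem j t
  obtain ⟨d, hd⟩ := hunit.exists_left_inv
  refine ⟨W.ι ''ᵁ O, ⟨⟨x, hW⟩, hi, rfl⟩, d • M.hyp.res k (b (Sum.inl i)),
    Submodule.smul_mem _ _ ?_, hd⟩
  rw [← hk]
  exact U.res_mem _ _ _ (hu.mem i)

end NPlus

section TotalSpace

lemma finrank_prod_self {R Q : Type*} [CommRing R] (hR : IsField R) [AddCommGroup Q] [Module R Q]
    [Module.Finite R Q] (V : Submodule R Q) :
    Module.finrank R (V × R) = Module.finrank R V + 1 := by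
  obtain ⟨F, rfl⟩ := exists_field_of_isField R hR
  rw [Module.finrank_prod, Module.finrank_self]

/-- The subsheaf `U' ⊕ 𝒪` of `𝒪 ⊕ M ⊕ 𝒪`. -/
def SubSheaf.addLine (U' : M.SubSheaf T) : M.hyp.SubSheaf T where
  sec {N} h := (⊥ : Submodule (Fun N) (Fun N)).prod ((U'.sec h).prod ⊤)
  res_mem g h v hv := ⟨(congrArg (resFun g) hv.1).trans (map_zero _), U'.res_mem g h _ hv.2.1,
    trivial⟩
  local_mem h v hv := by
    refine ⟨fun_sep fun t => ?_, U'.local_mem h _ fun t => ?_, trivial⟩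
    · obtain ⟨W, hW, h1⟩ := hv t
      exact ⟨W, hW, Eq.trans h1.1 (map_zero _).symm⟩
    · obtain ⟨W, hW, h1⟩ := hv t
      exact ⟨W, hW, h1.2.1⟩

lemma SubSheaf.mem_addLine {U' : M.SubSheaf T} {h : N ⟶ T} {v : M.hyp.sec N} :
    v ∈ U'.addLine.sec h ↔ v.1 = 0 ∧ mid N v ∈ U'.sec h :=
  ⟨fun hv => ⟨hv.1, hv.2.1⟩, fun hv => ⟨hv.1, hv.2, trivial⟩⟩

/-- The sections `(0, x, 1)` of `U' ⊕ 𝒪` are the sections `x` of `U'`, so the total space of `U'` is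
a scheme of unit sections of this subbundle. -/
lemma SubSheaf.isSubbundle_addLine (hM : M.IsVectorBundle d) {U' : M.SubSheaf T}
    (hU' : U'.IsLocSymp φ m) : U'.addLine.IsSubbundle (m + 1) := by
  obtain ⟨p, hp, hp', -⟩ := hU'.exists_proj hM.isSheaf
  let P : M.hyp.Endo T :=
    { app := fun {N} h => (0 : M.hyp.sec N →ₗ[Fun N] Fun N).prod
        (((p.app h).comp (mid N)).prod ((M.last T).app h))
      app_res := fun g h v => Prod.ext (map_zero (resFun g)).symm
        (Prod.ext (p.app_res g h _) rfl) }
  refine isSubbundle_of_proj hM.hyp P (fun N h v => ⟨rfl, hp N h _, trivial⟩) ?_ fun t => ?_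
  · rintro N h v ⟨h1, h2, -⟩
    exact Prod.ext (Eq.symm h1) (Prod.ext (hp' N h _ h2) rfl)
  · let e : U'.addLine.sec (ptIncl T t) ≃ₗ[Fun (pt T t)] U'.sec (ptIncl T t) × Fun (pt T t) :=
      { toFun := fun v => (⟨v.1.2.1, v.2.2.1⟩, v.1.2.2)
        map_add' := fun v v' => rfl
        map_smul' := fun c v => rfl
        invFun := fun z => ⟨vec 0 z.1.1 z.2, rfl, z.1.2, trivial⟩
        left_inv := fun v => Subtype.ext (Prod.ext (Eq.symm v.2.1) rfl)
        right_inv := fun z => rfl }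
    have := hM.finite_pt T t
    rw [e.finrank_eq, ← hU'.finrank_pt t]
    exact finrank_prod_self (isField_fun_pt T t) _

end TotalSpace

end BigModule

/-- The total space of a symplectic subbundle. -/
theorem IsAdmissible.exists_totalSpace {k : Scheme.{u}} {𝒱 : ObjectProperty (Over k)}
    (h𝒱 : IsAdmissible 𝒱) {S : Over k} {M : BigModule S.left} {d m : ℕ} (hM : M.IsVectorBundle d)
    {φ : M.AltForm} {G : Over S.left} {U' : M.SubSheaf G} (hU' : U'.IsLocSymp φ m) :
    ∃ (P : Over S.left) (π : P ⟶ G) (x : M.sec P), x ∈ U'.sec π ∧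
      (∀ (T : Over S.left) (g : T ⟶ G) (v : M.sec T), v ∈ U'.sec g →
        ∃! h : T ⟶ P, h ≫ π = g ∧ M.res h x = v) ∧ IsAffineHom π.left ∧
      (𝒱 (toBase S G) → 𝒱 (toBase S P)) ∧
      IsUnitSections U'.addLine (M.last G) π (vec 0 x 1) := by
  obtain ⟨P, π, w, hw, hfw, huniv, haff, hmem⟩ := h𝒱.exists_unitSections (isSheaf_hyp hM.isSheaf)
    (SubSheaf.isSubbundle_addLine hM hU') (M.last G)
  obtain ⟨x, rfl⟩ : ∃ x, w = vec 0 x 1 :=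
    ⟨mid P w, Prod.ext (SubSheaf.mem_addLine.1 hw).1 (Prod.ext rfl hfw)⟩
  refine ⟨P, π, x, (SubSheaf.mem_addLine.1 hw).2, fun T g v hv => ?_, haff, hmem,
    hw, hfw, fun g v => huniv _ g v⟩
  have hres : ∀ h : T ⟶ P, M.hyp.res h (vec 0 x 1) = vec 0 v 1 ↔ M.res h x = v := fun h => by
    rw [res_vec, map_zero, map_one]
    exact ⟨fun h1 => congrArg (mid T) h1, fun h1 => by rw [h1]⟩
  have h1 := huniv T g (vec 0 v 1) (SubSheaf.mem_addLine.2 ⟨rfl, hv⟩) rfl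
  simpa only [hres] using h1

end QuatGrass

/-! ### The open stratum: parts (a) and (b) -/

namespace QuatGrass

namespace BigModule

variable {S : Scheme.{u}} {M : BigModule S} {φ : M.AltForm} {T : Over S} {m d r : ℕ}

lemma exists_classified {G : Over S} (e : (φ.hgr r).RepresentableBy G) {U : M.SubSheaf T}
    (hU : U.IsSubbundle (2 * r)) (hs : U.IsSymplectic φ) : ∃ g : T ⟶ G, classified e g = U :=
  ⟨e.homEquiv.symm ⟨U, hU, hs⟩, congrArg Subtype.val (e.homEquiv.apply_symm_apply _)⟩

lemma classified_isSubbundle {G : Over S} (e : (φ.hgr r).RepresentableBy G) (g : T ⟶ G) :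
    (classified e g).IsSubbundle (2 * r) := (e.homEquiv g).2.1

lemma classified_isSymplectic {G : Over S} (e : (φ.hgr r).RepresentableBy G) (g : T ⟶ G) :
    (classified e g).IsSymplectic φ := (e.homEquiv g).2.2

lemma mem_classified {G : Over S} (e : (φ.hgr r).RepresentableBy G) (g : T ⟶ G) {v : M.sec T} :
    v ∈ (classified e g).sec (𝟙 T) ↔ v ∈ (taut e).sec g := by
  rw [classified_eq_pull]
  change v ∈ (taut e).sec (𝟙 T ≫ g) ↔ _
  rw [Category.id_comp]

lemma notMem_nPlus {U : M.hyp.SubSheaf T} (hU : U.IsSubbundle m) {v : M.hyp.sec T}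
    (hv : v ∈ U.sec (𝟙 T)) (hv1 : v.2.2 = 1) (t : T.left) : t ∉ nPlus U hU := fun h => by
  have h1 := h _ (U.res_mem_of_id hv (ptIncl T t))
  have h2 : resFun (ptIncl T t) v.2.2 = 0 := h1
  rw [hv1, map_one] at h2
  have := (isField_fun_pt T t).nontrivial
  exact one_ne_zero h2

lemma left_notMem_nPlus {GF : Over S} (eF : (φ.hyp.hgr r).RepresentableBy GF) (g : T ⟶ GF)
    {v : M.hyp.sec T} (hv : v ∈ (classified eF g).sec (𝟙 T)) (hv1 : v.2.2 = 1) (t : T.left) :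
    g.left t ∉ nPlus (taut eF) (taut_isSubbundle eF) := fun h => by
  rw [← mem_nPlus_pull_iff (taut_isSubbundle eF) g t] at h
  refine notMem_nPlus ((taut_isSubbundle eF).pull g) ?_ hv1 t h
  rwa [← classified_eq_pull]

/-- The open subscheme `Y` of `HGr(r; 𝒪 ⊕ M ⊕ 𝒪)`, the complement of `N⁺`. -/
abbrev openStratum {GF : Over S} (eF : (φ.hyp.hgr r).RepresentableBy GF) : Over S :=
  openSub GF (nPlus (taut eF) (taut_isSubbundle eF)).compl

/-- The inclusion of the open stratum. -/
abbrev openStratumIncl {GF : Over S} (eF : (φ.hyp.hgr r).RepresentableBy GF) :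
    openStratum eF ⟶ GF :=
  openIncl GF (nPlus (taut eF) (taut_isSubbundle eF)).compl

instance {GF : Over S} (eF : (φ.hyp.hgr r).RepresentableBy GF) :
    IsOpenImmersion (openStratumIncl eF).left :=
  inferInstanceAs (IsOpenImmersion (Scheme.Opens.ι _))

instance {GF : Over S} (eF : (φ.hyp.hgr r).RepresentableBy GF) : Mono (openStratumIncl eF) :=
  (Over.forget _).mono_of_mono_map (inferInstanceAs (Mono (openStratumIncl eF).left))

section Torsor

variable {GF Q : Over S} {eF : (φ.hyp.hgr r).RepresentableBy GF} {π : Q ⟶ openStratum eF}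
  {w : M.hyp.sec Q}
  (hQ : IsUnitSections ((taut eF).pull (openStratumIncl eF)) (M.last _) π w)
include hQ

/-- Points of `Q` are pairs of a symplectic subbundle and a section of it with last component one;
such a section keeps the classifying morphism away from `N⁺`. -/
lemma IsUnitSections.exists_hom {U : M.hyp.SubSheaf T} (hU : U.IsSubbundle (2 * r))
    (hs : U.IsSymplectic φ.hyp) {v : M.hyp.sec T} (hv : v ∈ U.sec (𝟙 T)) (hv1 : v.2.2 = 1) :
    ∃ h : T ⟶ Q, classified eF (h ≫ π ≫ openStratumIncl eF) = U ∧ M.hyp.res h w = v := by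
  obtain ⟨g, rfl⟩ := exists_classified eF hU hs
  obtain ⟨g', rfl⟩ := exists_lift_openSub (nPlus (taut eF) (taut_isSubbundle eF)).compl g
    (left_notMem_nPlus eF g hv hv1)
  obtain ⟨h, ⟨rfl, hh⟩, -⟩ := hQ.existsUnique g' v ((mem_classified eF _).1 hv) hv1
  exact ⟨h, by rw [Category.assoc], hh⟩

lemma IsUnitSections.hom_ext_of_classified {h h' : T ⟶ Q}
    (h1 : classified eF (h ≫ π ≫ openStratumIncl eF) =
      classified eF (h' ≫ π ≫ openStratumIncl eF))
    (h2 : M.hyp.res h w = M.hyp.res h' w) : h = h' := by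
  have h3 := BigModule.hom_ext_of_classified eF h1
  rw [← Category.assoc, ← Category.assoc, cancel_mono] at h3
  exact hQ.hom_ext h3 h2

end Torsor

lemma hypLift_zero_isSymplectic (hM : M.IsVectorBundle d) (hφ : φ.IsNondegenerate)
    {U' : M.SubSheaf T} (hU' : U'.IsSubbundle m) (hs : U'.IsSymplectic φ) :
    (SubSheaf.hypLift φ U' 0 0 0).IsSubbundle (m + 2) ∧
      (SubSheaf.hypLift φ U' 0 0 0).IsSymplectic φ.hyp :=
  SubSheaf.hypLift_isSymplectic hM hφ hU' hs 0 0 0 fun N h z _ => by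
    rw [map_zero, map_zero, LinearMap.zero_apply]

lemma hypLift_zero_pull (U' : M.SubSheaf T) {N : Over S} (h : N ⟶ T) :
    (SubSheaf.hypLift φ U' 0 0 0).pull h = SubSheaf.hypLift φ (U'.pull h) 0 0 0 := by
  rw [SubSheaf.hypLift_pull, map_zero, map_zero]

lemma shear_zero (v : M.hyp.sec T) : φ.shear 0 0 0 v = mid T v := by
  change v.2.1 - v.2.2 • (0 : M.sec T) - _ • (0 : M.sec T) = _
  rw [smul_zero, smul_zero, sub_zero, sub_zero]
  rfl

/-- The scheme of the symplectic subbundles of `𝒪 ⊕ M ⊕ 𝒪` with a section with last component one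
is homotopy equivalent to the quaternionic Grassmannian bundle of `M`. -/
lemma exists_homotopy (hM : M.IsVectorBundle d) (hφ : φ.IsNondegenerate) {G' GF Q : Over S}
    (e' : (φ.hgr r).RepresentableBy G') (eF : (φ.hyp.hgr (r + 1)).RepresentableBy GF)
    {π : Q ⟶ openStratum eF} {w : M.hyp.sec Q}
    (hQ : IsUnitSections ((taut eF).pull (openStratumIncl eF)) (M.last _) π w) :
    ∃ (q : Q ⟶ G') (s : G' ⟶ Q) (H : affineLine Q ⟶ Q) (s₀ s₁ : Q ⟶ affineLine Q),
      s ≫ q = 𝟙 G' ∧ s₀ ≫ affineLineProj Q = 𝟙 Q ∧ s₁ ≫ affineLineProj Q = 𝟙 Q ∧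
      s₀ ≫ H = q ≫ s ∧ s₁ ≫ H = 𝟙 Q ∧ ClassifiesSum e' eF (s ≫ π ≫ openStratumIncl eF) := by
  let g : Q ⟶ GF := π ≫ openStratumIncl eF
  obtain ⟨a, x, rfl⟩ : ∃ a x, w = vec a x 1 :=
    ⟨w.1, w.2.1, Prod.ext rfl (Prod.ext rfl hQ.app_eq_one)⟩
  have hw : vec a x 1 ∈ (classified eF g).sec (𝟙 Q) := (mem_classified eF g).2 hQ.mem
  -- A point of `Q` amounts to data `(U', a, x, y)` with `y` orthogonal to `U'`. The morphism `q`
  -- forgets `(a, x, y)`, the section `s` sets them to zero, and `H` multiplies them by the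
  -- coordinate `t`.
  obtain ⟨hd, hds, y, hy, hlift⟩ := SubSheaf.exists_eq_hypLift (m := 2 * r) hM hφ
    (classified_isSubbundle eF g) (classified_isSymplectic eF g) hw
  obtain ⟨q, hq⟩ := exists_classified e' hd hds
  have ht := hypLift_zero_isSymplectic hM hφ (taut_isSubbundle e')
    (classified_isSymplectic e' (𝟙 G'))
  obtain ⟨s, hs, hsw⟩ := hQ.exists_hom ht.1 ht.2 (SubSheaf.unit_mem_hypLift (taut e') 0 0 0) rfl
  let p : affineLine Q ⟶ Q := affineLineProj Q
  let t : Fun (affineLine Q) := lineCoord Q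
  have hl := SubSheaf.hypLift_isSymplectic hM hφ (hd.pull p)
    (fun N h => hds N (h ≫ p)) (t * resFun p a) (t • M.res p x) (t • M.res p y)
    fun N h z hz => by
      rw [M.res_smul, map_smul, LinearMap.smul_apply, ← M.res_comp, hy N (h ≫ p) z hz, smul_zero]
  obtain ⟨H, hH, hHw⟩ := hQ.exists_hom hl.1 hl.2 (SubSheaf.unit_mem_hypLift _ _ _ _) rfl
  obtain ⟨s₀, ⟨h₀, ht₀⟩, -⟩ := existsUnique_hom_affineLine (𝟙 Q) 0
  obtain ⟨s₁, ⟨h₁, ht₁⟩, -⟩ := existsUnique_hom_affineLine (𝟙 Q) 1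
  have hp₀ : s₀ ≫ p = 𝟙 Q := h₀
  have hp₁ : s₁ ≫ p = 𝟙 Q := h₁
  have hpull : ∀ {N : Over S} (h : N ⟶ affineLine Q), classified eF (h ≫ H ≫ g) =
      SubSheaf.hypLift φ ((SubSheaf.hypDescent φ (classified eF g) x).pull (h ≫ p))
        (resFun h (t * resFun p a)) (M.res h (t • M.res p x)) (M.res h (t • M.res p y)) := by
    intro N h
    rw [SubSheaf.pull_comp, ← SubSheaf.hypLift_pull, classified_comp, hH]
  refine ⟨q, s, H, s₀, s₁, BigModule.hom_ext_of_classified e' ?_, h₀, h₁,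
    hQ.hom_ext_of_classified ?_ ?_, hQ.hom_ext_of_classified ?_ ?_, fun T h v => ?_⟩
  · rw [classified_comp, hq]
    have hx : M.res s x = 0 := congrArg (mid G') hsw
    ext N h z
    change φ.emb (M.res (h ≫ s) x) z ∈ (classified eF g).sec (h ≫ s) ↔ _
    rw [M.res_comp, hx, map_zero]
    have h1 : (classified eF g).pull s = SubSheaf.hypLift φ (taut e') 0 0 0 := by
      rw [← hs, ← classified_comp eF s g]
    change _ ∈ ((classified eF g).pull s).sec h ↔ _
    rw [h1, SubSheaf.mem_hypLift, map_zero, map_zero, shear_zero]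
    rfl
  · rw [Category.assoc, hpull, hp₀, SubSheaf.pull_id, M.res_smul, M.res_smul, map_mul, ht₀,
      zero_mul, zero_smul, zero_smul, Category.assoc, classified_comp eF q, hs, hypLift_zero_pull,
      ← classified_eq_pull, hq]
  · rw [M.hyp.res_comp, hHw, M.hyp.res_comp, hsw, res_vec, res_vec, M.res_smul, map_mul, ht₀,
      zero_mul, zero_smul, map_zero, map_zero, map_one, map_one]
  · rw [Category.assoc, hpull, hp₁, SubSheaf.pull_id, M.res_smul, M.res_smul, map_mul, ht₁,
      one_mul, one_smul, one_smul, ← resFun_comp, ← M.res_comp, ← M.res_comp, hp₁, resFun_id,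
      M.res_id, M.res_id, hlift, Category.id_comp]
  · rw [M.hyp.res_comp, hHw, res_vec, M.res_smul, map_mul, ht₁, one_mul, one_smul, ← resFun_comp,
      ← M.res_comp, hp₁, resFun_id, M.res_id, map_one, M.hyp.res_id]
  · have h1 : ∀ v : M.hyp.sec T, v ∈ (SubSheaf.hypLift φ (taut e') 0 0 0).sec h ↔
        mid T v ∈ (taut e').sec h := fun v => by
      rw [SubSheaf.mem_hypLift, map_zero, map_zero, shear_zero]
    rw [hs]
    exact h1 v

end BigModule

section OpenStratum

variable {k : Scheme.{u}} {𝒱 : ObjectProperty (Over k)} {h𝒱 : IsAdmissible 𝒱} {S : Over k}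
  {E : BigModule S.left} {d r : ℕ} {φ : E.AltForm} {GF G' : Over S.left}

lemma IsAdmissible.openCompl_nPlus_mem (h𝒱 : IsAdmissible 𝒱) {T : Over S.left}
    (hT : 𝒱 (toBase S T)) {U : E.hyp.SubSheaf T} {m : ℕ} (hU : U.IsSubbundle m) :
    𝒱 (openCompl (toBase S T) (nPlus U hU : Closeds T.left)) := by
  have : CompactSpace T.left := h𝒱.compactSpace _ hT
  exact h𝒱.openCompl_mem hT (isCompact_compl_nPlus hU)

lemma exists_iso_openStratum (eF : (φ.hyp.hgr r).RepresentableBy GF) :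
    ∃ i : toBase S (openStratum eF) ⟶ openCompl (toBase S GF) (NPlus S eF), IsIso i ∧
      i ≫ openComplIncl (toBase S GF) (NPlus S eF) = toBaseMap S (openStratumIncl eF) := by
  have h1 : IsOpenImmersion (toBaseMap S (openStratumIncl eF)).left :=
    inferInstanceAs (IsOpenImmersion (openStratumIncl eF).left)
  have h2 : IsOpenImmersion (openComplIncl (toBase S GF) (NPlus S eF)).left :=
    inferInstanceAs (IsOpenImmersion (Scheme.Opens.ι _))
  exact CohomologyTheory.exists_iso_of_range_eq _ _ rfl

/-- The cohomology of the open stratum. -/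
theorem CohomologyTheory.exists_inverts_openStratum (A : CohomologyTheory.{w} h𝒱) (hS : 𝒱 S)
    (hE : E.IsVectorBundle d) (hφ : φ.IsNondegenerate) (e' : (φ.hgr r).RepresentableBy G')
    (eF : (φ.hyp.hgr (r + 1)).RepresentableBy GF) :
    ∃ (σF : G' ⟶ GF) (σ : toBase S G' ⟶ openCompl (toBase S GF) (NPlus S eF)),
      ClassifiesSum e' eF σF ∧
      σ ≫ openComplIncl (toBase S GF) (NPlus S eF) = toBaseMap S σF ∧ A.Inverts σ := by
  have hF : 𝒱 (toBase S GF) := h𝒱.hgr_mem hS hE.hyp hφ.hyp eF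
  have hY : 𝒱 (openCompl (toBase S GF) (NPlus S eF)) :=
    h𝒱.openCompl_nPlus_mem hF (taut_isSubbundle eF)
  have hG' : 𝒱 (toBase S G') := h𝒱.hgr_mem hS hE hφ e'
  obtain ⟨i, hi, hi'⟩ := exists_iso_openStratum eF
  have hY' : 𝒱 (toBase S (openStratum eF)) := h𝒱.of_iso hY (asIso i)
  have hU := (taut_isSubbundle eF).pull (openStratumIncl eF)
  obtain ⟨Q, π, w, hw, hfw, huniv, haff, hmem⟩ :=
    h𝒱.exists_unitSections (isSheaf_hyp hE.isSheaf) hU (E.last _)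
  have hQ : IsUnitSections ((taut eF).pull (openStratumIncl eF)) (E.last _) π w :=
    ⟨hw, hfw, fun g v => huniv _ g v⟩
  have hQm := hmem hY'
  have hc : CompactSpace (openStratum eF).left := h𝒱.compactSpace _ hY'
  have hπ : A.Inverts (toBaseMap S π) :=
    (A.invertsOver_of_isUnitSections hY' haff hQ (fun x => by
      obtain ⟨W, hW, v, hv, hv1⟩ := exists_last_eq_one hU x fun h => by
        rw [mem_nPlus_pull_iff (taut_isSubbundle eF)] at h
        exact x.2 h
      exact ⟨W, hW, v, hv, hv1⟩) ⊤ isCompact_univ).inverts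
  obtain ⟨q, s, H, s₀, s₁, hsq, h₀, h₁, hH₀, hH₁, hcl⟩ := exists_homotopy hE hφ e' eF hQ
  have hq : A.Inverts (toBaseMap S q) := A.inverts_of_homotopy q s hsq H s₀ s₁ h₀ h₁ hH₀ hH₁
  -- As a section of the homotopy equivalence `q`, the morphism `s` is inverted too; `σ` is its
  -- composite with the affine bundle `π`.
  have hs : A.Inverts (toBaseMap S s) := by
    refine Inverts.of_comp_right hG' hq ?_
    rw [← Functor.map_comp, hsq, (Over.map S.hom).map_id]
    exact A.inverts_id _
  refine ⟨s ≫ π ≫ openStratumIncl eF, toBaseMap S s ≫ toBaseMap S π ≫ i, hcl, ?_,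
    hs.comp hQm (hπ.comp hY' (A.inverts_of_isIso i))⟩
  rw [Category.assoc, Category.assoc, hi', ← Functor.map_comp, ← Functor.map_comp]

end OpenStratum

section RankZero

variable {S : Scheme.{u}} {M : BigModule S} {φ : M.AltForm} {T : Over S} {d : ℕ}

/-- The zero subsheaf. -/
def BigModule.SubSheaf.bot (hM : Presieve.IsSheaf (Scheme.zariskiTopology.over S) M.toFunctor)
    (T : Over S) : M.SubSheaf T where
  sec _ := ⊥
  res_mem g h x hx := by
    rw [Submodule.mem_bot] at hx ⊢
    rw [hx, map_zero]
  local_mem h x hx := by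
    rw [Submodule.mem_bot]
    refine sep hM fun t => ?_
    obtain ⟨W, hW, h1⟩ := hx t
    exact ⟨W, hW, ((Submodule.mem_bot _).1 h1).trans (map_zero _).symm⟩

lemma BigModule.SubSheaf.isSubbundle_bot (hM : M.IsVectorBundle d) (T : Over S) :
    (SubSheaf.bot hM.isSheaf T).IsSubbundle 0 := by
  intro t
  obtain ⟨W, hW, b, hb⟩ := hM.exists_basis T t
  refine ⟨W, hW, d, fun i => b ((Equiv.emptySum (Fin 0) (Fin d)) i),
    hb.reindex (Equiv.emptySum (Fin 0) (Fin d)), fun T' h => ?_⟩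
  rw [Set.range_eq_empty, Submodule.span_empty]
  rfl

lemma BigModule.SubSheaf.eq_bot_of_isSubbundle (hM : M.IsVectorBundle d) {U : M.SubSheaf T}
    (hU : U.IsSubbundle 0) : U = SubSheaf.bot hM.isSheaf T := by
  refine (SubSheaf.eq_of_local fun t => ?_)
  obtain ⟨W, hW, -, l, b, -, hu⟩ := hU.exists_frame t
  refine ⟨W, hW, SubSheaf.ext ?_⟩
  funext N h
  refine (hu.span N h).trans ?_
  rw [Set.range_eq_empty, Submodule.span_empty]
  rfl

/-- The quaternionic Grassmannian bundle of subbundles of rank zero is the base. -/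
lemma isIso_hom_of_hgr_zero (hM : M.IsVectorBundle d) {G' : Over S}
    (e' : (φ.hgr 0).RepresentableBy G') : IsIso G'.hom := by
  have hs : (SubSheaf.bot hM.isSheaf (QuatGrass.base S)).IsSymplectic φ := fun N h _ => by
    have h1 : Subsingleton ((SubSheaf.bot hM.isSheaf (QuatGrass.base S)).sec h) :=
      inferInstanceAs (Subsingleton (⊥ : Submodule (Fun N) (M.sec N)))
    exact ⟨fun _ _ _ => Subsingleton.elim _ _, fun l => ⟨0, LinearMap.ext fun v => by
      rw [Subsingleton.elim v 0, map_zero, map_zero]⟩⟩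
  obtain ⟨s, -⟩ := exists_classified e' (SubSheaf.isSubbundle_bot hM (QuatGrass.base S)) hs
  have h1 : toTerminal G' ≫ s = 𝟙 G' := hom_ext_of_classified e'
    ((SubSheaf.eq_bot_of_isSubbundle hM (classified_isSubbundle e' _)).trans
      (SubSheaf.eq_bot_of_isSubbundle hM (classified_isSubbundle e' _)).symm)
  refine ⟨s.left, congrArg CommaMorphism.left h1, Over.w s⟩

end RankZero

end QuatGrass

/-! ### The total space of the tautological bundle and `N⁻` -/

namespace QuatGrass

namespace BigModule

variable {S : Scheme.{u}} {M : BigModule S} {φ : M.AltForm} {T N : Over S} {m d r : ℕ}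

section TautTotal

variable {V : Over S} (eV : (φ.tautTotal r).RepresentableBy V)

/-- The universal subbundle on the total space of the tautological bundle. -/
def tautSub : M.SubSheaf V := (eV.homEquiv (𝟙 V)).1.1.1

/-- The universal section of the universal subbundle. -/
def tautSec : M.sec V := (eV.homEquiv (𝟙 V)).1.2

lemma tautSec_mem : tautSec eV ∈ (tautSub eV).sec (𝟙 V) := (eV.homEquiv (𝟙 V)).2

lemma tautSub_isSubbundle : (tautSub eV).IsSubbundle (2 * r) := (eV.homEquiv (𝟙 V)).1.1.2.1

lemma tautSub_isSymplectic : (tautSub eV).IsSymplectic φ := (eV.homEquiv (𝟙 V)).1.1.2.2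

lemma homEquiv_tautTotal_fst (h : T ⟶ V) : (eV.homEquiv h).1.1.1 = (tautSub eV).pull h :=
  congrArg (fun p => p.1.1.1) (eV.homEquiv_eq h)

lemma homEquiv_tautTotal_snd (h : T ⟶ V) : (eV.homEquiv h).1.2 = M.res h (tautSec eV) :=
  congrArg (fun p => p.1.2) (eV.homEquiv_eq h)

lemma exists_hom_tautTotal {U : M.SubSheaf T} (hU : U.IsSubbundle (2 * r)) (hs : U.IsSymplectic φ)
    {x : M.sec T} (hx : x ∈ U.sec (𝟙 T)) :
    ∃ h : T ⟶ V, (tautSub eV).pull h = U ∧ M.res h (tautSec eV) = x := by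
  let p : (φ.tautTotal r).obj (op T) := ⟨(⟨U, hU, hs⟩, x), hx⟩
  have hp := eV.homEquiv.apply_symm_apply p
  refine ⟨eV.homEquiv.symm p, ?_, ?_⟩
  · rw [← homEquiv_tautTotal_fst, hp]
  · rw [← homEquiv_tautTotal_snd, hp]

lemma hom_ext_tautTotal {h h' : T ⟶ V} (h1 : (tautSub eV).pull h = (tautSub eV).pull h')
    (h2 : M.res h (tautSec eV) = M.res h' (tautSec eV)) : h = h' := by
  refine eV.homEquiv.injective (Subtype.ext (Prod.ext (Subtype.ext ?_) ?_))
  · rw [homEquiv_tautTotal_fst, homEquiv_tautTotal_fst, h1]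
  · rw [homEquiv_tautTotal_snd, homEquiv_tautTotal_snd, h2]

variable {G : Over S} (e : (φ.hgr r).RepresentableBy G)

lemma homEquiv_zeroSection : eV.homEquiv (zeroSection e eV) =
    ⟨(e.homEquiv (𝟙 G), 0), Submodule.zero_mem _⟩ :=
  eV.homEquiv.apply_symm_apply _

lemma tautSub_pull_zeroSection : (tautSub eV).pull (zeroSection e eV) = taut e := by
  rw [← homEquiv_tautTotal_fst, homEquiv_zeroSection eV e]
  rfl

lemma res_zeroSection : M.res (zeroSection e eV) (tautSec eV) = 0 := by
  rw [← homEquiv_tautTotal_snd, homEquiv_zeroSection eV e]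

lemma exists_comp_zeroSection {h : T ⟶ V} (h0 : M.res h (tautSec eV) = 0) :
    ∃ c : T ⟶ G, c ≫ zeroSection e eV = h := by
  obtain ⟨c, hc⟩ := exists_classified e ((tautSub_isSubbundle eV).pull h)
    fun N g => tautSub_isSymplectic eV N (g ≫ h)
  refine ⟨c, hom_ext_tautTotal eV ?_ ?_⟩
  · rw [SubSheaf.pull_comp, tautSub_pull_zeroSection, ← classified_eq_pull, hc]
  · rw [M.res_comp, res_zeroSection, map_zero, h0]

/-- The total space of the tautological bundle represents its functor of points. -/
def tautTotalRepresentableBy {P : Over S} {π : P ⟶ G} {x : M.sec P} (hx : x ∈ (taut e).sec π)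
    (h : ∀ (T : Over S) (g : T ⟶ G) (v : M.sec T), v ∈ (taut e).sec g →
      ∃! h : T ⟶ P, h ≫ π = g ∧ M.res h x = v) : (φ.tautTotal r).RepresentableBy P where
  homEquiv {T} := Equiv.ofBijective (fun g => ⟨(e.homEquiv (g ≫ π), M.res g x), by
      have h1 := (taut e).res_mem g π x hx
      exact (mem_classified e _).2 h1⟩) (by
    constructor
    · intro g g' hg
      have h1 : g ≫ π = g' ≫ π := e.homEquiv.injective (congrArg (fun p => p.1.1) hg)
      have h2 : M.res g x = M.res g' x := congrArg (fun p => p.1.2) hg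
      exact (h T (g' ≫ π) _ ((taut e).res_mem g' π x hx)).unique ⟨h1, h2⟩ ⟨rfl, rfl⟩
    · rintro ⟨⟨U, v⟩, hv⟩
      obtain ⟨g, rfl⟩ := e.homEquiv.surjective U
      obtain ⟨h', ⟨h1, h2⟩, -⟩ := h T g v ((mem_classified e _).1 hv)
      refine ⟨h', Subtype.ext (Prod.ext ?_ h2)⟩
      exact congrArg e.homEquiv h1)
  homEquiv_comp f g := by
    refine Subtype.ext (Prod.ext ?_ (M.res_comp f g x))
    exact (congrArg e.homEquiv (Category.assoc f g π)).trans (e.homEquiv_comp f (g ≫ π))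

end TautTotal

section NMinus

variable {V GF : Over S} (eV : (φ.tautTotal r).RepresentableBy V)
  (eF : (φ.hyp.hgr r).RepresentableBy GF)
  (hM : Presieve.IsSheaf (Scheme.zariskiTopology.over S) M.toFunctor)

/-- The subbundle of the vectors `(0, y, φ(x, y))`. -/
abbrev tautGraph : M.hyp.SubSheaf V := SubSheaf.graph φ hM (tautSub eV) 0 (tautSec eV)

lemma exists_classified_tautGraph (hMb : M.IsVectorBundle d) :
    ∃ f : V ⟶ GF, classified eF f = tautGraph eV hM :=
  exists_classified eF ((tautSub_isSubbundle eV).graph hMb (tautSub_isSymplectic eV) _ _)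
    ((tautSub_isSymplectic eV).graph_zero_left _)

variable {eV eF hM} {f : V ⟶ GF} (hf : classified eF f = tautGraph eV hM)
include hf

lemma classifiesGraph_of_eq : ClassifiesGraph eV eF f := fun T h v => by
  have h1 : ∀ v : M.hyp.sec T, v ∈ (tautGraph eV hM).sec h ↔
      mid T v ∈ (tautSub eV).sec h ∧
        φ.graphVec (M.res h 0) (M.res h (tautSec eV)) (mid T v) = v := fun v => SubSheaf.mem_graph
  have h2 : mid T v ∈ ((tautSub eV).pull h).sec (𝟙 T) ↔ mid T v ∈ (tautSub eV).sec h := by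
    change _ ∈ (tautSub eV).sec (𝟙 T ≫ h) ↔ _
    rw [Category.id_comp]
  rw [hf, homEquiv_tautTotal_fst, homEquiv_tautTotal_snd]
  refine (h1 v).trans ?_
  rw [map_zero, φ.graphVec_apply, map_zero, LinearMap.zero_apply]
  constructor
  · rintro ⟨h3, h4⟩
    exact ⟨(congrArg Prod.fst h4).symm, h2.2 h3, (congrArg (fun t => t.2.2) h4).symm⟩
  · rintro ⟨h3, h4, h5⟩
    exact ⟨h2.1 h4, Prod.ext h3.symm (Prod.ext rfl h5.symm)⟩

lemma classified_comp_tautGraph (h : T ⟶ V) : classified eF (h ≫ f) =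
    SubSheaf.graph φ hM ((tautSub eV).pull h) 0 (M.res h (tautSec eV)) := by
  rw [classified_comp, hf, tautGraph, SubSheaf.graph_pull, map_zero]

lemma hom_ext_of_comp_tautGraph {h h' : T ⟶ V} (hh : h ≫ f = h' ≫ f) : h = h' := by
  have h1 := congrArg (classified eF) hh
  rw [classified_comp_tautGraph hf, classified_comp_tautGraph hf] at h1
  have hx : ∀ h : T ⟶ V, M.res h (tautSec eV) ∈ ((tautSub eV).pull h).sec (𝟙 T) := fun h => by
    change _ ∈ (tautSub eV).sec (𝟙 T ≫ h)
    rw [Category.id_comp]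
    exact SubSheaf.res_mem_of_id (tautSec_mem eV) h
  have h2 := SubSheaf.graph_injective
    (((tautSub_isSubbundle eV).isLocSymp (tautSub_isSymplectic eV)).pull h)
    (Submodule.zero_mem _) (hx h) (Submodule.zero_mem _) (hx h') h1
  exact hom_ext_tautTotal eV h2.1 h2.2.2

/-- If first components vanish on `U`, then `ψ` restricts to the form induced by `φ`, so `U` is a
graph. Its first component `φ(x, ·)` vanishes on `U'`, which forces `x = 0`. -/
lemma exists_comp_tautGraph_iff (hMb : M.IsVectorBundle d) (hφ : φ.IsNondegenerate) (g : T ⟶ GF) :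
    (∃ h : T ⟶ V, h ≫ f = g) ↔ ∀ (T' : Over S) (a : T' ⟶ T) (v : M.hyp.sec T'),
      v ∈ (classified eF g).sec a → v.1 = 0 := by
  constructor
  · rintro ⟨h, rfl⟩ T' a v hv
    rw [classified_comp_tautGraph hf] at hv
    obtain ⟨-, h2⟩ := SubSheaf.mem_graph.1 hv
    rw [← h2, map_zero, φ.graphVec_apply, map_zero]
    rfl
  · intro h0
    have hs : (classified eF g).IsSymplectic φ.comap := fun N a hN => by
      have h1 := classified_isSymplectic eF g N a hN
      have h2 : (φ.hyp.form N).domRestrict₁₂ ((classified eF g).sec a) ((classified eF g).sec a) =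
          (φ.comap.form N).domRestrict₁₂ ((classified eF g).sec a) ((classified eF g).sec a) := by
        refine LinearMap.ext fun v => LinearMap.ext fun v' => ?_
        change v.1.1 * v'.1.2.2 + φ.form N v.1.2.1 v'.1.2.1 - v.1.2.2 * v'.1.1 = _
        rw [h0 N a v.1 v.2, h0 N a v'.1 v'.2, zero_mul, mul_zero, zero_add, sub_zero]
        rfl
      rwa [h2] at h1
    obtain ⟨U', x, y, hU', hs', hx, hy, hG⟩ := SubSheaf.exists_eq_graph (hM := hM) hMb hφ
      ((classified_isSubbundle eF g).isLocSymp hs)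
    have hx0 : x = 0 := (hU'.isLocSymp hs').eq_zero hM hx fun N a v hv => by
      rw [Category.comp_id] at hv
      refine h0 N a (φ.graphVec (M.res a x) (M.res a y) v) ?_
      rw [← hG]
      exact ⟨v, hv, rfl⟩
    obtain ⟨h, h1, h2⟩ := exists_hom_tautTotal eV hU' hs' hy
    refine ⟨h, hom_ext_of_classified eF ?_⟩
    rw [classified_comp_tautGraph hf, h1, h2, ← hG, hx0]

/-- `f` is a monomorphism, as a graph determines its data, and its image is locally cut out by the
first components of a frame of the tautological subbundle. -/
theorem isNMinus_of_eq (hMb : M.IsVectorBundle d) (hφ : φ.IsNondegenerate) : IsNMinus eF f := by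
  refine ⟨?_, fun T g => exists_comp_tautGraph_iff hf hMb hφ g⟩
  have : Mono f := ⟨fun h h' hh => hom_ext_of_comp_tautGraph hf hh⟩
  refine isClosedImmersion_of_local f fun y => ?_
  obtain ⟨W, hW, -, l, b, -, hu⟩ := (taut_isSubbundle eF).exists_frame y
  refine ⟨W, hW, Fin (2 * r), fun i => (b (Sum.inl i)).1, fun T c => ?_⟩
  rw [exists_comp_tautGraph_iff hf hMb hφ]
  have hsec : ∀ (T' : Over S) (a : T' ⟶ T), (classified eF (c ≫ openIncl GF W)).sec a =
      Submodule.span (Fun T') (Set.range fun i : Fin (2 * r) =>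
        M.hyp.res (a ≫ c) (b (Sum.inl i))) := fun T' a => by
    rw [← hu.span, Category.assoc, classified_eq_pull]
    rfl
  constructor
  · intro h i
    have h1 := h T (𝟙 T) (M.hyp.res (𝟙 T ≫ c) (b (Sum.inl i))) (by
      rw [hsec]
      exact Submodule.subset_span ⟨i, rfl⟩)
    rwa [Category.id_comp] at h1
  · intro h T' a v hv
    rw [hsec] at hv
    let K : Submodule (Fun T') (M.hyp.sec T') :=
      LinearMap.ker (LinearMap.fst (Fun T') (Fun T') (M.sec T' × Fun T'))
    have h4 : Submodule.span (Fun T') (Set.range fun i : Fin (2 * r) =>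
        M.hyp.res (a ≫ c) (b (Sum.inl i))) ≤ K := by
      rw [Submodule.span_le]
      rintro _ ⟨i, rfl⟩
      change resFun (a ≫ c) (b (Sum.inl i)).1 = 0
      rw [resFun_comp, h i, map_zero]
    exact h4 hv

lemma comp_left_mem_nPlus_iff (h : T ⟶ V) (t : T.left) :
    (h ≫ f).left t ∈ nPlus (taut eF) (taut_isSubbundle eF) ↔
      M.res (ptIncl T t) (M.res h (tautSec eV)) = 0 := by
  have hx : M.res h (tautSec eV) ∈ ((tautSub eV).pull h).sec (𝟙 T) := by
    change _ ∈ (tautSub eV).sec (𝟙 T ≫ h)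
    rw [Category.id_comp]
    exact SubSheaf.res_mem_of_id (tautSec_mem eV) h
  have hG := classified_comp_tautGraph hf h
  have hsub : (SubSheaf.graph φ hM ((tautSub eV).pull h) 0
      (M.res h (tautSec eV))).IsSubbundle (2 * r) := hG ▸ classified_isSubbundle eF _
  rw [← mem_nPlus_graph_iff (fun N a => tautSub_isSymplectic eV N (a ≫ h)) hx hsub t,
    ← mem_nPlus_pull_iff (taut_isSubbundle eF) (h ≫ f) t, mem_nPlus_iff, mem_nPlus_iff,
    ← classified_eq_pull, hG]

/-- The inverse image of `N⁺` in the total space of the tautological bundle is the zero section. -/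
theorem preimage_nPlus {G : Over S} (e : (φ.hgr r).RepresentableBy G) :
    f.left ⁻¹' (nPlus (taut eF) (taut_isSubbundle eF) : Set GF.left) =
      Set.range (zeroSection e eV).left := by
  ext x
  constructor
  · intro hx
    have h1 := (comp_left_mem_nPlus_iff hf (𝟙 V) x).1 (by rwa [Category.id_comp])
    rw [M.res_id] at h1
    -- The tautological section vanishes at the residue field of `x`, so this point of `V` factors
    -- through the zero section.
    obtain ⟨c, hc⟩ := exists_comp_zeroSection eV e h1
    refine ⟨c.left (default : Spec (V.left.residueField x)), ?_⟩
    have h2 : (zeroSection e eV).left (c.left (default : Spec (V.left.residueField x))) =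
        (ptIncl V x).left (default : Spec (V.left.residueField x)) := by
      rw [← hc]
      rfl
    rw [h2]
    exact Scheme.fromSpecResidueField_apply _ _
  · rintro ⟨g, rfl⟩
    have h1 := (comp_left_mem_nPlus_iff hf (zeroSection e eV) g).2 (by rw [res_zeroSection, map_zero])
    exact h1

end NMinus

end BigModule

/-- The total space of the tautological bundle of a quaternionic Grassmannian bundle is a
vector bundle over it. -/
theorem IsAdmissible.exists_tautTotal {k : Scheme.{u}} {𝒱 : ObjectProperty (Over k)}
    (h𝒱 : IsAdmissible 𝒱) {S : Over k} {M : BigModule S.left} {d r : ℕ} (hM : M.IsVectorBundle d)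
    {φ : M.AltForm} {G : Over S.left} (e : (φ.hgr r).RepresentableBy G) :
    ∃ P, Nonempty ((φ.tautTotal r).RepresentableBy P) ∧ (𝒱 (toBase S G) → 𝒱 (toBase S P)) := by
  obtain ⟨P, π, x, hx, huniv, -, hmem, -⟩ := h𝒱.exists_totalSpace hM
    ((taut_isSubbundle e).isLocSymp (classified_isSymplectic e (𝟙 G)))
  exact ⟨P, ⟨tautTotalRepresentableBy e hx huniv⟩, hmem⟩

theorem IsAdmissible.tautTotal_mem {k : Scheme.{u}} {𝒱 : ObjectProperty (Over k)}
    (h𝒱 : IsAdmissible 𝒱) {S : Over k} (hS : 𝒱 S) {M : BigModule S.left} {d r : ℕ}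
    (hM : M.IsVectorBundle d) {φ : M.AltForm} (hφ : φ.IsNondegenerate) {G V : Over S.left}
    (e : (φ.hgr r).RepresentableBy G) (eV : (φ.tautTotal r).RepresentableBy V) :
    𝒱 (toBase S V) := by
  obtain ⟨P, ⟨eP⟩, hmem⟩ := h𝒱.exists_tautTotal hM e
  exact h𝒱.of_iso (hmem (h𝒱.hgr_mem hS hM hφ e))
    ((Over.map S.hom).mapIso (eV.uniqueUpToIso eP))

end QuatGrass

/-! ### A neighbourhood of `N⁺` inside a vector bundle over `V` -/

namespace QuatGrass

namespace BigModule

variable {S : Scheme.{u}} {M : BigModule S} {φ : M.AltForm} {T N : Over S} {m d r : ℕ}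

lemma SubSheaf.isCompact_of_isBasicOpen_local [CompactSpace T.left] {O : T.left.Opens}
    (h : ∀ t : T.left, ∃ W : T.left.Opens, t ∈ W ∧ IsAffine (openSub T W).left ∧
      ∃ f : Fun (openSub T W), ∀ s : W.toScheme, W.ι s ∈ O ↔ s ∈ (openSub T W).left.basicOpen f) :
    IsCompact (O : Set T.left) := by
  refine isCompact_of_local _ fun t => ?_
  obtain ⟨W, hW, haff, f, hf⟩ := h t
  refine ⟨W, hW, ?_⟩
  have h1 : (O : Set T.left) ∩ W = W.ι '' {z | z ∈ (openSub T W).left.basicOpen f} := by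
    ext y
    constructor
    · rintro ⟨hy, hyW⟩
      exact ⟨⟨y, hyW⟩, (hf ⟨y, hyW⟩).1 hy, rfl⟩
    · rintro ⟨z, hz, rfl⟩
      exact ⟨(hf z).2 hz, z.2⟩
  rw [h1]
  exact ((isAffineOpen_top (openSub T W).left).basicOpen _).isCompact.image W.ι.continuous

/-- Over `N⁺` the symplectic form is induced from the form on `M`. -/
lemma isSymplectic_comap_of_mem_nPlus {U : M.hyp.SubSheaf T} (hU : U.IsSubbundle m)
    (hs : U.IsSymplectic φ.hyp) {t : T.left} (ht : t ∈ nPlus U hU) :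
    (U.pull (ptIncl T t)).IsSymplectic φ.comap := by
  obtain ⟨W, hW, -, l, b, -, hu⟩ := hU.exists_frame t
  obtain ⟨h, hh, -⟩ := exists_lift_pt W t hW
  have h0 : ∀ (N : Over S) (a : N ⟶ pt T t) (v : M.hyp.sec N), v ∈ U.sec (a ≫ ptIncl T t) →
      v.2.2 = 0 := fun N a v hv => by
    rw [← hh, ← Category.assoc, hu.span] at hv
    have h4 : Submodule.span (Fun N) (Set.range fun i => M.hyp.res (a ≫ h) (b (Sum.inl i))) ≤
        LinearMap.ker ((M.last T).app (a ≫ ptIncl T t)) := by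
      rw [Submodule.span_le]
      rintro _ ⟨i, rfl⟩
      have h1 : resFun h (b (Sum.inl i)).2.2 = 0 := ht (M.hyp.res h (b (Sum.inl i))) (by
        rw [← hh, hu.span]
        exact Submodule.subset_span ⟨i, rfl⟩)
      change resFun (a ≫ h) (b (Sum.inl i)).2.2 = 0
      rw [resFun_comp, h1, map_zero]
    exact h4 hv
  intro N a hN
  have h1 := hs N (a ≫ ptIncl T t) hN
  have h2 : (φ.hyp.form N).domRestrict₁₂ (U.sec (a ≫ ptIncl T t)) (U.sec (a ≫ ptIncl T t)) =
      (φ.comap.form N).domRestrict₁₂ (U.sec (a ≫ ptIncl T t)) (U.sec (a ≫ ptIncl T t)) := by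
    refine LinearMap.ext fun v => LinearMap.ext fun v' => ?_
    change v.1.1 * v'.1.2.2 + φ.form N v.1.2.1 v'.1.2.1 - v.1.2.2 * v'.1.1 = _
    rw [h0 N a v.1 v.2, h0 N a v'.1 v'.2, zero_mul, mul_zero, zero_add, sub_zero]
    rfl
  rwa [h2] at h1

lemma isOpenImmersion_of_inverse {X Y : Over S} {O : Y.left.Opens} (κ : X ⟶ Y)
    (κ' : X ⟶ openSub Y O) (ρ : openSub Y O ⟶ X) (h1 : κ' ≫ openIncl Y O = κ) (h2 : κ' ≫ ρ = 𝟙 X)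
    (h3 : ρ ≫ κ = openIncl Y O) : IsOpenImmersion κ.left ∧ Set.range κ.left = (O : Set Y.left) := by
  have hm : Mono (openIncl Y O) :=
    (Over.forget _).mono_of_mono_map (inferInstanceAs (Mono (Scheme.Opens.ι O)))
  have h4 : ρ ≫ κ' = 𝟙 _ := by
    rw [← cancel_mono (openIncl Y O), Category.assoc, h1, h3, Category.id_comp]
  have hi : IsIso κ'.left :=
    ⟨ρ.left, congrArg CommaMorphism.left h2, congrArg CommaMorphism.left h4⟩
  subst h1
  refine ⟨?_, ?_⟩
  · rw [Over.comp_left]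
    infer_instance
  · refine Set.Subset.antisymm ?_ ?_
    · rintro _ ⟨x, rfl⟩
      exact openIncl_mem κ' x
    · rw [← range_openIncl Y O]
      rintro _ ⟨x, rfl⟩
      refine ⟨ρ.left x, ?_⟩
      exact congrArg (fun g => g.left x) h3

section Neighbourhood

variable {V GF : Over S} {eV : (φ.tautTotal r).RepresentableBy V}
  {eF : (φ.hyp.hgr r).RepresentableBy GF}
  {hM : Presieve.IsSheaf (Scheme.zariskiTopology.over S) M.toFunctor}
  {f : V ⟶ GF} (hf : classified eF f = tautGraph eV hM)

include hf

/-- The open subscheme of `HGr(r; 𝒪 ⊕ M ⊕ 𝒪)` where the form induced by `φ` is nondegenerate is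
an open subscheme of the total space of a vector bundle over `V`. -/
theorem exists_neighbourhood (hMb : M.IsVectorBundle d) (hφ : φ.IsNondegenerate) {W : Over S}
    {π : W ⟶ V} {x : M.sec W} (hx : x ∈ (tautSub eV).sec π)
    (huniv : ∀ (T : Over S) (g : T ⟶ V) (v : M.sec T), v ∈ (tautSub eV).sec g →
      ∃! h : T ⟶ W, h ≫ π = g ∧ M.res h x = v) :
    ∃ (O : GF.left.Opens) (κ : openSub GF O ⟶ W) (μ : V ⟶ openSub GF O),
      (CompactSpace GF.left → IsCompact (O : Set GF.left)) ∧
      (nPlus (taut eF) (taut_isSubbundle eF) : Set GF.left) ⊆ O ∧ IsOpenImmersion κ.left ∧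
      μ ≫ openIncl GF O = f ∧ μ ≫ κ ≫ π = 𝟙 V ∧
      (∀ t, (openIncl GF O).left t ∈ nPlus (taut eF) (taut_isSubbundle eF) ↔
        (κ ≫ π ≫ f).left t ∈ nPlus (taut eF) (taut_isSubbundle eF)) ∧
      ∀ t, (π ≫ f).left t ∈ nPlus (taut eF) (taut_isSubbundle eF) → t ∈ Set.range κ.left := by
  have hVs : ∀ {T : Over S} (h : T ⟶ V), ((tautSub eV).pull h).IsLocSymp φ (2 * r) := fun h =>
    ((tautSub_isSubbundle eV).isLocSymp (tautSub_isSymplectic eV)).pull h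
  have hVy : ∀ {T : Over S} (h : T ⟶ V),
      M.res h (tautSec eV) ∈ ((tautSub eV).pull h).sec (𝟙 T) := fun h => by
    change _ ∈ (tautSub eV).sec (𝟙 _ ≫ h)
    rw [Category.id_comp]
    exact SubSheaf.res_mem_of_id (tautSec_mem eV) h
  have hWx : ∀ {T : Over S} (h : T ⟶ W),
      M.res h x ∈ ((tautSub eV).pull (h ≫ π)).sec (𝟙 T) := fun h => by
    change _ ∈ (tautSub eV).sec (𝟙 _ ≫ h ≫ π)
    rw [Category.id_comp]
    exact (tautSub eV).res_mem h π x hx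
  -- Over `O` the tautological subbundle is a graph over some `U'` with data `x'`, `y'`. The pair
  -- `(U', y')` is the point `v` of `V`, and `x'` lifts it to the point `κ` of `W`.
  obtain ⟨O, hO, hOc⟩ := (taut_isSubbundle eF).exists_sympl_locus φ.comap
  have hOmem : ∀ {T : Over S} (g : T ⟶ GF), (classified eF g).IsSymplectic φ.comap →
      ∀ t, g.left t ∈ O := fun g hg => (hO _ g).1 (by
    rw [← classified_eq_pull]
    exact (classified_isSubbundle eF g).isLocSymp hg)
  let i : openSub GF O ⟶ GF := openIncl GF O
  have hi : ∀ {T : Over S} (a b : T ⟶ openSub GF O), a ≫ i = b ≫ i → a = b := fun a b hab => by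
    have hm : Mono i :=
      (Over.forget _).mono_of_mono_map (inferInstanceAs (Mono (Scheme.Opens.ι O)))
    exact (cancel_mono i).1 hab
  have hiO : ((taut eF).pull i).IsLocSymp φ.comap (2 * r) := (hO _ i).2 fun t => by
    have := openIncl_mem (𝟙 (openSub GF O)) t
    rwa [Category.id_comp] at this
  obtain ⟨U', x', y', hU', hs', hx', hy', hgr⟩ := SubSheaf.exists_eq_graph (hM := hM) hMb hφ hiO
  rw [← classified_eq_pull] at hgr
  obtain ⟨v, hv, hvy⟩ := exists_hom_tautTotal eV hU' hs' hy'
  obtain ⟨κ, ⟨hκ, hκx⟩, -⟩ := huniv _ v x' (by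
    rw [← hv] at hx'
    change _ ∈ (tautSub eV).sec (𝟙 _ ≫ v) at hx'
    rwa [Category.id_comp] at hx')
  obtain ⟨μ, hμ⟩ := exists_lift_openSub O f (hOmem f (by
    rw [hf]
    exact (tautSub_isSymplectic eV).graph_comap 0 _))
  have hclass : ∀ {T : Over S} (h : T ⟶ openSub GF O), classified eF (h ≫ i) =
      SubSheaf.graph φ hM ((tautSub eV).pull (h ≫ v)) (M.res (h ≫ κ) x)
        (M.res (h ≫ v) (tautSec eV)) := fun h => by
    rw [classified_comp, ← hgr, SubSheaf.graph_pull, ← hv, ← hvy, ← hκx, SubSheaf.pull_comp,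
      M.res_comp, M.res_comp]
  -- For the inverse direction, the universal graph over `W` is symplectic for `ψ` on an open
  -- subscheme `Ω`, where it is classified by `ρ`. Uniqueness of the data of a graph makes `ρ` and
  -- `κ'` mutually inverse.
  let Γ : M.hyp.SubSheaf W := SubSheaf.graph φ hM ((tautSub eV).pull π) x (M.res π (tautSec eV))
  have hΓ : ∀ {T : Over S} (h : T ⟶ W), Γ.pull h = SubSheaf.graph φ hM
      ((tautSub eV).pull (h ≫ π)) (M.res h x) (M.res (h ≫ π) (tautSec eV)) := fun h => by
    rw [SubSheaf.graph_pull, SubSheaf.pull_comp, M.res_comp]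
  have hΓs : Γ.IsSubbundle (2 * r) :=
    ((tautSub_isSubbundle eV).pull π).graph hMb (fun N a => tautSub_isSymplectic eV N (a ≫ π)) _ _
  obtain ⟨Ω, hΩ, -⟩ := hΓs.exists_sympl_locus φ.hyp
  let ι : openSub W Ω ⟶ W := openIncl W Ω
  have hιs : (Γ.pull ι).IsLocSymp φ.hyp (2 * r) := (hΩ _ ι).2 fun t => by
    have := openIncl_mem (𝟙 (openSub W Ω)) t
    rwa [Category.id_comp] at this
  obtain ⟨ρ', hρ'⟩ := exists_classified eF (hΓs.pull ι)
    (hιs.isSymplectic (isSheaf_hyp hM) hφ.hyp)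
  obtain ⟨ρ, hρ⟩ := exists_lift_openSub O ρ' (hOmem ρ' (by
    rw [hρ', hΓ]
    exact SubSheaf.IsSymplectic.graph_comap
      (fun N a => tautSub_isSymplectic eV N (a ≫ ι ≫ π)) _ _))
  have hκΓ : ∀ {T : Over S} (h : T ⟶ openSub GF O), Γ.pull (h ≫ κ) = classified eF (h ≫ i) :=
    fun h => by rw [hΓ, hclass, Category.assoc, hκ]
  obtain ⟨κ', hκ'⟩ := exists_lift_openSub Ω κ ((hΩ _ κ).1 (by
    have h1 := hκΓ (𝟙 _)
    rw [Category.id_comp] at h1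
    rw [h1]
    exact (classified_isSubbundle eF _).isLocSymp (classified_isSymplectic eF _)))
  have h2 : κ' ≫ ρ = 𝟙 _ := by
    refine hi _ _ (hom_ext_of_classified eF ?_)
    rw [Category.assoc, hρ, classified_comp eF κ' ρ', hρ', ← SubSheaf.pull_comp, hκ',
      ← hκΓ, Category.id_comp]
  have hρv : ρ ≫ v = ι ≫ π ∧ M.res (ρ ≫ κ) x = M.res ι x := by
    have h1 : classified eF (ρ ≫ i) = Γ.pull ι := by rw [hρ, hρ']
    rw [hclass, hΓ] at h1
    have hx1 := hWx (ρ ≫ κ)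
    rw [Category.assoc, hκ] at hx1
    have h3 := SubSheaf.graph_injective (hVs (ρ ≫ v)) hx1 (hVy _) (hWx ι) (hVy _) h1
    exact ⟨hom_ext_tautTotal eV h3.1 h3.2.2, h3.2.1⟩
  have h3 : ρ ≫ κ = ι := (huniv _ (ι ≫ π) (M.res ι x) ((tautSub eV).res_mem ι π x hx)).unique
    ⟨by rw [Category.assoc, hκ, hρv.1], hρv.2⟩ ⟨rfl, rfl⟩
  obtain ⟨hoi, hrange⟩ := isOpenImmersion_of_inverse κ κ' ρ hκ' h2 h3
  refine ⟨O, κ, μ, fun _ => SubSheaf.isCompact_of_isBasicOpen_local hOc, fun t ht => ?_, hoi, hμ,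
    ?_, fun t => ?_, fun t ht => ?_⟩
  · have h4 := hOmem (ptIncl GF t) (by
      rw [classified_eq_pull]
      exact isSymplectic_comap_of_mem_nPlus (taut_isSubbundle eF)
        (classified_isSymplectic eF (𝟙 GF)) ht) (default : Spec (GF.left.residueField t))
    have h5 : (ptIncl GF t).left (default : Spec (GF.left.residueField t)) = t :=
      Scheme.fromSpecResidueField_apply _ _
    rwa [h5] at h4
  · have h4 := hclass μ
    have h5 : classified eF (μ ≫ i) = _ := (congrArg _ hμ).trans hf
    rw [h5] at h4
    have hx1 := hWx (μ ≫ κ)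
    rw [Category.assoc, hκ] at hx1
    have h6 := SubSheaf.graph_injective ((tautSub_isSubbundle eV).isLocSymp
      (tautSub_isSymplectic eV)) (Submodule.zero_mem _) (tautSec_mem eV) hx1 (hVy _) h4
    rw [hκ]
    refine hom_ext_tautTotal eV ?_ ?_
    · rw [← h6.1, SubSheaf.pull_id]
    · rw [← h6.2.2, M.res_id]
  · rw [← Category.assoc κ, hκ, comp_left_mem_nPlus_iff hf]
    have h4 := hclass (𝟙 _)
    rw [Category.id_comp, Category.id_comp] at h4
    have hsub : (SubSheaf.graph φ hM ((tautSub eV).pull v) (M.res (𝟙 _ ≫ κ) x)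
        (M.res v (tautSec eV))).IsSubbundle (2 * r) := h4 ▸ classified_isSubbundle eF _
    rw [← mem_nPlus_graph_iff (fun N a => tautSub_isSymplectic eV N (a ≫ v)) (hVy v) hsub t,
      ← mem_nPlus_pull_iff (taut_isSubbundle eF) i t, mem_nPlus_iff, mem_nPlus_iff,
      ← classified_eq_pull, h4]
  -- At such a point the second section of the graph is zero, so `ψ` restricts to `φ` and is
  -- nondegenerate. The point thus lies in `Ω`, the image of `κ`.
  · rw [comp_left_mem_nPlus_iff hf] at ht
    rw [hrange]
    have h6 : ((tautSub eV).pull (ptIncl W t ≫ π)).IsSymplectic φ :=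
      fun N a => tautSub_isSymplectic eV N (a ≫ ptIncl W t ≫ π)
    have h7 : (Γ.pull (ptIncl W t)).IsSymplectic φ.hyp := by
      rw [hΓ, M.res_comp (ptIncl W t) π, ht]
      exact h6.graph_zero_right _
    have h4 := (hΩ _ (ptIncl W t)).1 ((hΓs.pull _).isLocSymp h7)
      (default : Spec (W.left.residueField t))
    have h5 : (ptIncl W t).left (default : Spec (W.left.residueField t)) = t :=
      Scheme.fromSpecResidueField_apply _ _
    rwa [h5] at h4

end Neighbourhood

end BigModule

end QuatGrass

/-! ### Cohomology with supports in `N⁺`: part (c) -/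

namespace QuatGrass

variable {k : Scheme.{u}} {𝒱 : ObjectProperty (Over k)} {h𝒱 : IsAdmissible 𝒱}

namespace CohomologyTheory

variable {A : CohomologyTheory.{w} h𝒱}

lemma Inverts.of_comp_left {X'' X' X : Over k} {f : X'' ⟶ X'} {g : X' ⟶ X} (h : 𝒱 X'')
    (hf : A.Inverts f) (hfg : A.Inverts (f ≫ g)) : A.Inverts g := fun h' h₀ => by
  have h1 : ⇑(A.totPullback h h₀ (f ≫ g)) = A.totPullback h h' f ∘ A.totPullback h' h₀ g :=
    funext fun a => A.totPullback_comp h h' h₀ f g a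
  have h2 := hfg h h₀
  rw [h1] at h2
  exact (Function.Bijective.of_comp_iff' (hf h h') _).1 h2

/-- Five lemma, with the hypothesis applied to the whole of `X` and to the complement of `Z`. -/
lemma bijective_pullback_of_invertsOver {q p : SupportPair 𝒱} (f : q ⟶ p)
    (hZ : (q.Z : Set q.X.left) = f.f.left ⁻¹' (p.Z : Set p.X.left))
    (h : ∀ W : p.X.left.Opens, IsCompact (W : Set p.X.left) → A.InvertsOver f.f W) :
    Function.Bijective (A.pullback f) := by
  have h1 := h𝒱.compactSpace _ p.mem
  have h2 := h𝒱.compactSpace _ p.mem_compl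
  have hmem : ∀ t, f.f.left ((openComplIncl q.X q.Z).left t) ∈ p.Z.compl := fun t ht => by
    have h3 := openIncl_mem (𝟙 (openCompl q.X q.Z)) t
    rw [Category.id_comp] at h3
    refine h3 ?_
    rw [hZ]
    exact ht
  obtain ⟨g, hg⟩ := exists_lift_openSub p.Z.compl (openComplIncl q.X q.Z ≫ f.f) hmem
  refine A.bijective_pullback_of_inverts f g hg (h ⊤ isCompact_univ).inverts
    (h p.Z.compl (isCompact_iff_compactSpace.2 h2) _ _ _ _ _
      (inferInstanceAs (IsOpenImmersion (Scheme.Opens.ι _)))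
      (inferInstanceAs (IsOpenImmersion (Scheme.Opens.ι _))) (range_openIncl _ _) ?_ hg)
  refine (range_openIncl q.X q.Z.compl).trans ?_
  change (q.Z : Set q.X.left)ᶜ = (f.f.left ⁻¹' (p.Z : Set p.X.left))ᶜ
  rw [hZ]

variable {S : Over k} {E : BigModule S.left} {φ : E.AltForm} {d r : ℕ}

/-- The pullback `A_{N⁺}(HGr(r; 𝒪 ⊕ E ⊕ 𝒪)) → A_Z(V)` is an isomorphism. -/
theorem bijective_pullback_tautGraph (A : CohomologyTheory.{w} h𝒱) (hE : E.IsVectorBundle d)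
    (hφ : φ.IsNondegenerate) {V GF : Over S.left} {eV : (φ.tautTotal r).RepresentableBy V}
    {eF : (φ.hyp.hgr r).RepresentableBy GF} {f : V ⟶ GF}
    (hf : classified eF f = tautGraph eV hE.isSheaf) {hF : 𝒱 (toBase S GF)}
    {hY : 𝒱 (openCompl (toBase S GF) (NPlus S eF))} {hV : 𝒱 (toBase S V)}
    {Z : Closeds (toBase S V).left} {hVZ : 𝒱 (openCompl (toBase S V) Z)}
    (hZ : (toBaseMap S f).left ⁻¹' (NPlus S eF : Set (toBase S GF).left) = Z) :
    Function.Bijective (A.pullback (q := ⟨toBase S V, Z, hV, hVZ⟩)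
      (p := ⟨toBase S GF, NPlus S eF, hF, hY⟩)
      (QuatGrass.SupportPair.Hom.mk (toBaseMap S f) hZ.subset)) := by
  obtain ⟨W, π, x, hx, huniv, haff, hmem, hW⟩ := h𝒱.exists_totalSpace hE
    ((tautSub_isSubbundle eV).isLocSymp (tautSub_isSymplectic eV))
  obtain ⟨O, κ, μ, hOc, hNO, hκ, hμ, hμκ, hpre, hrange⟩ :=
    exists_neighbourhood hf hE hφ hx huniv
  have hO : 𝒱 (toBase S (openSub GF O)) :=
    h𝒱.openSub_mem hF (hOc (h𝒱.compactSpace _ hF))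
  let ZO : Closeds (toBase S (openSub GF O)).left :=
    (nPlus ((taut eF).pull (openIncl GF O)) ((taut_isSubbundle eF).pull _) :
      Closeds (openSub GF O).left)
  let ZW : Closeds (toBase S W).left :=
    (nPlus ((taut eF).pull (π ≫ f)) ((taut_isSubbundle eF).pull _) : Closeds W.left)
  let p : SupportPair 𝒱 := ⟨toBase S GF, NPlus S eF, hF, hY⟩
  let pO : SupportPair 𝒱 :=
    ⟨toBase S (openSub GF O), ZO, hO, h𝒱.openCompl_nPlus_mem hO ((taut_isSubbundle eF).pull _)⟩
  let pW : SupportPair 𝒱 :=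
    ⟨toBase S W, ZW, hmem hV, h𝒱.openCompl_nPlus_mem (hmem hV) ((taut_isSubbundle eF).pull _)⟩
  let pV : SupportPair 𝒱 := ⟨toBase S V, Z, hV, hVZ⟩
  have hZO : ∀ t, t ∈ ZO ↔ (openIncl GF O).left t ∈ nPlus (taut eF) (taut_isSubbundle eF) :=
    fun t => mem_nPlus_pull_iff (taut_isSubbundle eF) (openIncl GF O) t
  have hZW : ∀ t, t ∈ ZW ↔ (π ≫ f).left t ∈ nPlus (taut eF) (taut_isSubbundle eF) :=
    fun t => mem_nPlus_pull_iff (taut_isSubbundle eF) (π ≫ f) t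
  have hZV : ∀ t, t ∈ Z ↔ f.left t ∈ nPlus (taut eF) (taut_isSubbundle eF) := fun t => by
    change t ∈ (Z : Set (toBase S V).left) ↔ _
    rw [← hZ]
    rfl
  have eO : (ZO : Set (toBase S (openSub GF O)).left) =
      (toBaseMap S (openIncl GF O)).left ⁻¹' (NPlus S eF : Set (toBase S GF).left) :=
    Set.ext hZO
  have eκ : (ZO : Set (toBase S (openSub GF O)).left) =
      (toBaseMap S κ).left ⁻¹' (ZW : Set (toBase S W).left) :=
    Set.ext fun t => (hZO t).trans ((hpre t).trans (hZW (κ.left t)).symm)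
  have eπ : (ZW : Set (toBase S W).left) =
      (toBaseMap S π).left ⁻¹' (Z : Set (toBase S V).left) :=
    Set.ext fun t => (hZW t).trans (hZV (π.left t)).symm
  have eμ : (toBaseMap S μ).left ⁻¹' (ZO : Set (toBase S (openSub GF O)).left) ⊆ Z := by
    intro t ht
    have h1 := (hZO (μ.left t)).1 ht
    refine (hZV t).2 ?_
    rw [← hμ]
    exact h1
  let i' : pO ⟶ p := QuatGrass.SupportPair.Hom.mk (toBaseMap S (openIncl GF O)) eO.symm.subset
  let κ' : pO ⟶ pW := QuatGrass.SupportPair.Hom.mk (toBaseMap S κ) eκ.symm.subset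
  let π' : pW ⟶ pV := QuatGrass.SupportPair.Hom.mk (toBaseMap S π) eπ.symm.subset
  let μ' : pV ⟶ pO := QuatGrass.SupportPair.Hom.mk (toBaseMap S μ) eμ
  have hi : Function.Bijective (A.pullback i') :=
    A.bijective_pullback_of_isOpenImmersion i'
      (hf := inferInstanceAs (IsOpenImmersion (Scheme.Opens.ι O))) eO
      (hNO.trans (range_openIncl GF O).symm.subset)
  have hκb : Function.Bijective (A.pullback κ') :=
    A.bijective_pullback_of_isOpenImmersion κ' (hf := hκ) eκ fun t ht => hrange t ((hZW t).1 ht)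
  -- The zero section of the vector bundle is the global unit section `(0, 0, 1)`.
  have hπb : Function.Bijective (A.pullback π') :=
    bijective_pullback_of_invertsOver π' eπ fun W' hW' =>
      A.invertsOver_of_isUnitSections hV haff hW (fun t => ⟨⊤, trivial, vec 0 0 1,
        SubSheaf.mem_addLine.2 ⟨rfl, Submodule.zero_mem _⟩, rfl⟩) W' hW'
  -- Since `κ'` and `π'` induce isomorphisms, this identity shows that `μ'` does; then so does `f`,
  -- which is `μ'` followed by the inclusion `i'`.
  have hid : μ' ≫ κ' ≫ π' = 𝟙 pV := by
    refine SupportPair.Hom.ext ?_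
    change toBaseMap S μ ≫ toBaseMap S κ ≫ toBaseMap S π = 𝟙 (toBase S V)
    rw [← Functor.map_comp, ← Functor.map_comp, hμκ]
    exact (Over.map S.hom).map_id V
  have hμb : Function.Bijective (A.pullback μ') := by
    have h1 : ⇑(A.pullback (μ' ≫ κ' ≫ π')) =
        A.pullback μ' ∘ (A.pullback κ' ∘ A.pullback π') := funext fun a => by
      rw [A.pullback_comp, A.pullback_comp]
      rfl
    have h2 : Function.Bijective (A.pullback (μ' ≫ κ' ≫ π')) := by
      rw [hid]
      exact ⟨fun a b hab => by rwa [A.pullback_id, A.pullback_id] at hab,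
        fun a => ⟨a, A.pullback_id a⟩⟩
    rw [h1] at h2
    exact (Function.Bijective.of_comp_iff _ (hκb.comp hπb)).1 h2
  have hcomp : μ' ≫ i' = (QuatGrass.SupportPair.Hom.mk (toBaseMap S f) hZ.subset : pV ⟶ p) := by
    refine SupportPair.Hom.ext ?_
    change toBaseMap S μ ≫ toBaseMap S (openIncl GF O) = toBaseMap S f
    rw [← Functor.map_comp, hμ]
  have h3 : ⇑(A.pullback (QuatGrass.SupportPair.Hom.mk (toBaseMap S f) hZ.subset : pV ⟶ p)) =
      A.pullback μ' ∘ A.pullback i' := by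
    rw [← hcomp]
    exact funext fun a => A.pullback_comp μ' i' a
  change Function.Bijective
    (A.pullback (QuatGrass.SupportPair.Hom.mk (toBaseMap S f) hZ.subset : pV ⟶ p))
  rw [h3]
  exact hμb.comp hi

end CohomologyTheory

end QuatGrass

/-! ### The case `r = 1` and the conclusion -/

namespace QuatGrass

lemma BigModule.exists_hgr {S : Scheme.{u}} {M : BigModule S} {φ : M.AltForm} {d : ℕ}
    (hM : M.IsVectorBundle d) (hφ : φ.IsNondegenerate) (r : ℕ) :
    ∃ G, Nonempty ((φ.hgr r).RepresentableBy G) := by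
  obtain ⟨G, -, O, h⟩ := exists_hgr_openSub hM hφ r
  exact ⟨_, h⟩

namespace CohomologyTheory

variable {k : Scheme.{u}} {𝒱 : ObjectProperty (Over k)} {h𝒱 : IsAdmissible 𝒱}
  (A : CohomologyTheory.{w} h𝒱) {S : Over k} {E : BigModule S.left} {φ : E.AltForm} {d : ℕ}

/-- The open stratum of the quaternionic projective bundle has the cohomology of the base. -/
theorem inverts_openStratum_proj (hS : 𝒱 S) (hE : E.IsVectorBundle d) (hφ : φ.IsNondegenerate)
    {GF : Over S.left} (eF : (φ.hyp.hgr 1).RepresentableBy GF) :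
    A.Inverts (openComplIncl (toBase S GF) (NPlus S eF) ≫ toBaseProj S GF) := by
  -- Here `σ` starts from the Grassmannian of rank zero, which is `S`. Its composite with the
  -- projection is an isomorphism, so the projection is inverted because `σ` is.
  obtain ⟨G', ⟨e'⟩⟩ := exists_hgr hE hφ 0
  obtain ⟨σF, σ, -, hσ, hσA⟩ := A.exists_inverts_openStratum hS hE hφ e' eF
  refine Inverts.of_comp_left (h𝒱.hgr_mem hS hE hφ e') hσA ?_
  have h1 : σ ≫ openComplIncl (toBase S GF) (NPlus S eF) ≫ toBaseProj S GF = toBaseProj S G' := by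
    rw [← Category.assoc, hσ]
    ext1
    exact Over.w σF
  rw [h1]
  have h2 : IsIso ((Over.forget k).map (toBaseProj S G')) := isIso_hom_of_hgr_zero hE e'
  have h3 : IsIso (toBaseProj S G') := isIso_of_reflects_iso _ (Over.forget k)
  exact A.inverts_of_isIso _

end CohomologyTheory

end QuatGrass

end

theorem theoremT {k : Scheme.{u}} {𝒱 : ObjectProperty (Over k)} (h𝒱 : IsAdmissible 𝒱)
    (A : CohomologyTheory.{w, u} h𝒱) (S : Over k) (hS : 𝒱 S)
    (n r : ℕ) (hr : 1 ≤ r) (hrn : r ≤ n)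
    (E : BigModule S.left) (hE : E.IsVectorBundle (2 * n - 2))
    (φ : E.AltForm) (hφ : φ.IsNondegenerate) :
    -- the quaternionic Grassmannian bundles and the total space of the tautological bundle exist
    (∃ GF, Nonempty ((φ.hyp.hgr r).RepresentableBy GF)) ∧
    (∃ G', Nonempty ((φ.hgr (r - 1)).RepresentableBy G')) ∧
    (∃ GE, Nonempty ((φ.hgr r).RepresentableBy GE)) ∧
    (∃ V, Nonempty ((φ.tautTotal r).RepresentableBy V)) ∧
    ∀ (GF : Over S.left) (eF : (φ.hyp.hgr r).RepresentableBy GF),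
    ∃ (hF : 𝒱 (toBase S GF)) (hY : 𝒱 (openCompl (toBase S GF) (NPlus S eF))),
      -- for `r = 1` the projection `t : Y ⟶ S` induces an isomorphism
      (r = 1 → Function.Bijective (A.totPullback hY hS
        (openComplIncl (toBase S GF) (NPlus S eF) ≫ toBaseProj S GF))) ∧
      ∀ (G' : Over S.left) (e' : (φ.hgr (r - 1)).RepresentableBy G'),
      ∃ (hG' : 𝒱 (toBase S G')) (σF : G' ⟶ GF)
        (σ : toBase S G' ⟶ openCompl (toBase S GF) (NPlus S eF)),
        ClassifiesSum e' eF σF ∧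
        σ ≫ openComplIncl (toBase S GF) (NPlus S eF) = toBaseMap S σF ∧
        -- `σ` induces an isomorphism
        Function.Bijective (A.totPullback hG' hY σ) ∧
        -- the localization sequence
        ∀ (GE : Over S.left) (eE : (φ.hgr r).RepresentableBy GE)
          (V : Over S.left) (eV : (φ.tautTotal r).RepresentableBy V),
        ∃ (f : V ⟶ GF) (Z : Closeds (toBase S V).left) (hV : 𝒱 (toBase S V))
          (hVZ : 𝒱 (openCompl (toBase S V) Z))
          (hZ : (toBaseMap S f).left ⁻¹' (NPlus S eF : Set (toBase S GF).left) = Z),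
          ClassifiesGraph eV eF f ∧ IsNMinus eF f ∧
          (Z : Set (toBase S V).left) = Set.range (toBaseMap S (zeroSection eE eV)).left ∧
          ∃ (fA : A.grp ⟨toBase S GF, NPlus S eF, hF, hY⟩ ≃+ A.grp ⟨toBase S V, Z, hV, hVZ⟩)
            (σA : A.tot (openCompl (toBase S GF) (NPlus S eF)) hY ≃+ A.tot (toBase S G') hG'),
            (∀ a, fA a = A.pullback (QuatGrass.SupportPair.Hom.mk (toBaseMap S f) hZ.subset) a) ∧
            (∀ a, σA a = A.totPullback hG' hY σ a) ∧
            Function.Exact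
              (fun a => A.extSupport ⟨toBase S GF, NPlus S eF, hF, hY⟩ (fA.symm a))
              (fun a => σA (A.restrict ⟨toBase S GF, NPlus S eF, hF, hY⟩ a)) ∧
            Function.Exact
              (fun a => σA (A.restrict ⟨toBase S GF, NPlus S eF, hF, hY⟩ a))
              (fun a => fA (A.boundary ⟨toBase S GF, NPlus S eF, hF, hY⟩ (σA.symm a))) ∧
            Function.Exact
              (fun a => fA (A.boundary ⟨toBase S GF, NPlus S eF, hF, hY⟩ (σA.symm a)))
              (fun a => A.extSupport ⟨toBase S GF, NPlus S eF, hF, hY⟩ (fA.symm a)) := by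
  -- Writing `r` as a successor removes the truncated subtraction from `r - 1`.
  obtain ⟨r, rfl⟩ : ∃ r', r = r' + 1 := ⟨r - 1, (Nat.succ_pred_eq_of_pos hr).symm⟩
  rw [Nat.add_sub_cancel]
  obtain ⟨GE, ⟨eE⟩⟩ := exists_hgr hE hφ (r + 1)
  obtain ⟨V, hV, -⟩ := h𝒱.exists_tautTotal hE eE
  refine ⟨exists_hgr hE.hyp hφ.hyp _, exists_hgr hE hφ _, ⟨GE, ⟨eE⟩⟩, ⟨V, hV⟩, fun GF eF => ?_⟩
  have hF : 𝒱 (toBase S GF) := h𝒱.hgr_mem hS hE.hyp hφ.hyp eF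
  have hY : 𝒱 (openCompl (toBase S GF) (NPlus S eF)) :=
    h𝒱.openCompl_nPlus_mem hF (taut_isSubbundle eF)
  refine ⟨hF, hY, fun h1 => ?_, fun G' e' => ?_⟩
  · obtain rfl : r = 0 := Nat.succ_injective h1
    exact A.inverts_openStratum_proj hS hE hφ eF hY hS
  have hG' : 𝒱 (toBase S G') := h𝒱.hgr_mem hS hE hφ e'
  obtain ⟨σF, σ, hσF, hσ, hσA⟩ := A.exists_inverts_openStratum hS hE hφ e' eF
  refine ⟨hG', σF, σ, hσF, hσ, hσA hG' hY, fun GE eE V eV => ?_⟩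
  obtain ⟨f, hf⟩ := exists_classified_tautGraph eV eF hE.isSheaf hE
  have hV : 𝒱 (toBase S V) := h𝒱.tautTotal_mem hS hE hφ eE eV
  -- `Z` is taken to be the set `N⁺` of the pulled back subbundle, whose complement is known to be
  -- in `𝒱`; that it is the zero section is `preimage_nPlus`.
  let Z : Closeds (toBase S V).left :=
    (nPlus ((taut eF).pull f) ((taut_isSubbundle eF).pull f) : Closeds V.left)
  have hVZ : 𝒱 (openCompl (toBase S V) Z) :=
    h𝒱.openCompl_nPlus_mem hV ((taut_isSubbundle eF).pull f)
  have hZ : (toBaseMap S f).left ⁻¹' (NPlus S eF : Set (toBase S GF).left) = Z :=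
    Set.ext fun t => (mem_nPlus_pull_iff (taut_isSubbundle eF) f t).symm
  let p : SupportPair 𝒱 := ⟨toBase S GF, NPlus S eF, hF, hY⟩
  let fA := AddEquiv.ofBijective _
    (A.bijective_pullback_tautGraph hE hφ hf (hF := hF) (hY := hY) (hV := hV) (hVZ := hVZ) hZ)
  let σA := AddEquiv.ofBijective _ (hσA hG' hY)
  refine ⟨f, Z, hV, hVZ, hZ, classifiesGraph_of_eq hf, isNMinus_of_eq hf hE hφ,
    hZ.symm.trans (preimage_nPlus hf eE), fA, σA, fun _ => rfl, fun _ => rfl,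
    fun b => ?_, fun b => ?_, fun b => ?_⟩
  -- The three exactness statements are those of the localization sequence, transported along the
  -- additive bijections `fA` and `σA`.
  · rw [← σA.map_zero, σA.injective.eq_iff]
    refine (A.exact_e_j p b).trans ⟨?_, ?_⟩
    · rintro ⟨a, rfl⟩
      exact ⟨fA a, congrArg (A.extSupport p) (fA.symm_apply_apply a)⟩
    · rintro ⟨a, rfl⟩
      exact ⟨fA.symm a, rfl⟩
  · rw [← fA.map_zero, fA.injective.eq_iff]
    refine (A.exact_j_bd p (σA.symm b)).trans ⟨?_, ?_⟩
    · rintro ⟨a, ha⟩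
      exact ⟨a, (congrArg σA ha).trans (σA.apply_symm_apply b)⟩
    · rintro ⟨a, rfl⟩
      exact ⟨a, (σA.symm_apply_apply _).symm⟩
  · refine (A.exact_bd_e p (fA.symm b)).trans ⟨?_, ?_⟩
    · rintro ⟨a, ha⟩
      refine ⟨σA a, ?_⟩
      change fA (A.boundary p (σA.symm (σA a))) = b
      rw [σA.symm_apply_apply]
      exact (congrArg fA ha).trans (fA.apply_symm_apply b)
    · rintro ⟨a, rfl⟩
      exact ⟨σA.symm a, (fA.symm_apply_apply _).symm⟩
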